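/- **Model.** Programs are fixed programs for a randomized word RAM with word length $w$: finitely many registers and finitely many arrays of $w$-bit words, arrays indexed by words, unit cost for word arithmetic (addition, subtraction, multiplication, division, bitwise operations, shifts, comparisons), for reading and writing an array cell, for drawing a uniformly random word, and for control flow. All programs are Las Vegas: their output is always correct, and only the running time is random. Words are assumed to have $w\ge\kappa(\log N+1)$ bits, where $N$ is the input size parameter and $\kappa$ is a constant that may depend on the program; time bounds do not depend on $w$. **3SUM conjecture.** Given at most $n$ distinct integers that fit into (signed) machine words, 3SUM asks whether there are distinct elements $a,b,c$ among them with $a+b=c$. The conjecture: whenever a program solves 3SUM in expected time at most $T(n)$ on all instances of at most $n$ numbers, $T(n)=\Omega(n^{2-o(1)})$. **Online SetIntersection.** Preprocess two families $A,B$ of nonempty sets, with sum of set sizes at most $N$ and with elements from $\{0,\dots,N-1\}$, so that, given a pair $(S,S')\in A\times B$, all elements of $S\cap S'$ can be reported, each exactly once. A data structure has *expected preprocessing time $t_p$, amortized expected query time $t_q$, and amortized expected time $t_r$ to report an element* (nonnegative functions of $N$) if for every such instance and every fixed sequence of $k\ge 0$ queries with total output size $m$, the expected total time of the preprocessing followed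 by the $k$ queries is at most $t_p(N)+k\,t_q(N)+m\,t_r(N)$. **Theorem.** Assume the 3SUM conjecture. Let $0\le\gamma<1$ and $\delta>0$ be real constants. Then every data structure for online SetIntersection with expected preprocessing time $t_p$, amortized expected query time $t_q$, and amortized expected time $t_r$ to report an element of the output satisfies $$t_p(N)+N^{\frac{2(1+\gamma)}{3+\delta-\gamma}}\,t_q(N)+N^{\frac{2(2-\delta)}{3+\delta-\gamma}}\,t_r(N)=\Omega\left(N^{\frac{4}{3+\delta-\gamma}-o(1)}\right).$$ Here $f(N)=\Omega(N^{c-o(1)})$ means that there are a function $\eta(N)\to 0$ and a constant $K>0$ with $f(N)\ge K\,N^{c-\eta(N)}$ for all sufficiently large $N$. -/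

import Mathlib

open Filter Topology Asymptotics
open scoped NNReal ENNReal

/-! ## A randomized word RAM

Programs are structured (assignment, conditional, loop) programs over finitely many registers and
finitely many arrays.  Every register and every array cell holds a word of `w` bits, that is, a
natural number below `2 ^ w`, and every array is indexed by words.  Each executed command costs one
unit of time.  A program is a fixed finite object: it depends neither on `w` nor on the input. -/

namespace WordRAM

/-- The binary word operations (comparisons return `0` or `1`). -/
inductive BinOp where
  | add | sub | mul | div | mod | and | or | xor | shl | shr | lt | eq

/-- Value of a binary operation on `w`-bit words; overflow is cut off modulo `2 ^ w`. -/
def BinOp.eval (w : ℕ) : BinOp → ℕ → ℕ → ℕ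
  | .add, x, y => (x + y) % 2 ^ w
  | .sub, x, y => (x + (2 ^ w - y)) % 2 ^ w
  | .mul, x, y => (x * y) % 2 ^ w
  | .div, x, y => (x / y) % 2 ^ w
  | .mod, x, y => (x % y) % 2 ^ w
  | .and, x, y => (x &&& y) % 2 ^ w
  | .or, x, y => (x ||| y) % 2 ^ w
  | .xor, x, y => (x ^^^ y) % 2 ^ w
  | .shl, x, y => (x * 2 ^ y) % 2 ^ w
  | .shr, x, y => (x / 2 ^ y) % 2 ^ w
  | .lt, x, y => if x < y then 1 % 2 ^ w else 0
  | .eq, x, y => if x = y then 1 % 2 ^ w else 0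

/-- Commands.  Registers and arrays are named by natural numbers. -/
inductive Cmd where
  /-- `r_d := c` -/
  | const (d c : ℕ)
  /-- `r_d := w`, the word length of the machine -/
  | wordLen (d : ℕ)
  /-- `r_d := ` a fresh uniformly random word -/
  | rand (d : ℕ)
  /-- `r_d := r_a o r_b` -/
  | op (o : BinOp) (d a b : ℕ)
  /-- `r_d := M_arr[r_a]` -/
  | load (d arr a : ℕ)
  /-- `M_arr[r_a] := r_b` -/
  | store (arr a b : ℕ)
  /-- `c₁; c₂` -/
  | seq (c₁ c₂ : Cmd)
  /-- if `r_a ≠ 0` then `c₁` else `c₂` -/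
  | ite (a : ℕ) (c₁ c₂ : Cmd)
  /-- while `r_a ≠ 0` do `c` -/
  | loop (a : ℕ) (c : Cmd)

/-- The contents of the registers and of the arrays. -/
structure State where
  reg : ℕ → ℕ
  mem : ℕ → ℕ → ℕ

/-- `r_d := v` -/
def State.setReg (s : State) (d v : ℕ) : State :=
  { s with reg := Function.update s.reg d v }

/-- `M_arr[i] := v` -/
def State.setMem (s : State) (arr i v : ℕ) : State :=
  { s with mem := Function.update s.mem arr (Function.update (s.mem arr) i v) }

/-- A configuration: the commands that are still to be executed, in order, and the state. -/
structure Config where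
  todo : List Cmd
  state : State

/-- The machine has halted when nothing is left to be executed. -/
def Config.Halted (c : Config) : Prop := c.todo = []

/-- One step of the machine with word length `w`; `x` is the random word available in this step,
and only the command `rand` looks at it.  A halted machine stays as it is. -/
def stepWith (w x : ℕ) : Config → Config
  | ⟨[], s⟩ => ⟨[], s⟩
  | ⟨.const d c :: k, s⟩ => ⟨k, s.setReg d (c % 2 ^ w)⟩
  | ⟨.wordLen d :: k, s⟩ => ⟨k, s.setReg d w⟩
  | ⟨.rand d :: k, s⟩ => ⟨k, s.setReg d x⟩
  | ⟨.op o d a b :: k, s⟩ => ⟨k, s.setReg d (o.eval w (s.reg a) (s.reg b))⟩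
  | ⟨.load d arr a :: k, s⟩ => ⟨k, s.setReg d (s.mem arr (s.reg a))⟩
  | ⟨.store arr a b :: k, s⟩ => ⟨k, s.setMem arr (s.reg a) (s.reg b)⟩
  | ⟨.seq c₁ c₂ :: k, s⟩ => ⟨c₁ :: c₂ :: k, s⟩
  | ⟨.ite a c₁ c₂ :: k, s⟩ => if s.reg a ≠ 0 then ⟨c₁ :: k, s⟩ else ⟨c₂ :: k, s⟩
  | ⟨.loop a c :: k, s⟩ => if s.reg a ≠ 0 then ⟨c :: .loop a c :: k, s⟩ else ⟨k, s⟩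

/-- The uniform distribution on the words of `w` bits. -/
noncomputable def uniformWord (w : ℕ) : PMF ℕ :=
  PMF.uniformOfFinset (Finset.range (2 ^ w)) ⟨0, Finset.mem_range.2 (Nat.two_pow_pos w)⟩

/-- One step of the randomized machine: every step draws a fresh independent uniform word. -/
noncomputable def step (w : ℕ) (c : Config) : PMF Config :=
  (uniformWord w).map fun x => stepWith w x c

/-- The distribution of the configuration after `t` steps. -/
noncomputable def distAfter (w : ℕ) (c : Config) : ℕ → PMF Config
  | 0 => PMF.pure c
  | t + 1 => (distAfter w c t).bind (step w)

/-- The expected running time `𝔼[T] = ∑ₜ ℙ[T > t]`, where `T` is the number of steps until the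
machine halts.  It is infinite if the machine fails to halt with positive probability. -/
noncomputable def expectedTime (w : ℕ) (c : Config) : ℝ≥0∞ :=
  ∑' t : ℕ, (distAfter w c t).toOuterMeasure {c' | ¬ c'.Halted}

/-- `s` is a possible final state, that is, the machine halts in state `s` with positive
probability. -/
def FinalState (w : ℕ) (c : Config) (s : State) : Prop :=
  ∃ t : ℕ, (⟨[], s⟩ : Config) ∈ (distAfter w c t).support

end WordRAM

open WordRAM

/-- `f(n) = Ω(n ^ (c - o(1)))`. -/
def IsOmegaPowSubLittleO (f : ℕ → ℝ) (c : ℝ) : Prop :=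
  ∃ η : ℕ → ℝ, Tendsto η atTop (𝓝 0) ∧ (fun n : ℕ => (n : ℝ) ^ (c - η n)) =O[atTop] f

/-! ## 3SUM -/

namespace ThreeSum

/-- Is there a triple of distinct elements with `a + b = c`? -/
def HasWitness (A : List ℤ) : Prop :=
  ∃ a ∈ A, ∃ b ∈ A, ∃ c ∈ A, a ≠ b ∧ a ≠ c ∧ b ≠ c ∧ a + b = c

/-- The two's complement representation of an integer in a word of `w` bits. -/
def encode (w : ℕ) (a : ℤ) : ℕ := (a % (2 : ℤ) ^ w).toNat

/-- The list `A` represents an instance of at most `n` distinct integers, each of which fits into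
a (signed) word of `w` bits: `-2 ^ (w - 1) ≤ a < 2 ^ (w - 1)`. -/
def IsInstance (n w : ℕ) (A : List ℤ) : Prop :=
  A.Nodup ∧ A.length ≤ n ∧ ∀ a ∈ A, -(2 : ℤ) ^ w ≤ 2 * a ∧ 2 * a < (2 : ℤ) ^ w

/-- At the start, register `0` holds the number of elements and array `0` holds the elements; all
else is `0`. -/
def initState (w : ℕ) (A : List ℤ) : State where
  reg := fun r => if r = 0 then A.length else 0
  mem := fun arr i => if arr = 0 then ((A.map (encode w)).getD i 0) else 0

/-- The program `P` solves 3SUM (Las Vegas: the answer, whether register `0` is nonzero, is never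
wrong), in expected time at most `T n` on every instance of at most `n` numbers, on all machines
with word length at least `κ (log n + 1)` for some constant `κ`. -/
def Solves (P : Cmd) (T : ℕ → ℝ≥0) : Prop :=
  ∃ κ : ℕ, ∀ n w : ℕ, κ * (Nat.log 2 n + 1) ≤ w → ∀ A : List ℤ, IsInstance n w A →
    (∀ s, FinalState w ⟨[P], initState w A⟩ s → (s.reg 0 ≠ 0 ↔ HasWitness A)) ∧
    expectedTime w ⟨[P], initState w A⟩ ≤ T n

/-- The 3SUM conjecture: the time complexity of 3SUM is `Ω(n ^ (2 - o(1)))`, even in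
expectation. -/
def Conjecture : Prop :=
  ∀ (P : Cmd) (T : ℕ → ℝ≥0), Solves P T → IsOmegaPowSubLittleO (fun n => (T n : ℝ)) 2

end ThreeSum

/-! ## Online SetIntersection -/

namespace SetIntersection

/-- Two families of sets; every set is given as a list of its elements. -/
structure SetSystem where
  A : List (List ℕ)
  B : List (List ℕ)

/-- All the sets, those of `A` before those of `B`. -/
def SetSystem.sets (I : SetSystem) : List (List ℕ) := I.A ++ I.B

/-- The lists represent nonempty sets (the elements of a set are listed once, in any order), the
sum of the set sizes is at most `N`, and the elements are drawn from `{0, …, N - 1}` (at most `N`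
elements occur in the sets). -/
def SetSystem.IsInstance (I : SetSystem) (N : ℕ) : Prop :=
  (∀ S ∈ I.sets, S ≠ [] ∧ S.Nodup ∧ ∀ x ∈ S, x < N) ∧ (I.sets.map List.length).sum ≤ N

/-- The `i`-th set of `A` intersected with the `j`-th set of `B`, for a query `q = (i, j)`. -/
def SetSystem.answer (I : SetSystem) (q : ℕ × ℕ) : Finset ℕ :=
  (I.A.getD q.1 []).toFinset ∩ (I.B.getD q.2 []).toFinset

/-- At the start, registers `0` and `1` hold the numbers of sets in `A` and `B`, array `0` holds the
elements of all the sets, one set after the other, and cell `i` of array `1` holds the position at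
which the `i`-th set starts (the last entry is the position after the end of the last set); all
else is `0`. -/
def SetSystem.initState (I : SetSystem) : State where
  reg := fun r => if r = 0 then I.A.length else if r = 1 then I.B.length else 0
  mem := fun arr i =>
    if arr = 0 then I.sets.flatten.getD i 0
    else if arr = 1 ∧ i ≤ I.sets.length then ((I.sets.take i).map List.length).sum
    else 0

/-- A data structure: a program for the preprocessing and a program for a query.  Registers and
arrays keep their contents from one operation to the next. -/
structure DataStructure where
  pre : Cmd
  query : Cmd

/-- Preprocessing, followed by the queries `qs` one after the other.  A query `(i, j)` is passed in
registers `0` and `1`. -/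
def DataStructure.session (D : DataStructure) (qs : List (ℕ × ℕ)) : List Cmd :=
  D.pre :: qs.flatMap fun q => [Cmd.const 0 q.1, Cmd.const 1 q.2, D.query]

/-- The list reported by a query: register `0` holds its length, array `2` its entries. -/
def reported (s : State) : List ℕ := (List.range (s.reg 0)).map (s.mem 2)

/-- `D` is a data structure for SetIntersection with expected preprocessing time `tp`, amortized
expected query time `tq` and amortized expected time `tr` per reported element, as functions of the
bound `N` on the sum of the set sizes.

On all machines with word length at least `κ (log N + 1)`, for some constant `κ`, every query
reports every element of the intersection exactly once, and for every sequence of queries (fixed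
in advance, possibly empty) the total expected time of the preprocessing and the queries is at
most `tp N + (number of queries) * tq N + (total output size) * tr N`.  For the empty sequence this
says that the expected preprocessing time is at most `tp N`. -/
def DataStructure.HasBounds (D : DataStructure) (tp tq tr : ℕ → ℝ≥0) : Prop :=
  ∃ κ : ℕ, ∀ N w : ℕ, κ * (Nat.log 2 N + 1) ≤ w → ∀ I : SetSystem, I.IsInstance N →
    ∀ qs : List (ℕ × ℕ), (∀ q ∈ qs, q.1 < I.A.length ∧ q.2 < I.B.length) →
      (∀ s, FinalState w ⟨D.session qs, I.initState⟩ s → ∀ q ∈ qs.getLast?,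
        (reported s).Nodup ∧ (reported s).toFinset = I.answer q) ∧
      expectedTime w ⟨D.session qs, I.initState⟩ ≤
        ((tp N + qs.length * tq N + (qs.map fun q => (I.answer q).card).sum * tr N : ℝ≥0) : ℝ≥0∞)

end SetIntersection

/-! ## Expected running time and reachability -/

namespace WordRAM

/-! There are two regimes. If δ ≥ 1 + γ, the exponent 4/(3+δ-γ) is at most 1 and a linear bound
suffices: a structure that answers a query in less time than it takes to read a set errs after an
unread cell is changed (`le_preprocessing_add_query`). No conjecture is needed there. If δ < 1 + γ,
a fast structure yields a fast program for 3SUM.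

Let n numbers be given as w-bit words. Hash x to H(x), the top s + 2r bits of αx mod 2^w, for a
random odd α. Truncation costs one carry e ∈ {0,1}: H(a) + H(b) + e = H(a+b) modulo 2^(s+2r)
(`exists_carry`). The upper s bits of H name a bucket, the lower 2r bits are a value `lo` in [0,Q)
with Q = 4^r. Given the bucket of a, the sum c, the carry e, and a second carry f between the two
halves, the bucket of b is determined, and lo a + lo b + e = lo c + fQ (`exists_carries`). Hence a
witness with sum c shows up as a common element of a translate of one bucket and a translate of the
mirror image of another. About 2Q amounts of translation occur, but each is written in base 2^r: the
first family contains the translates by multiples of 2^r, the second those by amounts below 2^r. So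
every bucket is copied only O(2^r) times, and the instance has size N ≈ n 2^r up to logarithms.
There are about n 2^s queries, again up to logarithms: one for each bucket, each c and each of
boundedly many options.

Some refinements make this exact. Distinct elements have indices that differ in some bit; buckets
are split by the value of such a bit, which keeps a and b distinct, and by the sign, which allows
`Admissible` to exclude overflow modulo 2^w. Buckets are cut into chunks of at most T ≈ n/2^s
entries, so that no single query reports more than T elements. Every reported value is checked: the
elements with this value form a linked list, and the missing summand c - a is looked up in a table
addressed by the words themselves. So the answer is always correct (`Input.hasWitness_iff`).

The queries stop at the first one that finds a witness. All others report false positives only, and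
these are charged injectively to triples whose hash values fit although the elements do not add up
(`sum_chainSum_le`). For fixed z ≠ 0 the product αz is close to 0 modulo 2^w with probability
O(2^-(s+2r)) (`card_near_zero_le`), so about n^3/2^(s+2r) false positives are expected
(`avg_nearSet_le`). The structure promises its time only for sequences of queries fixed in advance.
This is enough: correct answers are unique as sets, so the queries asked depend on the input and on
α alone, and α is drawn before the structure is started (`spec_mainLoop`, `spec_program`).

With 2^s ≈ n^γ and 2^r ≈ n^((1+δ-γ)/2) one has N ≈ n^((3+δ-γ)/2), about n^(1+γ) queries, and an
output of n^(2-δ), plus n^(1-γ) for the last query, which is of lower order because δ < 1 + γ. The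
remaining work is of order n(2^s + 2^r) + n^(2-δ), below n^2. A violation of the bound at infinitely
many N therefore gives 3SUM in time n^(2-μ) for infinitely many n (`not_frequently_fast`,
`omega_of_lt`).

On the machine, deterministic parts are written in a small language with a cost semantics `Big` and
compiled (`Spec.big`); the programs of the structure run unchanged on registers and arrays of their
own (`Spec.embed`). -/

theorem uniformWord_apply (w x : ℕ) :
    uniformWord w x = if x ∈ Finset.range (2 ^ w) then ((2 : ℝ≥0∞) ^ w)⁻¹ else 0 := by
  refine (PMF.uniformOfFinset_apply (s := Finset.range (2 ^ w)) _ x).trans ?_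
  simp

theorem uniformWord_apply_of_lt {w x : ℕ} (hx : x < 2 ^ w) :
    uniformWord w x = ((2 : ℝ≥0∞) ^ w)⁻¹ := by
  rw [uniformWord_apply, if_pos (Finset.mem_range.2 hx)]

theorem uniformWord_apply_of_le {w x : ℕ} (hx : 2 ^ w ≤ x) : uniformWord w x = 0 := by
  rw [uniformWord_apply, if_neg (by simpa using hx)]

theorem mem_support_uniformWord {w x : ℕ} : x ∈ (uniformWord w).support ↔ x < 2 ^ w := by
  rw [PMF.mem_support_iff, uniformWord_apply]
  simp

/-- The expectation of a function of a uniformly random word. -/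
noncomputable def avg (w : ℕ) (F : ℕ → ℝ≥0∞) : ℝ≥0∞ := ∑' x, uniformWord w x * F x

theorem avg_mono {w : ℕ} {F G : ℕ → ℝ≥0∞} (h : ∀ x < 2 ^ w, F x ≤ G x) : avg w F ≤ avg w G := by
  refine ENNReal.tsum_le_tsum fun x => ?_
  by_cases hx : x < 2 ^ w
  · gcongr; exact h x hx
  · simp [uniformWord_apply_of_le (not_lt.1 hx)]

theorem avg_const (w : ℕ) (a : ℝ≥0∞) : avg w (fun _ => a) = a := by
  simp [avg, ENNReal.tsum_mul_right, (uniformWord w).tsum_coe]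

theorem avg_add (w : ℕ) (F G : ℕ → ℝ≥0∞) : avg w (fun x => F x + G x) = avg w F + avg w G := by
  simp [avg, mul_add, ENNReal.tsum_add]

theorem avg_mul_right (w : ℕ) (F : ℕ → ℝ≥0∞) (a : ℝ≥0∞) :
    avg w (fun x => F x * a) = avg w F * a := by
  simp [avg, ← mul_assoc, ENNReal.tsum_mul_right]

theorem avg_eq_sum (w : ℕ) (F : ℕ → ℝ≥0∞) :
    avg w F = ∑ x ∈ Finset.range (2 ^ w), ((2 : ℝ≥0∞) ^ w)⁻¹ * F x := by
  rw [avg, tsum_eq_sum (s := Finset.range (2 ^ w))]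
  · exact Finset.sum_congr rfl fun x hx => by
      rw [uniformWord_apply_of_lt (Finset.mem_range.1 hx)]
  · intro x hx
    rw [uniformWord_apply_of_le (by simpa using hx), zero_mul]

/-- By definition steps are added at the end of a run. All recursions below peel off the first step
instead; associativity of `bind` mediates between the two. -/
theorem distAfter_succ' (w : ℕ) (c : Config) (t : ℕ) :
    distAfter w c (t + 1) = (step w c).bind fun c' => distAfter w c' t := by
  induction t with
  | zero => simp [distAfter]
  | succ t ih => rw [distAfter, ih, PMF.bind_bind]; rfl

/-- The probability that the machine is still running after `t` steps. -/
noncomputable def running (w : ℕ) (c : Config) (t : ℕ) : ℝ≥0∞ :=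
  (distAfter w c t).toOuterMeasure {c' | ¬ c'.Halted}

theorem running_zero (w : ℕ) {c : Config} (h : ¬ c.Halted) : running w c 0 = 1 := by
  rw [running, distAfter, PMF.toOuterMeasure_pure_apply, if_pos (show c ∈ {c' | ¬ Config.Halted c'} from h)]

theorem running_zero_le (w : ℕ) (c : Config) : running w c 0 ≤ 1 := by
  rw [running, distAfter, PMF.toOuterMeasure_pure_apply]; split_ifs <;> simp

theorem running_succ (w : ℕ) (c : Config) (t : ℕ) :
    running w c (t + 1) = avg w fun x => running w (stepWith w x c) t := by
  simp only [running, distAfter_succ', step, PMF.bind_map, PMF.toOuterMeasure_bind_apply, avg]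
  rfl

theorem expectedTime_eq (w : ℕ) (c : Config) : expectedTime w c = ∑' t, running w c t := rfl

/-- The term t = 0 of the tail sum contributes 1, and the other terms are averages over the first
random word. In `ℝ≥0∞` the two sums commute without any convergence hypothesis. -/
theorem expectedTime_step (w : ℕ) {c : Config} (h : ¬ c.Halted) :
    expectedTime w c = 1 + avg w fun x => expectedTime w (stepWith w x c) := by
  rw [expectedTime_eq, tsum_eq_zero_add' ENNReal.summable, running_zero w h]
  simp only [running_succ, expectedTime_eq, avg]
  rw [ENNReal.tsum_comm]
  simp only [ENNReal.tsum_mul_left]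

theorem running_halted (w : ℕ) (s : State) (t : ℕ) : running w ⟨[], s⟩ t = 0 := by
  induction t with
  | zero =>
    rw [running, distAfter, PMF.toOuterMeasure_pure_apply, if_neg]
    simp [Config.Halted]
  | succ t ih =>
    rw [running_succ]
    simp [stepWith, ih, avg]

theorem expectedTime_halted (w : ℕ) (s : State) : expectedTime w ⟨[], s⟩ = 0 := by
  simp [expectedTime_eq, running_halted]

/-- The expected number of steps, counting at most `n` of them. -/
noncomputable def timeUpTo (w : ℕ) (c : Config) (n : ℕ) : ℝ≥0∞ :=
  ∑ t ∈ Finset.range n, running w c t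

theorem timeUpTo_le (w : ℕ) (c : Config) (n : ℕ) : timeUpTo w c n ≤ expectedTime w c :=
  ENNReal.sum_le_tsum _

/-- A program of unknown behaviour offers nothing to induct on, since its runs may be unbounded; a
budget of n steps does. -/
theorem expectedTime_le_of_timeUpTo (w : ℕ) (c : Config) (B : ℝ≥0∞)
    (h : ∀ n, timeUpTo w c n ≤ B) : expectedTime w c ≤ B := by
  rw [expectedTime_eq, ENNReal.tsum_eq_iSup_nat]
  exact iSup_le h

theorem timeUpTo_succ_le (w : ℕ) (c : Config) (n : ℕ) :
    timeUpTo w c (n + 1) ≤ 1 + avg w fun x => timeUpTo w (stepWith w x c) n := by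
  rw [timeUpTo, Finset.sum_range_succ', add_comm]
  gcongr
  · exact running_zero_le w c
  · simp only [running_succ, avg, timeUpTo, Finset.mul_sum]
    rw [Summable.tsum_finsetSum fun _ _ => ENNReal.summable]

/-- One step of a machine that has not halted, with some random word. -/
def StepRel (w : ℕ) (c c' : Config) : Prop :=
  c.todo ≠ [] ∧ ∃ x < 2 ^ w, c' = stepWith w x c

/-- `c'` can be reached from `c`. -/
def Reach (w : ℕ) : Config → Config → Prop := Relation.ReflTransGen (StepRel w)

theorem mem_support_step {w : ℕ} {c c' : Config} :
    c' ∈ (step w c).support ↔ ∃ x < 2 ^ w, stepWith w x c = c' := by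
  simp only [step, PMF.mem_support_map_iff, mem_support_uniformWord]

theorem mem_support_distAfter_of_reach {w : ℕ} {c c' : Config} (h : Reach w c c') :
    ∃ t, c' ∈ (distAfter w c t).support := by
  induction h with
  | refl => exact ⟨0, by simp [distAfter]⟩
  | tail _ h ih =>
    obtain ⟨t, ht⟩ := ih
    obtain ⟨_, x, hx, rfl⟩ := h
    exact ⟨t + 1, by
      rw [distAfter, PMF.mem_support_bind_iff]
      exact ⟨_, ht, mem_support_step.2 ⟨x, hx, rfl⟩⟩⟩

theorem reach_of_mem_support_distAfter {w : ℕ} {c c' : Config} {t : ℕ}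
    (h : c' ∈ (distAfter w c t).support) : Reach w c c' := by
  induction t generalizing c' with
  | zero =>
    simp only [distAfter, PMF.support_pure, Set.mem_singleton_iff] at h
    exact h ▸ .refl
  | succ t ih =>
    rw [distAfter, PMF.mem_support_bind_iff] at h
    obtain ⟨d, hd, h⟩ := h
    obtain ⟨x, hx, rfl⟩ := mem_support_step.1 h
    rcases d with ⟨_ | ⟨e, k⟩, s⟩
    · exact ih hd
    · exact (ih hd).tail ⟨by simp, x, hx, rfl⟩

/-- Every word below 2^w has positive probability, so the support after t steps consists of what
some choice of words can reach. Halted configurations stay put, hence `StepRel` may leave them out.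
-/
theorem finalState_iff {w : ℕ} {c : Config} {s : State} :
    FinalState w c s ↔ Reach w c ⟨[], s⟩ :=
  ⟨fun ⟨_, h⟩ => reach_of_mem_support_distAfter h, mem_support_distAfter_of_reach⟩

theorem stepWith_append (w x : ℕ) (e : Cmd) (l k : List Cmd) (s : State) :
    stepWith w x ⟨e :: l ++ k, s⟩ =
      ⟨(stepWith w x ⟨e :: l, s⟩).todo ++ k, (stepWith w x ⟨e :: l, s⟩).state⟩ := by
  cases e <;> simp only [stepWith, List.cons_append] <;> split_ifs <;> rfl

theorem Reach.append {w : ℕ} {c c' : Config} (h : Reach w c c') (k : List Cmd) :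
    Reach w ⟨c.todo ++ k, c.state⟩ ⟨c'.todo ++ k, c'.state⟩ := by
  induction h with
  | refl => exact .refl
  | @tail d d' _ h ih =>
    obtain ⟨hne, x, hx, rfl⟩ := h
    rcases d with ⟨_ | ⟨e, l⟩, s⟩
    · exact absurd rfl hne
    · exact ih.tail ⟨by simp, x, hx, (stepWith_append w x e l k s).symm⟩

theorem FinalState.append {w : ℕ} {l₁ l₂ : List Cmd} {s s' s'' : State}
    (h₁ : FinalState w ⟨l₁, s⟩ s') (h₂ : FinalState w ⟨l₂, s'⟩ s'') :
    FinalState w ⟨l₁ ++ l₂, s⟩ s'' := by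
  rw [finalState_iff] at *
  exact (h₁.append l₂).trans h₂

/-- The expected running time is at most `B`, and every possible final state satisfies `Q`. -/
def Spec (w : ℕ) (c : Config) (B : ℝ≥0∞) (Q : State → Prop) : Prop :=
  expectedTime w c ≤ B ∧ ∀ s, FinalState w c s → Q s

theorem Spec.mono {w : ℕ} {c : Config} {B B' : ℝ≥0∞} {Q : State → Prop} (h : Spec w c B Q)
    (hB : B ≤ B') : Spec w c B' Q :=
  ⟨h.1.trans hB, h.2⟩

theorem Spec.halted {w : ℕ} {s : State} {Q : State → Prop} (h : Q s) : Spec w ⟨[], s⟩ 0 Q := by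
  refine ⟨(expectedTime_halted w s).le, fun s' hs' => ?_⟩
  rw [finalState_iff] at hs'
  rcases Relation.ReflTransGen.cases_head hs' with h' | ⟨c, h', _⟩
  · cases h'; exact h
  · exact absurd rfl h'.1

/-- The budget may depend on the random word. Outside deterministic steps this serves a single
purpose, the draw of the multiplier, where it turns a bound for each multiplier into an average. -/
theorem Spec.step {w : ℕ} {c : Config} {B : ℕ → ℝ≥0∞} {Q : State → Prop} (hc : c.todo ≠ [])
    (h : ∀ x < 2 ^ w, Spec w (stepWith w x c) (B x) Q) : Spec w c (1 + avg w B) Q := by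
  refine ⟨?_, fun s hs => ?_⟩
  · rw [expectedTime_step w (c := c) hc]
    gcongr
    exact avg_mono fun x hx => (h x hx).1
  · rw [finalState_iff] at hs
    rcases Relation.ReflTransGen.cases_head hs with h' | ⟨c', ⟨_, x, hx, rfl⟩, h'⟩
    · exact absurd (congrArg Config.todo h') hc
    · exact (h x hx).2 s (finalState_iff.2 h')

/-- `t` steps, none of which depends on the random words, lead from one configuration to another. -/
inductive Det (w : ℕ) : ℕ → Config → Config → Prop
  | refl (c : Config) : Det w 0 c c
  | head {t : ℕ} {c c' c'' : Config} (hc : c.todo ≠ []) (h : ∀ x, stepWith w x c = c')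
      (h' : Det w t c' c'') : Det w (t + 1) c c''

theorem Det.trans {w t t' : ℕ} {c c' c'' : Config} (h : Det w t c c') (h' : Det w t' c' c'') :
    Det w (t + t') c c'' := by
  induction h with
  | refl => simpa using h'
  | head hc hs _ ih => rw [Nat.add_right_comm]; exact .head hc hs (ih h')

theorem Det.one {w : ℕ} {c c' : Config} (hc : c.todo ≠ []) (h : ∀ x, stepWith w x c = c') :
    Det w 1 c c' := .head hc h (.refl _)

theorem Spec.det {w t : ℕ} {c c' : Config} {B : ℝ≥0∞} {Q : State → Prop} (h : Det w t c c')
    (h' : Spec w c' B Q) : Spec w c (t + B) Q := by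
  induction h with
  | refl => simpa using h'
  | @head t c c' c'' hc hs _ ih =>
    have := Spec.step (B := fun _ => t + B) hc (fun x _ => (hs x).symm ▸ ih h')
    rw [avg_const] at this
    refine this.mono (le_of_eq ?_)
    push_cast; ring

/-- All registers and cells hold words. -/
def State.WF (w : ℕ) (s : State) : Prop := (∀ r, s.reg r < 2 ^ w) ∧ ∀ a i, s.mem a i < 2 ^ w

theorem State.WF.setReg {w : ℕ} {s : State} (h : s.WF w) {d v : ℕ} (hv : v < 2 ^ w) :
    (s.setReg d v).WF w := by
  refine ⟨fun r => ?_, h.2⟩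
  by_cases hr : r = d
  · subst hr; simpa [State.setReg] using hv
  · simpa [State.setReg, hr] using h.1 r

theorem State.WF.setMem {w : ℕ} {s : State} (h : s.WF w) {a i v : ℕ} (hv : v < 2 ^ w) :
    (s.setMem a i v).WF w := by
  refine ⟨h.1, fun b j => ?_⟩
  by_cases hb : b = a
  · subst hb
    by_cases hj : j = i
    · subst hj; simpa [State.setMem] using hv
    · simpa [State.setMem, hj] using h.2 b j
  · simpa [State.setMem, hb] using h.2 b j

theorem BinOp.eval_lt (w : ℕ) (o : BinOp) (x y : ℕ) : o.eval w x y < 2 ^ w := by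
  have h : 0 < 2 ^ w := Nat.two_pow_pos w
  cases o <;> simp only [BinOp.eval] <;> first
    | exact Nat.mod_lt _ h
    | (split_ifs <;> first | exact Nat.mod_lt _ h | exact h)

/-- Compiled code copies a register as x or x, which truncates modulo 2^w; this is a faithful copy
only of words. -/
theorem WF_stepWith {w x : ℕ} (hx : x < 2 ^ w) {c : Config} (h : c.state.WF w) :
    (stepWith w x c).state.WF w := by
  rcases c with ⟨_ | ⟨e, k⟩, s⟩
  · exact h
  · cases e with
    | const d c => exact State.WF.setReg h (Nat.mod_lt _ (Nat.two_pow_pos w))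
    | wordLen d => exact State.WF.setReg h Nat.lt_two_pow_self
    | rand d => exact State.WF.setReg h hx
    | op o d a b => exact State.WF.setReg h (o.eval_lt w _ _)
    | load d arr a => exact State.WF.setReg h (h.2 _ _)
    | store arr a b => exact State.WF.setMem h (h.1 _)
    | seq c₁ c₂ => exact h
    | ite a c₁ c₂ => simp only [stepWith]; split_ifs <;> exact h
    | loop a c => simp only [stepWith]; split_ifs <;> exact h

end WordRAM

/-! ## A language with expressions, compiled to commands -/

namespace WordRAM

/-- Expressions: registers, constants, the word length, operations, array cells. -/
inductive Ex where
  | v (r : ℕ)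
  | n (c : ℕ)
  | wl
  | o (o : BinOp) (e₁ e₂ : Ex)
  | ld (arr : ℕ) (e : Ex)

namespace Ex

def eval (w : ℕ) (σ : State) : Ex → ℕ
  | v r => σ.reg r
  | n c => c % 2 ^ w
  | wl => w
  | o op e₁ e₂ => op.eval w (e₁.eval w σ) (e₂.eval w σ)
  | ld arr e => σ.mem arr (e.eval w σ)

/-- Evaluate an expression into register `2 * d + 1`, using odd registers from there on. -/
def comp : Ex → ℕ → Cmd
  | v r, d => .op .or (2 * d + 1) (2 * r) (2 * r)
  | n c, d => .const (2 * d + 1) c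
  | wl, d => .wordLen (2 * d + 1)
  | o op e₁ e₂, d => .seq (e₁.comp d) (.seq (e₂.comp (d + 1))
      (.op op (2 * d + 1) (2 * d + 1) (2 * d + 3)))
  | ld arr e, d => .seq (e.comp d) (.load (2 * d + 1) arr (2 * d + 1))

/-- The number of steps that the evaluation takes. -/
def size : Ex → ℕ
  | v _ => 1
  | n _ => 1
  | wl => 1
  | o _ e₁ e₂ => e₁.size + e₂.size + 3
  | ld _ e => e.size + 2

end Ex

/-- The even registers, renumbered, and the arrays. -/
def State.abs (s : State) : State := ⟨fun j => s.reg (2 * j), s.mem⟩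

/-- Variables live in even registers, and the odd registers form an evaluation stack. Evaluation at
depth d leaves everything below d alone, so the left operand survives the evaluation of the right
one. -/
theorem Ex.comp_det (w : ℕ) (e : Ex) : ∀ (d : ℕ) (k : List Cmd) (s : State), s.WF w →
    ∃ s' : State, Det w e.size ⟨e.comp d :: k, s⟩ ⟨k, s'⟩ ∧ s'.reg (2 * d + 1) = e.eval w s.abs ∧
      s'.abs = s.abs ∧ (∀ i < d, s'.reg (2 * i + 1) = s.reg (2 * i + 1)) ∧ s'.WF w := by
  have key : ∀ (d v : ℕ) (s : State), (s.setReg (2 * d + 1) v).abs = s.abs ∧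
      ∀ i < d, (s.setReg (2 * d + 1) v).reg (2 * i + 1) = s.reg (2 * i + 1) := by
    intro d v s
    refine ⟨?_, fun i hi => ?_⟩
    · simp only [State.abs, State.setReg, State.mk.injEq, and_true]
      funext j
      rw [Function.update_of_ne (by omega)]
    · simp only [State.setReg]
      rw [Function.update_of_ne (by omega)]
  induction e with
  | v r =>
    intro d k s hs
    refine ⟨s.setReg (2 * d + 1) _, .one (by simp) fun x => rfl, ?_, (key _ _ _).1, (key _ _ _).2,
      hs.setReg (BinOp.eval_lt w _ _ _)⟩
    simp [State.setReg, BinOp.eval, eval, State.abs, Nat.mod_eq_of_lt (hs.1 _)]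
  | n c =>
    intro d k s hs
    exact ⟨s.setReg (2 * d + 1) _, .one (by simp) fun x => rfl, by simp [State.setReg, eval],
      (key _ _ _).1, (key _ _ _).2, hs.setReg (Nat.mod_lt _ (Nat.two_pow_pos w))⟩
  | wl =>
    intro d k s hs
    exact ⟨s.setReg (2 * d + 1) _, .one (by simp) fun x => rfl, by simp [State.setReg, eval],
      (key _ _ _).1, (key _ _ _).2, hs.setReg Nat.lt_two_pow_self⟩
  | o op e₁ e₂ ih₁ ih₂ =>
    intro d k s hs
    obtain ⟨s₁, h₁, hv₁, ha₁, ho₁, hw₁⟩ := ih₁ d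
      (.seq (e₂.comp (d + 1)) (.op op (2 * d + 1) (2 * d + 1) (2 * d + 3)) :: k) s hs
    obtain ⟨s₂, h₂, hv₂, ha₂, ho₂, hw₂⟩ := ih₂ (d + 1)
      (.op op (2 * d + 1) (2 * d + 1) (2 * d + 3) :: k) s₁ hw₁
    refine ⟨s₂.setReg (2 * d + 1) (op.eval w (s₂.reg (2 * d + 1)) (s₂.reg (2 * d + 3))), ?_, ?_, ?_,
      ?_, hw₂.setReg (BinOp.eval_lt w _ _ _)⟩
    · have : (Ex.o op e₁ e₂).size = 1 + (e₁.size + (1 + (e₂.size + 1))) := by simp [size]; ring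
      rw [this]
      exact (Det.one (by simp) fun x => rfl).trans (h₁.trans ((Det.one (by simp) fun x => rfl).trans
        (h₂.trans (Det.one (by simp) fun x => rfl))))
    · have : s₂.reg (2 * d + 3) = e₂.eval w s₁.abs := hv₂
      simp [State.setReg, eval, this, ho₂ d (by omega), hv₁, ha₁]
    · rw [(key _ _ _).1, ha₂, ha₁]
    · intro i hi
      rw [(key _ _ _).2 i hi, ho₂ i (by omega), ho₁ i hi]
  | ld arr e ih =>
    intro d k s hs
    obtain ⟨s₁, h₁, hv₁, ha₁, ho₁, hw₁⟩ := ih d (.load (2 * d + 1) arr (2 * d + 1) :: k) s hs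
    refine ⟨s₁.setReg (2 * d + 1) (s₁.mem arr (s₁.reg (2 * d + 1))), ?_, ?_, ?_, ?_,
      hw₁.setReg (hw₁.2 _ _)⟩
    · have : (Ex.ld arr e).size = 1 + (e.size + 1) := by simp [size]; ring
      rw [this]
      exact (Det.one (by simp) fun x => rfl).trans (h₁.trans (Det.one (by simp) fun x => rfl))
    · have : s₁.abs.mem = s.abs.mem := by rw [ha₁]
      change s₁.mem = s.mem at this
      simp [State.setReg, eval, hv₁, this, State.abs]
    · rw [(key _ _ _).1, ha₁]
    · intro i hi
      rw [(key _ _ _).2 i hi, ho₁ i hi]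

/-- Statements without random words. -/
inductive Stm where
  | skip
  | asg (d : ℕ) (e : Ex)
  | sto (arr : ℕ) (e₁ e₂ : Ex)
  | seq (s₁ s₂ : Stm)
  | ite (e : Ex) (s₁ s₂ : Stm)
  | whil (e : Ex) (s : Stm)

namespace Stm

/-- `Cmd.loop` tests a register, so the condition is evaluated once in front of the loop and again
at the end of every round. `skip` writes a scratch register. -/
def comp : Stm → Cmd
  | skip => .const 1 0
  | asg d e => .seq (e.comp 0) (.op .or (2 * d) 1 1)
  | sto arr e₁ e₂ => .seq (e₁.comp 0) (.seq (e₂.comp 1) (.store arr 1 3))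
  | seq s₁ s₂ => .seq s₁.comp s₂.comp
  | ite e s₁ s₂ => .seq (e.comp 0) (.ite 1 s₁.comp s₂.comp)
  | whil e s => .seq (e.comp 0) (.loop 1 (.seq s.comp (e.comp 0)))

/-- A bound for the number of machine steps per unit of cost. -/
def width : Stm → ℕ
  | skip => 1
  | asg _ e => e.size + 2
  | sto _ e₁ e₂ => e₁.size + e₂.size + 3
  | seq s₁ s₂ => s₁.width + s₂.width
  | ite e s₁ s₂ => e.size + 2 + s₁.width + s₂.width
  | whil e s => e.size + 3 + s.width

end Stm

theorem Stm.width_pos (st : Stm) : 1 ≤ st.width := by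
  induction st <;> simp only [width] <;> omega

/-- `Big w st σ σ' t`: the statement `st` leads from `σ` to `σ'` at cost `t`. -/
inductive Big (w : ℕ) : Stm → State → State → ℕ → Prop
  | skip (σ) : Big w .skip σ σ 1
  | asg (d e σ) : Big w (.asg d e) σ (σ.setReg d (e.eval w σ)) 1
  | sto (arr e₁ e₂ σ) : Big w (.sto arr e₁ e₂) σ (σ.setMem arr (e₁.eval w σ) (e₂.eval w σ)) 1
  | seq {s₁ s₂ σ σ₁ σ₂ t₁ t₂} (h₁ : Big w s₁ σ σ₁ t₁) (h₂ : Big w s₂ σ₁ σ₂ t₂) :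
      Big w (.seq s₁ s₂) σ σ₂ (t₁ + t₂ + 1)
  | iteT {e s₁ s₂ σ σ' t} (he : e.eval w σ ≠ 0) (h : Big w s₁ σ σ' t) :
      Big w (.ite e s₁ s₂) σ σ' (t + 1)
  | iteF {e s₁ s₂ σ σ' t} (he : e.eval w σ = 0) (h : Big w s₂ σ σ' t) :
      Big w (.ite e s₁ s₂) σ σ' (t + 1)
  | whilF {e s σ} (he : e.eval w σ = 0) : Big w (.whil e s) σ σ 1
  | whilT {e s σ σ₁ σ₂ t₁ t₂} (he : e.eval w σ ≠ 0) (h₁ : Big w s σ σ₁ t₁)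
      (h₂ : Big w (.whil e s) σ₁ σ₂ t₂) : Big w (.whil e s) σ σ₂ (t₁ + t₂ + 1)

/-- The commands for a statement, with the first step of a loop already taken. -/
def Stm.start : Stm → List Cmd → List Cmd
  | .whil e s, k => e.comp 0 :: .loop 1 (.seq s.comp (e.comp 0)) :: k
  | st, k => st.comp :: k

theorem Stm.start_det (w : ℕ) (st : Stm) (k : List Cmd) (s : State) :
    ∃ t ≤ 1, Det w t ⟨st.comp :: k, s⟩ ⟨st.start k, s⟩ := by
  cases st <;> first
    | exact ⟨0, by simp, .refl _⟩
    | exact ⟨1, le_rfl, .one (by simp) fun x => rfl⟩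

/-- After a round of a loop the machine faces the condition followed by the loop, which is the code
of the loop with its first step already taken. Induction on the derivation therefore works for
`Stm.start` rather than `Stm.comp`; the slack of 1 in the bound pays for that step. A common M for
all substatements lets the bounds be added. -/
theorem Big.start_det {w : ℕ} {st : Stm} {σ σ' : State} {t : ℕ} (h : Big w st σ σ' t) :
    ∀ (M : ℕ), st.width ≤ M → ∀ (k : List Cmd) (s : State), s.WF w → s.abs = σ →
      ∃ t' s', t' + 1 ≤ (M + 1) * t ∧ Det w t' ⟨st.start k, s⟩ ⟨k, s'⟩ ∧ s'.abs = σ' ∧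
        s'.WF w := by
  have one : ∀ {c c' : Config}, c.todo ≠ [] → (∀ x, stepWith w x c = c') → Det w 1 c c' := Det.one
  induction h with
  | skip σ =>
    intro M hM k s hs ha
    refine ⟨1, s.setReg 1 (0 % 2 ^ w), by simp [Stm.width] at hM; omega,
      one (by simp [Stm.start]) fun x => rfl, ?_, hs.setReg (by simp)⟩
    rw [← ha]
    simp only [State.abs, State.setReg, State.mk.injEq, and_true]
    funext j
    rw [Function.update_of_ne (by omega)]
  | asg d e σ =>
    intro M hM k s hs ha
    obtain ⟨s₁, h₁, hv₁, ha₁, -, hw₁⟩ := e.comp_det w 0 (.op .or (2 * d) 1 1 :: k) s hs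
    refine ⟨1 + (e.size + 1), s₁.setReg (2 * d) (BinOp.or.eval w (s₁.reg 1) (s₁.reg 1)), ?_,
      (one (by simp [Stm.start]) fun x => rfl).trans (h₁.trans (one (by simp) fun x => rfl)), ?_,
      hw₁.setReg (BinOp.eval_lt w _ _ _)⟩
    · simp [Stm.width] at hM; omega
    · have h1 : s₁.reg 1 = e.eval w s.abs := hv₁
      have h2 : BinOp.or.eval w (s₁.reg 1) (s₁.reg 1) = e.eval w σ := by
        simp only [BinOp.eval, Nat.or_self, Nat.mod_eq_of_lt (hw₁.1 1)]
        rw [h1, ha]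
      rw [h2, ← ha, ← ha₁]
      simp only [State.abs, State.setReg, State.mk.injEq, and_true]
      funext j
      by_cases hj : j = d
      · subst hj; simp
      · rw [Function.update_of_ne (by omega), Function.update_of_ne hj]
  | sto arr e₁ e₂ σ =>
    intro M hM k s hs ha
    obtain ⟨s₁, h₁, hv₁, ha₁, -, hw₁⟩ :=
      e₁.comp_det w 0 (.seq (e₂.comp 1) (.store arr 1 3) :: k) s hs
    obtain ⟨s₂, h₂, hv₂, ha₂, ho₂, hw₂⟩ := e₂.comp_det w 1 (.store arr 1 3 :: k) s₁ hw₁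
    refine ⟨1 + (e₁.size + (1 + (e₂.size + 1))), s₂.setMem arr (s₂.reg 1) (s₂.reg 3), ?_,
      (one (by simp [Stm.start]) fun x => rfl).trans (h₁.trans ((one (by simp) fun x => rfl).trans
        (h₂.trans (one (by simp) fun x => rfl)))), ?_, hw₂.setMem (hw₂.1 _)⟩
    · simp [Stm.width] at hM; omega
    · have h1 : s₂.reg 1 = e₁.eval w σ := by
        rw [← ha, ← hv₁]; exact ho₂ 0 (by omega)
      have h2 : s₂.reg 3 = e₂.eval w σ := by
        rw [← ha, ← ha₁]; exact hv₂
      rw [h1, h2, ← ha, ← ha₁, ← ha₂]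
      rfl
  | @seq s₁ s₂ σ σ₁ σ₂ t₁ t₂ _ _ ih₁ ih₂ =>
    intro M hM k s hs ha
    simp only [Stm.width] at hM
    obtain ⟨u₁, hu₁, d₁⟩ := s₁.start_det w (s₂.comp :: k) s
    obtain ⟨t₁', s₁', ht₁, d₁', ha₁, hw₁⟩ := ih₁ M (by omega) (s₂.comp :: k) s hs ha
    obtain ⟨u₂, hu₂, d₂⟩ := s₂.start_det w k s₁'
    obtain ⟨t₂', s₂', ht₂, d₂', ha₂, hw₂⟩ := ih₂ M (by omega) k s₁' hw₁ ha₁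
    refine ⟨1 + (u₁ + (t₁' + (u₂ + t₂'))), s₂', ?_,
      (one (by simp [Stm.start]) fun x => rfl).trans (d₁.trans (d₁'.trans (d₂.trans d₂'))),
      ha₂, hw₂⟩
    have : (M + 1) * (t₁ + t₂ + 1) = (M + 1) * t₁ + (M + 1) * t₂ + M + 1 := by ring
    have h1 := s₁.width_pos
    omega
  | @iteT e s₁ s₂ σ σ' t he _ ih =>
    intro M hM k s hs ha
    simp only [Stm.width] at hM
    obtain ⟨s₁', h₁, hv₁, ha₁, -, hw₁⟩ := e.comp_det w 0 (.ite 1 s₁.comp s₂.comp :: k) s hs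
    obtain ⟨u, hu, d⟩ := s₁.start_det w k s₁'
    obtain ⟨t', s', ht, d', ha', hw'⟩ := ih M (by omega) k s₁' hw₁ (ha₁.trans ha)
    have h1 : s₁'.reg 1 ≠ 0 := by rw [ha] at hv₁; exact hv₁ ▸ he
    refine ⟨1 + (e.size + (1 + (u + t'))), s', ?_,
      (one (by simp [Stm.start]) fun x => rfl).trans (h₁.trans
        ((one (by simp) fun x => by simp only [stepWith, if_pos h1]).trans (d.trans d'))),
      ha', hw'⟩
    rw [mul_add]; omega
  | @iteF e s₁ s₂ σ σ' t he _ ih =>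
    intro M hM k s hs ha
    simp only [Stm.width] at hM
    obtain ⟨s₁', h₁, hv₁, ha₁, -, hw₁⟩ := e.comp_det w 0 (.ite 1 s₁.comp s₂.comp :: k) s hs
    obtain ⟨u, hu, d⟩ := s₂.start_det w k s₁'
    obtain ⟨t', s', ht, d', ha', hw'⟩ := ih M (by omega) k s₁' hw₁ (ha₁.trans ha)
    have h1 : ¬ s₁'.reg 1 ≠ 0 := by rw [ha] at hv₁; exact not_not.2 (hv₁.trans he)
    refine ⟨1 + (e.size + (1 + (u + t'))), s', ?_,
      (one (by simp [Stm.start]) fun x => rfl).trans (h₁.trans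
        ((one (by simp) fun x => by simp only [stepWith, if_neg h1]).trans (d.trans d'))),
      ha', hw'⟩
    rw [mul_add]; omega
  | @whilF e b σ he =>
    intro M hM k s hs ha
    simp only [Stm.width] at hM
    obtain ⟨s₁', h₁, hv₁, ha₁, -, hw₁⟩ :=
      e.comp_det w 0 (.loop 1 (.seq b.comp (e.comp 0)) :: k) s hs
    have h1 : ¬ s₁'.reg 1 ≠ 0 := by rw [ha] at hv₁; exact not_not.2 (hv₁.trans he)
    refine ⟨e.size + 1, s₁', by omega,
      h₁.trans (one (by simp) fun x => by simp only [stepWith, if_neg h1]), ha₁.trans ha, hw₁⟩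
  | @whilT e b σ σ₁ σ₂ t₁ t₂ he _ _ ih₁ ih₂ =>
    intro M hM k s hs ha
    have hM' := hM
    simp only [Stm.width] at hM
    obtain ⟨s₁', h₁, hv₁, ha₁, -, hw₁⟩ :=
      e.comp_det w 0 (.loop 1 (.seq b.comp (e.comp 0)) :: k) s hs
    have h1 : s₁'.reg 1 ≠ 0 := by rw [ha] at hv₁; exact hv₁ ▸ he
    obtain ⟨u, hu, d⟩ := b.start_det w
      (e.comp 0 :: .loop 1 (.seq b.comp (e.comp 0)) :: k) s₁'
    obtain ⟨t', s', ht, d', ha', hw'⟩ := ih₁ M (by omega)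
      (e.comp 0 :: .loop 1 (.seq b.comp (e.comp 0)) :: k) s₁' hw₁ (ha₁.trans ha)
    obtain ⟨t'', s'', ht'', d'', ha'', hw''⟩ := ih₂ M hM' k s' hw' ha'
    refine ⟨e.size + (1 + (1 + (u + (t' + t'')))), s'', ?_,
      h₁.trans ((one (c' := ⟨.seq b.comp (e.comp 0) :: .loop 1 (.seq b.comp (e.comp 0)) :: k, s₁'⟩)
        (by simp) fun x => by simp only [stepWith, if_pos h1]).trans
        ((one (by simp) fun x => rfl).trans (d.trans (d'.trans d'')))), ha'', hw''⟩
    have : (M + 1) * (t₁ + t₂ + 1) = (M + 1) * t₁ + (M + 1) * t₂ + M + 1 := by ring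
    omega

/-- From here on costs of statements stand for numbers of steps: the conversion factor depends on
the text of the statement alone. -/
theorem Spec.big {w : ℕ} {st : Stm} {σ σ' : State} {t : ℕ} (h : Big w st σ σ' t)
    {k : List Cmd} {s : State} (hs : s.WF w) (ha : s.abs = σ) {B : ℝ≥0∞} {Q : State → Prop}
    (h' : ∀ s' : State, s'.WF w → s'.abs = σ' → Spec w ⟨k, s'⟩ B Q) :
    Spec w ⟨st.comp :: k, s⟩ (((st.width + 1) * t : ℕ) + B) Q := by
  obtain ⟨u, hu, d⟩ := st.start_det w k s
  obtain ⟨t', s', ht, d', ha', hw'⟩ := h.start_det st.width le_rfl k s hs ha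
  refine (Spec.det (d.trans d') (h' s' hw' ha')).mono ?_
  gcongr
  omega

end WordRAM

/-! ## Programs inside programs -/

namespace WordRAM

/-- Rename registers and arrays: the register `r` becomes `2 * (100 + r)`, the array `a` becomes
`50 + a`. -/
def Cmd.embed : Cmd → Cmd
  | .const d c => .const (2 * (100 + d)) c
  | .wordLen d => .wordLen (2 * (100 + d))
  | .rand d => .rand (2 * (100 + d))
  | .op o d a b => .op o (2 * (100 + d)) (2 * (100 + a)) (2 * (100 + b))
  | .load d arr a => .load (2 * (100 + d)) (50 + arr) (2 * (100 + a))
  | .store arr a b => .store (50 + arr) (2 * (100 + a)) (2 * (100 + b))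
  | .seq c₁ c₂ => .seq c₁.embed c₂.embed
  | .ite a c₁ c₂ => .ite (2 * (100 + a)) c₁.embed c₂.embed
  | .loop a c => .loop (2 * (100 + a)) c.embed

/-- What an embedded program sees. -/
def State.inner (s : State) : State := ⟨fun r => s.abs.reg (100 + r), fun a => s.mem (50 + a)⟩

/-- The states agree on what an embedded program does not use. -/
def OuterEq (s s' : State) : Prop :=
  (∀ r < 100, s.abs.reg r = s'.abs.reg r) ∧ ∀ a < 50, s.mem a = s'.mem a

theorem OuterEq.refl (s : State) : OuterEq s s := ⟨fun _ _ => rfl, fun _ _ => rfl⟩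

theorem OuterEq.trans {s s' s'' : State} (h : OuterEq s s') (h' : OuterEq s' s'') :
    OuterEq s s'' :=
  ⟨fun r hr => (h.1 r hr).trans (h'.1 r hr), fun a ha => (h.2 a ha).trans (h'.2 a ha)⟩

theorem State.inner_setReg (s : State) (d v : ℕ) :
    (s.setReg (2 * (100 + d)) v).inner = s.inner.setReg d v := by
  simp only [inner, abs, setReg, mk.injEq, and_true]
  funext r
  by_cases h : r = d
  · subst h; simp
  · rw [Function.update_of_ne (by omega), Function.update_of_ne h]

theorem State.inner_setMem (s : State) (a i v : ℕ) :
    (s.setMem (50 + a) i v).inner = s.inner.setMem a i v := by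
  simp only [inner, abs, setMem, mk.injEq, true_and]
  funext b
  by_cases h : b = a
  · subst h; simp
  · rw [Function.update_of_ne (by omega), Function.update_of_ne h]

theorem outerEq_setReg (s : State) (d v : ℕ) : OuterEq (s.setReg (2 * (100 + d)) v) s := by
  refine ⟨fun r hr => ?_, fun a ha => rfl⟩
  simp only [State.abs, State.setReg]
  rw [Function.update_of_ne (by omega)]

theorem outerEq_setMem (s : State) (a i v : ℕ) : OuterEq (s.setMem (50 + a) i v) s := by
  refine ⟨fun r hr => rfl, fun b hb => ?_⟩
  simp only [State.setMem]
  rw [Function.update_of_ne (by omega)]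

theorem stepWith_embed (w x : ℕ) (e : Cmd) (l k : List Cmd) (s : State) :
    ∃ s' : State, stepWith w x ⟨(e :: l).map Cmd.embed ++ k, s⟩ =
        ⟨(stepWith w x ⟨e :: l, s.inner⟩).todo.map Cmd.embed ++ k, s'⟩ ∧
      s'.inner = (stepWith w x ⟨e :: l, s.inner⟩).state ∧ OuterEq s' s := by
  cases e with
  | const d c => exact ⟨_, rfl, s.inner_setReg _ _, outerEq_setReg _ _ _⟩
  | wordLen d => exact ⟨_, rfl, s.inner_setReg _ _, outerEq_setReg _ _ _⟩
  | rand d => exact ⟨_, rfl, s.inner_setReg _ _, outerEq_setReg _ _ _⟩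
  | op o d a b => exact ⟨_, rfl, s.inner_setReg _ _, outerEq_setReg _ _ _⟩
  | load d arr a => exact ⟨_, rfl, s.inner_setReg _ _, outerEq_setReg _ _ _⟩
  | store arr a b => exact ⟨_, rfl, s.inner_setMem _ _ _, outerEq_setMem _ _ _ _⟩
  | seq c₁ c₂ => exact ⟨s, rfl, rfl, .refl s⟩
  | ite a c₁ c₂ =>
    refine ⟨s, ?_, ?_, .refl s⟩
    · simp only [List.map_cons, List.cons_append, Cmd.embed, stepWith]
      change (if s.inner.reg a ≠ 0 then _ else _) = _
      split_ifs <;> simp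
    · simp only [stepWith]; split_ifs <;> rfl
  | loop a c =>
    refine ⟨s, ?_, ?_, .refl s⟩
    · simp only [List.map_cons, List.cons_append, Cmd.embed, stepWith]
      change (if s.inner.reg a ≠ 0 then _ else _) = _
      split_ifs <;> simp [Cmd.embed]
    · simp only [stepWith]; split_ifs <;> rfl

/-- An embedded program takes its own expected time, and its possible results are its own. -/
theorem Spec.embed {w : ℕ} {k kD : List Cmd} {a : ℝ≥0∞} {Q : State → Prop} {l : List Cmd}
    {s : State} (hs : s.WF w)
    (h : ∀ s' : State, s'.WF w → FinalState w ⟨l, s.inner⟩ s'.inner → OuterEq s' s →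
      Spec w ⟨k, s'⟩ (a + expectedTime w ⟨kD, s'.inner⟩) Q) :
    Spec w ⟨l.map Cmd.embed ++ k, s⟩ (a + expectedTime w ⟨l ++ kD, s.inner⟩) Q := by
  simp only [finalState_iff] at h
  -- With the same random word, the outer machine and the inner one take matching steps, and the
  -- hypothesis about the continuation is inherited by the new configuration.
  have next : ∀ (e : Cmd) (l : List Cmd) (s : State), s.WF w →
      (∀ s' : State, s'.WF w → Reach w ⟨e :: l, s.inner⟩ ⟨[], s'.inner⟩ → OuterEq s' s →
        Spec w ⟨k, s'⟩ (a + expectedTime w ⟨kD, s'.inner⟩) Q) → ∀ x < 2 ^ w,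
      ∃ (l' : List Cmd) (s₁ : State),
        stepWith w x ⟨(e :: l).map Cmd.embed ++ k, s⟩ = ⟨l'.map Cmd.embed ++ k, s₁⟩ ∧
        stepWith w x ⟨e :: l, s.inner⟩ = ⟨l', s₁.inner⟩ ∧ s₁.WF w ∧
        (∀ s' : State, s'.WF w → Reach w ⟨l', s₁.inner⟩ ⟨[], s'.inner⟩ → OuterEq s' s₁ →
          Spec w ⟨k, s'⟩ (a + expectedTime w ⟨kD, s'.inner⟩) Q) := by
    intro e l s hs h x hx
    obtain ⟨s₁, h₁, h₂, h₃⟩ := stepWith_embed w x e l k s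
    refine ⟨_, s₁, h₁, by rw [h₂], ?_, fun s' hw hr ho => h s' hw (.head ⟨by simp, x, hx, rfl⟩ ?_)
      (ho.trans h₃)⟩
    · have := WF_stepWith hx (c := ⟨(e :: l).map Cmd.embed ++ k, s⟩) hs
      rwa [h₁] at this
    · rw [h₂] at hr; exact hr
  constructor
  -- The embedded program is arbitrary and may never halt, so the induction is on the number of
  -- steps that are counted.
  · refine expectedTime_le_of_timeUpTo w _ _ fun n => ?_
    induction n generalizing l s with
    | zero => simp [timeUpTo]
    | succ n ih =>
      cases l with
      | nil => exact (timeUpTo_le w _ _).trans (h s hs .refl (.refl s)).1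
      | cons e l =>
        refine (timeUpTo_succ_le w _ n).trans ?_
        rw [expectedTime_step w (c := ⟨e :: l ++ kD, s.inner⟩) (by simp [Config.Halted])]
        calc _ ≤ 1 + avg w fun x => a + expectedTime w (stepWith w x ⟨e :: l ++ kD, s.inner⟩) := by
              gcongr
              refine avg_mono fun x hx => ?_
              obtain ⟨l', s₁, h₁, h₂, h₃, h₄⟩ := next e l s hs h x hx
              rw [h₁, stepWith_append, h₂]
              exact ih h₃ h₄
          _ = _ := by rw [avg_add, avg_const]; ring
  · intro sf hsf
    rw [finalState_iff] at hsf
    generalize hc : (⟨l.map Cmd.embed ++ k, s⟩ : Config) = c at hsf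
    induction hsf using Relation.ReflTransGen.head_induction_on generalizing l s with
    | refl =>
      obtain ⟨h₁, rfl⟩ := Config.mk.inj hc
      obtain ⟨h₁, h₂⟩ := List.append_eq_nil_iff.1 h₁
      obtain rfl := List.map_eq_nil_iff.1 h₁
      subst h₂
      exact (h s hs .refl (.refl s)).2 s (finalState_iff.2 .refl)
    | @head c' d hst hr ih =>
      subst hc
      cases l with
      | nil =>
        exact (h s hs .refl (.refl s)).2 sf (finalState_iff.2 (.head hst hr))
      | cons e l =>
        obtain ⟨_, x, hx, rfl⟩ := hst
        obtain ⟨l', s₁, h₁, h₂, h₃, h₄⟩ := next e l s hs h x hx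
        exact ih h₃ h₄ h₁.symm

end WordRAM

/-! ## Reasoning about statements -/

namespace WordRAM

section Registers
variable (σ : State) (d v a i r b : ℕ)

theorem reg_setReg : (σ.setReg d v).reg r = if r = d then v else σ.reg r := by
  simp [State.setReg, Function.update_apply]

theorem mem_setReg : (σ.setReg d v).mem = σ.mem := rfl

theorem reg_setMem : (σ.setMem a i v).reg = σ.reg := rfl

theorem mem_setMem : (σ.setMem a i v).mem b =
    if b = a then Function.update (σ.mem a) i v else σ.mem b := by
  simp [State.setMem, Function.update_apply]

end Registers

instance : Add Ex := ⟨.o .add⟩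
instance : Sub Ex := ⟨.o .sub⟩
instance : Mul Ex := ⟨.o .mul⟩
instance : Div Ex := ⟨.o .div⟩
instance : Mod Ex := ⟨.o .mod⟩

namespace Ex
variable {w a b i : ℕ} {σ : State} {e e₁ e₂ : Ex} {P Q : Prop} [Decidable P] [Decidable Q]

theorem eval_v {r : ℕ} (h : σ.reg r = a) : (v r).eval w σ = a := h

theorem eval_n (h : a < 2 ^ w) : (n a).eval w σ = a := Nat.mod_eq_of_lt h

theorem eval_ld {arr : ℕ} (h : e.eval w σ = i) (h' : σ.mem arr i = a) :
    (ld arr e).eval w σ = a := by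
  rw [eval, h, h']

theorem eval_add (h₁ : e₁.eval w σ = a) (h₂ : e₂.eval w σ = b) (h : a + b < 2 ^ w) :
    (e₁ + e₂).eval w σ = a + b := by
  subst h₁ h₂; exact Nat.mod_eq_of_lt h

theorem eval_sub (h₁ : e₁.eval w σ = a) (h₂ : e₂.eval w σ = b) (h : b ≤ a) (h' : a < 2 ^ w) :
    (e₁ - e₂).eval w σ = a - b := by
  subst h₁ h₂
  change (_ + (2 ^ w - _)) % 2 ^ w = _
  rw [show e₁.eval w σ + (2 ^ w - e₂.eval w σ) = (e₁.eval w σ - e₂.eval w σ) + 2 ^ w by omega,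
    Nat.add_mod_right, Nat.mod_eq_of_lt (by omega)]

theorem eval_mul (h₁ : e₁.eval w σ = a) (h₂ : e₂.eval w σ = b) (h : a * b < 2 ^ w) :
    (e₁ * e₂).eval w σ = a * b := by
  subst h₁ h₂; exact Nat.mod_eq_of_lt h

theorem eval_div (h₁ : e₁.eval w σ = a) (h₂ : e₂.eval w σ = b) (h : a < 2 ^ w) :
    (e₁ / e₂).eval w σ = a / b := by
  subst h₁ h₂; exact Nat.mod_eq_of_lt ((Nat.div_le_self _ _).trans_lt h)

theorem eval_mod (h₁ : e₁.eval w σ = a) (h₂ : e₂.eval w σ = b) (h : a < 2 ^ w) :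
    (e₁ % e₂).eval w σ = a % b := by
  subst h₁ h₂; exact Nat.mod_eq_of_lt ((Nat.mod_le _ _).trans_lt h)

theorem eval_shr (h₁ : e₁.eval w σ = a) (h₂ : e₂.eval w σ = b) (h : a < 2 ^ w) :
    (o .shr e₁ e₂).eval w σ = a / 2 ^ b := by
  subst h₁ h₂; exact Nat.mod_eq_of_lt ((Nat.div_le_self _ _).trans_lt h)

theorem eval_shl (h₁ : e₁.eval w σ = a) (h₂ : e₂.eval w σ = b) (h : a * 2 ^ b < 2 ^ w) :
    (o .shl e₁ e₂).eval w σ = a * 2 ^ b := by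
  subst h₁ h₂; exact Nat.mod_eq_of_lt h

theorem eval_lt (hw : w ≠ 0) (h₁ : e₁.eval w σ = a) (h₂ : e₂.eval w σ = b) :
    (o .lt e₁ e₂).eval w σ = if a < b then 1 else 0 := by
  subst h₁ h₂
  simp only [eval, BinOp.eval, Nat.mod_eq_of_lt (Nat.one_lt_two_pow hw)]

theorem eval_eq (hw : w ≠ 0) (h₁ : e₁.eval w σ = a) (h₂ : e₂.eval w σ = b) :
    (o .eq e₁ e₂).eval w σ = if a = b then 1 else 0 := by
  subst h₁ h₂
  simp only [eval, BinOp.eval, Nat.mod_eq_of_lt (Nat.one_lt_two_pow hw)]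

theorem eval_and (hw : w ≠ 0) (h₁ : e₁.eval w σ = if P then 1 else 0)
    (h₂ : e₂.eval w σ = if Q then 1 else 0) :
    (e₁ * e₂).eval w σ = if P ∧ Q then 1 else 0 := by
  rw [eval_mul h₁ h₂]
  · by_cases P <;> by_cases Q <;> simp [*]
  · have := Nat.one_lt_two_pow hw
    by_cases P <;> by_cases Q <;> simp [*]

theorem eval_or (hw : w ≠ 0) (h₁ : e₁.eval w σ = if P then 1 else 0)
    (h₂ : e₂.eval w σ = if Q then 1 else 0) :
    (o .or e₁ e₂).eval w σ = if P ∨ Q then 1 else 0 := by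
  have := Nat.one_lt_two_pow hw
  simp only [eval, BinOp.eval, h₁, h₂]
  by_cases P <;> by_cases Q <;> simp [*] <;> omega

theorem eval_not (hw : w ≠ 0) (h₁ : e₁.eval w σ = if P then 1 else 0) :
    (o .eq e₁ (n 0)).eval w σ = if ¬ P then 1 else 0 := by
  rw [eval_eq hw h₁ (b := 0) (by simp [eval])]
  by_cases P <;> simp [*]

end Ex

namespace Stm

/-- Append a value to the list in the array `arr`, whose length is in register `c`. -/
def push (arr c : ℕ) (e : Ex) : Stm := .seq (.sto arr (.v c) e) (.asg c (.v c + .n 1))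

/-- For `i` from `0` to `e - 1` do `b`. -/
def forr (i : ℕ) (e : Ex) (b : Stm) : Stm :=
  .seq (.asg i (.n 0)) (.whil (.o .lt (.v i) e) (.seq b (.asg i (.v i + .n 1))))

/-- The registers that a statement may change. -/
def regs : Stm → List ℕ
  | skip => []
  | asg d _ => [d]
  | sto _ _ _ => []
  | seq s₁ s₂ => s₁.regs ++ s₂.regs
  | ite _ s₁ s₂ => s₁.regs ++ s₂.regs
  | whil _ s => s.regs

/-- The arrays that a statement may change. -/
def arrs : Stm → List ℕ
  | skip => []
  | asg _ _ => []
  | sto a _ _ => [a]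
  | seq s₁ s₂ => s₁.arrs ++ s₂.arrs
  | ite _ s₁ s₂ => s₁.arrs ++ s₂.arrs
  | whil _ s => s.arrs

end Stm

/-- The states differ only in what `st` may change. -/
structure Frame (st : Stm) (σ σ' : State) : Prop where
  reg : ∀ r, r ∉ st.regs → σ'.reg r = σ.reg r
  mem : ∀ a, a ∉ st.arrs → σ'.mem a = σ.mem a

theorem Frame.refl (st : Stm) (σ : State) : Frame st σ σ := ⟨fun _ _ => rfl, fun _ _ => rfl⟩

theorem Frame.trans {st : Stm} {σ σ' σ'' : State} (h : Frame st σ σ') (h' : Frame st σ' σ'') :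
    Frame st σ σ'' :=
  ⟨fun r hr => (h'.reg r hr).trans (h.reg r hr), fun a ha => (h'.mem a ha).trans (h.mem a ha)⟩

theorem Frame.mono {st st' : Stm} {σ σ' : State} (h : Frame st σ σ') (hr : st.regs ⊆ st'.regs)
    (ha : st.arrs ⊆ st'.arrs) : Frame st' σ σ' :=
  ⟨fun r hr' => h.reg r fun h => hr' (hr h), fun a ha' => h.mem a fun h => ha' (ha h)⟩

theorem Big.frame {w : ℕ} {st : Stm} {σ σ' : State} {t : ℕ} (h : Big w st σ σ' t) :
    Frame st σ σ' := by
  induction h with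
  | skip => exact .refl _ _
  | asg d e σ =>
    exact ⟨fun r hr => by simp only [Stm.regs, List.mem_singleton] at hr; simp [reg_setReg, hr],
      fun _ _ => rfl⟩
  | sto a e₁ e₂ σ =>
    exact ⟨fun _ _ => rfl,
      fun b hb => by simp only [Stm.arrs, List.mem_singleton] at hb; simp [mem_setMem, hb]⟩
  | seq _ _ ih₁ ih₂ =>
    exact (ih₁.mono (by simp [Stm.regs]) (by simp [Stm.arrs])).trans
      (ih₂.mono (by simp [Stm.regs]) (by simp [Stm.arrs]))
  | iteT _ _ ih => exact ih.mono (by simp [Stm.regs]) (by simp [Stm.arrs])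
  | iteF _ _ ih => exact ih.mono (by simp [Stm.regs]) (by simp [Stm.arrs])
  | whilF => exact .refl _ _
  | whilT _ _ _ ih₁ ih₂ => exact Frame.trans ⟨ih₁.reg, ih₁.mem⟩ ih₂

theorem Big.asg' {w d a : ℕ} {e : Ex} {σ : State} (h : e.eval w σ = a) :
    Big w (.asg d e) σ (σ.setReg d a) 1 := h ▸ .asg d e σ

theorem Big.sto' {w arr i a : ℕ} {e₁ e₂ : Ex} {σ : State} (h₁ : e₁.eval w σ = i)
    (h₂ : e₂.eval w σ = a) : Big w (.sto arr e₁ e₂) σ (σ.setMem arr i a) 1 :=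
  h₁ ▸ h₂ ▸ .sto arr e₁ e₂ σ

theorem Big.push {w arr c i a : ℕ} {e : Ex} {σ : State} (hc : σ.reg c = i) (h : e.eval w σ = a)
    (hi : i + 1 < 2 ^ w) : Big w (.push arr c e) σ ((σ.setMem arr i a).setReg c (i + 1)) 3 :=
  .seq (.sto' (Ex.eval_v hc) h) (.asg' (Ex.eval_add (Ex.eval_v hc) (Ex.eval_n (by omega)) hi))

/-- The rule for loops with an invariant, a frame, and a bound for the cost of each iteration. -/
theorem Big.forr {w i N : ℕ} {e : Ex} {b : Stm} {σ : State} (Inv : ℕ → State → Prop) (c : ℕ → ℕ)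
    (hw : w ≠ 0) (hN : N < 2 ^ w) (h0 : Inv 0 (σ.setReg i 0))
    (he : ∀ k σ', k ≤ N → Frame (.forr i e b) σ σ' → Inv k σ' → σ'.reg i = k → e.eval w σ' = N)
    (hb : ∀ k σ', k < N → Frame (.forr i e b) σ σ' → Inv k σ' → σ'.reg i = k →
      ∃ σ'' t, Big w b σ' σ'' t ∧ t ≤ c k ∧ σ''.reg i = k ∧ Inv (k + 1) (σ''.setReg i (k + 1))) :
    ∃ σ' t, Big w (.forr i e b) σ σ' t ∧ t ≤ ∑ k ∈ Finset.range N, (c k + 3) + 3 ∧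
      σ'.reg i = N ∧ Inv N σ' := by
  set L := Stm.whil (.o .lt (.v i) e) (.seq b (.asg i (.v i + .n 1))) with hL
  have hfr : ∀ σ₁ : State, Frame (.forr i e b) σ₁ (σ₁.setReg i 0) := fun σ₁ =>
    ⟨fun r hr => by
      rw [reg_setReg, if_neg]; rintro rfl; simp [Stm.forr, Stm.regs] at hr, fun _ _ => rfl⟩
  have main : ∀ j k σ', k + j = N → Frame (.forr i e b) σ σ' → Inv k σ' → σ'.reg i = k →
      ∃ σ'' t, Big w L σ' σ'' t ∧ t ≤ ∑ k ∈ Finset.Ico k N, (c k + 3) + 1 ∧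
        σ''.reg i = N ∧ Inv N σ'' := by
    intro j
    induction j with
    | zero =>
      intro k σ' hk hf hi hr
      obtain rfl : k = N := by omega
      refine ⟨σ', 1, .whilF ?_, by simp, hr, hi⟩
      rw [Ex.eval_lt hw (Ex.eval_v hr) (he k σ' le_rfl hf hi hr), if_neg (lt_irrefl _)]
    | succ j ih =>
      intro k σ' hk hf hi hr
      obtain ⟨σ₁, t₁, h₁, ht₁, hr₁, hi₁⟩ := hb k σ' (by omega) hf hi hr
      have h₂ : Big w (.asg i (.v i + .n 1)) σ₁ (σ₁.setReg i (k + 1)) 1 :=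
        .asg' (Ex.eval_add (Ex.eval_v hr₁) (Ex.eval_n (by omega)) (by omega))
      obtain ⟨σ₂, t₂, h₃, ht₂, hr₂, hi₂⟩ := ih (k + 1) (σ₁.setReg i (k + 1)) (by omega)
        (hf.trans (((Big.seq h₁ h₂).frame).mono (by simp [Stm.forr, Stm.regs])
          (by simp [Stm.forr, Stm.arrs]))) hi₁ (by simp [reg_setReg])
      refine ⟨σ₂, _, .whilT ?_ (.seq h₁ h₂) h₃, ?_, hr₂, hi₂⟩
      · rw [Ex.eval_lt hw (Ex.eval_v hr) (he k σ' (by omega) hf hi hr), if_pos (by omega)]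
        simp
      · rw [Finset.sum_eq_sum_Ico_succ_bot (by omega)]
        omega
  obtain ⟨σ', t, h, ht, hr, hi⟩ := main N 0 (σ.setReg i 0) (by simp) (hfr σ) h0 (by simp [reg_setReg])
  refine ⟨σ', _, .seq (.asg' (Ex.eval_n (by omega))) h, ?_, hr, hi⟩
  rw [Finset.range_eq_Ico]
  omega

/-- The array holds the list, followed by zeros. -/
def Holds (f : ℕ → ℕ) (l : List ℕ) : Prop := ∀ i, f i = l.getD i 0

theorem Holds.push {f : ℕ → ℕ} {l : List ℕ} (h : Holds f l) (a : ℕ) :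
    Holds (Function.update f l.length a) (l ++ [a]) := by
  intro i
  rw [Function.update_apply, h i]
  rcases lt_trichotomy i l.length with hi | rfl | hi
  · rw [if_neg hi.ne, List.getD_append _ _ _ _ hi]
  · simp
  · rw [if_neg hi.ne', List.getD_eq_default _ _ hi.le, List.getD_eq_default]
    simp; omega

/-- A loop that appends one value in each iteration. -/
theorem Big.pushLoop {w i arr c N : ℕ} {e e' : Ex} {σ : State} {l : List ℕ} (val : ℕ → ℕ)
    (hw : w ≠ 0) (hic : i ≠ c) (hl : l.length + N < 2 ^ w) (hc : σ.reg c = l.length)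
    (hm : Holds (σ.mem arr) l)
    (he : ∀ σ', Frame (.forr i e (.push arr c e')) σ σ' → e.eval w σ' = N)
    (hb : ∀ k σ', k < N → Frame (.forr i e (.push arr c e')) σ σ' → σ'.reg i = k →
      e'.eval w σ' = val k) :
    ∃ σ' t, Big w (.forr i e (.push arr c e')) σ σ' t ∧ t ≤ 6 * N + 3 ∧
      σ'.reg c = (l ++ (List.range N).map val).length ∧
      Holds (σ'.mem arr) (l ++ (List.range N).map val) := by
  obtain ⟨σ', t, h, ht, -, h₁, h₂⟩ := Big.forr (σ := σ) (i := i) (e := e) (b := .push arr c e')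
    (fun k σ' => σ'.reg c = (l ++ (List.range k).map val).length ∧
      Holds (σ'.mem arr) (l ++ (List.range k).map val)) (fun _ => 3) hw (N := N) (by omega)
    (by simpa [reg_setReg, hic.symm, hc, mem_setReg] using hm)
    (fun k σ' _ hf _ _ => he σ' hf)
    (fun k σ' hk hf hi hr => by
      have hlen : (l ++ (List.range k).map val).length = l.length + k := by simp
      refine ⟨_, 3, .push hi.1 (hb k σ' hk hf hr) (by omega), le_rfl, ?_, ?_, ?_⟩
      · simp [reg_setReg, hic, reg_setMem, hr]
      · simp [reg_setReg, hic.symm, List.range_succ]; omega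
      · simp only [mem_setReg, mem_setMem, if_true, List.range_succ, List.map_append,
          ← List.append_assoc]
        exact hi.2.push _)
  refine ⟨σ', t, h, ht.trans ?_, h₁, h₂⟩
  simp; omega

end WordRAM

/-! ## The reduction: sets, queries and chains -/

namespace Reduction

open WordRAM SetIntersection

/-- The data of the reduction: word length, number of elements, elements (as words), multiplier,
bit length of the number of elements, logarithms of the number of buckets and of the number of
shifts. -/
structure Par where
  w : ℕ
  l : ℕ
  X : ℕ → ℕ
  α : ℕ
  Lg : ℕ
  s : ℕ
  r : ℕ

namespace Par
variable (p : Par)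

/-- The largest number of elements of a set of the first family. -/
def T : ℕ := p.l / 2 ^ p.s + 1

/-- The number of keys, that is, pairs of a class and a bucket. -/
def NK : ℕ := 4 * p.Lg * 2 ^ p.s

/-- The number of shifts in the first family. -/
def U : ℕ := 2 ^ p.r + 2 ^ p.r + 1

/-- The range of the lower half of the hash function. -/
def Q : ℕ := 2 ^ p.r * 2 ^ p.r

/-- The hash function. -/
def H (x : ℕ) : ℕ := p.α * x % 2 ^ p.w / 2 ^ (p.w - (p.s + (p.r + p.r)))

/-- The element number `i` belongs to the key. -/
def Mem (key i : ℕ) : Prop :=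
  0 < p.X i ∧ key / 2 ^ p.s % 4 = 2 * (i / 2 ^ (key / 2 ^ p.s / 4) % 2) + p.X i / 2 ^ (p.w - 1) ∧
    key % 2 ^ p.s = p.H (p.X i) / p.Q

instance (key i : ℕ) : Decidable (p.Mem key i) := by unfold Mem; infer_instance

/-- The lower half of the hash value of the element number `i`. -/
def lo (i : ℕ) : ℕ := p.H (p.X i) % p.Q

/-- The different lower halves of hash values of the first `n` elements, for a key. -/
def ent (key : ℕ) : ℕ → List ℕ
  | 0 => []
  | n + 1 => if p.Mem key n ∧ p.lo n ∉ ent key n then ent key n ++ [p.lo n] else ent key n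

/-- The elements that belong to a key and have a given lower half of the hash value. -/
def chain (key h n : ℕ) : List ℕ :=
  ((List.range n).filter fun i => p.Mem key i ∧ p.lo i = h).reverse

/-- The code of a linked list. -/
def code : List ℕ → ℕ
  | [] => 0
  | i :: _ => i + 1

/-- The entries of all keys below `K`. -/
def flat (K : ℕ) : List ℕ := (List.range K).flatMap fun key => p.ent key p.l

/-- The number of chunks of a key. -/
def nc (key : ℕ) : ℕ := ((p.ent key p.l).length + p.T - 1) / p.T

/-- All chunks, as pairs of a key and a number. -/
def chunksTo (K : ℕ) : List (ℕ × ℕ) :=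
  (List.range K).flatMap fun key => (List.range (p.nc key)).map fun j => (key, j)

def chunks : List (ℕ × ℕ) := p.chunksTo p.NK

/-- A set of the first family: a shifted chunk. -/
def setA (key j u : ℕ) : List ℕ :=
  (List.range (min p.T ((p.ent key p.l).length - j * p.T))).map
    fun i => (p.ent key p.l).getD (j * p.T + i) 0 + u * 2 ^ p.r

/-- A set of the second family: a reflected and shifted list of entries, and a further element. -/
def setB (key v : ℕ) : List ℕ :=
  8 * p.Q :: (List.range (p.ent key p.l).length).map
    fun i => p.Q + p.Q - (p.ent key p.l).getD i 0 - v

def famA : List (List ℕ) :=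
  p.chunks.flatMap fun c => (List.range p.U).map fun u => p.setA c.1 c.2 u

def famB : List (List ℕ) :=
  (List.range p.NK).flatMap fun key => (List.range (2 ^ p.r)).map fun v => p.setB key v

def sys : SetSystem := ⟨p.famA, p.famB⟩

/-- Are the signs of the elements compatible? -/
def Admissible (key i y : ℕ) : Prop :=
  y % 2 + key / 2 ^ p.s % 2 = 1 ∨ p.X i / 2 ^ (p.w - 1) = key / 2 ^ p.s % 2

instance (key i y : ℕ) : Decidable (p.Admissible key i y) := by
  unfold Admissible; infer_instance

/-- The shift needed in the query. -/
def shift (i y : ℕ) : ℕ := p.Q + p.Q + y / 2 % 2 - (p.lo i + y / 4 * p.Q)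

/-- The key of the set of the second family in the query. -/
def keyB (key i y : ℕ) : ℕ :=
  (key / 2 ^ p.s / 4 * 4 + (2 - key / 2 ^ p.s % 4 / 2 * 2 + y % 2)) * 2 ^ p.s +
    (p.H (p.X i) / p.Q + (2 ^ p.s + 2 ^ p.s) - key % 2 ^ p.s - y / 4) % 2 ^ p.s

/-- The query for the chunk with index `ch`, the element number `i` as sum, and the options `y`. -/
def query (ch i y : ℕ) : ℕ × ℕ :=
  (ch * p.U + p.shift i y / 2 ^ p.r,
    p.keyB (p.chunks.getD ch (0, 0)).1 i y * 2 ^ p.r + p.shift i y % 2 ^ p.r)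

/-- The chunks, elements and options of all queries. -/
def metas : List (ℕ × ℕ × ℕ) :=
  (List.range p.chunks.length).flatMap fun ch => (List.range p.l).flatMap fun i =>
    (List.range 8).flatMap fun y =>
      if p.Admissible (p.chunks.getD ch (0, 0)).1 i y then [(ch, i, y)] else []

def queryOf (q : ℕ × ℕ × ℕ) : ℕ × ℕ := p.query q.1 q.2.1 q.2.2

def keyOf (q : ℕ × ℕ × ℕ) : ℕ := (p.chunks.getD q.1 (0, 0)).1

/-- The offset between reported elements and indices of chains. -/
def base (q : ℕ × ℕ × ℕ) : ℕ :=
  (p.keyOf q * p.Q + (2 ^ p.w - p.shift q.2.1 q.2.2 / 2 ^ p.r * 2 ^ p.r)) % 2 ^ p.w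

/-- The word arithmetic is exact. -/
structure Ok : Prop where
  hw : p.w ≠ 0
  hα : p.α < 2 ^ p.w
  hX : ∀ i, p.X i < 2 ^ p.w
  hl : p.l < 2 ^ p.Lg
  hLg : p.l ≠ 0 → 2 ^ p.Lg ≤ 2 * p.l
  hr : 1 ≤ p.r
  hm : p.s + (p.r + p.r) ≤ p.w
  hbig : 512 * ((p.NK + 1) * ((p.l + 1) * ((p.l + 1) * p.Q))) ≤ 2 ^ p.w

end Par

/-! ### The program -/

open Ex Stm

/-- Registers `0` to `10` hold the number of elements, the multiplier, and derived numbers, and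
array `0` holds the elements. -/
structure Env (p : Par) (σ : State) : Prop where
  h0 : σ.reg 0 = p.l
  h1 : σ.reg 1 = p.α
  h3 : σ.reg 3 = 2 ^ p.s
  h4 : σ.reg 4 = 2 ^ p.r
  h5 : σ.reg 5 = p.Q
  h6 : σ.reg 6 = 2 ^ (p.w - (p.s + (p.r + p.r)))
  h7 : σ.reg 7 = 2 ^ (p.w - 1)
  h8 : σ.reg 8 = p.T
  h9 : σ.reg 9 = p.NK
  h10 : σ.reg 10 = p.U
  m0 : σ.mem 0 = p.X

theorem Env.frame {p : Par} {σ σ' : State} {st : Stm} (h : Env p σ) (hf : Frame st σ σ')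
    (hr : ∀ r < 11, r ∉ st.regs) (hm : 0 ∉ st.arrs) : Env p σ' where
  h0 := (hf.reg 0 (hr _ (by norm_num))).trans h.h0
  h1 := (hf.reg 1 (hr _ (by norm_num))).trans h.h1
  h3 := (hf.reg 3 (hr _ (by norm_num))).trans h.h3
  h4 := (hf.reg 4 (hr _ (by norm_num))).trans h.h4
  h5 := (hf.reg 5 (hr _ (by norm_num))).trans h.h5
  h6 := (hf.reg 6 (hr _ (by norm_num))).trans h.h6
  h7 := (hf.reg 7 (hr _ (by norm_num))).trans h.h7
  h8 := (hf.reg 8 (hr _ (by norm_num))).trans h.h8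
  h9 := (hf.reg 9 (hr _ (by norm_num))).trans h.h9
  h10 := (hf.reg 10 (hr _ (by norm_num))).trans h.h10
  m0 := (hf.mem 0 hm).trans h.m0

/-- Does the element number `r₁₂`, equal to `r₁₈` and with hash value `r₁₉`, belong to the key
`r₁₁`? -/
def exMem : Ex :=
  o .lt (n 0) (v 18) *
    (o .eq (v 11 / v 3 % n 4) (n 2 * (o .shr (v 12) (v 11 / v 3 / n 4) % n 2) + v 18 / v 7) *
      o .eq (v 11 % v 3) (v 19 / v 5))

/-- Enter the element number `r₁₂` if it belongs to the key `r₁₁`. -/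
def buildBody : Stm :=
  .seq (asg 18 (ld 0 (v 12))) <| .seq (asg 19 (v 1 * v 18 / v 6)) <|
  ite exMem
    (.seq (asg 20 (v 19 % v 5)) <| .seq (asg 21 (v 11 * v 5 + v 20)) <|
      .seq (ite (ld 4 (v 21)) skip (push 2 13 (v 20))) <|
      .seq (sto 5 (v 11 * v 0 + v 12) (ld 4 (v 21))) (sto 4 (v 21) (v 12 + n 1)))
    skip

/-- Compute the entries and the chains of all keys. -/
def build : Stm :=
  .seq (forr 11 (v 9) (.seq (sto 3 (v 11) (v 13)) (forr 12 (v 0) buildBody)))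
    (sto 3 (v 11) (v 13))

/-- Write the sets of the first family that belong to a chunk. -/
def emitChunk : Stm :=
  .seq (push 6 16 (v 11)) <| .seq (asg 20 (v 12 * v 8)) <|
  .seq (ite (o .lt (v 8) (v 19 - v 20)) (asg 21 (v 8)) (asg 21 (v 19 - v 20))) <|
  forr 22 (v 10) (.seq (push 51 15 (v 14))
    (forr 23 (v 21) (push 50 14 (ld 2 (v 18 + (v 20 + v 23)) + v 22 * v 4))))

/-- Write the first family. -/
def emitA : Stm :=
  forr 11 (v 9) <| .seq (asg 18 (ld 3 (v 11))) <|
    .seq (asg 19 (ld 3 (v 11 + n 1) - v 18)) (forr 12 ((v 19 + v 8 - n 1) / v 8) emitChunk)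

/-- Write the second family. -/
def emitB : Stm :=
  forr 11 (v 9) <| .seq (asg 18 (ld 3 (v 11))) <| .seq (asg 19 (ld 3 (v 11 + n 1) - v 18)) <|
    forr 22 (v 4) <| .seq (push 51 15 (v 14)) <| .seq (push 50 14 (n 8 * v 5))
      (forr 23 (v 19) (push 50 14 (v 5 + v 5 - ld 2 (v 18 + v 23) - v 22)))

/-- Write a query, if the signs are compatible. -/
def makeQuery : Stm :=
  ite (o .or (o .eq (v 22 % n 2 + v 19 % n 2) (n 1)) (o .eq (v 20 / v 7) (v 19 % n 2)))
    (.seq (asg 23 (v 5 + v 5 + v 22 / n 2 % n 2 - (v 21 % v 5 + v 22 / n 4 * v 5))) <|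
      .seq (sto 7 (v 17) (v 11 * v 10 + v 23 / v 4)) <|
      .seq (sto 8 (v 17) (((v 19 / n 4 * n 4 + (n 2 - v 19 % n 4 / n 2 * n 2 + v 22 % n 2)) * v 3 +
        (v 21 / v 5 + (v 3 + v 3) - v 18 % v 3 - v 22 / n 4) % v 3) * v 4 + v 23 % v 4)) <|
      .seq (sto 9 (v 17) (v 20)) <|
      .seq (sto 10 (v 17) (v 18 * v 5 - v 23 / v 4 * v 4)) <|
      push 11 17 (v 18 * v 0))
    skip

/-- Write all queries. -/
def makeQueries : Stm :=
  forr 11 (v 16) <| .seq (asg 18 (ld 6 (v 11))) <| .seq (asg 19 (v 18 / v 3)) <|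
    forr 12 (v 0) <| .seq (asg 20 (ld 0 (v 12))) <| .seq (asg 21 (v 1 * v 20 / v 6)) <|
      forr 22 (n 8) makeQuery

end Reduction

/-! ### Entry lists, chains, and exactness of the word arithmetic -/

namespace Reduction

open WordRAM SetIntersection

namespace Par
variable {p : Par}

theorem Q_pos (p : Par) : 0 < p.Q := by unfold Q; positivity

theorem T_pos (p : Par) : 0 < p.T := by unfold T; positivity

theorem lo_lt (p : Par) (i : ℕ) : p.lo i < p.Q := Nat.mod_lt _ p.Q_pos

theorem H_lt (h : p.Ok) (x : ℕ) : p.H x < 2 ^ p.s * p.Q := by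
  have : 2 ^ p.s * p.Q = 2 ^ (p.s + (p.r + p.r)) := by rw [Q, ← pow_add, ← pow_add]
  rw [this, H]
  refine Nat.div_lt_of_lt_mul ?_
  rw [← pow_add, Nat.sub_add_cancel h.hm]
  exact Nat.mod_lt _ (Nat.two_pow_pos _)

theorem H_div_lt (h : p.Ok) (x : ℕ) : p.H x / p.Q < 2 ^ p.s := by
  refine Nat.div_lt_of_lt_mul ?_
  rw [mul_comm]; exact H_lt h x

theorem Ok.two_pow_s_le (h : p.Ok) : 2 ^ p.s * p.Q ≤ 2 ^ p.w := by
  have : 2 ^ p.s * p.Q = 2 ^ (p.s + (p.r + p.r)) := by rw [Q, ← pow_add, ← pow_add]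
  rw [this]
  exact Nat.pow_le_pow_right (by norm_num) h.hm

theorem mem_ent {key h n : ℕ} : h ∈ p.ent key n ↔ ∃ i < n, p.Mem key i ∧ p.lo i = h := by
  induction n with
  | zero => simp [ent]
  | succ n ih =>
    have h1 : (∃ i < n + 1, p.Mem key i ∧ p.lo i = h) ↔
        (∃ i < n, p.Mem key i ∧ p.lo i = h) ∨ (p.Mem key n ∧ p.lo n = h) := by
      constructor
      · rintro ⟨i, hi, h⟩
        rcases Nat.lt_succ_iff_lt_or_eq.1 hi with hi | rfl
        · exact .inl ⟨i, hi, h⟩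
        · exact .inr h
      · rintro (⟨i, hi, h⟩ | h)
        · exact ⟨i, hi.trans (Nat.lt_succ_self _), h⟩
        · exact ⟨n, Nat.lt_succ_self _, h⟩
    rw [h1, ← ih, ent]
    split_ifs with hc
    · rw [List.mem_append, List.mem_singleton]
      refine or_congr_right ⟨?_, ?_⟩
      · rintro rfl; exact ⟨hc.1, rfl⟩
      · rintro ⟨-, rfl⟩; rfl
    · refine ⟨.inl, ?_⟩
      rintro (h | ⟨hm, rfl⟩)
      · exact h
      · by_contra hn; exact hc ⟨hm, hn⟩

theorem ent_nodup (p : Par) (key n : ℕ) : (p.ent key n).Nodup := by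
  induction n with
  | zero => simp [ent]
  | succ n ih =>
    rw [ent]
    split_ifs with hc
    · rw [List.nodup_append]
      exact ⟨ih, List.nodup_singleton _, fun a ha b hb => by
        rw [List.mem_singleton] at hb; rintro rfl; exact hc.2 (hb ▸ ha)⟩
    · exact ih

theorem ent_length_le (p : Par) (key n : ℕ) : (p.ent key n).length ≤ n := by
  induction n with
  | zero => simp [ent]
  | succ n ih =>
    rw [ent]
    split_ifs
    · simpa using ih
    · omega

theorem lt_of_mem_ent {key h n : ℕ} (hh : h ∈ p.ent key n) : h < p.Q := by
  obtain ⟨i, _, _, rfl⟩ := mem_ent.1 hh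
  exact p.lo_lt i

theorem chain_succ (key h n : ℕ) : p.chain key h (n + 1) =
    if p.Mem key n ∧ p.lo n = h then n :: p.chain key h n else p.chain key h n := by
  simp only [chain, List.range_succ, List.filter_append, List.reverse_append]
  by_cases hc : p.Mem key n ∧ p.lo n = h
  · rw [if_pos hc, List.filter_cons_of_pos (by simpa using hc)]; rfl
  · rw [if_neg hc, List.filter_cons_of_neg (by simpa using hc)]; rfl

theorem mem_chain {key h n i : ℕ} : i ∈ p.chain key h n ↔ i < n ∧ p.Mem key i ∧ p.lo i = h := by
  simp [chain]

theorem code_eq_zero {l : List ℕ} : code l = 0 ↔ l = [] := by cases l <;> simp [code]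

/-- The head pointer of a chain doubles as the test whether a hash value has already been entered,
so no search in the entry list is needed. -/
theorem code_chain_eq_zero {key h n : ℕ} : code (p.chain key h n) = 0 ↔ h ∉ p.ent key n := by
  rw [code_eq_zero, List.eq_nil_iff_forall_not_mem, mem_ent]
  simp only [mem_chain]
  push Not
  rfl

theorem flat_succ (K : ℕ) : p.flat (K + 1) = p.flat K ++ p.ent K p.l := by
  simp [flat, List.range_succ]

theorem flat_length_le (p : Par) (K : ℕ) : (p.flat K).length ≤ K * p.l := by
  induction K with
  | zero => simp [flat]
  | succ K ih =>
    rw [flat_succ, List.length_append, add_mul, one_mul]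
    exact add_le_add ih (p.ent_length_le K p.l)

/-- Tables with two indices are stored row by row; distinct pairs of indices must not share a cell.
-/
theorem mul_add_inj {q a b x y : ℕ} (hx : x < q) (hy : y < q) (h : a * q + x = b * q + y) :
    a = b ∧ x = y := by
  have h1 := congrArg (· / q) h
  have h2 := congrArg (· % q) h
  have hq : 0 < q := by omega
  simp only [mul_comm _ q, Nat.mul_add_div hq, Nat.div_eq_of_lt hx, Nat.div_eq_of_lt hy,
    Nat.mul_add_mod, Nat.mod_eq_of_lt hx, Nat.mod_eq_of_lt hy] at h1 h2
  exact ⟨by omega, h2⟩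

theorem mul_add_lt {q a b x : ℕ} (ha : a < b) (hx : x < q) : a * q + x < b * q := by
  calc a * q + x < a * q + q := by omega
    _ = (a + 1) * q := by ring
    _ ≤ b * q := Nat.mul_le_mul_right q ha

end Par

open Par

/-- What holds after the entries and chains of the keys below `K`, and the first `n` elements for
the key `K`, have been computed. -/
structure BuildInv (p : Par) (K n : ℕ) (σ : State) : Prop where
  cnt : σ.reg 13 = (p.flat K ++ p.ent K n).length
  list : Holds (σ.mem 2) (p.flat K ++ p.ent K n)
  start : ∀ key < K, σ.mem 3 key = (p.flat key).length
  head : ∀ key h, h < p.Q → σ.mem 4 (key * p.Q + h) =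
    if key < K then code (p.chain key h p.l) else if key = K then code (p.chain K h n) else 0
  next : ∀ key i, i < p.l → (key < K ∨ key = K ∧ i < n) → p.Mem key i →
    σ.mem 5 (key * p.l + i) = code (p.chain key (p.lo i) i)

theorem Ex.eval_mulmod {w a b : ℕ} {σ : State} {e₁ e₂ : Ex} (h₁ : e₁.eval w σ = a)
    (h₂ : e₂.eval w σ = b) : (e₁ * e₂).eval w σ = a * b % 2 ^ w := by
  subst h₁ h₂; rfl

open Ex Stm

theorem eval_H {p : Par} {σ : State} (h1 : σ.reg 1 = p.α)
    (h6 : σ.reg 6 = 2 ^ (p.w - (p.s + (p.r + p.r)))) {r x : ℕ} (hr : σ.reg r = x) :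
    (v 1 * v r / v 6).eval p.w σ = p.H x :=
  eval_div (Ex.eval_mulmod (eval_v h1) (eval_v hr)) (eval_v h6) (Nat.mod_lt _ (Nat.two_pow_pos _))

/-- This and the next facts extract from `Ok.hbig` that the constants, table indices and counters of
the program stay below 2^w, so that the word operations on them agree with those of ℕ. -/
theorem Par.Ok.small {p : Par} (hp : p.Ok) {c : ℕ} (hc : c ≤ 500) : c < 2 ^ p.w := by
  have h1 := p.Q_pos
  have : 1 ≤ (p.NK + 1) * ((p.l + 1) * ((p.l + 1) * p.Q)) := Nat.one_le_iff_ne_zero.2 (by positivity)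
  have := hp.hbig
  omega

theorem Par.Ok.mul_Q_lt {p : Par} (hp : p.Ok) : 8 * ((p.NK + 1) * p.Q) < 2 ^ p.w := by
  have h1 := p.Q_pos
  have : (p.NK + 1) * p.Q ≤ (p.NK + 1) * ((p.l + 1) * ((p.l + 1) * p.Q)) := by
    gcongr
    rw [← mul_assoc]
    exact Nat.le_mul_of_pos_left _ (by positivity)
  have h2 : 0 < (p.NK + 1) * p.Q := by positivity
  have := hp.hbig
  omega

theorem Par.Ok.mul_l_lt {p : Par} (hp : p.Ok) : 64 * ((p.NK + 1) * ((p.l + 1) * (p.l + 1))) < 2 ^ p.w := by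
  have h1 := p.Q_pos
  have : (p.NK + 1) * ((p.l + 1) * (p.l + 1)) ≤ (p.NK + 1) * ((p.l + 1) * ((p.l + 1) * p.Q)) := by
    gcongr
    exact Nat.le_mul_of_pos_right _ h1
  have h2 : 0 < (p.NK + 1) * ((p.l + 1) * (p.l + 1)) := by positivity
  have := hp.hbig
  omega

theorem Par.Ok.mul_add_lt {p : Par} (hp : p.Ok) {K n : ℕ} (hK : K < p.NK) (hn : n < p.l) :
    K * p.l + n + 1 < 2 ^ p.w := by
  have h3 := hp.mul_l_lt
  have h4 := Par.mul_add_lt (q := p.l) hK hn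
  have h5 : p.NK * p.l ≤ (p.NK + 1) * ((p.l + 1) * (p.l + 1)) :=
    Nat.mul_le_mul (by omega) ((Nat.le_succ _).trans (Nat.le_mul_of_pos_left _ (by omega)))
  omega

theorem Par.Ok.lt_of_lt_l {p : Par} (hp : p.Ok) {n : ℕ} (hn : n ≤ p.l) : n + 1 < 2 ^ p.w := by
  have := hp.mul_l_lt
  have h2 : 1 * (1 * (p.l + 1)) ≤ (p.NK + 1) * ((p.l + 1) * (p.l + 1)) :=
    Nat.mul_le_mul (by omega) (Nat.mul_le_mul_right _ (by omega))
  omega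

theorem eval_exMem {p : Par} (hp : p.Ok) {σ : State} (h3 : σ.reg 3 = 2 ^ p.s)
    (h5 : σ.reg 5 = p.Q) (h7 : σ.reg 7 = 2 ^ (p.w - 1)) {K n : ℕ} (hK : K < p.NK)
    (hn : n < 2 ^ p.w) (h11 : σ.reg 11 = K) (h12 : σ.reg 12 = n) (h18 : σ.reg 18 = p.X n)
    (h19 : σ.reg 19 = p.H (p.X n)) :
    exMem.eval p.w σ = if p.Mem K n then 1 else 0 := by
  have hKw : K < 2 ^ p.w := by
    have h1 := hp.mul_Q_lt
    have h2 : p.NK * 1 ≤ (p.NK + 1) * p.Q := Nat.mul_le_mul (by omega) p.Q_pos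
    omega
  have hHw : p.H (p.X n) < 2 ^ p.w := (H_lt hp _).trans_le hp.two_pow_s_le
  have hdiv : K / 2 ^ p.s < 2 ^ p.w := (Nat.div_le_self _ _).trans_lt hKw
  have hsign : p.X n / 2 ^ (p.w - 1) < 2 := by
    refine Nat.div_lt_of_lt_mul ?_
    rw [← pow_succ, Nat.sub_add_cancel (Nat.one_le_iff_ne_zero.2 hp.hw)]
    exact hp.hX n
  have hshr : n / 2 ^ (K / 2 ^ p.s / 4) < 2 ^ p.w := (Nat.div_le_self _ _).trans_lt hn
  refine eval_and hp.hw (eval_lt hp.hw (eval_n (hp.small (by norm_num))) (eval_v h18))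
    (eval_and hp.hw (eval_eq hp.hw (eval_mod (eval_div (eval_v h11) (eval_v h3) hKw)
      (eval_n (hp.small (by norm_num))) hdiv)
      (eval_add (eval_mul (eval_n (hp.small (by norm_num))) (eval_mod (eval_shr (eval_v h12)
        (eval_div (eval_div (eval_v h11) (eval_v h3) hKw) (eval_n (hp.small (by norm_num))) hdiv) hn)
        (eval_n (hp.small (by norm_num))) hshr) ?_) (eval_div (eval_v h18) (eval_v h7) (hp.hX n)) ?_))
      (eval_eq hp.hw (eval_mod (eval_v h11) (eval_v h3) hKw) (eval_div (eval_v h19) (eval_v h5) hHw)))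
  · exact hp.small (by have := Nat.mod_lt (n / 2 ^ (K / 2 ^ p.s / 4)) two_pos; omega)
  · exact hp.small (by have := Nat.mod_lt (n / 2 ^ (K / 2 ^ p.s / 4)) two_pos; omega)

/-- An element is put in front of its chain: its successor is the old head, and the head becomes its
index plus 1. Its hash value is a new entry exactly if the old head was 0. -/
theorem big_buildBody {p : Par} (hp : p.Ok) {K n : ℕ} (hK : K < p.NK) (hn : n < p.l) {σ : State}
    (he : Env p σ) (h11 : σ.reg 11 = K) (h12 : σ.reg 12 = n) (hi : BuildInv p K n σ) :
    ∃ σ' t, Big p.w buildBody σ σ' t ∧ t ≤ 30 ∧ BuildInv p K (n + 1) σ' := by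
  have hnw : n < 2 ^ p.w := (Nat.lt_succ_self _).trans (hp.lt_of_lt_l hn.le)
  have hHw : p.H (p.X n) < 2 ^ p.w := (H_lt hp _).trans_le hp.two_pow_s_le
  set σ₁ := (σ.setReg 18 (p.X n)).setReg 19 (p.H (p.X n)) with hσ₁
  have b1 : Big p.w (asg 18 (ld 0 (v 12))) σ (σ.setReg 18 (p.X n)) 1 :=
    .asg' (eval_ld (eval_v h12) (by rw [he.m0]))
  have b2 : Big p.w (asg 19 (v 1 * v 18 / v 6)) (σ.setReg 18 (p.X n)) σ₁ 1 :=
    .asg' (eval_H (by simp [reg_setReg, he.h1]) (by simp [reg_setReg, he.h6]) (by simp [reg_setReg]))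
  have hmem := eval_exMem hp (σ := σ₁) (by simp [hσ₁, reg_setReg, he.h3])
    (by simp [hσ₁, reg_setReg, he.h5]) (by simp [hσ₁, reg_setReg, he.h7]) hK hnw
    (by simp [hσ₁, reg_setReg, h11]) (by simp [hσ₁, reg_setReg, h12])
    (by simp [hσ₁, reg_setReg]) (by simp [hσ₁, reg_setReg])
  by_cases hM : p.Mem K n
  · rw [if_pos hM] at hmem
    have hkey : K * p.Q + p.lo n < 2 ^ p.w := by
      have h1 := hp.mul_Q_lt
      have h2 := mul_add_lt (q := p.Q) hK (p.lo_lt n)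
      have h3 : (p.NK + 1) * p.Q = p.NK * p.Q + p.Q := by ring
      omega
    set σ₂ := (σ₁.setReg 20 (p.lo n)).setReg 21 (K * p.Q + p.lo n) with hσ₂
    have b3 : Big p.w (asg 20 (v 19 % v 5)) σ₁ (σ₁.setReg 20 (p.lo n)) 1 :=
      .asg' (eval_mod (eval_v (by simp [hσ₁, reg_setReg]))
        (eval_v (by simp [hσ₁, reg_setReg, he.h5])) hHw)
    have b4 : Big p.w (asg 21 (v 11 * v 5 + v 20)) (σ₁.setReg 20 (p.lo n)) σ₂ 1 :=
      .asg' (eval_add (eval_mul (eval_v (by simp [hσ₁, reg_setReg, h11]))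
        (eval_v (by simp [hσ₁, reg_setReg, he.h5])) (by omega)) (eval_v (by simp [reg_setReg])) hkey)
    have hhead : σ.mem 4 (K * p.Q + p.lo n) = code (p.chain K (p.lo n) n) := by
      rw [hi.head K _ (p.lo_lt n), if_neg (lt_irrefl _), if_pos rfl]
    have hm₂ : σ₂.mem = σ.mem := rfl
    -- the entry list
    have step3 : ∃ σ₃ t, Big p.w (ite (ld 4 (v 21)) skip (push 2 13 (v 20))) σ₂ σ₃ t ∧ t ≤ 4 ∧
        σ₃.reg 13 = (p.flat K ++ p.ent K (n + 1)).length ∧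
        Holds (σ₃.mem 2) (p.flat K ++ p.ent K (n + 1)) := by
      have hl4 : (ld 4 (v 21)).eval p.w σ₂ = code (p.chain K (p.lo n) n) :=
        eval_ld (i := K * p.Q + p.lo n) (eval_v (by simp [hσ₂, reg_setReg])) (by rw [hm₂, hhead])
      by_cases hin : p.lo n ∈ p.ent K n
      · refine ⟨σ₂, _, .iteT (by rw [hl4, Ne, code_chain_eq_zero]; exact not_not.2 hin) (.skip _),
          by norm_num, ?_, ?_⟩
        · rw [ent, if_neg (fun h => h.2 hin)]
          simp [hσ₂, hσ₁, reg_setReg, hi.cnt]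
        · rw [ent, if_neg (fun h => h.2 hin)]
          exact hi.list
      · have hlen : (p.flat K ++ p.ent K n).length + 1 < 2 ^ p.w := by
          rw [List.length_append]
          have h1 := p.flat_length_le K
          have h2 := p.ent_length_le K n
          have h3 := hp.mul_add_lt hK hn
          omega
        refine ⟨_, _, .iteF (by rw [hl4, code_chain_eq_zero]; exact hin) (.push
          (i := (p.flat K ++ p.ent K n).length) (a := p.lo n)
          (by simp [hσ₂, hσ₁, reg_setReg, hi.cnt]) (eval_v (by simp [hσ₂, reg_setReg])) hlen),
          by norm_num, ?_, ?_⟩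
        · rw [ent, if_pos ⟨hM, hin⟩]
          simp [reg_setReg, add_assoc]
        · rw [ent, if_pos ⟨hM, hin⟩, ← List.append_assoc]
          simp only [mem_setReg, mem_setMem, if_true]
          exact hi.list.push _
    obtain ⟨σ₃, t₃, b5, ht₃, hc₃, hl₃⟩ := step3
    have hreg : ∀ r, r ≠ 13 → σ₃.reg r = σ₂.reg r := fun r hr => b5.frame.reg r (by simpa [regs, push])
    have hmm : ∀ a, a ≠ 2 → σ₃.mem a = σ.mem a := fun a ha => b5.frame.mem a (by simpa [arrs, push])
    have hnx : K * p.l + n < 2 ^ p.w := (Nat.lt_succ_self _).trans (hp.mul_add_lt hK hn)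
    set σ₄ := σ₃.setMem 5 (K * p.l + n) (code (p.chain K (p.lo n) n)) with hσ₄
    have b6 : Big p.w (sto 5 (v 11 * v 0 + v 12) (ld 4 (v 21))) σ₃ σ₄ 1 :=
      .sto' (eval_add (eval_mul
        (eval_v (by rw [hreg 11 (by norm_num)]; simp [hσ₂, hσ₁, reg_setReg, h11]))
        (eval_v (by rw [hreg 0 (by norm_num)]; simp [hσ₂, hσ₁, reg_setReg, he.h0])) (by omega))
        (eval_v (by rw [hreg 12 (by norm_num)]; simp [hσ₂, hσ₁, reg_setReg, h12])) hnx)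
        (eval_ld (i := K * p.Q + p.lo n)
          (eval_v (by rw [hreg 21 (by norm_num)]; simp [hσ₂, reg_setReg])) (by rw [hmm 4 (by norm_num), hhead]))
    set σ₅ := σ₄.setMem 4 (K * p.Q + p.lo n) (n + 1) with hσ₅
    have b7 : Big p.w (sto 4 (v 21) (v 12 + Ex.n 1)) σ₄ σ₅ 1 :=
      .sto' (eval_v (by rw [hσ₄, reg_setMem, hreg 21 (by norm_num)]; simp [hσ₂, reg_setReg]))
        (eval_add (eval_v (by
          rw [hσ₄, reg_setMem, hreg 12 (by norm_num)]; simp [hσ₂, hσ₁, reg_setReg, h12]))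
          (eval_n (hp.small (by norm_num))) (hp.lt_of_lt_l hn.le))
    refine ⟨σ₅, _, .seq b1 (.seq b2 (.iteT (by rw [hmem]; norm_num)
      (.seq b3 (.seq b4 (.seq b5 (.seq b6 b7)))))), by omega, ?_, ?_, ?_, ?_, ?_⟩
    · simpa [hσ₅, hσ₄, reg_setMem] using hc₃
    · simpa [hσ₅, hσ₄, mem_setMem] using hl₃
    · intro key hk
      simp only [hσ₅, hσ₄, mem_setMem]
      simpa [hmm 3] using hi.start key hk
    · intro key h hh
      simp only [hσ₅, hσ₄, mem_setMem, if_true, show (4 : ℕ) ≠ 5 by norm_num, if_false]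
      rw [Function.update_apply]
      split_ifs with h1 h2 h3 h4 h5
      · obtain ⟨rfl, rfl⟩ := mul_add_inj hh (p.lo_lt n) h1; omega
      · obtain ⟨rfl, rfl⟩ := mul_add_inj hh (p.lo_lt n) h1
        rw [chain_succ, if_pos ⟨hM, rfl⟩, code]
      · obtain ⟨rfl, rfl⟩ := mul_add_inj hh (p.lo_lt n) h1; omega
      · rw [hmm 4 (by norm_num), hi.head key h hh, if_pos h4]
      · rw [hmm 4 (by norm_num), hi.head key h hh, if_neg h4, if_pos h5, chain_succ,
          if_neg (fun h' => h1 (by rw [h5, h'.2]))]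
      · rw [hmm 4 (by norm_num), hi.head key h hh, if_neg h4, if_neg h5]
    · intro key i hil hki hMi
      simp only [hσ₅, hσ₄, mem_setMem, if_true, show (5 : ℕ) ≠ 4 by norm_num, if_false]
      rw [Function.update_apply]
      split_ifs with h1
      · obtain ⟨rfl, rfl⟩ := mul_add_inj hil hn h1
        rfl
      · rw [hmm 5 (by norm_num)]
        refine hi.next key i hil ?_ hMi
        rcases hki with hk | ⟨rfl, hin⟩
        · exact .inl hk
        · refine .inr ⟨rfl, lt_of_le_of_ne (Nat.lt_succ_iff.1 hin) ?_⟩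
          rintro rfl; exact h1 rfl
  · rw [if_neg hM] at hmem
    refine ⟨σ₁, _, .seq b1 (.seq b2 (.iteF hmem (.skip _))), by norm_num, ?_, ?_, ?_, ?_, ?_⟩
    · rw [ent, if_neg (fun h => hM h.1)]; simp [hσ₁, reg_setReg, hi.cnt]
    · rw [ent, if_neg (fun h => hM h.1)]; exact hi.list
    · exact hi.start
    · intro key h hh
      rw [chain_succ, if_neg (fun h' : p.Mem K n ∧ _ => hM h'.1)]
      exact hi.head key h hh
    · intro key i hil hki hMi
      refine hi.next key i hil ?_ hMi
      rcases hki with hk | ⟨rfl, hin⟩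
      · exact .inl hk
      · refine .inr ⟨rfl, lt_of_le_of_ne (Nat.lt_succ_iff.1 hin) ?_⟩
        rintro rfl; exact hM hMi

end Reduction

/-! ### Tables of entries and chains for all keys -/

namespace Reduction

open WordRAM SetIntersection Par Ex Stm

/-- What holds after all entries and chains have been computed. -/
structure Built (p : Par) (σ : State) : Prop where
  list : Holds (σ.mem 2) (p.flat p.NK)
  start : ∀ key ≤ p.NK, σ.mem 3 key = (p.flat key).length
  head : ∀ key h, key < p.NK → h < p.Q → σ.mem 4 (key * p.Q + h) = code (p.chain key h p.l)
  next : ∀ key i, key < p.NK → i < p.l → p.Mem key i →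
    σ.mem 5 (key * p.l + i) = code (p.chain key (p.lo i) i)

theorem BuildInv.congr {p : Par} {K n : ℕ} {σ σ' : State} (h : BuildInv p K n σ)
    (h13 : σ'.reg 13 = σ.reg 13) (hm : σ'.mem = σ.mem) : BuildInv p K n σ' where
  cnt := h13.trans h.cnt
  list := hm ▸ h.list
  start := hm ▸ h.start
  head := hm ▸ h.head
  next := hm ▸ h.next

/-- The chain of a key before its first element is empty and has code 0, which is also the value of
cells not yet touched; so no initialization separates one key from the next. -/
theorem BuildInv.next_key {p : Par} {K : ℕ} {σ : State} (h : BuildInv p K p.l σ)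
    (hK : σ.mem 3 K = (p.flat K).length) : BuildInv p (K + 1) 0 σ where
  cnt := by rw [h.cnt, flat_succ]; simp [ent]
  list := by rw [flat_succ]; simpa [ent] using h.list
  start key hk := by
    rcases Nat.lt_succ_iff_lt_or_eq.1 hk with hk | rfl
    · exact h.start key hk
    · exact hK
  head key x hx := by
    rw [h.head key x hx]
    rcases lt_trichotomy key K with hk | rfl | hk
    · rw [if_pos hk, if_pos (by omega)]
    · rw [if_neg (lt_irrefl _), if_pos rfl, if_pos (by omega)]
    · rw [if_neg (by omega), if_neg (by omega), if_neg (by omega)]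
      split_ifs <;> rfl
  next key i hi hk hM := by
    refine h.next key i hi ?_ hM
    rcases hk with hk | ⟨-, h0⟩
    · rcases Nat.lt_succ_iff_lt_or_eq.1 hk with hk | rfl
      · exact .inl hk
      · exact .inr ⟨rfl, hi⟩
    · omega

theorem Par.Ok.NK_lt {p : Par} (hp : p.Ok) : 8 * p.NK < 2 ^ p.w := by
  have h1 := hp.mul_Q_lt
  have h2 : p.NK * 1 ≤ (p.NK + 1) * p.Q := Nat.mul_le_mul (by omega) p.Q_pos
  omega

/-- The table of heads has a row of length Q for every key and could not be cleared in the time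
allowed. It is used as found, which is correct because all memory starts at 0. -/
theorem big_build {p : Par} (hp : p.Ok) {σ : State} (he : Env p σ) (h13 : σ.reg 13 = 0)
    (h2 : σ.mem 2 = fun _ => 0) (h4 : σ.mem 4 = fun _ => 0) :
    ∃ σ' t, Big p.w build σ σ' t ∧ t ≤ p.NK * (33 * p.l + 8) + 5 ∧ Built p σ' := by
  have hNK : p.NK < 2 ^ p.w := by have := hp.NK_lt; omega
  obtain ⟨σ₁, t₁, b₁, ht₁, hr₁, hi₁⟩ := Big.forr (w := p.w) (i := 11) (N := p.NK) (e := v 9)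
    (b := .seq (sto 3 (v 11) (v 13)) (forr 12 (v 0) buildBody)) (σ := σ)
    (fun K σ => BuildInv p K 0 σ) (fun _ => 33 * p.l + 5) hp.hw hNK
    (by
      refine ⟨?_, ?_, ?_, ?_, ?_⟩
      · simp [reg_setReg, h13, flat, ent]
      · intro i; simp [mem_setReg, h2, flat, ent]
      · intro key hk; omega
      · intro key h hh
        simp only [mem_setReg, h4, if_neg (Nat.not_lt_zero key)]
        split_ifs <;> rfl
      · intro key i _ h; omega)
    (fun k σ' _ hf _ _ => eval_v (by rw [hf.reg 9 (by decide), he.h9]))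
    (by
      intro K σ' hK hf hi hr
      have he' : Env p σ' := he.frame hf (by decide) (by decide)
      have b1 : Big p.w (sto 3 (v 11) (v 13)) σ' (σ'.setMem 3 K (p.flat K).length) 1 :=
        .sto' (eval_v hr) (eval_v (by rw [hi.cnt]; simp [ent]))
      have he1 : Env p (σ'.setMem 3 K (p.flat K).length) := he'.frame b1.frame (by decide) (by decide)
      obtain ⟨σ₂, t₂, b₂, ht₂, hr₂, hi₂⟩ := Big.forr (w := p.w) (i := 12) (N := p.l) (e := v 0)
        (b := buildBody) (σ := σ'.setMem 3 K (p.flat K).length)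
        (fun n σ => BuildInv p K n σ ∧ σ.mem 3 K = (p.flat K).length) (fun _ => 30) hp.hw
        ((Nat.lt_succ_self _).trans (hp.lt_of_lt_l le_rfl))
        (by
          refine ⟨⟨hi.cnt, ?_, ?_, ?_, ?_⟩, ?_⟩
          · simpa [mem_setReg, mem_setMem] using hi.list
          · intro key hk
            simpa [mem_setReg, mem_setMem, Function.update_apply, hk.ne] using hi.start key hk
          · intro key h hh
            simpa [mem_setReg, mem_setMem] using hi.head key h hh
          · intro key i hil hk hM
            simpa [mem_setReg, mem_setMem] using hi.next key i hil hk hM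
          · simp [mem_setReg, mem_setMem])
        (fun k σ'' _ hf' _ _ => eval_v (by rw [hf'.reg 0 (by decide), he1.h0]))
        (by
          intro n σ'' hn hf' hi' hr'
          have he'' : Env p σ'' := he1.frame hf' (by decide) (by decide)
          obtain ⟨σ₃, t₃, b₃, ht₃, hi₃⟩ := big_buildBody hp hK hn he''
            (by rw [hf'.reg 11 (by decide)]; exact hr) hr' hi'.1
          exact ⟨σ₃, t₃, b₃, ht₃, by rw [b₃.frame.reg 12 (by decide), hr'],
            hi₃.congr (by simp [reg_setReg]) rfl,
            by rw [mem_setReg, b₃.frame.mem 3 (by decide)]; exact hi'.2⟩)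
      refine ⟨σ₂, _, .seq b1 b₂, ?_, ?_, ?_⟩
      · rw [Finset.sum_const, Finset.card_range, smul_eq_mul] at ht₂; omega
      · rw [b₂.frame.reg 11 (by decide)]; exact hr
      · exact (hi₂.1.next_key hi₂.2).congr (by simp [reg_setReg]) rfl)
  have b2 : Big p.w (sto 3 (v 11) (v 13)) σ₁ (σ₁.setMem 3 p.NK (p.flat p.NK).length) 1 :=
    .sto' (eval_v hr₁) (eval_v (by rw [hi₁.cnt]; simp [ent]))
  refine ⟨_, _, .seq b₁ b2, ?_, ?_, ?_, ?_, ?_⟩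
  · rw [Finset.sum_const, Finset.card_range, smul_eq_mul] at ht₁
    have : p.NK * (33 * p.l + 5 + 3) = p.NK * (33 * p.l + 8) := rfl
    omega
  · simpa [mem_setMem, ent] using hi₁.list
  · intro key hk
    rcases hk.lt_or_eq with hk | rfl
    · simpa [mem_setMem, Function.update_apply, hk.ne] using hi₁.start key hk
    · simp [mem_setMem]
  · intro key h hk hh
    simpa [mem_setMem, hk] using hi₁.head key h hh
  · intro key i hk hi hM
    simpa [mem_setMem] using hi₁.next key i hi (.inl hk) hM

end Reduction

/-! ### Writing a chunk of the first family -/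

namespace Reduction

open WordRAM SetIntersection Par Ex Stm

/-- The sets in the list have been written. -/
structure Written (l : List (List ℕ)) (σ : State) : Prop where
  cells : σ.reg 14 = l.flatten.length
  sets : σ.reg 15 = l.length
  elems : Holds (σ.mem 50) l.flatten
  start : ∀ i, σ.mem 51 i = if i < l.length then ((l.take i).map List.length).sum else 0

theorem Written.congr {l : List (List ℕ)} {σ σ' : State} (h : Written l σ)
    (h14 : σ'.reg 14 = σ.reg 14) (h15 : σ'.reg 15 = σ.reg 15) (h50 : σ'.mem 50 = σ.mem 50)
    (h51 : σ'.mem 51 = σ.mem 51) : Written l σ' :=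
  ⟨h14.trans h.cells, h15.trans h.sets, h50 ▸ h.elems, h51 ▸ h.start⟩

theorem Written.append {l : List (List ℕ)} {L : List ℕ} {σ σ' : State} (h : Written l σ)
    (h14 : σ'.reg 14 = (l.flatten ++ L).length) (h15 : σ'.reg 15 = l.length + 1)
    (h50 : Holds (σ'.mem 50) (l.flatten ++ L))
    (h51 : σ'.mem 51 = Function.update (σ.mem 51) l.length l.flatten.length) :
    Written (l ++ [L]) σ' where
  cells := by simpa using h14
  sets := by simpa using h15
  elems := by simpa using h50
  start i := by
    rw [h51, Function.update_apply]
    rcases lt_trichotomy i l.length with hi | rfl | hi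
    · rw [if_neg hi.ne, h.start, if_pos hi, if_pos (by simp; omega), List.take_append_of_le_length hi.le]
    · rw [if_pos rfl, if_pos (by simp), List.take_left, List.length_flatten]
    · rw [if_neg hi.ne', h.start, if_neg (by omega), if_neg (by simp; omega)]

/-- Overflow is excluded once and for all: whatever has been written at some moment is a prefix of
the complete list S of sets, whose length and total size are below 2^w. -/
theorem prefix_flatMap_range {β : Type*} {K N : ℕ} (h : K < N) {F : ℕ → List β} {l S : List β}
    (hS : l ++ (List.range N).flatMap F <+: S) : (l ++ (List.range K).flatMap F) ++ F K <+: S := by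
  refine List.IsPrefix.trans ?_ hS
  obtain ⟨d, rfl⟩ := Nat.exists_eq_add_of_lt h
  rw [show K + d + 1 = (K + 1) + d by ring, List.range_add, List.flatMap_append, List.range_succ,
    List.flatMap_append, List.append_assoc, List.append_assoc]
  refine (List.prefix_append_right_inj l).2 ?_
  rw [← List.append_assoc]
  simp

theorem prefix_map_range {β : Type*} {K N : ℕ} (h : K < N) {F : ℕ → β} {l S : List β}
    (hS : l ++ (List.range N).map F <+: S) : (l ++ (List.range K).map F) ++ [F K] <+: S := by
  have := prefix_flatMap_range (F := fun k => [F k]) h (l := l) (S := S)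
    (by simpa [← List.map_eq_flatMap] using hS)
  simpa [← List.map_eq_flatMap] using this

theorem flatten_length_le {l S : List (List ℕ)} (h : l <+: S) :
    l.flatten.length ≤ S.flatten.length := by
  obtain ⟨t, rfl⟩ := h
  simp

theorem Par.flat_getD (p : Par) {K N i : ℕ} (hK : K < N) (hi : i < (p.ent K p.l).length) :
    (p.flat N).getD ((p.flat K).length + i) 0 = (p.ent K p.l).getD i 0 := by
  have h := prefix_flatMap_range (F := fun key => p.ent key p.l) hK (l := []) (S := p.flat N)
    (by rw [flat]; simp)
  obtain ⟨t, ht⟩ := h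
  rw [← ht]
  change ((p.flat K ++ p.ent K p.l) ++ t).getD _ 0 = _
  rw [List.append_assoc, List.getD_append_right _ _ _ _ (by omega), Nat.add_sub_cancel_left,
    List.getD_append _ _ _ _ hi]

theorem Par.getD_ent_lt (p : Par) (K i : ℕ) : (p.ent K p.l).getD i 0 < p.Q := by
  by_cases h : i < (p.ent K p.l).length
  · rw [List.getD_eq_getElem _ _ h]
    exact lt_of_mem_ent (List.getElem_mem h)
  · rw [List.getD_eq_default _ _ (not_lt.1 h)]; exact p.Q_pos

theorem Par.Ok.Q_lt {p : Par} (hp : p.Ok) : 8 * p.Q < 2 ^ p.w := by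
  have h1 := hp.mul_Q_lt
  have h2 : 1 * p.Q ≤ (p.NK + 1) * p.Q := Nat.mul_le_mul_right _ (by omega)
  omega

theorem Par.two_pow_r_le (p : Par) : 2 ^ p.r ≤ p.Q :=
  Nat.le_mul_of_pos_left _ (Nat.two_pow_pos _)

theorem Par.U_mul_le (p : Par) {u : ℕ} (hu : u < p.U) : u * 2 ^ p.r ≤ p.Q + p.Q := by
  have : u ≤ 2 ^ p.r + 2 ^ p.r := by rw [U] at hu; omega
  calc u * 2 ^ p.r ≤ (2 ^ p.r + 2 ^ p.r) * 2 ^ p.r := Nat.mul_le_mul_right _ this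
    _ = _ := by rw [Q]; ring

/-- The number of chunks is rounded up, so even the last one starts inside the list. This makes the
sets of the first family nonempty, as an instance requires. -/
theorem Par.mul_T_lt (p : Par) {K j : ℕ} (hj : j < p.nc K) : j * p.T < (p.ent K p.l).length := by
  have h := p.T_pos
  have : (j + 1) * p.T ≤ (p.ent K p.l).length + p.T - 1 :=
    (Nat.le_div_iff_mul_le h).1 hj
  rw [add_mul, one_mul] at this
  omega

theorem Par.Ok.T_lt {p : Par} (hp : p.Ok) : 2 * p.T + p.l < 2 ^ p.w := by
  have h1 := hp.mul_l_lt
  have h2 : 1 * (1 * (p.l + 1)) ≤ (p.NK + 1) * ((p.l + 1) * (p.l + 1)) :=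
    Nat.mul_le_mul (by omega) (Nat.mul_le_mul_right _ (by omega))
  have h3 : p.T ≤ p.l + 1 := by unfold T; exact Nat.succ_le_succ (Nat.div_le_self _ _)
  omega

theorem big_emitChunk {p : Par} (hp : p.Ok) {K j : ℕ} (hK : K < p.NK) (hj : j < p.nc K)
    {S l : List (List ℕ)} {cl : List ℕ} (hS : S.flatten.length < 2 ^ p.w) (hS' : S.length < 2 ^ p.w)
    (hcl : cl.length + 1 < 2 ^ p.w)
    (hl : l ++ (List.range p.U).map (p.setA K j) <+: S) {σ : State} (he : Env p σ)
    (h11 : σ.reg 11 = K) (h12 : σ.reg 12 = j) (h18 : σ.reg 18 = (p.flat K).length)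
    (h19 : σ.reg 19 = (p.ent K p.l).length) (hE : Holds (σ.mem 2) (p.flat p.NK))
    (hi : Written l σ) (h16 : σ.reg 16 = cl.length) (h6 : Holds (σ.mem 6) cl) :
    ∃ σ' t, Big p.w emitChunk σ σ' t ∧ t ≤ p.U * (6 * p.T + 10) + 13 ∧
      Written (l ++ (List.range p.U).map (p.setA K j)) σ' ∧ σ'.reg 16 = (cl ++ [K]).length ∧
      Holds (σ'.mem 6) (cl ++ [K]) := by
  have hlen := p.ent_length_le K p.l
  have hjT := p.mul_T_lt hj
  have hlw := hp.lt_of_lt_l (le_refl p.l)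
  have hQw := hp.Q_lt
  set N := min p.T ((p.ent K p.l).length - j * p.T) with hN
  set σ₁ := (σ.setMem 6 cl.length K).setReg 16 (cl.length + 1) with hσ₁
  have b1 : Big p.w (push 6 16 (v 11)) σ σ₁ 3 := .push h16 (eval_v h11) hcl
  set σ₂ := σ₁.setReg 20 (j * p.T) with hσ₂
  have b2 : Big p.w (asg 20 (v 12 * v 8)) σ₁ σ₂ 1 :=
    .asg' (eval_mul (eval_v (by simp [hσ₁, reg_setReg, reg_setMem, h12]))
      (eval_v (by simp [hσ₁, reg_setReg, reg_setMem, he.h8])) (by omega))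
  have e3 : (v 19 - v 20).eval p.w σ₂ = (p.ent K p.l).length - j * p.T :=
    eval_sub (eval_v (by simp [hσ₂, hσ₁, reg_setReg, reg_setMem, h19]))
      (eval_v (by simp [hσ₂, reg_setReg])) hjT.le (by omega)
  have e8 : (v 8).eval p.w σ₂ = p.T := eval_v (by simp [hσ₂, hσ₁, reg_setReg, reg_setMem, he.h8])
  set σ₃ := σ₂.setReg 21 N with hσ₃
  have b3 : Big p.w (ite (o .lt (v 8) (v 19 - v 20)) (asg 21 (v 8)) (asg 21 (v 19 - v 20))) σ₂ σ₃
      2 := by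
    have e := eval_lt hp.hw e8 e3
    by_cases h : p.T < (p.ent K p.l).length - j * p.T
    · rw [if_pos h] at e
      exact .iteT (by rw [e]; norm_num) (.asg' (by rw [e8, hN, min_eq_left h.le]))
    · rw [if_neg h] at e
      exact .iteF e (.asg' (by rw [e3, hN, min_eq_right (not_lt.1 h)]))
  have b123 := Big.seq b1 (.seq b2 b3)
  have he₃ : Env p σ₃ := he.frame b123.frame (by decide) (by decide)
  have hi₃ : Written l σ₃ := hi.congr (by simp [hσ₃, hσ₂, hσ₁, reg_setReg, reg_setMem])
    (by simp [hσ₃, hσ₂, hσ₁, reg_setReg, reg_setMem])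
    (by simp [hσ₃, hσ₂, hσ₁, mem_setReg, mem_setMem])
    (by simp [hσ₃, hσ₂, hσ₁, mem_setReg, mem_setMem])
  obtain ⟨σ₄, t₄, b4, ht₄, hr₄, hi₄⟩ := Big.forr (w := p.w) (i := 22) (N := p.U) (e := v 10)
    (b := .seq (push 51 15 (v 14))
      (forr 23 (v 21) (push 50 14 (ld 2 (v 18 + (v 20 + v 23)) + v 22 * v 4)))) (σ := σ₃)
    (fun u σ => Written (l ++ (List.range u).map (p.setA K j)) σ) (fun _ => 6 * p.T + 7) hp.hw
    (by
      have h1 := p.two_pow_r_le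
      have h2 := p.Q_pos
      unfold U; omega)
    (by
      simp only [List.range_zero, List.map_nil, List.append_nil]
      exact hi₃.congr (by simp [reg_setReg]) (by simp [reg_setReg]) rfl rfl)
    (fun k σ' _ hf _ _ => eval_v (by rw [hf.reg 10 (by decide), he₃.h10]))
    (by
      intro u σ' hu hf hi' hr
      have he' : Env p σ' := he₃.frame hf (by decide) (by decide)
      have hpre := prefix_map_range hu hl
      set l' := l ++ (List.range u).map (p.setA K j) with hl'
      have hf1 := flatten_length_le hpre
      have hf2 := hpre.length_le
      simp only [List.flatten_append, List.flatten_singleton, List.length_append,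
        List.length_singleton] at hf1 hf2
      have hAl : (p.setA K j u).length = N := by simp [setA, hN]
      set σ₅ := (σ'.setMem 51 l'.length l'.flatten.length).setReg 15 (l'.length + 1) with hσ₅
      have b5 : Big p.w (push 51 15 (v 14)) σ' σ₅ 3 :=
        .push hi'.sets (eval_v hi'.cells) (by omega)
      have hreg : ∀ r, r ≠ 14 → r ≠ 15 → r ≠ 22 → r ≠ 23 → σ₅.reg r = σ₃.reg r := by
        intro r h1 h2 h3 h4
        rw [hσ₅, reg_setReg, if_neg h2, reg_setMem, hf.reg r (by simp [forr, push, regs, *])]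
      have h2 : σ₅.mem 2 = σ.mem 2 := by
        rw [hσ₅, mem_setReg, mem_setMem, if_neg (by norm_num), hf.mem 2 (by decide)]
        simp [hσ₃, hσ₂, hσ₁, mem_setReg, mem_setMem]
      obtain ⟨σ₆, t₆, b6, ht₆, hc₆, hh₆⟩ := Big.pushLoop (w := p.w) (i := 23) (arr := 50) (c := 14)
        (N := N) (e := v 21) (e' := ld 2 (v 18 + (v 20 + v 23)) + v 22 * v 4) (σ := σ₅)
        (l := l'.flatten) (fun i => (p.ent K p.l).getD (j * p.T + i) 0 + u * 2 ^ p.r) hp.hw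
        (by norm_num) (by rw [← hAl, ← List.length_append]; simp only [List.length_append]; omega)
        (by simp [hσ₅, reg_setReg, reg_setMem, hi'.cells])
        (by simpa [hσ₅, mem_setReg, mem_setMem] using hi'.elems)
        (fun σ'' hf' => eval_v (by
          rw [hf'.reg 21 (by decide), hreg 21 (by norm_num) (by norm_num) (by norm_num)
            (by norm_num)]; simp [hσ₃, reg_setReg]))
        (by
          intro i σ'' hiN hf' hr'
          have hiN' : j * p.T + i < (p.ent K p.l).length := by omega
          have hflat := p.flat_length_le p.NK
          have hsum : (p.flat K).length + (j * p.T + i) < 2 ^ p.w := by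
            have h1 := p.flat_length_le K
            have h3 := mul_add_lt (q := p.l) (x := j * p.T + i) hK (by omega)
            have h4 := hp.mul_add_lt (K := K) (n := j * p.T + i) hK (by omega)
            omega
          refine eval_add (eval_ld (eval_add (eval_v (a := (p.flat K).length) ?_)
            (eval_add (eval_v (a := j * p.T) ?_) (eval_v hr') (by omega)) hsum) ?_)
            (eval_mul (eval_v (a := u) ?_) (eval_v (a := 2 ^ p.r) ?_) ?_) ?_
          · rw [hf'.reg 18 (by decide), hreg 18 (by norm_num) (by norm_num) (by norm_num)
              (by norm_num)]; simp [hσ₃, hσ₂, hσ₁, reg_setReg, reg_setMem, h18]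
          · rw [hf'.reg 20 (by decide), hreg 20 (by norm_num) (by norm_num) (by norm_num)
              (by norm_num)]; simp [hσ₃, hσ₂, reg_setReg]
          · rw [hf'.mem 2 (by decide), h2, hE, p.flat_getD hK hiN']
          · rw [hf'.reg 22 (by decide), hσ₅, reg_setReg, if_neg (by norm_num), reg_setMem, hr]
          · rw [hf'.reg 4 (by decide), hσ₅, reg_setReg, if_neg (by norm_num), reg_setMem, he'.h4]
          · have := p.U_mul_le hu; omega
          · have := p.U_mul_le hu
            have := p.getD_ent_lt K (j * p.T + i)
            omega)
      refine ⟨σ₆, _, .seq b5 b6, ?_, ?_, ?_⟩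
      · have : N ≤ p.T := min_le_left _ _
        omega
      · rw [b6.frame.reg 22 (by decide), hσ₅, reg_setReg, if_neg (by norm_num), reg_setMem, hr]
      · rw [List.range_succ, List.map_append, ← List.append_assoc]
        refine (hi'.append (L := p.setA K j u) hc₆ ?_ hh₆ ?_).congr (by simp [reg_setReg])
          (by simp [reg_setReg]) rfl rfl
        · rw [b6.frame.reg 15 (by decide), hσ₅, reg_setReg, if_pos rfl]
        · rw [b6.frame.mem 51 (by decide), hσ₅, mem_setReg, mem_setMem, if_pos rfl])
  refine ⟨σ₄, _, .seq b1 (.seq b2 (.seq b3 b4)), ?_, hi₄, ?_, ?_⟩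
  · rw [Finset.sum_const, Finset.card_range, smul_eq_mul] at ht₄
    have : p.U * (6 * p.T + 7 + 3) = p.U * (6 * p.T + 10) := rfl
    omega
  · rw [b4.frame.reg 16 (by decide)]; simp [hσ₃, hσ₂, hσ₁, reg_setReg]
  · rw [b4.frame.mem 6 (by decide)]
    simp only [hσ₃, hσ₂, hσ₁, mem_setReg, mem_setMem, if_true]
    exact h6.push K

end Reduction

/-! ### Writing both families -/

namespace Reduction

open WordRAM SetIntersection Par Ex Stm

namespace Par

theorem famA_eq (p : Par) : p.famA = (List.range p.NK).flatMap fun K =>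
    (List.range (p.nc K)).flatMap fun j => (List.range p.U).map (p.setA K j) := by
  simp [famA, chunks, chunksTo, List.flatMap_assoc, List.flatMap_map]

theorem chunksTo_succ (p : Par) (K : ℕ) :
    p.chunksTo (K + 1) = p.chunksTo K ++ (List.range (p.nc K)).map fun j => (K, j) := by
  simp [chunksTo, List.range_succ]

theorem nc_le (p : Par) (K : ℕ) : p.nc K ≤ (p.ent K p.l).length := by
  have h := p.T_pos
  rw [nc]
  rcases Nat.eq_zero_or_pos (p.ent K p.l).length with h0 | h0
  · rw [h0, Nat.zero_add, Nat.div_eq_of_lt (by omega)]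
  · refine Nat.div_le_of_le_mul ?_
    obtain ⟨a, ha⟩ := Nat.exists_eq_add_of_lt h
    obtain ⟨b, hb⟩ := Nat.exists_eq_add_of_lt h0
    rw [ha, hb]
    ring_nf
    omega

theorem chunksTo_length (p : Par) (K : ℕ) :
    (p.chunksTo K).length = ∑ k ∈ Finset.range K, p.nc k := by
  induction K with
  | zero => simp [chunksTo]
  | succ K ih => rw [chunksTo_succ, Finset.sum_range_succ, List.length_append, ih]; simp

theorem flat_length (p : Par) (K : ℕ) :
    (p.flat K).length = ∑ k ∈ Finset.range K, (p.ent k p.l).length := by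
  induction K with
  | zero => simp [flat]
  | succ K ih => rw [flat_succ, Finset.sum_range_succ, List.length_append, ih]

theorem chunksTo_length_le (p : Par) (K : ℕ) : (p.chunksTo K).length ≤ (p.flat K).length := by
  rw [chunksTo_length, flat_length]
  exact Finset.sum_le_sum fun k _ => p.nc_le k

theorem mem_chunks {p : Par} {c : ℕ × ℕ} : c ∈ p.chunks ↔ c.1 < p.NK ∧ c.2 < p.nc c.1 := by
  rcases c with ⟨K, j⟩
  simp [chunks, chunksTo]

end Par

theorem big_emitA {p : Par} (hp : p.Ok) {S : List (List ℕ)} (hS : S.flatten.length < 2 ^ p.w)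
    (hS' : S.length < 2 ^ p.w) (hl : p.famA <+: S) {σ : State} (he : Env p σ) (hb : Built p σ)
    (hi : Written [] σ) (h16 : σ.reg 16 = 0) (h6 : σ.mem 6 = fun _ => 0) :
    ∃ σ' t, Big p.w emitA σ σ' t ∧
      t ≤ p.chunks.length * (p.U * (6 * p.T + 10) + 16) + 10 * p.NK + 3 ∧ Written p.famA σ' ∧
      σ'.reg 16 = p.chunks.length ∧ Holds (σ'.mem 6) (p.chunks.map Prod.fst) := by
  have hNK := hp.NK_lt
  have hlw := hp.lt_of_lt_l (le_refl p.l)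
  have hT := hp.T_lt
  set F : ℕ → List (List ℕ) := fun K =>
    (List.range (p.nc K)).flatMap fun j => (List.range p.U).map (p.setA K j) with hF
  obtain ⟨σ', t, b, ht, -, hi'⟩ := Big.forr (w := p.w) (i := 11) (N := p.NK) (e := v 9)
    (b := .seq (asg 18 (ld 3 (v 11))) <|
      .seq (asg 19 (ld 3 (v 11 + n 1) - v 18)) (forr 12 ((v 19 + v 8 - n 1) / v 8) emitChunk))
    (σ := σ)
    (fun K σ => Written ((List.range K).flatMap F) σ ∧ σ.reg 16 = (p.chunksTo K).length ∧
      Holds (σ.mem 6) ((p.chunksTo K).map Prod.fst))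
    (fun K => p.nc K * (p.U * (6 * p.T + 10) + 16) + 7) hp.hw (by omega)
    (by
      refine ⟨?_, ?_, ?_⟩
      · exact hi.congr (by simp [reg_setReg]) (by simp [reg_setReg]) rfl rfl
      · simp [reg_setReg, h16, chunksTo]
      · intro i; simp [mem_setReg, h6, chunksTo])
    (fun k σ' _ hf _ _ => eval_v (by rw [hf.reg 9 (by decide), he.h9]))
    (by
      rintro K σ₁ hK hf ⟨hi₁, h16₁, h6₁⟩ hr
      have he₁ : Env p σ₁ := he.frame hf (by decide) (by decide)
      have hst : ∀ key ≤ p.NK, σ₁.mem 3 key = (p.flat key).length := by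
        rw [hf.mem 3 (by decide)]; exact hb.start
      have hlist : Holds (σ₁.mem 2) (p.flat p.NK) := by
        rw [hf.mem 2 (by decide)]; exact hb.list
      have hlen := p.ent_length_le K p.l
      have hfl := p.flat_length_le K
      have hKl : K * p.l ≤ p.NK * p.l := Nat.mul_le_mul_right _ hK.le
      have hnc := p.nc_le K
      have hKlw : p.NK * p.l + p.l < 2 ^ p.w := by
        have h1 := hp.mul_l_lt
        have h2 : (p.NK + 1) * ((p.l + 1) * 1) ≤ (p.NK + 1) * ((p.l + 1) * (p.l + 1)) :=
          Nat.mul_le_mul_left _ (Nat.mul_le_mul_left _ (by omega))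
        have h3 : (p.NK + 1) * ((p.l + 1) * 1) = p.NK * p.l + p.l + p.NK + 1 := by ring
        omega
      set σ₂ := (σ₁.setReg 18 (p.flat K).length).setReg 19 (p.ent K p.l).length with hσ₂
      have b1 : Big p.w (asg 18 (ld 3 (v 11))) σ₁ (σ₁.setReg 18 (p.flat K).length) 1 :=
        .asg' (eval_ld (eval_v hr) (hst K hK.le))
      -- The length of an entry list is the difference of two consecutive starts. For the last key
      -- this needs the start numbered `NK`, which the construction stores after its loop.
      have b2 : Big p.w (asg 19 (ld 3 (v 11 + n 1) - v 18)) (σ₁.setReg 18 (p.flat K).length) σ₂ 1 := by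
        have : (p.ent K p.l).length = (p.flat (K + 1)).length - (p.flat K).length := by
          rw [flat_succ]; simp
        rw [hσ₂, this]
        refine .asg' (eval_sub (eval_ld (eval_add (eval_v (by simp [reg_setReg, hr]))
          (eval_n (hp.small (by norm_num))) (by omega)) (hst (K + 1) hK)) (eval_v (by simp [reg_setReg]))
          (by rw [flat_succ]; simp) ?_)
        rw [flat_succ, List.length_append]; omega
      have he₂ : Env p σ₂ := he₁.frame (Big.seq b1 b2).frame (by decide) (by decide)
      have hpre : (List.range K).flatMap F ++ F K <+: S :=
        prefix_flatMap_range (l := []) hK (by rwa [List.nil_append, ← famA_eq])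
      obtain ⟨σ₃, t₃, b3, ht₃, hr₃, hi₃⟩ := Big.forr (w := p.w) (i := 12) (N := p.nc K)
        (e := (v 19 + v 8 - n 1) / v 8) (b := emitChunk) (σ := σ₂)
        (fun j σ => Written ((List.range K).flatMap F ++
            (List.range j).flatMap fun j => (List.range p.U).map (p.setA K j)) σ ∧
          σ.reg 16 = ((p.chunksTo K).map Prod.fst ++ (List.range j).map fun _ => K).length ∧
          Holds (σ.mem 6) ((p.chunksTo K).map Prod.fst ++ (List.range j).map fun _ => K))
        (fun _ => p.U * (6 * p.T + 10) + 13) hp.hw (by omega)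
        (by
          refine ⟨?_, ?_, ?_⟩
          · simp only [List.range_zero, List.flatMap_nil, List.append_nil]
            exact hi₁.congr (by simp [hσ₂, reg_setReg]) (by simp [hσ₂, reg_setReg]) rfl rfl
          · simp [hσ₂, reg_setReg, h16₁]
          · simpa [hσ₂, mem_setReg] using h6₁)
        (by
          intro j σ' _ hf' _ _
          have hTp := p.T_pos
          exact eval_div (eval_sub (eval_add (eval_v (by rw [hf'.reg 19 (by decide)]; simp [hσ₂, reg_setReg]))
            (eval_v (by rw [hf'.reg 8 (by decide), he₂.h8])) (by omega))
            (eval_n (hp.small (by norm_num))) (by omega) (by omega))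
            (eval_v (by rw [hf'.reg 8 (by decide), he₂.h8])) (by omega))
        (by
          rintro j σ' hj hf' ⟨hi', h16', h6'⟩ hr'
          obtain ⟨σ'', t'', b'', ht'', hi'', h16'', h6''⟩ := big_emitChunk hp hK hj hS hS'
            (l := (List.range K).flatMap F ++
              (List.range j).flatMap fun j => (List.range p.U).map (p.setA K j))
            (cl := (p.chunksTo K).map Prod.fst ++ (List.range j).map fun _ => K) (σ := σ')
            (by
              have := p.chunksTo_length_le K
              have h2 := hp.mul_add_lt (K := K) (n := j) hK (by omega)
              simp; omega)
            (prefix_flatMap_range hj hpre)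
            (he₂.frame hf' (by decide) (by decide))
            (by rw [hf'.reg 11 (by decide)]; simp [hσ₂, reg_setReg, hr]) hr'
            (by rw [hf'.reg 18 (by decide)]; simp [hσ₂, reg_setReg])
            (by rw [hf'.reg 19 (by decide)]; simp [hσ₂, reg_setReg])
            (by rw [hf'.mem 2 (by decide)]; exact hlist) hi' h16' h6'
          refine ⟨σ'', t'', b'', ht'', by rw [b''.frame.reg 12 (by decide), hr'], ?_, ?_, ?_⟩
          · rw [List.range_succ, List.flatMap_append, ← List.append_assoc]
            simp only [List.flatMap_singleton]
            exact hi''.congr (by simp [reg_setReg]) (by simp [reg_setReg]) rfl rfl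
          · rw [reg_setReg, if_neg (by norm_num), h16'', List.range_succ]; simp
          · rw [mem_setReg, List.range_succ, List.map_append, ← List.append_assoc]; exact h6'')
      refine ⟨σ₃, _, .seq b1 (.seq b2 b3), ?_, ?_, ?_, ?_, ?_⟩
      · rw [Finset.sum_const, Finset.card_range, smul_eq_mul] at ht₃
        have : p.nc K * (p.U * (6 * p.T + 10) + 13 + 3) = p.nc K * (p.U * (6 * p.T + 10) + 16) := rfl
        omega
      · rw [b3.frame.reg 11 (by decide)]; simp [hσ₂, reg_setReg, hr]
      · rw [List.range_succ, List.flatMap_append]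
        simp only [List.flatMap_singleton]
        exact hi₃.1.congr (by simp [reg_setReg]) (by simp [reg_setReg]) rfl rfl
      · rw [reg_setReg, if_neg (by norm_num), hi₃.2.1, chunksTo_succ]; simp
      · rw [mem_setReg, chunksTo_succ, List.map_append, List.map_map]; exact hi₃.2.2)
  refine ⟨σ', t, b, ht.trans ?_, by rw [famA_eq]; exact hi'.1, hi'.2.1, hi'.2.2⟩
  simp only [Finset.sum_add_distrib, ← Finset.sum_mul, Finset.sum_const, Finset.card_range,
    smul_eq_mul]
  rw [← chunksTo_length, ← chunks]
  omega

theorem big_emitB {p : Par} (hp : p.Ok) {S l : List (List ℕ)} (hS : S.flatten.length < 2 ^ p.w)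
    (hS' : S.length < 2 ^ p.w) (hl : l ++ p.famB <+: S) {σ : State} (he : Env p σ) (hb : Built p σ)
    (hi : Written l σ) :
    ∃ σ' t, Big p.w emitB σ σ' t ∧
      t ≤ 2 ^ p.r * (6 * (p.flat p.NK).length + 14 * p.NK) + 10 * p.NK + 3 ∧
      Written (l ++ p.famB) σ' := by
  have hNK := hp.NK_lt
  have hlw := hp.lt_of_lt_l (le_refl p.l)
  have hQw := hp.Q_lt
  have hrQ := p.two_pow_r_le
  have hQ0 := p.Q_pos
  set F : ℕ → List (List ℕ) := fun K => (List.range (2 ^ p.r)).map fun v => p.setB K v with hF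
  obtain ⟨σ', t, b, ht, -, hi'⟩ := Big.forr (w := p.w) (i := 11) (N := p.NK) (e := v 9)
    (b := .seq (asg 18 (ld 3 (v 11))) <| .seq (asg 19 (ld 3 (v 11 + n 1) - v 18)) <|
      forr 22 (v 4) <| .seq (push 51 15 (v 14)) <| .seq (push 50 14 (n 8 * v 5))
        (forr 23 (v 19) (push 50 14 (v 5 + v 5 - ld 2 (v 18 + v 23) - v 22))))
    (σ := σ) (fun K σ => Written (l ++ (List.range K).flatMap F) σ)
    (fun K => 2 ^ p.r * (6 * (p.ent K p.l).length + 14) + 7) hp.hw (by omega)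
    (by
      simp only [List.range_zero, List.flatMap_nil, List.append_nil]
      exact hi.congr (by simp [reg_setReg]) (by simp [reg_setReg]) rfl rfl)
    (fun k σ' _ hf _ _ => eval_v (by rw [hf.reg 9 (by decide), he.h9]))
    (by
      intro K σ₁ hK hf hi₁ hr
      have he₁ : Env p σ₁ := he.frame hf (by decide) (by decide)
      have hst : ∀ key ≤ p.NK, σ₁.mem 3 key = (p.flat key).length := by
        rw [hf.mem 3 (by decide)]; exact hb.start
      have hlist : Holds (σ₁.mem 2) (p.flat p.NK) := by
        rw [hf.mem 2 (by decide)]; exact hb.list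
      have hlen := p.ent_length_le K p.l
      have hfl := p.flat_length_le K
      have hKl : K * p.l ≤ p.NK * p.l := Nat.mul_le_mul_right _ hK.le
      have hKlw : p.NK * p.l + p.l < 2 ^ p.w := by
        have h1 := hp.mul_l_lt
        have h2 : (p.NK + 1) * ((p.l + 1) * 1) ≤ (p.NK + 1) * ((p.l + 1) * (p.l + 1)) :=
          Nat.mul_le_mul_left _ (Nat.mul_le_mul_left _ (by omega))
        have h3 : (p.NK + 1) * ((p.l + 1) * 1) = p.NK * p.l + p.l + p.NK + 1 := by ring
        omega
      set σ₂ := (σ₁.setReg 18 (p.flat K).length).setReg 19 (p.ent K p.l).length with hσ₂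
      have b1 : Big p.w (asg 18 (ld 3 (v 11))) σ₁ (σ₁.setReg 18 (p.flat K).length) 1 :=
        .asg' (eval_ld (eval_v hr) (hst K hK.le))
      have b2 : Big p.w (asg 19 (ld 3 (v 11 + n 1) - v 18)) (σ₁.setReg 18 (p.flat K).length) σ₂ 1 := by
        have : (p.ent K p.l).length = (p.flat (K + 1)).length - (p.flat K).length := by
          rw [flat_succ]; simp
        rw [hσ₂, this]
        refine .asg' (eval_sub (eval_ld (eval_add (eval_v (by simp [reg_setReg, hr]))
          (eval_n (hp.small (by norm_num))) (by omega)) (hst (K + 1) hK)) (eval_v (by simp [reg_setReg]))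
          (by rw [flat_succ]; simp) ?_)
        rw [flat_succ, List.length_append]; omega
      have he₂ : Env p σ₂ := he₁.frame (Big.seq b1 b2).frame (by decide) (by decide)
      have hpre : (l ++ (List.range K).flatMap F) ++ F K <+: S := prefix_flatMap_range hK hl
      obtain ⟨σ₃, t₃, b3, ht₃, hr₃, hi₃⟩ := Big.forr (w := p.w) (i := 22) (N := 2 ^ p.r)
        (e := v 4) (b := .seq (push 51 15 (v 14)) <| .seq (push 50 14 (n 8 * v 5))
          (forr 23 (v 19) (push 50 14 (v 5 + v 5 - ld 2 (v 18 + v 23) - v 22)))) (σ := σ₂)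
        (fun u σ => Written (l ++ (List.range K).flatMap F ++ (List.range u).map (p.setB K)) σ)
        (fun _ => 6 * (p.ent K p.l).length + 11) hp.hw (by omega)
        (by
          simp only [List.range_zero, List.map_nil, List.append_nil]
          exact hi₁.congr (by simp [hσ₂, reg_setReg]) (by simp [hσ₂, reg_setReg]) rfl rfl)
        (fun k σ' _ hf _ _ => eval_v (by rw [hf.reg 4 (by decide), he₂.h4]))
        (by
          intro u σ' hu hf hi' hr'
          have he' : Env p σ' := he₂.frame hf (by decide) (by decide)
          have hpre' := prefix_map_range hu hpre
          set l' := l ++ (List.range K).flatMap F ++ (List.range u).map (p.setB K) with hl'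
          have hf1 := flatten_length_le hpre'
          have hf2 := hpre'.length_le
          simp only [List.flatten_append, List.flatten_singleton, List.length_append,
            List.length_singleton] at hf1 hf2
          have hAl : (p.setB K u).length = (p.ent K p.l).length + 1 := by simp [setB]
          set σ₅ := (σ'.setMem 51 l'.length l'.flatten.length).setReg 15 (l'.length + 1) with hσ₅
          have b5 : Big p.w (push 51 15 (v 14)) σ' σ₅ 3 :=
            .push hi'.sets (eval_v hi'.cells) (by omega)
          set σ₇ := (σ₅.setMem 50 l'.flatten.length (8 * p.Q)).setReg 14 (l'.flatten.length + 1)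
            with hσ₇
          have b7 : Big p.w (push 50 14 (n 8 * v 5)) σ₅ σ₇ 3 := by
            refine .push (by simp [hσ₅, reg_setReg, reg_setMem, hi'.cells])
              (eval_mul (eval_n (hp.small (by norm_num)))
                (eval_v (by simp [hσ₅, reg_setReg, reg_setMem, he'.h5])) hp.Q_lt) (by omega)
          have hreg : ∀ r, r ≠ 14 → r ≠ 15 → r ≠ 22 → r ≠ 23 → σ₇.reg r = σ₂.reg r := by
            intro r h1 h2 h3 h4
            rw [hσ₇, hσ₅, reg_setReg, if_neg h1, reg_setMem, reg_setReg, if_neg h2, reg_setMem,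
              hf.reg r (by simp [forr, push, regs, *])]
          have h2 : σ₇.mem 2 = σ₁.mem 2 := by
            rw [hσ₇, hσ₅, mem_setReg, mem_setMem, if_neg (by norm_num), mem_setReg, mem_setMem,
              if_neg (by norm_num), hf.mem 2 (by decide)]
            rfl
          have h50 : Holds (σ₇.mem 50) (l'.flatten ++ [8 * p.Q]) := by
            simp only [hσ₇, hσ₅, mem_setReg, mem_setMem, if_true]
            exact hi'.elems.push _
          obtain ⟨σ₆, t₆, b6, ht₆, hc₆, hh₆⟩ := Big.pushLoop (w := p.w) (i := 23) (arr := 50) (c := 14)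
            (N := (p.ent K p.l).length) (e := v 19) (e' := v 5 + v 5 - ld 2 (v 18 + v 23) - v 22)
            (σ := σ₇) (l := l'.flatten ++ [8 * p.Q])
            (fun i => p.Q + p.Q - (p.ent K p.l).getD i 0 - u) hp.hw
            (by norm_num) (by simp only [List.length_append, List.length_singleton]; omega)
            (by simp [hσ₇, reg_setReg]) h50
            (fun σ'' hf' => eval_v (by
              rw [hf'.reg 19 (by decide), hreg 19 (by norm_num) (by norm_num) (by norm_num)
                (by norm_num)]; simp [hσ₂, reg_setReg]))
            (by
              intro i σ'' hiN hf' hr''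
              have hent := p.getD_ent_lt K i
              have hsum := hp.mul_add_lt (K := K) (n := i) hK (by omega)
              have e5 : (v 5).eval p.w σ'' = p.Q := eval_v (by
                rw [hf'.reg 5 (by decide), hreg 5 (by norm_num) (by norm_num) (by norm_num)
                  (by norm_num), he₂.h5])
              refine eval_sub (eval_sub (eval_add e5 e5 (by omega)) (eval_ld (eval_add
                (eval_v (a := (p.flat K).length) ?_) (eval_v hr'') (by omega)) ?_) (by omega) (by omega))
                (eval_v (a := u) ?_) (by omega) (by omega)
              · rw [hf'.reg 18 (by decide), hreg 18 (by norm_num) (by norm_num) (by norm_num)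
                  (by norm_num)]; simp [hσ₂, reg_setReg]
              · rw [hf'.mem 2 (by decide), h2, hlist, p.flat_getD hK hiN]
              · rw [hf'.reg 22 (by decide)]; simp [hσ₇, hσ₅, reg_setReg, reg_setMem, hr'])
          refine ⟨σ₆, _, .seq b5 (.seq b7 b6), by omega, ?_, ?_⟩
          · rw [b6.frame.reg 22 (by decide)]; simp [hσ₇, hσ₅, reg_setReg, reg_setMem, hr']
          · rw [List.range_succ, List.map_append, ← List.append_assoc]
            rw [List.append_assoc] at hc₆ hh₆
            refine (hi'.append (L := p.setB K u) hc₆ ?_ hh₆ ?_).congr (by simp [reg_setReg])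
              (by simp [reg_setReg]) rfl rfl
            · rw [b6.frame.reg 15 (by decide)]; simp [hσ₇, hσ₅, reg_setReg, reg_setMem]
            · rw [b6.frame.mem 51 (by decide)]; simp [hσ₇, hσ₅, mem_setReg, mem_setMem])
      refine ⟨σ₃, _, .seq b1 (.seq b2 b3), ?_, ?_, ?_⟩
      · rw [Finset.sum_const, Finset.card_range, smul_eq_mul] at ht₃
        have : 2 ^ p.r * (6 * (p.ent K p.l).length + 11 + 3) =
          2 ^ p.r * (6 * (p.ent K p.l).length + 14) := rfl
        omega
      · rw [b3.frame.reg 11 (by decide)]; simp [hσ₂, reg_setReg, hr]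
      · rw [List.range_succ, List.flatMap_append, ← List.append_assoc]
        simp only [List.flatMap_singleton]
        exact hi₃.congr (by simp [reg_setReg]) (by simp [reg_setReg]) rfl rfl)
  refine ⟨σ', t, b, ht.trans ?_, hi'⟩
  simp only [Finset.sum_add_distrib, ← Finset.mul_sum, Finset.sum_const, Finset.card_range,
    smul_eq_mul]
  rw [← flat_length]
  have : p.NK * 14 = 14 * p.NK := mul_comm _ _
  rw [this]
  omega

end Reduction

/-! ### Sizes of the families, and writing the queries -/

namespace Reduction

open WordRAM SetIntersection Par Ex Stm

namespace Par
variable {p : Par}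

/-- The chunks of length at most T tile the entry list; truncated subtraction makes chunks beyond
its end empty. -/
theorem sum_min_le (T len n : ℕ) : ∑ j ∈ Finset.range n, min T (len - j * T) = min (n * T) len := by
  induction n with
  | zero => simp
  | succ n ih => rw [Finset.sum_range_succ, ih, add_mul, one_mul]; omega

theorem length_flatten_map_range {N : ℕ} {F : ℕ → List ℕ} :
    ((List.range N).map F).flatten.length = ∑ u ∈ Finset.range N, (F u).length := by
  induction N with
  | zero => simp
  | succ N ih =>
    rw [List.range_succ, List.map_append, List.flatten_append, List.length_append, ih,
      Finset.sum_range_succ]; simp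

theorem length_flatten_flatMap_range {N : ℕ} {F : ℕ → List (List ℕ)} :
    ((List.range N).flatMap F).flatten.length = ∑ u ∈ Finset.range N, (F u).flatten.length := by
  induction N with
  | zero => simp
  | succ N ih =>
    rw [List.range_succ, List.flatMap_append, List.flatten_append, List.length_append, ih,
      Finset.sum_range_succ]; simp

theorem length_flatMap_range {β : Type*} {N : ℕ} {F : ℕ → List β} :
    ((List.range N).flatMap F).length = ∑ u ∈ Finset.range N, (F u).length := by
  induction N with
  | zero => simp
  | succ N ih =>
    rw [List.range_succ, List.flatMap_append, List.length_append, ih, Finset.sum_range_succ]; simp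

/-- Every entry lies in exactly one chunk, and a chunk is copied once for each of the `U` shifts.
Cutting into chunks does not enlarge the family. -/
theorem famA_flatten_length_le (p : Par) : p.famA.flatten.length ≤ p.U * (p.flat p.NK).length := by
  rw [famA_eq, length_flatten_flatMap_range, flat_length, Finset.mul_sum]
  refine Finset.sum_le_sum fun K _ => ?_
  simp only [length_flatten_flatMap_range, length_flatten_map_range]
  rw [Finset.sum_comm]
  simp only [setA, List.length_map, List.length_range, sum_min_le, Finset.sum_const,
    Finset.card_range, smul_eq_mul]
  exact Nat.mul_le_mul_left _ (min_le_right _ _)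

theorem famA_length (p : Par) : p.famA.length = p.chunks.length * p.U := by
  simp [famA, List.length_flatMap]

theorem famB_flatten_length (p : Par) :
    p.famB.flatten.length = 2 ^ p.r * ((p.flat p.NK).length + p.NK) := by
  rw [famB, length_flatten_flatMap_range, flat_length]
  simp only [length_flatten_map_range, setB, List.length_cons, List.length_map, List.length_range,
    Finset.sum_const, Finset.card_range, smul_eq_mul, ← Finset.mul_sum, Finset.sum_add_distrib]
  simp

theorem famB_length (p : Par) : p.famB.length = p.NK * 2 ^ p.r := by
  simp [famB, List.length_flatMap]

theorem U_le (p : Par) : p.U ≤ 3 * p.Q := by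
  have h1 := p.two_pow_r_le
  have h2 := p.Q_pos
  unfold U; omega

theorem Ok.NK_mul_lt (hp : p.Ok) : 64 * (p.NK * ((p.l + 1) * p.Q)) < 2 ^ p.w := by
  have h0 := p.Q_pos
  have h1 : (p.NK + 1) * ((p.l + 1) * p.Q) ≤ (p.NK + 1) * ((p.l + 1) * ((p.l + 1) * p.Q)) :=
    Nat.mul_le_mul_left _ (Nat.mul_le_mul_left _ (Nat.le_mul_of_pos_left _ (by omega)))
  have h2 : (p.NK + 1) * ((p.l + 1) * p.Q) = p.NK * ((p.l + 1) * p.Q) + (p.l + 1) * p.Q := by ring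
  have h3 : 0 < (p.l + 1) * p.Q := by positivity
  have := hp.hbig
  omega

theorem Ok.sets_flatten_lt (hp : p.Ok) : p.sys.sets.flatten.length < 2 ^ p.w := by
  have h1 := p.famA_flatten_length_le
  have h2 := p.famB_flatten_length
  have h3 := p.flat_length_le p.NK
  have h4 : p.U * (p.flat p.NK).length ≤ 3 * p.Q * (p.NK * p.l) := Nat.mul_le_mul p.U_le h3
  have h5 : 2 ^ p.r * ((p.flat p.NK).length + p.NK) ≤ p.Q * (p.NK * p.l + p.NK) :=
    Nat.mul_le_mul p.two_pow_r_le (by omega)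
  have h6 := hp.NK_mul_lt
  have h7 : 3 * p.Q * (p.NK * p.l) ≤ 3 * (p.NK * ((p.l + 1) * p.Q)) := by
    calc _ = 3 * (p.NK * (p.l * p.Q)) := by ring
      _ ≤ _ := by gcongr; omega
  have h8 : p.Q * (p.NK * p.l + p.NK) = p.NK * ((p.l + 1) * p.Q) := by ring
  change (p.famA ++ p.famB).flatten.length < _
  rw [List.flatten_append, List.length_append]
  omega

theorem Ok.sets_length_lt (hp : p.Ok) : p.chunks.length * p.U + p.NK * 2 ^ p.r + 1 < 2 ^ p.w := by
  have h1 : p.chunks.length * p.U ≤ p.NK * p.l * (3 * p.Q) :=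
    Nat.mul_le_mul ((p.chunksTo_length_le _).trans (p.flat_length_le _)) p.U_le
  have h5 : p.NK * 2 ^ p.r ≤ p.NK * p.Q := Nat.mul_le_mul_left _ p.two_pow_r_le
  have h6 := hp.NK_mul_lt
  have h7 : p.NK * p.l * (3 * p.Q) + p.NK * p.Q ≤ 3 * (p.NK * ((p.l + 1) * p.Q)) := by
    have : p.NK * p.Q ≥ 0 := Nat.zero_le _
    calc _ = 3 * (p.NK * (p.l * p.Q)) + p.NK * p.Q := by ring
      _ ≤ 3 * (p.NK * (p.l * p.Q)) + 3 * (p.NK * p.Q) := by omega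
      _ = _ := by ring
  have h8 := hp.small (c := 100) (by norm_num)
  omega

theorem metas_length_le (p : Par) : p.metas.length ≤ p.chunks.length * (p.l * 8) := by
  rw [metas, length_flatMap_range]
  refine (Finset.sum_le_card_nsmul _ _ (p.l * 8) fun ch _ => ?_).trans (by simp)
  rw [length_flatMap_range]
  refine (Finset.sum_le_card_nsmul _ _ 8 fun i _ => ?_).trans (by simp)
  rw [length_flatMap_range]
  refine (Finset.sum_le_card_nsmul _ _ 1 fun y _ => ?_).trans (by simp)
  split_ifs <;> simp

theorem Ok.metas_lt (hp : p.Ok) : p.metas.length + 1 < 2 ^ p.w := by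
  have h1 : p.chunks.length * (p.l * 8) ≤ p.NK * p.l * (p.l * 8) :=
    Nat.mul_le_mul_right _ ((p.chunksTo_length_le _).trans (p.flat_length_le _))
  have h2 := p.metas_length_le
  have h3 := hp.mul_l_lt
  have h4 : p.NK * p.l * (p.l * 8) ≤ 8 * ((p.NK + 1) * ((p.l + 1) * (p.l + 1))) := by
    calc _ = 8 * (p.NK * (p.l * p.l)) := by ring
      _ ≤ _ := by gcongr <;> omega
  have h8 := hp.small (c := 100) (by norm_num)
  omega

theorem shift_le {i y : ℕ} : p.shift i y ≤ p.Q + p.Q + 1 := by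
  unfold shift; omega

/-- This explains the value of `U`: shifts go up to 2Q + 1, and 2^r ≥ 2 makes the quotient by 2^r at
most 2·2^r. -/
theorem shift_div_lt (hp : p.Ok) {i y : ℕ} : p.shift i y / 2 ^ p.r < p.U := by
  have h1 := p.shift_le (i := i) (y := y)
  have h2 : 2 ≤ 2 ^ p.r := by simpa using Nat.pow_le_pow_right (n := 2) (by norm_num) hp.hr
  refine Nat.div_lt_of_lt_mul (h1.trans_lt ?_)
  rw [U, Q]
  have : 2 ^ p.r * (2 ^ p.r + 2 ^ p.r + 1) = 2 ^ p.r * 2 ^ p.r + 2 ^ p.r * 2 ^ p.r + 2 ^ p.r := by ring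
  omega

/-- Passing to the partner flips the index bit and sets the sign within the same block of four
classes, and changes the bucket only modulo 2^s. -/
theorem keyB_lt {key i y : ℕ} (hk : key < p.NK) : p.keyB key i y < p.NK := by
  have h1 : key / 2 ^ p.s < 4 * p.Lg := Nat.div_lt_of_lt_mul (by rwa [NK, mul_comm] at hk)
  rw [keyB, NK]
  refine mul_add_lt ?_ (Nat.mod_lt _ (Nat.two_pow_pos _))
  omega

end Par

/-- The offset of a query and the missing summand c - a may be negative; there the wraparound of
subtraction is wanted, in contrast to `Ex.eval_sub`. -/
theorem _root_.WordRAM.Ex.eval_sub_mod {w a b : ℕ} {σ : State} {e₁ e₂ : Ex}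
    (h₁ : e₁.eval w σ = a) (h₂ : e₂.eval w σ = b) :
    (e₁ - e₂).eval w σ = (a + (2 ^ w - b)) % 2 ^ w := by
  subst h₁ h₂; rfl

/-- The queries in the list have been written. -/
structure Queried (p : Par) (ms : List (ℕ × ℕ × ℕ)) (σ : State) : Prop where
  cnt : σ.reg 17 = ms.length
  a : Holds (σ.mem 7) (ms.map fun q => (p.queryOf q).1)
  b : Holds (σ.mem 8) (ms.map fun q => (p.queryOf q).2)
  c : Holds (σ.mem 9) (ms.map fun q => p.X q.2.1)
  d : Holds (σ.mem 10) (ms.map p.base)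
  e : Holds (σ.mem 11) (ms.map fun q => p.keyOf q * p.l)

theorem Queried.congr {p : Par} {ms : List (ℕ × ℕ × ℕ)} {σ σ' : State} (h : Queried p ms σ)
    (h17 : σ'.reg 17 = σ.reg 17) (hm : σ'.mem = σ.mem) : Queried p ms σ' :=
  ⟨h17.trans h.cnt, hm ▸ h.a, hm ▸ h.b, hm ▸ h.c, hm ▸ h.d, hm ▸ h.e⟩

theorem _root_.WordRAM.Holds.push_map {β : Type*} {f : ℕ → ℕ} {l : List β} {g : β → ℕ} (h : Holds f (l.map g))
    (a : β) : Holds (Function.update f l.length (g a)) ((l ++ [a]).map g) := by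
  have := h.push (g a)
  simpa using this

theorem big_makeQuery {p : Par} (hp : p.Ok) {ch i y : ℕ} (hch : ch < p.chunks.length) (hi : i < p.l)
    (hy : y < 8) {ms : List (ℕ × ℕ × ℕ)} {σ : State} (he : Env p σ) (hms : ms.length + 1 < 2 ^ p.w)
    (h11 : σ.reg 11 = ch) (h22 : σ.reg 22 = y)
    (h18 : σ.reg 18 = (p.chunks.getD ch (0, 0)).1)
    (h19 : σ.reg 19 = (p.chunks.getD ch (0, 0)).1 / 2 ^ p.s) (h20 : σ.reg 20 = p.X i)
    (h21 : σ.reg 21 = p.H (p.X i)) (hq : Queried p ms σ) :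
    ∃ σ' t, Big p.w makeQuery σ σ' t ∧ t ≤ 20 ∧
      Queried p (ms ++ if p.Admissible (p.chunks.getD ch (0, 0)).1 i y then [(ch, i, y)] else []) σ' := by
  set key := (p.chunks.getD ch (0, 0)).1 with hkey
  have hK : key < p.NK := by
    rw [hkey, List.getD_eq_getElem _ _ hch]
    exact (mem_chunks.1 (List.getElem_mem hch)).1
  have hNK := hp.NK_lt
  have hdiv : key / 2 ^ p.s ≤ key := Nat.div_le_self _ _
  have hsm : ∀ {c}, c ≤ 500 → c < 2 ^ p.w := hp.small
  have hcond : (o .or (o .eq (v 22 % n 2 + v 19 % n 2) (n 1)) (o .eq (v 20 / v 7) (v 19 % n 2))).eval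
      p.w σ = if p.Admissible key i y then 1 else 0 := by
    have e19 : (v 19 % n 2).eval p.w σ = key / 2 ^ p.s % 2 :=
      eval_mod (eval_v h19) (eval_n (hsm (by norm_num))) (by omega)
    exact eval_or hp.hw (eval_eq hp.hw (eval_add (eval_mod (eval_v h22)
      (eval_n (hsm (by norm_num))) (hsm (by omega))) e19 (hsm (by omega)))
      (eval_n (hsm (by norm_num)))) (eval_eq hp.hw (eval_div (eval_v h20) (eval_v he.h7) (hp.hX i)) e19)
  by_cases hA : p.Admissible key i y
  · rw [if_pos hA] at hcond ⊢
    have hQw := hp.Q_lt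
    have hQ0 := p.Q_pos
    have hlo := p.lo_lt i
    have hy4 : y / 4 * p.Q ≤ p.Q := by
      have : y / 4 ≤ 1 := by omega
      exact (Nat.mul_le_mul_right _ this).trans (by omega)
    have hHw : p.H (p.X i) < 2 ^ p.w := (H_lt hp _).trans_le hp.two_pow_s_le
    have hHd := H_div_lt hp (p.X i)
    have hsQ : 4 * 2 ^ p.s ≤ 2 ^ p.w := by
      refine le_trans ?_ hp.two_pow_s_le
      rw [mul_comm]
      refine Nat.mul_le_mul_left _ ?_
      have h2 : 2 ≤ 2 ^ p.r := by simpa using Nat.pow_le_pow_right (n := 2) (by norm_num) hp.hr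
      exact Nat.mul_le_mul h2 h2
    have hs0 : 0 < 2 ^ p.s := Nat.two_pow_pos _
    have hsh := p.shift_le (i := i) (y := y)
    have hshU := shift_div_lt hp (i := i) (y := y)
    have hlen := hp.sets_length_lt
    have hkB := keyB_lt (i := i) (y := y) hK
    set σ₁ := σ.setReg 23 (p.shift i y) with hσ₁
    have b1 : Big p.w (asg 23 (v 5 + v 5 + v 22 / n 2 % n 2 - (v 21 % v 5 + v 22 / n 4 * v 5))) σ σ₁
        1 := by
      refine .asg' (eval_sub (eval_add (eval_add (eval_v he.h5) (eval_v he.h5) (by omega))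
        (eval_mod (eval_div (eval_v h22) (eval_n (hsm (by norm_num))) (hsm (by omega)))
        (eval_n (hsm (by norm_num))) (hsm (by omega))) (by omega)) (eval_add
        (eval_mod (eval_v h21) (eval_v he.h5) hHw) (eval_mul (eval_div (eval_v h22)
        (eval_n (hsm (by norm_num))) (hsm (by omega))) (eval_v he.h5) (by omega)) ?_) ?_ ?_)
      · omega
      · omega
      · omega
    have e23 : (v 23 / v 4).eval p.w σ₁ = p.shift i y / 2 ^ p.r :=
      eval_div (eval_v (by simp [hσ₁, reg_setReg])) (eval_v (by simp [hσ₁, reg_setReg, he.h4]))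
        (by omega)
    have hqa : ch * p.U + p.shift i y / 2 ^ p.r < p.chunks.length * p.U := mul_add_lt hch hshU
    have hqb : p.keyB key i y * 2 ^ p.r + p.shift i y % 2 ^ p.r < p.NK * 2 ^ p.r :=
      mul_add_lt hkB (Nat.mod_lt _ (Nat.two_pow_pos _))
    have hdQ : key * p.Q + p.Q ≤ 2 ^ p.w := by
      have h1 := hp.mul_Q_lt
      have h2 : (key + 1) * p.Q ≤ (p.NK + 1) * p.Q := Nat.mul_le_mul_right _ (by omega)
      have h3 : (key + 1) * p.Q = key * p.Q + p.Q := by ring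
      omega
    set σ₂ := σ₁.setMem 7 ms.length (p.query ch i y).1 with hσ₂
    have b2 : Big p.w (sto 7 (v 17) (v 11 * v 10 + v 23 / v 4)) σ₁ σ₂ 1 :=
      .sto' (eval_v (by simp [hσ₁, reg_setReg, hq.cnt])) (eval_add (eval_mul
        (eval_v (by simp [hσ₁, reg_setReg, h11])) (eval_v (by simp [hσ₁, reg_setReg, he.h10]))
        (by omega)) e23 (by omega))
    set σ₃ := σ₂.setMem 8 ms.length (p.keyB key i y * 2 ^ p.r + p.shift i y % 2 ^ p.r) with hσ₃
    have e18 : (v 18).eval p.w σ₂ = key := eval_v (by simp [hσ₂, hσ₁, reg_setReg, reg_setMem, h18])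
    have e19 : (v 19).eval p.w σ₂ = key / 2 ^ p.s :=
      eval_v (by simp [hσ₂, hσ₁, reg_setReg, reg_setMem, h19])
    have e3 : (v 3).eval p.w σ₂ = 2 ^ p.s :=
      eval_v (by simp [hσ₂, hσ₁, reg_setReg, reg_setMem, he.h3])
    have e22 : (v 22).eval p.w σ₂ = y :=
      eval_v (by simp [hσ₂, hσ₁, reg_setReg, reg_setMem, h22])
    have e4 : (v 4).eval p.w σ₂ = 2 ^ p.r :=
      eval_v (by simp [hσ₂, hσ₁, reg_setReg, reg_setMem, he.h4])
    -- The partner bucket is a difference modulo 2^s. Adding 2·2^s beforehand keeps all intermediate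
    -- values nonnegative and does not change the residue.
    have eK : ((v 19 / n 4 * n 4 + (n 2 - v 19 % n 4 / n 2 * n 2 + v 22 % n 2)) * v 3 +
        (v 21 / v 5 + (v 3 + v 3) - v 18 % v 3 - v 22 / n 4) % v 3).eval p.w σ₂ = p.keyB key i y := by
      have hkB' : p.keyB key i y < 2 ^ p.w := by omega
      have hks : key % 2 ^ p.s < 2 ^ p.s := Nat.mod_lt _ hs0
      have hcls : (key / 2 ^ p.s / 4 * 4 + (2 - key / 2 ^ p.s % 4 / 2 * 2 + y % 2)) * 2 ^ p.s
          < 2 ^ p.w := (Nat.le_add_right _ _).trans_lt hkB'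
      have aux : ∀ a k f S W : ℕ, a < S → k < S → f ≤ 1 → 4 * S ≤ W → a + (S + S) < W ∧
          k ≤ a + (S + S) ∧ f ≤ a + (S + S) - k ∧ a + (S + S) - k < W ∧ a + (S + S) - k - f < W := by
        omega
      obtain ⟨a1, a2, a3, a4, a5⟩ := aux _ _ (y / 4) _ _ hHd hks (by omega) hsQ
      refine eval_add (eval_mul (eval_add (eval_mul (eval_div e19 (eval_n (hsm (by norm_num)))
        (by omega)) (eval_n (hsm (by norm_num))) (by omega)) (eval_add (eval_sub
        (eval_n (hsm (by norm_num))) (eval_mul (eval_div (eval_mod e19 (eval_n (hsm (by norm_num)))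
        (by omega)) (eval_n (hsm (by norm_num))) (hsm (by omega))) (eval_n (hsm (by norm_num)))
        (hsm (by omega))) (by omega) (hsm (by omega))) (eval_mod e22 (eval_n (hsm (by norm_num)))
        (hsm (by omega))) (hsm (by omega))) ?_) e3 hcls) (eval_mod (eval_sub (eval_sub
        (eval_add (eval_div (eval_v (by simp [hσ₂, hσ₁, reg_setReg, reg_setMem, h21]))
        (eval_v (by simp [hσ₂, hσ₁, reg_setReg, reg_setMem, he.h5])) hHw) (eval_add e3 e3 (by omega))
        a1) (eval_mod e18 e3 (by omega)) a2 a1) (eval_div e22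
        (eval_n (hsm (by norm_num))) (hsm (by omega))) a3 a4) e3 a5) hkB'
      exact (Nat.le_mul_of_pos_right _ hs0).trans_lt hcls
    have b3 : Big p.w (sto 8 (v 17) (((v 19 / n 4 * n 4 + (n 2 - v 19 % n 4 / n 2 * n 2 + v 22 % n 2))
        * v 3 + (v 21 / v 5 + (v 3 + v 3) - v 18 % v 3 - v 22 / n 4) % v 3) * v 4 + v 23 % v 4))
        σ₂ σ₃ 1 :=
      .sto' (eval_v (by simp [hσ₂, hσ₁, reg_setReg, reg_setMem, hq.cnt])) (eval_add
        (eval_mul eK e4 (by omega)) (eval_mod (eval_v (by simp [hσ₂, hσ₁, reg_setReg, reg_setMem])) e4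
          (by omega)) (by omega))
    set σ₄ := σ₃.setMem 9 ms.length (p.X i) with hσ₄
    have b4 : Big p.w (sto 9 (v 17) (v 20)) σ₃ σ₄ 1 :=
      .sto' (eval_v (by simp [hσ₃, hσ₂, hσ₁, reg_setReg, reg_setMem, hq.cnt]))
        (eval_v (by simp [hσ₃, hσ₂, hσ₁, reg_setReg, reg_setMem, h20]))
    set σ₅ := σ₄.setMem 10 ms.length (p.base (ch, i, y)) with hσ₅
    have b5 : Big p.w (sto 10 (v 17) (v 18 * v 5 - v 23 / v 4 * v 4)) σ₄ σ₅ 1 :=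
      .sto' (eval_v (by simp [hσ₄, hσ₃, hσ₂, hσ₁, reg_setReg, reg_setMem, hq.cnt])) (Ex.eval_sub_mod
        (eval_mul (eval_v (by simp [hσ₄, hσ₃, hσ₂, hσ₁, reg_setReg, reg_setMem, h18, keyOf, hkey]))
          (eval_v (by simp [hσ₄, hσ₃, hσ₂, hσ₁, reg_setReg, reg_setMem, he.h5]))
          (by change key * p.Q < _; omega))
        (eval_mul (eval_div
          (eval_v (by simp [hσ₄, hσ₃, hσ₂, hσ₁, reg_setReg, reg_setMem]))
          (eval_v (by simp [hσ₄, hσ₃, hσ₂, hσ₁, reg_setReg, reg_setMem, he.h4]))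
          (by change p.shift i y < _; omega))
          (eval_v (by simp [hσ₄, hσ₃, hσ₂, hσ₁, reg_setReg, reg_setMem, he.h4]))
          (lt_of_le_of_lt (Nat.div_mul_le_self _ _) (by change p.shift i y < _; omega))))
    have b6 : Big p.w (push 11 17 (v 18 * v 0)) σ₅
        ((σ₅.setMem 11 ms.length (p.keyOf (ch, i, y) * p.l)).setReg 17 (ms.length + 1)) 3 := by
      refine .push (by simp [hσ₅, hσ₄, hσ₃, hσ₂, hσ₁, reg_setReg, reg_setMem, hq.cnt]) (eval_mul
        (eval_v (by
          simp [hσ₅, hσ₄, hσ₃, hσ₂, hσ₁, reg_setReg, reg_setMem, h18, keyOf, hkey]))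
        (eval_v (by simp [hσ₅, hσ₄, hσ₃, hσ₂, hσ₁, reg_setReg, reg_setMem, he.h0])) ?_) hms
      have := hp.mul_add_lt hK hi
      change key * p.l < _; omega
    refine ⟨_, _, .iteT (by rw [hcond]; norm_num) (.seq b1 (.seq b2 (.seq b3 (.seq b4 (.seq b5 b6))))),
      by norm_num, ?_, ?_, ?_, ?_, ?_, ?_⟩
    · simp [reg_setReg]
    all_goals simp only [hσ₅, hσ₄, hσ₃, hσ₂, hσ₁, mem_setReg, mem_setMem, reduceIte, Nat.reduceEqDiff]
    · exact hq.a.push_map (g := fun q => (p.queryOf q).1) (ch, i, y)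
    · exact hq.b.push_map (g := fun q => (p.queryOf q).2) (ch, i, y)
    · exact hq.c.push_map (g := fun q => p.X q.2.1) (ch, i, y)
    · exact hq.d.push_map (ch, i, y)
    · exact hq.e.push_map (g := fun q => p.keyOf q * p.l) (ch, i, y)
  · rw [if_neg hA] at hcond ⊢
    exact ⟨σ, _, .iteF hcond (.skip _), by norm_num, by simpa using hq⟩

theorem big_makeQueries {p : Par} (hp : p.Ok) {σ : State} (he : Env p σ)
    (h16 : σ.reg 16 = p.chunks.length) (h6 : Holds (σ.mem 6) (p.chunks.map Prod.fst))
    (hq : Queried p [] σ) :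
    ∃ σ' t, Big p.w makeQueries σ σ' t ∧ t ≤ p.chunks.length * (200 * p.l + 11) + 3 ∧
      Queried p p.metas σ' := by
  have hml := hp.metas_lt
  have hsl := hp.sets_length_lt
  have hcl : p.chunks.length < 2 ^ p.w := by
    have : p.chunks.length * 1 ≤ p.chunks.length * p.U := Nat.mul_le_mul_left _ (Nat.le_add_left 1 _)
    omega
  have hNK := hp.NK_lt
  set G : ℕ → ℕ → ℕ → List (ℕ × ℕ × ℕ) := fun ch i y =>
    if p.Admissible (p.chunks.getD ch (0, 0)).1 i y then [(ch, i, y)] else [] with hG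
  obtain ⟨σ', t, b, ht, -, hi'⟩ := Big.forr (w := p.w) (i := 11) (N := p.chunks.length) (e := v 16)
    (b := .seq (asg 18 (ld 6 (v 11))) <| .seq (asg 19 (v 18 / v 3)) <|
      forr 12 (v 0) <| .seq (asg 20 (ld 0 (v 12))) <| .seq (asg 21 (v 1 * v 20 / v 6)) <|
        forr 22 (n 8) makeQuery) (σ := σ)
    (fun ch σ => Queried p ((List.range ch).flatMap fun ch => (List.range p.l).flatMap fun i =>
      (List.range 8).flatMap (G ch i)) σ) (fun _ => 200 * p.l + 8) hp.hw hcl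
    (hq.congr (by simp [reg_setReg]) rfl)
    (fun k σ' _ hf _ _ => eval_v (by rw [hf.reg 16 (by decide), h16]))
    (by
      intro ch σ₁ hch hf hi₁ hr
      have he₁ : Env p σ₁ := he.frame hf (by decide) (by decide)
      have hK : (p.chunks.getD ch (0, 0)).1 < p.NK := by
        rw [List.getD_eq_getElem _ _ hch]
        exact (mem_chunks.1 (List.getElem_mem hch)).1
      set key := (p.chunks.getD ch (0, 0)).1 with hkey
      have hm6 : σ₁.mem 6 ch = key := by
        rw [hf.mem 6 (by decide), h6, hkey, List.getD_eq_getElem _ _ hch,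
          List.getD_eq_getElem _ _ (by simpa using hch)]
        simp
      set σ₂ := (σ₁.setReg 18 key).setReg 19 (key / 2 ^ p.s) with hσ₂
      have b1 : Big p.w (asg 18 (ld 6 (v 11))) σ₁ (σ₁.setReg 18 key) 1 :=
        .asg' (eval_ld (eval_v hr) hm6)
      have b2 : Big p.w (asg 19 (v 18 / v 3)) (σ₁.setReg 18 key) σ₂ 1 :=
        .asg' (eval_div (eval_v (by simp [reg_setReg])) (eval_v (by simp [reg_setReg, he₁.h3]))
          (by omega))
      have he₂ : Env p σ₂ := he₁.frame (Big.seq b1 b2).frame (by decide) (by decide)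
      have hpre : (List.range ch).flatMap (fun ch => (List.range p.l).flatMap fun i =>
          (List.range 8).flatMap (G ch i)) ++ ((List.range p.l).flatMap fun i =>
          (List.range 8).flatMap (G ch i)) <+: p.metas :=
        prefix_flatMap_range (l := []) (F := fun ch => (List.range p.l).flatMap fun i =>
          (List.range 8).flatMap (G ch i)) hch (by rw [List.nil_append, metas])
      set l₁ := (List.range ch).flatMap (fun ch => (List.range p.l).flatMap fun i =>
          (List.range 8).flatMap (G ch i)) with hl₁
      obtain ⟨σ₃, t₃, b3, ht₃, hr₃, hi₃⟩ := Big.forr (w := p.w) (i := 12) (N := p.l)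
        (e := v 0) (b := .seq (asg 20 (ld 0 (v 12))) <| .seq (asg 21 (v 1 * v 20 / v 6)) <|
          forr 22 (n 8) makeQuery) (σ := σ₂)
        (fun i σ => Queried p (l₁ ++ (List.range i).flatMap fun i =>
          (List.range 8).flatMap (G ch i)) σ) (fun _ => 195) hp.hw
        (by have := hp.lt_of_lt_l (le_refl p.l); omega)
        (by
          simp only [List.range_zero, List.flatMap_nil, List.append_nil]
          exact hi₁.congr (by simp [hσ₂, reg_setReg]) rfl)
        (fun k σ' _ hf _ _ => eval_v (by rw [hf.reg 0 (by decide), he₂.h0]))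
        (by
          intro i σ₄ hi hf₄ hi₄ hr₄
          have he₄ : Env p σ₄ := he₂.frame hf₄ (by decide) (by decide)
          have hpre₄ := prefix_flatMap_range hi hpre
          set l₂ := l₁ ++ (List.range i).flatMap fun i => (List.range 8).flatMap (G ch i) with hl₂
          set σ₅ := (σ₄.setReg 20 (p.X i)).setReg 21 (p.H (p.X i)) with hσ₅
          have b5 : Big p.w (asg 20 (ld 0 (v 12))) σ₄ (σ₄.setReg 20 (p.X i)) 1 :=
            .asg' (eval_ld (eval_v hr₄) (by rw [he₄.m0]))
          have b6 : Big p.w (asg 21 (v 1 * v 20 / v 6)) (σ₄.setReg 20 (p.X i)) σ₅ 1 :=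
            .asg' (eval_H (by simp [reg_setReg, he₄.h1]) (by simp [reg_setReg, he₄.h6])
              (by simp [reg_setReg]))
          have he₅ : Env p σ₅ := he₄.frame (Big.seq b5 b6).frame (by decide) (by decide)
          obtain ⟨σ₆, t₆, b7, ht₆, hr₆, hi₆⟩ := Big.forr (w := p.w) (i := 22) (N := 8)
            (e := n 8) (b := makeQuery) (σ := σ₅)
            (fun y σ => Queried p (l₂ ++ (List.range y).flatMap (G ch i)) σ) (fun _ => 20) hp.hw
            (hp.small (by norm_num))
            (by
              simp only [List.range_zero, List.flatMap_nil, List.append_nil]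
              exact hi₄.congr (by simp [hσ₅, reg_setReg]) rfl)
            (fun k σ' _ _ _ _ => eval_n (hp.small (by norm_num)))
            (by
              intro y σ₇ hy hf₇ hi₇ hr₇
              have hlen := (prefix_flatMap_range hy hpre₄).length_le
              have hreg : ∀ r, r ≠ 12 → r ≠ 17 → r ≠ 20 → r ≠ 21 → r ≠ 22 → r ≠ 23 →
                  σ₇.reg r = σ₂.reg r := by
                intro r h1 h2 h3 h4 h5 h6
                rw [hf₇.reg r (by simp [forr, makeQuery, push, regs, *]), hσ₅, reg_setReg, if_neg h4,
                  reg_setReg, if_neg h3, hf₄.reg r (by simp [forr, makeQuery, push, regs, *])]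
              obtain ⟨σ₈, t₈, b8, ht₈, hi₈⟩ := big_makeQuery hp hch hi hy
                (ms := l₂ ++ (List.range y).flatMap (G ch i)) (σ := σ₇)
                (he₅.frame hf₇ (by decide) (by decide))
                (by rw [List.length_append] at hlen; omega)
                (by rw [hreg 11 (by norm_num) (by norm_num) (by norm_num) (by norm_num) (by norm_num)
                  (by norm_num)]; simp [hσ₂, reg_setReg, hr]) hr₇
                (by rw [hreg 18 (by norm_num) (by norm_num) (by norm_num) (by norm_num) (by norm_num)
                  (by norm_num)]; simp [hσ₂, reg_setReg, hkey])
                (by rw [hreg 19 (by norm_num) (by norm_num) (by norm_num) (by norm_num) (by norm_num)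
                  (by norm_num)]; simp [hσ₂, reg_setReg, hkey])
                (by rw [hf₇.reg 20 (by decide)]; simp [hσ₅, reg_setReg])
                (by rw [hf₇.reg 21 (by decide)]; simp [hσ₅, reg_setReg]) hi₇
              refine ⟨σ₈, t₈, b8, ht₈, by rw [b8.frame.reg 22 (by decide), hr₇], ?_⟩
              rw [List.range_succ, List.flatMap_append, ← List.append_assoc]
              simp only [List.flatMap_singleton]
              exact hi₈.congr (by simp [reg_setReg]) rfl)
          refine ⟨σ₆, _, .seq b5 (.seq b6 b7), ?_, ?_, ?_⟩
          · simp at ht₆; omega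
          · rw [b7.frame.reg 12 (by decide)]; simp [hσ₅, reg_setReg, hr₄]
          · rw [List.range_succ (n := i), List.flatMap_append, ← List.append_assoc]
            simp only [List.flatMap_singleton]
            exact hi₆.congr (by simp [reg_setReg]) rfl)
      refine ⟨σ₃, _, .seq b1 (.seq b2 b3), ?_, ?_, ?_⟩
      · rw [Finset.sum_const, Finset.card_range, smul_eq_mul] at ht₃; omega
      · rw [b3.frame.reg 11 (by decide)]; simp [hσ₂, reg_setReg, hr]
      · rw [List.range_succ (n := ch), List.flatMap_append]
        simp only [List.flatMap_singleton]
        exact hi₃.congr (by simp [reg_setReg]) rfl)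
  refine ⟨σ', t, b, ht.trans ?_, by rw [metas]; exact hi'⟩
  simp

end Reduction

namespace Reduction

open WordRAM SetIntersection Par Ex Stm

/-! ### Initialization -/

/-- Compute the bit length of the number of elements. -/
def bitLength : Stm := .seq (asg 2 (n 0)) (whil (o .shr (v 0) (v 2)) (asg 2 (v 2 + n 1)))

/-- Compute the derived numbers and the dictionary. -/
def setUp (p₁ p₂ d : ℕ) : Stm :=
  .seq bitLength <| .seq (asg 24 (n p₁ * v 2 / n d)) <| .seq (asg 25 (n p₂ * v 2 / n d + n 1)) <|
  .seq (asg 3 (o .shl (n 1) (v 24))) <| .seq (asg 4 (o .shl (n 1) (v 25))) <|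
  .seq (asg 5 (v 4 * v 4)) <| .seq (asg 6 (o .shl (n 1) (wl - (v 24 + (v 25 + v 25))))) <|
  .seq (asg 7 (o .shl (n 1) (wl - n 1))) <| .seq (asg 8 (v 0 / v 3 + n 1)) <|
  .seq (asg 9 (n 4 * v 2 * v 3)) <| .seq (asg 10 (v 4 + v 4 + n 1)) <|
  forr 11 (v 0) (sto 1 (ld 0 (v 11)) (n 1))

/-- Make the multiplier odd, and write the instance and the queries. -/
def prepare : Stm :=
  .seq (asg 1 (o .or (v 1) (n 1))) <| .seq build <| .seq emitA <| .seq emitB <|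
  .seq (sto 51 (v 15) (v 14)) <| .seq (asg 100 (v 16 * v 10)) <| .seq (asg 101 (v 9 * v 4)) <|
  .seq makeQueries <| .seq (asg 11 (n 0)) <| .seq (asg 25 (n 0)) (asg 26 (v 17))

theorem big_bitLength {w l : ℕ} (hw : l + 1 < 2 ^ w) {σ : State} (h0 : σ.reg 0 = l) :
    Big w bitLength σ (σ.setReg 2 (Nat.size l)) (2 * Nat.size l + 3) := by
  have hS : ∀ k, k < Nat.size l → k + 1 < 2 ^ w := fun k hk => by
    have h1 := Nat.lt_size.1 hk
    have h2 : k < 2 ^ k := Nat.lt_two_pow_self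
    omega
  have main : ∀ j k, k + j = Nat.size l → Big w (whil (o .shr (v 0) (v 2)) (asg 2 (v 2 + n 1)))
      (σ.setReg 2 k) (σ.setReg 2 (Nat.size l)) (2 * j + 1) := by
    intro j
    induction j with
    | zero =>
      intro k hk
      obtain rfl : k = Nat.size l := by omega
      refine .whilF ?_
      rw [eval_shr (eval_v (a := l) (by simp [reg_setReg, h0])) (eval_v (a := Nat.size l)
        (by simp [reg_setReg])) (by omega)]
      exact Nat.div_eq_of_lt (Nat.lt_size_self l)
    | succ j ih =>
      intro k hk
      have h1 := Nat.lt_size.1 (show k < Nat.size l by omega)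
      have h2 : (σ.setReg 2 k).setReg 2 (k + 1) = σ.setReg 2 (k + 1) := by simp [State.setReg]
      have := Big.whilT (e := o .shr (v 0) (v 2)) (w := w) (σ := σ.setReg 2 k) (by
        rw [eval_shr (eval_v (a := l) (by simp [reg_setReg, h0])) (eval_v (a := k)
          (by simp [reg_setReg])) (by omega)]
        exact (Nat.div_pos h1 (Nat.two_pow_pos _)).ne')
        (.asg' (eval_add (eval_v (by simp [reg_setReg])) (eval_n (a := 1) (by omega))
          (hS k (by omega)))) (h2 ▸ ih (k + 1) (by omega))
      convert this using 1
      ring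
  have := Big.seq (.asg' (d := 2) (eval_n (w := w) (σ := σ) (a := 0) (by omega))) (main _ 0 (Nat.zero_add _))
  rwa [show 1 + (2 * Nat.size l + 1) + 1 = 2 * Nat.size l + 3 by ring] at this

theorem Env.of_setReg_one {p : Par} {α : ℕ} {σ : State} (h : Env p σ) :
    Env { p with α := α } (σ.setReg 1 α) where
  h0 := h.h0
  h1 := by simp [reg_setReg]
  h3 := h.h3
  h4 := h.h4
  h5 := h.h5
  h6 := h.h6
  h7 := h.h7
  h8 := h.h8
  h9 := h.h9
  h10 := h.h10
  m0 := h.m0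

/-- The dictionary is an array addressed by the elements themselves: setting one cell per element
gives membership tests in constant time, for words of any length. -/
theorem big_setUp {p : Par} (hp : p.Ok) {p₁ p₂ d : ℕ} (hd : d < 2 ^ p.w)
    (h₁ : p₁ * p.Lg < 2 ^ p.w) (h₁' : p₁ < 2 ^ p.w) (h₂ : p₂ * p.Lg < 2 ^ p.w)
    (h₂' : p₂ < 2 ^ p.w) (hLg : p.Lg = Nat.size p.l) (hs : p.s = p₁ * p.Lg / d)
    (hr : p.r = p₂ * p.Lg / d + 1) {σ : State} (h0 : σ.reg 0 = p.l) (h1 : σ.reg 1 = p.α)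
    (hm : σ.mem 0 = p.X) (hm1 : σ.mem 1 = fun _ => 0) :
    ∃ σ' t, Big p.w (setUp p₁ p₂ d) σ σ' t ∧ t ≤ 2 * p.Lg + 4 * p.l + 30 ∧ Env p σ' ∧
      ∀ x, σ'.mem 1 x = if ∃ i < p.l, p.X i = x then 1 else 0 := by
  have hl1 := hp.lt_of_lt_l (le_refl p.l)
  have hQw := hp.Q_lt
  have hQ0 := p.Q_pos
  have h2r := p.two_pow_r_le
  have hsm : ∀ {c}, c ≤ 500 → c < 2 ^ p.w := hp.small
  have hw := hp.hw
  have hww : p.w < 2 ^ p.w := Nat.lt_two_pow_self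
  have hm' := hp.hm
  have hpow : ∀ k, k < p.w → 2 ^ k < 2 ^ p.w := fun k hk => Nat.pow_lt_pow_right (by norm_num) hk
  have hr1 := hp.hr
  have hTw := hp.T_lt
  have hNK := hp.NK_lt
  have hU := p.U_le
  have e1 : ∀ σ, (n 1).eval p.w σ = 1 := fun σ => eval_n (hsm (by norm_num))
  set σ₁ := σ.setReg 2 p.Lg with hσ₁
  have b1 : Big p.w bitLength σ σ₁ (2 * p.Lg + 3) := by
    rw [hσ₁, hLg]; exact big_bitLength hl1 h0
  set σ₂ := σ₁.setReg 24 p.s with hσ₂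
  have b2 : Big p.w (asg 24 (n p₁ * v 2 / n d)) σ₁ σ₂ 1 := .asg' (by
    rw [hs]
    exact eval_div (eval_mul (eval_n h₁') (eval_v (by simp [hσ₁, reg_setReg])) h₁) (eval_n hd) h₁)
  set σ₃ := σ₂.setReg 25 p.r with hσ₃
  have b3 : Big p.w (asg 25 (n p₂ * v 2 / n d + n 1)) σ₂ σ₃ 1 := .asg' (by
    rw [hr]
    exact eval_add (eval_div (eval_mul (eval_n h₂') (eval_v (by simp [hσ₂, hσ₁, reg_setReg])) h₂)
      (eval_n hd) h₂) (e1 _) (by rw [← hr]; omega))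
  set σ₄ := σ₃.setReg 3 (2 ^ p.s) with hσ₄
  have b4 : Big p.w (asg 3 (o .shl (n 1) (v 24))) σ₃ σ₄ 1 := .asg' (by
    rw [← one_mul (2 ^ p.s)]
    exact eval_shl (e1 _) (eval_v (by simp [hσ₃, hσ₂, reg_setReg]))
      (by rw [one_mul]; exact hpow _ (by omega)))
  set σ₅ := σ₄.setReg 4 (2 ^ p.r) with hσ₅
  have b5 : Big p.w (asg 4 (o .shl (n 1) (v 25))) σ₄ σ₅ 1 := .asg' (by
    rw [← one_mul (2 ^ p.r)]
    exact eval_shl (e1 _) (eval_v (by simp [hσ₄, hσ₃, reg_setReg]))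
      (by rw [one_mul]; exact hpow _ (by omega)))
  set σ₆ := σ₅.setReg 5 p.Q with hσ₆
  have b6 : Big p.w (asg 5 (v 4 * v 4)) σ₅ σ₆ 1 :=
    .asg' (eval_mul (eval_v (by simp [hσ₅, reg_setReg])) (eval_v (by simp [hσ₅, reg_setReg]))
      (by change p.Q < _; omega))
  set σ₇ := σ₆.setReg 6 (2 ^ (p.w - (p.s + (p.r + p.r)))) with hσ₇
  have b7 : Big p.w (asg 6 (o .shl (n 1) (wl - (v 24 + (v 25 + v 25))))) σ₆ σ₇ 1 := .asg' (by
    rw [← one_mul (2 ^ (p.w - _))]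
    have e25 : (v 25).eval p.w σ₆ = p.r := eval_v (by simp [hσ₆, hσ₅, hσ₄, hσ₃, reg_setReg])
    exact eval_shl (e1 _) (eval_sub rfl (eval_add
      (eval_v (by simp [hσ₆, hσ₅, hσ₄, hσ₃, hσ₂, reg_setReg])) (eval_add e25 e25 (by omega))
        (by omega)) hm' hww) (by rw [one_mul]; exact hpow _ (by omega)))
  set σ₈ := σ₇.setReg 7 (2 ^ (p.w - 1)) with hσ₈
  have b8 : Big p.w (asg 7 (o .shl (n 1) (wl - n 1))) σ₇ σ₈ 1 := .asg' (by
    rw [← one_mul (2 ^ (p.w - 1))]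
    exact eval_shl (e1 _) (eval_sub rfl (e1 _) (by omega) hww)
      (by rw [one_mul]; exact hpow _ (by omega)))
  set σ₉ := σ₈.setReg 8 p.T with hσ₉
  have b9 : Big p.w (asg 8 (v 0 / v 3 + n 1)) σ₈ σ₉ 1 :=
    .asg' (eval_add (eval_div (a := p.l) (b := 2 ^ p.s)
      (eval_v (by simp [hσ₈, hσ₇, hσ₆, hσ₅, hσ₄, hσ₃, hσ₂, hσ₁, reg_setReg, h0]))
      (eval_v (by simp [hσ₈, hσ₇, hσ₆, hσ₅, hσ₄, reg_setReg])) (by omega)) (e1 _)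
      (by change p.T < _; omega))
  set σ₁₀ := σ₉.setReg 9 p.NK with hσ₁₀
  have b10 : Big p.w (asg 9 (n 4 * v 2 * v 3)) σ₉ σ₁₀ 1 := .asg' (by
    have : 4 * p.Lg * 1 ≤ 4 * p.Lg * 2 ^ p.s := Nat.mul_le_mul_left _ (Nat.two_pow_pos _)
    have h : 4 * p.Lg * 2 ^ p.s < 2 ^ p.w := by change p.NK < _; omega
    exact eval_mul (eval_mul (eval_n (hsm (by norm_num)))
      (eval_v (by simp [hσ₉, hσ₈, hσ₇, hσ₆, hσ₅, hσ₄, hσ₃, hσ₂, hσ₁, reg_setReg])) (by omega))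
      (eval_v (by simp [hσ₉, hσ₈, hσ₇, hσ₆, hσ₅, hσ₄, reg_setReg])) h)
  set σ₁₁ := σ₁₀.setReg 10 p.U with hσ₁₁
  have b11 : Big p.w (asg 10 (v 4 + v 4 + n 1)) σ₁₀ σ₁₁ 1 := .asg' (by
    have e4 : (v 4).eval p.w σ₁₀ = 2 ^ p.r :=
      eval_v (by simp [hσ₁₀, hσ₉, hσ₈, hσ₇, hσ₆, hσ₅, reg_setReg])
    exact eval_add (eval_add e4 e4 (by omega)) (e1 _) (by change p.U < _; omega))
  have he : Env p σ₁₁ := by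
    constructor <;>
    simp [hσ₁₁, hσ₁₀, hσ₉, hσ₈, hσ₇, hσ₆, hσ₅, hσ₄, hσ₃, hσ₂, hσ₁, reg_setReg, mem_setReg, h0, h1, hm]
  obtain ⟨σ', t, b12, ht, -, hi⟩ := Big.forr (w := p.w) (i := 11) (N := p.l) (e := v 0)
    (b := sto 1 (ld 0 (v 11)) (n 1)) (σ := σ₁₁)
    (fun k σ => ∀ x, σ.mem 1 x = if ∃ i < k, p.X i = x then 1 else 0) (fun _ => 1) hw (by omega)
    (by
      intro x
      simp [hσ₁₁, hσ₁₀, hσ₉, hσ₈, hσ₇, hσ₆, hσ₅, hσ₄, hσ₃, hσ₂, hσ₁, mem_setReg, hm1])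
    (fun k σ' _ hf _ _ => eval_v (by rw [hf.reg 0 (by decide), he.h0]))
    (by
      intro k σ' hk hf hi hr
      refine ⟨_, 1, .sto' (eval_ld (a := p.X k) (eval_v hr)
        (by rw [hf.mem 0 (by decide), he.m0])) (e1 _), le_rfl, hr, fun x => ?_⟩
      simp only [mem_setReg, mem_setMem, if_true, Function.update_apply, hi x]
      by_cases hx : x = p.X k
      · rw [if_pos hx, if_pos ⟨k, by omega, hx.symm⟩]
      · rw [if_neg hx]
        congr 1
        refine propext ⟨fun ⟨i, hi, h⟩ => ⟨i, by omega, h⟩, fun ⟨i, hi, h⟩ => ⟨i, ?_, h⟩⟩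
        rcases Nat.lt_succ_iff_lt_or_eq.1 hi with hi | rfl
        · exact hi
        · exact absurd h.symm hx)
  refine ⟨σ', _, .seq b1 <| .seq b2 <| .seq b3 <| .seq b4 <| .seq b5 <| .seq b6 <| .seq b7 <|
    .seq b8 <| .seq b9 <| .seq b10 <| .seq b11 b12, ?_, he.frame b12.frame (by decide) (by decide), hi⟩
  simp at ht
  omega

/-- What holds before the queries are asked. -/
structure Ready (p : Par) (σ : State) : Prop where
  env : Env p σ
  built : Built p σ
  queried : Queried p p.metas σ
  dict : ∀ x, σ.mem 1 x = if ∃ i < p.l, p.X i = x then 1 else 0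

/-- A bound for the cost of the preparation. -/
def Par.prepareCost (p : Par) : ℕ :=
  p.NK * (33 * p.l + 8) + 5 + (p.chunks.length * (p.U * (6 * p.T + 10) + 16) + 10 * p.NK + 3) +
    (2 ^ p.r * (6 * (p.flat p.NK).length + 14 * p.NK) + 10 * p.NK + 3) +
    (p.chunks.length * (200 * p.l + 11) + 3) + 20

theorem Written.nil {σ : State} (h14 : σ.reg 14 = 0) (h15 : σ.reg 15 = 0)
    (h50 : σ.mem 50 = fun _ => 0) (h51 : σ.mem 51 = fun _ => 0) : Written [] σ :=
  ⟨h14, h15, by simp [h50, Holds], by simp [h51]⟩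

theorem Built.frame {p : Par} {st : Stm} {σ σ' : State} (h : Built p σ) (hf : Frame st σ σ')
    (hm : ∀ a ∈ [2, 3, 4, 5], a ∉ st.arrs) : Built p σ' where
  list := by rw [hf.mem 2 (hm _ (by simp))]; exact h.list
  start := by rw [hf.mem 3 (hm _ (by simp))]; exact h.start
  head := by rw [hf.mem 4 (hm _ (by simp))]; exact h.head
  next := by rw [hf.mem 5 (hm _ (by simp))]; exact h.next

/-- The environment is assumed for the raw random word x because the multiplier is made odd only by
the first command; no other derived number depends on it. The last conclusion says that the
structure, on its own registers and arrays, finds precisely the input that its specification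
demands. -/
theorem big_prepare {p : Par} (hp : p.Ok) {x : ℕ} (hx : p.α = x ||| 1) {σ : State}
    (he : Env { p with α := x } σ) (hd : ∀ y, σ.mem 1 y = if ∃ i < p.l, p.X i = y then 1 else 0)
    (hreg : ∀ r ∈ [13, 14, 15, 16, 17], σ.reg r = 0) (hreg' : ∀ r, 100 ≤ r → σ.reg r = 0)
    (hmem : ∀ a, 2 ≤ a → σ.mem a = fun _ => 0) :
    ∃ σ' t, Big p.w prepare σ σ' t ∧ t ≤ p.prepareCost ∧ Ready p σ' ∧ σ'.reg 11 = 0 ∧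
      σ'.reg 25 = 0 ∧ σ'.reg 26 = p.metas.length ∧
      (⟨fun r => σ'.reg (100 + r), fun a => σ'.mem (50 + a)⟩ : State) = p.sys.initState := by
  have h1w : 1 < 2 ^ p.w := hp.small (by norm_num)
  have hα := hp.hα
  have hsl := hp.sets_length_lt
  have hsf := hp.sets_flatten_lt
  have hsets : p.sys.sets = p.famA ++ p.famB := rfl
  have hslen : p.sys.sets.length + 1 < 2 ^ p.w := by
    rw [hsets, List.length_append, famA_length, famB_length]; exact hsl
  set σ₁ := σ.setReg 1 p.α with hσ₁
  have b1 : Big p.w (asg 1 (o .or (v 1) (n 1))) σ σ₁ 1 := by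
    refine .asg' ?_
    have h1 : (n 1).eval p.w σ = 1 := eval_n h1w
    have h2 : (v 1).eval p.w σ = x := he.h1
    simp only [eval, BinOp.eval] at h1 h2 ⊢
    rw [h1, h2, ← hx, Nat.mod_eq_of_lt hα]
  have he₁ : Env p σ₁ := he.of_setReg_one (α := p.α)
  obtain ⟨σ₂, t₂, b2, ht₂, hb₂⟩ := big_build hp he₁
    (by simp [hσ₁, reg_setReg, hreg]) (hmem 2 (by norm_num)) (hmem 4 (by norm_num))
  have he₂ := he₁.frame b2.frame (by decide) (by decide)
  obtain ⟨σ₃, t₃, b3, ht₃, hw₃, h16, h6⟩ := big_emitA hp (S := p.sys.sets) hsf (by omega)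
    (by rw [hsets]; exact List.prefix_append _ _) he₂ hb₂
    (.nil (by rw [b2.frame.reg 14 (by decide)]; simp [hσ₁, reg_setReg, hreg])
      (by rw [b2.frame.reg 15 (by decide)]; simp [hσ₁, reg_setReg, hreg])
      (by rw [b2.frame.mem 50 (by decide)]; exact hmem 50 (by norm_num))
      (by rw [b2.frame.mem 51 (by decide)]; exact hmem 51 (by norm_num)))
    (by rw [b2.frame.reg 16 (by decide)]; simp [hσ₁, reg_setReg, hreg])
    (by rw [b2.frame.mem 6 (by decide)]; exact hmem 6 (by norm_num))
  have he₃ := he₂.frame b3.frame (by decide) (by decide)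
  have hb₃ := hb₂.frame b3.frame (by decide)
  obtain ⟨σ₄, t₄, b4, ht₄, hw₄⟩ := big_emitB hp (S := p.sys.sets) (l := p.famA) hsf (by omega)
    (by rw [hsets]) he₃ hb₃ hw₃
  have he₄ := he₃.frame b4.frame (by decide) (by decide)
  have hb₄ := hb₃.frame b4.frame (by decide)
  have h16₄ : σ₄.reg 16 = p.chunks.length := by rw [b4.frame.reg 16 (by decide), h16]
  set σ₅ := σ₄.setMem 51 p.sys.sets.length p.sys.sets.flatten.length with hσ₅
  have b5 : Big p.w (sto 51 (v 15) (v 14)) σ₄ σ₅ 1 :=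
    .sto' (eval_v hw₄.sets) (eval_v hw₄.cells)
  set σ₆ := σ₅.setReg 100 p.famA.length with hσ₆
  have b6 : Big p.w (asg 100 (v 16 * v 10)) σ₅ σ₆ 1 := .asg' (by
    rw [famA_length]
    exact eval_mul (eval_v h16₄) (eval_v he₄.h10) (by omega))
  set σ₇ := σ₆.setReg 101 p.famB.length with hσ₇
  have b7 : Big p.w (asg 101 (v 9 * v 4)) σ₆ σ₇ 1 := .asg' (by
    rw [famB_length]
    exact eval_mul (eval_v (by simp [hσ₆, reg_setReg, hσ₅, reg_setMem, he₄.h9]))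
      (eval_v (by simp [hσ₆, reg_setReg, hσ₅, reg_setMem, he₄.h4])) (by omega))
  have b57 := Big.seq b5 (.seq b6 b7)
  have he₇ := he₄.frame b57.frame (by decide) (by decide)
  have hb₇ := hb₄.frame b57.frame (by decide)
  -- The structure expects zeros wherever its input is not stored. That nothing else has been
  -- touched is read off from the frames of the statements executed so far.
  have pre : ∀ r a, r ∉ [1, 11, 12, 13, 14, 15, 16, 18, 19, 20, 21, 22, 23, 100, 101] →
      a ∉ [2, 3, 4, 5, 6, 50, 51] → σ₇.reg r = σ.reg r ∧ σ₇.mem a = σ.mem a := by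
    intro r a hr ha
    have hr' : ∀ L : List ℕ, L ⊆ [1, 11, 12, 13, 14, 15, 16, 18, 19, 20, 21, 22, 23, 100, 101] →
      r ∉ L := fun L hL h => hr (hL h)
    have ha' : ∀ L : List ℕ, L ⊆ [2, 3, 4, 5, 6, 50, 51] → a ∉ L := fun L hL h => ha (hL h)
    rw [b57.frame.reg r (hr' _ (by decide)), b4.frame.reg r (hr' _ (by decide)),
      b3.frame.reg r (hr' _ (by decide)), b2.frame.reg r (hr' _ (by decide)),
      b1.frame.reg r (hr' _ (by decide)), b57.frame.mem a (ha' _ (by decide)),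
      b4.frame.mem a (ha' _ (by decide)), b3.frame.mem a (ha' _ (by decide)),
      b2.frame.mem a (ha' _ (by decide)), b1.frame.mem a (ha' _ (by decide))]
    exact ⟨rfl, rfl⟩
  have z : ∀ a, a ∉ [2, 3, 4, 5, 6, 50, 51] → 2 ≤ a → σ₇.mem a = fun _ => 0 := fun a ha ha2 => by
    rw [(pre 0 a (by decide) ha).2, hmem a ha2]
  obtain ⟨σ₈, t₈, b8, ht₈, hq₈⟩ := big_makeQueries hp he₇
    (by rw [b57.frame.reg 16 (by decide), h16₄])
    (by rw [b57.frame.mem 6 (by decide), b4.frame.mem 6 (by decide)]; exact h6)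
    ⟨by rw [(pre 17 1 (by decide) (by decide)).1]; simp [hreg],
      by simp [z, Holds], by simp [z, Holds], by simp [z, Holds], by simp [z, Holds],
      by simp [z, Holds]⟩
  have he₈ := he₇.frame b8.frame (by decide) (by decide)
  have hb₈ := hb₇.frame b8.frame (by decide)
  set σ₉ := ((σ₈.setReg 11 0).setReg 25 0).setReg 26 p.metas.length with hσ₉
  have b9 : Big p.w (.seq (asg 11 (n 0)) <| .seq (asg 25 (n 0)) (asg 26 (v 17))) σ₈ σ₉ 5 :=
    .seq (.asg' (eval_n (by omega))) (.seq (.asg' (eval_n (by omega)))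
      (.asg' (eval_v (by simp [reg_setReg, hq₈.cnt]))))
  refine ⟨σ₉, _, .seq b1 (.seq b2 (.seq b3 (.seq b4 (.seq b5 (.seq b6 (.seq b7 (.seq b8 b9))))))),
    ?_, ⟨he₈.frame b9.frame (by decide) (by decide), hb₈.frame b9.frame (by decide),
      hq₈.congr (by simp [hσ₉, reg_setReg]) rfl, fun y => ?_⟩, by simp [hσ₉, reg_setReg],
      by simp [hσ₉, reg_setReg], by simp [hσ₉, reg_setReg], ?_⟩
  · simp only [prepareCost]; omega
  · rw [b9.frame.mem 1 (by decide), b8.frame.mem 1 (by decide),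
      (pre 0 1 (by decide) (by decide)).2, hd y]
  · have hr : ∀ r, 100 ≤ r → σ₉.reg r = σ₇.reg r := fun r hr => by
      rw [b9.frame.reg r (fun h => by
        have : ∀ r ∈ (Stm.seq (asg 11 (n 0)) <| .seq (asg 25 (n 0)) (asg 26 (v 17))).regs, r < 100 := by
          decide
        exact absurd (this r h) (by omega)), b8.frame.reg r (fun h => by
        have : ∀ r ∈ makeQueries.regs, r < 100 := by decide
        exact absurd (this r h) (by omega))]
    have ha : ∀ a, 50 ≤ a → σ₉.mem a = σ₇.mem a := fun a ha => by
      rw [b9.frame.mem a (by simp [arrs]), b8.frame.mem a (fun h => by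
        have : ∀ r ∈ makeQueries.arrs, r < 50 := by decide
        exact absurd (this a h) (by omega))]
    simp only [SetSystem.initState, State.mk.injEq]
    constructor
    · funext r
      rw [hr _ (by omega)]
      rcases r with _ | _ | r
      · simp [hσ₇, hσ₆, reg_setReg, sys]
      · simp [hσ₇, reg_setReg, sys]
      · rw [(pre (100 + (r + 2)) 1 (by simp; omega) (by decide)).1, hreg' _ (by omega)]
        simp
    · funext a i
      rw [ha _ (by omega)]
      rcases a with _ | _ | a
      · simp only [Nat.add_zero, if_true]
        rw [b57.frame.mem 50 (by decide)]
        exact hw₄.elems i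
      · simp only [hσ₇, hσ₆, hσ₅, mem_setReg, mem_setMem, zero_add, Nat.reduceAdd, if_true,
          Function.update_apply, one_ne_zero, if_false, true_and, hw₄.start]
        rw [← hsets]
        rcases lt_trichotomy i p.sys.sets.length with h | rfl | h
        · rw [if_neg h.ne, if_pos h, if_pos h.le]
        · simp [List.length_flatten]
        · rw [if_neg h.ne', if_neg (by omega), if_neg (by omega)]
      · rw [(pre 0 (50 + (a + 2)) (by decide) (by simp; omega)).2, hmem _ (by omega)]
        simp

end Reduction

namespace Reduction

open WordRAM SetIntersection Par Ex Stm

/-! ### Checking the answer of a query -/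

/-- Does the element number `r₂₃ - 1` form a witness with `r₂₄` and the sum of the query? -/
def exGood : Ex :=
  ld 1 (v 24) * (o .eq (o .eq (ld 0 (v 23 - n 1)) (v 24)) (n 0) * (o .lt (n 0) (v 24) *
    o .or (o .eq (ld 0 (v 23 - n 1) / v 7 + v 24 / v 7) (n 1))
      (o .eq (ld 9 (v 11) / v 7) (ld 0 (v 23 - n 1) / v 7))))

/-- Check all elements of the chain that starts with `r₂₃`. -/
def walk : Stm :=
  whil (v 23) <| .seq (asg 24 (ld 9 (v 11) - ld 0 (v 23 - n 1))) <|
    .seq (ite exGood (.seq (asg 25 (n 1)) (asg 26 (n 0))) skip)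
      (asg 23 (ld 5 (ld 11 (v 11) + (v 23 - n 1))))

/-- Check everything that has been reported. -/
def check : Stm :=
  .seq (asg 26 (v 26 - n 1)) <|
    .seq (forr 12 (v 100) (.seq (asg 23 (ld 4 (ld 10 (v 11) + ld 52 (v 12)))) walk))
      (asg 11 (v 11 + n 1))

/-- The other summand. -/
def Par.other (p : Par) (q : ℕ × ℕ × ℕ) (i : ℕ) : ℕ := (p.X q.2.1 + (2 ^ p.w - p.X i)) % 2 ^ p.w

/-- The element number `i` is part of a witness. -/
def Par.Good (p : Par) (q : ℕ × ℕ × ℕ) (i : ℕ) : Prop :=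
  (∃ j < p.l, p.X j = p.other q i) ∧ ¬ p.X i = p.other q i ∧ 0 < p.other q i ∧
    (p.X i / 2 ^ (p.w - 1) + p.other q i / 2 ^ (p.w - 1) = 1 ∨
      p.X q.2.1 / 2 ^ (p.w - 1) = p.X i / 2 ^ (p.w - 1))

instance (p : Par) (q : ℕ × ℕ × ℕ) (i : ℕ) : Decidable (p.Good q i) := by
  unfold Par.Good; infer_instance

/-- The flags have been set if `P` holds, and are unchanged otherwise. -/
structure Flagged (P : Prop) (σ σ' : State) : Prop where
  pos : P → σ'.reg 25 = 1 ∧ σ'.reg 26 = 0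
  neg : ¬ P → σ'.reg 25 = σ.reg 25 ∧ σ'.reg 26 = σ.reg 26

theorem Flagged.trans {P P' : Prop} {σ σ' σ'' : State} (h : Flagged P σ σ') (h' : Flagged P' σ' σ'') :
    Flagged (P ∨ P') σ σ'' := by
  by_cases hP' : P'
  · exact ⟨fun _ => h'.pos hP', fun h => absurd (.inr hP') h⟩
  · obtain ⟨h1, h2⟩ := h'.neg hP'
    exact ⟨fun hP => by rw [h1, h2]; exact h.pos (hP.resolve_right hP'),
      fun hP => by rw [h1, h2]; exact h.neg fun h => hP (.inl h)⟩

theorem Flagged.congr {P : Prop} {σ₁ σ₂ σ₁' σ₂' : State} (h : Flagged P σ₁ σ₂)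
    (h1 : σ₁'.reg 25 = σ₁.reg 25) (h2 : σ₁'.reg 26 = σ₁.reg 26) (h3 : σ₂'.reg 25 = σ₂.reg 25)
    (h4 : σ₂'.reg 26 = σ₂.reg 26) : Flagged P σ₁' σ₂' := by
  constructor
  · rw [h3, h4]; exact h.pos
  · rw [h1, h2, h3, h4]; exact h.neg

theorem Ready.congr {p : Par} {σ σ' : State} (h : Ready p σ)
    (hr : ∀ r ∈ List.range 11 ++ [17], σ'.reg r = σ.reg r) (hm : ∀ a < 12, σ'.mem a = σ.mem a) :
    Ready p σ' where
  env := by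
    obtain ⟨h0, h1, h3, h4, h5, h6, h7, h8, h9, h10, m0⟩ := h.env
    exact ⟨(hr _ (by simp)).trans h0, (hr _ (by simp)).trans h1, (hr _ (by simp)).trans h3,
      (hr _ (by simp)).trans h4, (hr _ (by simp)).trans h5, (hr _ (by simp)).trans h6,
      (hr _ (by simp)).trans h7, (hr _ (by simp)).trans h8, (hr _ (by simp)).trans h9,
      (hr _ (by simp)).trans h10, (hm 0 (by norm_num)).trans m0⟩
  built := by
    obtain ⟨h2, h3, h4, h5⟩ := h.built
    exact ⟨hm 2 (by norm_num) ▸ h2, hm 3 (by norm_num) ▸ h3, hm 4 (by norm_num) ▸ h4,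
      hm 5 (by norm_num) ▸ h5⟩
  queried := by
    obtain ⟨h1, h2, h3, h4, h5, h6⟩ := h.queried
    exact ⟨(hr 17 (by simp)).trans h1, hm 7 (by norm_num) ▸ h2, hm 8 (by norm_num) ▸ h3,
      hm 9 (by norm_num) ▸ h4, hm 10 (by norm_num) ▸ h5, hm 11 (by norm_num) ▸ h6⟩
  dict y := by rw [hm 1 (by norm_num)]; exact h.dict y

theorem Ready.frame {p : Par} {st : Stm} {σ σ' : State} (h : Ready p σ) (hf : Frame st σ σ')
    (hr : ∀ r ∈ List.range 11 ++ [17], r ∉ st.regs) (hm : ∀ a < 12, a ∉ st.arrs) : Ready p σ' :=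
  h.congr (fun r hr' => hf.reg r (hr r hr')) fun a ha => hf.mem a (hm a ha)

theorem getD_map_of_lt {β : Type*} {l : List β} {f : β → ℕ} {j : ℕ} (hj : j < l.length) :
    (l.map f).getD j 0 = f l[j] := by
  rw [List.getD_eq_getElem _ _ (by simpa using hj), List.getElem_map]

/-- Among the first n + 1 elements the chain either begins with element n, and the stored successor
is the head among the first n, or it is unchanged. Induction on n thus follows the pointers and
charges only the elements of the chain. -/
theorem big_walk {p : Par} (hp : p.Ok) {j : ℕ} (hj : j < p.metas.length)
    (hK : p.keyOf p.metas[j] < p.NK) {h n : ℕ} (hn : n ≤ p.l) {σ : State} (hR : Ready p σ)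
    (h11 : σ.reg 11 = j) (h23 : σ.reg 23 = code (p.chain (p.keyOf p.metas[j]) h n)) :
    ∃ σ' t, Big p.w walk σ σ' t ∧ t ≤ 12 * (p.chain (p.keyOf p.metas[j]) h n).length + 1 ∧
      Flagged (∃ i ∈ p.chain (p.keyOf p.metas[j]) h n, p.Good p.metas[j] i) σ σ' := by
  have h1w : 1 < 2 ^ p.w := hp.small (by norm_num)
  set q := p.metas[j] with hq
  set key := p.keyOf q with hkey
  induction n generalizing σ with
  | zero =>
    refine ⟨σ, 1, .whilF h23, by simp, ⟨?_, fun _ => ⟨rfl, rfl⟩⟩⟩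
    rintro ⟨i, hi, -⟩
    simp [chain] at hi
  | succ n ih =>
    rw [chain_succ] at h23 ⊢
    split_ifs at h23 ⊢ with hM
    swap
    · exact ih (by omega) hR h11 h23
    have hnl := hp.mul_add_lt hK (show n < p.l by omega)
    have hnw : n + 1 < 2 ^ p.w := hp.lt_of_lt_l (by omega)
    have hXn := hp.hX n
    have h23' : (v 23).eval p.w σ = n + 1 := eval_v h23
    have h9 : σ.mem 9 j = p.X q.2.1 := by rw [hR.queried.c, getD_map_of_lt hj]
    have ha : ∀ σ₁ : State, σ₁.mem 0 = σ.mem 0 → σ₁.reg 23 = σ.reg 23 →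
        (ld 0 (v 23 - Ex.n 1)).eval p.w σ₁ = p.X n := fun σ₁ h0 hr =>
      eval_ld (i := n + 1 - 1) (eval_sub (eval_v (hr.trans h23)) (eval_n h1w) (by omega) hnw)
        (by rw [h0, hR.env.m0]; rfl)
    set σ₁ := σ.setReg 24 (p.other q n) with hσ₁
    have b1 : Big p.w (asg 24 (ld 9 (v 11) - ld 0 (v 23 - Ex.n 1))) σ σ₁ 1 :=
      .asg' (eval_sub_mod (eval_ld (eval_v h11) h9) (ha σ rfl rfl))
    have e24 : (v 24).eval p.w σ₁ = p.other q n := eval_v (by simp [hσ₁, reg_setReg])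
    have ha₁ : (ld 0 (v 23 - Ex.n 1)).eval p.w σ₁ = p.X n :=
      ha _ (by simp [hσ₁, mem_setReg]) (by simp [hσ₁, reg_setReg])
    have e7 : (v 7).eval p.w σ₁ = 2 ^ (p.w - 1) := eval_v (by simp [hσ₁, reg_setReg, hR.env.h7])
    have hd : ∀ x < 2 ^ p.w, x / 2 ^ (p.w - 1) < 2 := fun x hx => Nat.div_lt_of_lt_mul (by
      rwa [mul_comm, ← pow_succ', Nat.sub_add_cancel (Nat.one_le_iff_ne_zero.2 hp.hw)])
    have how : p.other q n < 2 ^ p.w := Nat.mod_lt _ (Nat.two_pow_pos _)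
    have hd1 := hd _ how
    have hd2 := hd _ hXn
    have h4w : 4 < 2 ^ p.w := hp.small (by norm_num)
    have hgood : exGood.eval p.w σ₁ = if p.Good q n then 1 else 0 :=
      eval_and hp.hw (eval_ld e24 (by rw [hσ₁, mem_setReg, hR.dict]))
        (eval_and hp.hw (eval_not hp.hw (eval_eq hp.hw ha₁ e24)) (eval_and hp.hw
          (eval_lt hp.hw (eval_n (by omega)) e24) (eval_or hp.hw (eval_eq hp.hw
            (eval_add (eval_div ha₁ e7 hXn) (eval_div e24 e7 how) (by omega)) (eval_n h1w))
            (eval_eq hp.hw (eval_div (eval_ld (eval_v (by simp [hσ₁, reg_setReg, h11])) h9) e7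
              (hp.hX _)) (eval_div ha₁ e7 hXn)))))
    obtain ⟨σ₂, t₂, b2, ht₂, hf₂⟩ : ∃ σ₂ t₂, Big p.w
        (ite exGood (.seq (asg 25 (Ex.n 1)) (asg 26 (Ex.n 0))) skip) σ₁ σ₂ t₂ ∧ t₂ ≤ 4 ∧
        Flagged (p.Good q n) σ₁ σ₂ := by
      by_cases hG : p.Good q n
      · rw [if_pos hG] at hgood
        refine ⟨_, _, .iteT (by rw [hgood]; norm_num) (.seq (.asg' (eval_n h1w))
          (.asg' (eval_n (a := 0) (by omega)))), by norm_num, ⟨fun _ => ?_, fun h => absurd hG h⟩⟩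
        simp [reg_setReg]
      · rw [if_neg hG] at hgood
        exact ⟨σ₁, _, .iteF hgood (.skip _), by norm_num, ⟨fun h => absurd h hG, fun _ => ⟨rfl, rfl⟩⟩⟩
    have hreg : ∀ r, r ∉ [24, 25, 26] → σ₂.reg r = σ.reg r := fun r hr => by
      rw [b2.frame.reg r (by simp at hr; simp [regs]; omega), b1.frame.reg r (by simp at hr; simp [regs]; omega)]
    have hmem : σ₂.mem = σ.mem := by
      funext a
      rw [b2.frame.mem a (by simp [arrs]), b1.frame.mem a (by simp [arrs])]
    set σ₃ := σ₂.setReg 23 (code (p.chain key h n)) with hσ₃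
    have b3 : Big p.w (asg 23 (ld 5 (ld 11 (v 11) + (v 23 - Ex.n 1)))) σ₂ σ₃ 1 := by
      refine .asg' (eval_ld (i := key * p.l + (n + 1 - 1)) (eval_add (eval_ld
        (eval_v (a := j) (by rw [hreg 11 (by decide), h11]))
        (by rw [hmem, hR.queried.e, getD_map_of_lt hj])) (eval_sub
        (eval_v (by rw [hreg 23 (by decide), h23]; rfl)) (eval_n h1w) (by omega) hnw) (by omega)) ?_)
      rw [hmem]
      have := hR.built.next key n hK (by omega) hM.1
      rw [hM.2] at this
      exact this
    have b13 := Big.seq b1 (.seq b2 b3)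
    obtain ⟨σ₄, t₄, b4, ht₄, hf₄⟩ := ih (by omega) (hR.frame b13.frame (by decide) (by decide))
      (by rw [b13.frame.reg 11 (by decide), h11]) (by simp [hσ₃, reg_setReg])
    refine ⟨σ₄, _, .whilT (by rw [h23']; omega) b13 b4, ?_, ?_⟩
    · simp only [List.length_cons]; omega
    · have := (hf₂.congr (σ₁' := σ) (σ₂' := σ₃) (by simp [hσ₁, reg_setReg])
        (by simp [hσ₁, reg_setReg]) (by simp [hσ₃, reg_setReg]) (by simp [hσ₃, reg_setReg])).trans hf₄
      simpa only [List.mem_cons, exists_eq_or_imp] using this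

/-- The lower half of the hash value that belongs to a reported element. -/
def Par.unshift (p : Par) (q : ℕ × ℕ × ℕ) (x : ℕ) : ℕ := x - p.shift q.2.1 q.2.2 / 2 ^ p.r * 2 ^ p.r

theorem big_check {p : Par} (hp : p.Ok) {j N : ℕ} (hj : j < p.metas.length)
    (hK : p.keyOf p.metas[j] < p.NK) {R : ℕ → ℕ} {σ : State} (hR : Ready p σ) (hN : N < 2 ^ p.w)
    (h100 : σ.reg 100 = N) (h11 : σ.reg 11 = j) (h52 : σ.mem 52 = R) (h25 : σ.reg 25 = 0)
    (h26 : σ.reg 26 = p.metas.length - j)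
    (hx : ∀ i < N, p.shift p.metas[j].2.1 p.metas[j].2.2 / 2 ^ p.r * 2 ^ p.r ≤ R i ∧
      p.unshift p.metas[j] (R i) < p.Q) :
    ∃ σ' t, Big p.w check σ σ' t ∧
      t ≤ ∑ i ∈ Finset.range N,
        (12 * (p.chain (p.keyOf p.metas[j]) (p.unshift p.metas[j] (R i)) p.l).length + 6) + 8 ∧
      Ready p σ' ∧ σ'.reg 11 = j + 1 ∧
      ((∃ i < N, ∃ a ∈ p.chain (p.keyOf p.metas[j]) (p.unshift p.metas[j] (R i)) p.l,
        p.Good p.metas[j] a) → σ'.reg 25 = 1 ∧ σ'.reg 26 = 0) ∧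
      (¬ (∃ i < N, ∃ a ∈ p.chain (p.keyOf p.metas[j]) (p.unshift p.metas[j] (R i)) p.l,
        p.Good p.metas[j] a) → σ'.reg 25 = 0 ∧ σ'.reg 26 = p.metas.length - (j + 1)) := by
  have h1w : 1 < 2 ^ p.w := hp.small (by norm_num)
  have hmw := hp.metas_lt
  set q := p.metas[j] with hq
  set key := p.keyOf q with hkey
  set σ₁ := σ.setReg 26 (p.metas.length - j - 1) with hσ₁
  have b1 : Big p.w (asg 26 (v 26 - n 1)) σ σ₁ 1 :=
    .asg' (eval_sub (eval_v h26) (eval_n h1w) (by omega) (by omega))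
  have hR₁ := hR.frame b1.frame (by decide) (by decide)
  obtain ⟨σ₂, t₂, b2, ht₂, -, hi₂⟩ := Big.forr (w := p.w) (i := 12) (N := N) (e := v 100)
    (b := .seq (asg 23 (ld 4 (ld 10 (v 11) + ld 52 (v 12)))) walk) (σ := σ₁)
    (fun k σ' => Flagged (∃ i < k, ∃ a ∈ p.chain key (p.unshift q (R i)) p.l, p.Good q a) σ₁ σ')
    (fun i => 12 * (p.chain key (p.unshift q (R i)) p.l).length + 3) hp.hw hN
    ⟨fun ⟨i, hi, _⟩ => absurd hi (by omega), fun _ => by simp [reg_setReg]⟩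
    (fun k σ' _ hf _ _ => eval_v (by rw [hf.reg 100 (by decide), hσ₁]; simp [reg_setReg, h100]))
    (by
      intro k σ' hk hf hi hr
      have hR' := hR₁.frame hf (by decide) (by decide)
      have h11' : σ'.reg 11 = j := by rw [hf.reg 11 (by decide)]; simp [hσ₁, reg_setReg, h11]
      obtain ⟨hx1, hx2⟩ := hx k hk
      -- The offset is key·Q minus the translation, wrapped around; adding a reported element
      -- cancels both the translation and the wraparound and leaves the index of a head.
      have hidx : (p.base q + R k) % 2 ^ p.w = key * p.Q + p.unshift q (R k) := by
        have h1 := mul_add_lt hK hx2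
        have h2 := hp.mul_Q_lt
        have h3 : (p.NK + 1) * p.Q = p.NK * p.Q + p.Q := by ring
        have h4 : p.shift q.2.1 q.2.2 / 2 ^ p.r * 2 ^ p.r < 2 ^ p.w := by
          have h5 := Nat.div_mul_le_self (p.shift q.2.1 q.2.2) (2 ^ p.r)
          have h6 := p.shift_le (i := q.2.1) (y := q.2.2)
          have h7 := hp.Q_lt
          have h8 := p.Q_pos
          omega
        rw [base, Nat.mod_add_mod]
        unfold unshift at h1 ⊢
        rw [show p.keyOf q * p.Q + (2 ^ p.w - p.shift q.2.1 q.2.2 / 2 ^ p.r * 2 ^ p.r) + R k =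
          (key * p.Q + (R k - p.shift q.2.1 q.2.2 / 2 ^ p.r * 2 ^ p.r)) + 2 ^ p.w by
            rw [← hkey]; omega, Nat.add_mod_right, Nat.mod_eq_of_lt (by omega)]
      set σ₃ := σ'.setReg 23 (code (p.chain key (p.unshift q (R k)) p.l)) with hσ₃
      have b3 : Big p.w (asg 23 (ld 4 (ld 10 (v 11) + ld 52 (v 12)))) σ' σ₃ 1 := by
        refine .asg' (eval_ld (i := key * p.Q + p.unshift q (R k)) ?_
          (hR'.built.head _ _ hK hx2))
        have e1 : (ld 10 (v 11)).eval p.w σ' = p.base q :=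
          eval_ld (eval_v h11') (by rw [hR'.queried.d, getD_map_of_lt hj])
        have e2 : (ld 52 (v 12)).eval p.w σ' = R k :=
          eval_ld (eval_v hr) (by rw [hf.mem 52 (by decide), hσ₁, mem_setReg, h52])
        change BinOp.eval p.w .add _ _ = _
        rw [e1, e2]; exact hidx
      obtain ⟨σ₄, t₄, b4, ht₄, hf₄⟩ := big_walk hp hj hK le_rfl
        (hR'.frame b3.frame (by decide) (by decide)) (by rw [b3.frame.reg 11 (by decide), h11'])
        (by simp [hσ₃, reg_setReg]; rfl)
      refine ⟨σ₄, _, .seq b3 b4, ?_, ?_, ?_⟩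
      · change t₄ ≤ 12 * (p.chain key (p.unshift q (R k)) p.l).length + 1 at ht₄
        omega
      · rw [b4.frame.reg 12 (by decide), b3.frame.reg 12 (by decide), hr]
      · have := hi.trans (hf₄.congr (σ₁' := σ') (σ₂' := σ₄.setReg 12 (k + 1))
          (by simp [hσ₃, reg_setReg]) (by simp [hσ₃, reg_setReg]) (by simp [reg_setReg])
          (by simp [reg_setReg]))
        convert this using 1
        refine ⟨fun ⟨i, hi, h⟩ => ?_, ?_⟩
        · rcases Nat.lt_succ_iff_lt_or_eq.1 hi with hi | rfl
          · exact .inl ⟨i, hi, h⟩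
          · exact .inr h
        · rintro (⟨i, hi, h⟩ | h)
          · exact ⟨i, by omega, h⟩
          · exact ⟨k, by omega, h⟩)
  have h11₂ : σ₂.reg 11 = j := by
    rw [b2.frame.reg 11 (by decide)]; simp [hσ₁, reg_setReg, h11]
  have b3 : Big p.w (asg 11 (v 11 + n 1)) σ₂ (σ₂.setReg 11 (j + 1)) 1 :=
    .asg' (eval_add (eval_v h11₂) (eval_n h1w) (by omega))
  have hb := Big.seq b1 (.seq b2 b3)
  refine ⟨_, _, hb, ?_, hR.frame hb.frame (by decide) (by decide), by simp [reg_setReg], ?_, ?_⟩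
  · have : ∀ i, 12 * (p.chain key (p.unshift q (R i)) p.l).length + 3 + 3 =
      12 * (p.chain key (p.unshift q (R i)) p.l).length + 6 := fun i => by ring
    simp only [this] at ht₂
    omega
  · intro h
    have := hi₂.pos h
    simpa [reg_setReg] using this
  · intro h
    have := hi₂.neg h
    simp only [reg_setReg, hσ₁, h25] at this ⊢
    simp at this ⊢
    omega

end Reduction

namespace Reduction

open WordRAM SetIntersection

/-! ### The instance -/

theorem getD_flatMap_map {β γ : Type*} {U : ℕ} (f : β → ℕ → γ) (b₀ : β) (d : γ) {u : ℕ} (hu : u < U) :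
    ∀ (L : List β) {i : ℕ}, i < L.length →
      (L.flatMap fun c => (List.range U).map (f c)).getD (i * U + u) d = f (L.getD i b₀) u := by
  intro L
  induction L with
  | nil => intro i hi; simp at hi
  | cons c L ih =>
    intro i hi
    rw [List.flatMap_cons]
    cases i with
    | zero =>
      rw [List.getD_append _ _ _ _ (by simpa using hu), List.getD_eq_getElem _ _ (by simpa using hu)]
      simp
    | succ i =>
      rw [List.getD_append_right _ _ _ _ (by simp; rw [add_mul]; omega)]
      simp only [List.length_map, List.length_range, List.getD_cons_succ]
      rw [show (i + 1) * U + u - U = i * U + u by rw [add_mul]; omega]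
      exact ih (by simpa using hi)

namespace Par
variable {p : Par}

theorem famA_getD {ch u : ℕ} (hc : ch < p.chunks.length) (hu : u < p.U) :
    p.famA.getD (ch * p.U + u) [] =
      p.setA (p.chunks.getD ch (0, 0)).1 (p.chunks.getD ch (0, 0)).2 u :=
  getD_flatMap_map (fun c : ℕ × ℕ => p.setA c.1 c.2) (0, 0) [] hu _ hc

theorem famB_getD {key v : ℕ} (hk : key < p.NK) (hv : v < 2 ^ p.r) :
    p.famB.getD (key * 2 ^ p.r + v) [] = p.setB key v := by
  rw [famB, getD_flatMap_map p.setB 0 [] hv _ (by simpa using hk),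
    List.getD_eq_getElem _ _ (by simpa using hk)]
  simp

theorem mem_setA {key j u x : ℕ} : x ∈ p.setA key j u ↔ ∃ h ∈ p.ent key p.l,
    (p.ent key p.l).idxOf h / p.T = j ∧ x = h + u * 2 ^ p.r := by
  have hT := p.T_pos
  simp only [setA, List.mem_map, List.mem_range]
  constructor
  · rintro ⟨i, hi, rfl⟩
    have hlt : j * p.T + i < (p.ent key p.l).length := by omega
    rw [List.getD_eq_getElem _ _ hlt]
    refine ⟨_, List.getElem_mem hlt, ?_, rfl⟩
    rw [(p.ent_nodup key p.l).idxOf_getElem _ hlt, mul_comm, Nat.mul_add_div hT,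
      Nat.div_eq_of_lt (by omega), add_zero]
  · rintro ⟨h, hh, rfl, rfl⟩
    have hlt := List.idxOf_lt_length_of_mem hh
    have h1 := Nat.div_add_mod ((p.ent key p.l).idxOf h) p.T
    have h2 := Nat.mod_lt ((p.ent key p.l).idxOf h) hT
    rw [mul_comm] at h1
    refine ⟨(p.ent key p.l).idxOf h % p.T, by omega, ?_⟩
    rw [h1, List.getD_eq_getElem _ _ hlt, List.getElem_idxOf]

theorem mem_setB {key v x : ℕ} : x ∈ p.setB key v ↔ x = 8 * p.Q ∨ ∃ h ∈ p.ent key p.l,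
    x = p.Q + p.Q - h - v := by
  simp only [setB, List.mem_cons, List.mem_map, List.mem_range]
  refine or_congr Iff.rfl ⟨?_, ?_⟩
  · rintro ⟨i, hi, rfl⟩
    rw [List.getD_eq_getElem _ _ hi]
    exact ⟨_, List.getElem_mem hi, rfl⟩
  · rintro ⟨h, hh, rfl⟩
    have hlt := List.idxOf_lt_length_of_mem hh
    exact ⟨_, hlt, by rw [List.getD_eq_getElem _ _ hlt, List.getElem_idxOf]⟩

theorem setA_nodup (p : Par) (key j u : ℕ) : (p.setA key j u).Nodup := by
  refine List.Nodup.map_on ?_ List.nodup_range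
  intro a ha b hb hab
  rw [List.mem_range] at ha hb
  have h1 : j * p.T + a < (p.ent key p.l).length := by omega
  have h2 : j * p.T + b < (p.ent key p.l).length := by omega
  rw [List.getD_eq_getElem _ _ h1, List.getD_eq_getElem _ _ h2] at hab
  have := (p.ent_nodup key p.l).getElem_inj_iff.1 (Nat.add_right_cancel hab)
  omega

theorem setB_nodup (p : Par) (key : ℕ) {v : ℕ} (hv : v < 2 ^ p.r) : (p.setB key v).Nodup := by
  have hQ := p.Q_pos
  have h2 := p.two_pow_r_le
  refine List.nodup_cons.2 ⟨?_, List.Nodup.map_on ?_ List.nodup_range⟩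
  · simp only [List.mem_map, not_exists, not_and]
    intro i _
    omega
  · intro a ha b hb hab
    rw [List.mem_range] at ha hb
    have h3 := p.getD_ent_lt key a
    have h4 := p.getD_ent_lt key b
    have h5 : (p.ent key p.l).getD a 0 = (p.ent key p.l).getD b 0 := by omega
    rw [List.getD_eq_getElem _ _ ha, List.getD_eq_getElem _ _ hb] at h5
    exact (p.ent_nodup key p.l).getElem_inj_iff.1 h5

/-- An entry list may be empty, and then only the extra element 8Q keeps the set of the second
family nonempty. It is the largest element used, hence the condition 8Q < N. -/
theorem isInstance (p : Par) {N : ℕ} (h8 : 8 * p.Q < N)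
    (hN : p.U * (p.flat p.NK).length + 2 ^ p.r * ((p.flat p.NK).length + p.NK) ≤ N) :
    p.sys.IsInstance N := by
  have h2 := p.two_pow_r_le
  constructor
  · intro S hS
    rcases List.mem_append.1 hS with hS | hS
    · simp only [sys, famA, List.mem_flatMap, List.mem_map, List.mem_range] at hS
      obtain ⟨c, hc, u, hu, rfl⟩ := hS
      refine ⟨fun h => ?_, p.setA_nodup _ _ _, fun x hx => ?_⟩
      · have h1 := p.mul_T_lt (mem_chunks.1 hc).2
        have := p.T_pos
        simp [setA] at h
        omega
      · obtain ⟨h, hh, -, rfl⟩ := mem_setA.1 hx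
        have := lt_of_mem_ent hh
        have := p.U_mul_le hu
        omega
    · simp only [sys, famB, List.mem_flatMap, List.mem_map, List.mem_range] at hS
      obtain ⟨key, -, v, hv, rfl⟩ := hS
      refine ⟨by simp [setB], p.setB_nodup _ hv, fun x hx => ?_⟩
      rcases mem_setB.1 hx with rfl | ⟨h, -, rfl⟩ <;> omega
  · rw [← List.length_flatten]
    change (p.famA ++ p.famB).flatten.length ≤ N
    rw [List.flatten_append, List.length_append, famB_flatten_length]
    have := p.famA_flatten_length_le
    omega

theorem chunks_nodup (p : Par) : p.chunks.Nodup := by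
  rw [chunks, chunksTo, List.nodup_flatMap]
  refine ⟨fun k _ => (List.nodup_range).map fun a b h => by simpa using h, ?_⟩
  refine List.Pairwise.imp (R := fun a b => a ≠ b) ?_ List.nodup_range
  intro a b hab x hx hy
  simp only [List.mem_map] at hx hy
  obtain ⟨_, _, rfl⟩ := hx
  obtain ⟨_, _, h⟩ := hy
  exact hab (by simpa using (congrArg Prod.fst h).symm)

theorem mem_metas {q : ℕ × ℕ × ℕ} : q ∈ p.metas ↔ q.1 < p.chunks.length ∧ q.2.1 < p.l ∧ q.2.2 < 8 ∧
    p.Admissible (p.keyOf q) q.2.1 q.2.2 := by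
  obtain ⟨ch, i, y⟩ := q
  simp only [metas, List.mem_flatMap, List.mem_range, keyOf]
  constructor
  · rintro ⟨ch', h1, i', h2, y', h3, h4⟩
    split_ifs at h4 with h5
    · simp only [List.mem_singleton, Prod.mk.injEq] at h4
      obtain ⟨rfl, rfl, rfl⟩ := h4
      exact ⟨h1, h2, h3, h5⟩
    · simp at h4
  · rintro ⟨h1, h2, h3, h4⟩
    exact ⟨ch, h1, i, h2, y, h3, by rw [if_pos h4]; simp⟩

theorem nodup_flatMap_of {β γ : Type*} {L : List β} (hL : L.Nodup) {f : β → List γ} (g : γ → β)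
    (hf : ∀ b, (f b).Nodup) (hg : ∀ b, ∀ x ∈ f b, g x = b) : (L.flatMap f).Nodup := by
  rw [List.nodup_flatMap]
  refine ⟨fun b _ => hf b, List.Pairwise.imp (R := fun a b => a ≠ b) ?_ hL⟩
  intro a b hab x hx hy
  exact hab ((hg a x hx).symm.trans (hg b x hy))

theorem metas_nodup (p : Par) : p.metas.Nodup := by
  have key : ∀ ch i y, ∀ x ∈ (if p.Admissible (p.chunks.getD ch (0, 0)).1 i y then [(ch, i, y)] else []),
      x = (ch, i, y) := by
    intro ch i y x hx
    split_ifs at hx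
    · simpa using hx
    · simp at hx
  refine nodup_flatMap_of List.nodup_range (fun x => x.1) (fun ch =>
    nodup_flatMap_of List.nodup_range (fun x => x.2.1) (fun i =>
      nodup_flatMap_of List.nodup_range (fun x => x.2.2) (fun y => by split_ifs <;> simp)
        fun y x hx => ?_) fun i x hx => ?_) fun ch x hx => ?_
  · rw [key _ _ _ x hx]
  · simp only [List.mem_flatMap] at hx
    obtain ⟨y, -, hx⟩ := hx
    rw [key _ _ _ x hx]
  · simp only [List.mem_flatMap] at hx
    obtain ⟨i, -, y, -, hx⟩ := hx
    rw [key _ _ _ x hx]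

theorem keyOf_lt {q : ℕ × ℕ × ℕ} (hq : q ∈ p.metas) : p.keyOf q < p.NK := by
  have h := (mem_metas.1 hq).1
  rw [keyOf, List.getD_eq_getElem _ _ h]
  exact (mem_chunks.1 (List.getElem_mem h)).1

theorem queryOf_fst_lt (hp : p.Ok) {q : ℕ × ℕ × ℕ} (hq : q ∈ p.metas) :
    (p.queryOf q).1 < p.famA.length := by
  rw [famA_length]
  exact mul_add_lt (mem_metas.1 hq).1 (shift_div_lt hp)

theorem queryOf_snd_lt {q : ℕ × ℕ × ℕ} (hq : q ∈ p.metas) : (p.queryOf q).2 < p.famB.length := by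
  rw [famB_length]
  exact mul_add_lt (keyB_lt (keyOf_lt hq)) (Nat.mod_lt _ (Nat.two_pow_pos _))

/-- The elements of the answer to a query. -/
theorem mem_answer (hp : p.Ok) {q : ℕ × ℕ × ℕ} (hq : q ∈ p.metas) {x : ℕ} :
    x ∈ p.sys.answer (p.queryOf q) ↔ ∃ h ∈ p.ent (p.keyOf q) p.l,
      (p.ent (p.keyOf q) p.l).idxOf h / p.T = (p.chunks.getD q.1 (0, 0)).2 ∧
      x = h + p.shift q.2.1 q.2.2 / 2 ^ p.r * 2 ^ p.r ∧
      ∃ h' ∈ p.ent (p.keyB (p.keyOf q) q.2.1 q.2.2) p.l,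
        h + h' + q.2.2 / 2 % 2 = p.lo q.2.1 + q.2.2 / 4 * p.Q := by
  obtain ⟨hch, hi, hy, -⟩ := mem_metas.1 hq
  have h2 := p.two_pow_r_le
  have hu := shift_div_lt hp (i := q.2.1) (y := q.2.2)
  have hv : p.shift q.2.1 q.2.2 % 2 ^ p.r < 2 ^ p.r := Nat.mod_lt _ (Nat.two_pow_pos _)
  have h3 := p.U_mul_le hu
  have h4 := Nat.div_add_mod (p.shift q.2.1 q.2.2) (2 ^ p.r)
  rw [mul_comm] at h4
  have hlo := p.lo_lt q.2.1
  have hy4 : q.2.2 / 4 * p.Q ≤ p.Q := by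
    have : q.2.2 / 4 ≤ 1 := by omega
    exact (Nat.mul_le_mul_right _ this).trans (by omega)
  -- No truncation occurs, as lo c + fQ is below 2Q. Splitting the shift as u·2^r + v, the equation
  -- h + u·2^r = 2Q - h' - v of a common element becomes h + h' + e = lo c + fQ.
  have hsh : p.shift q.2.1 q.2.2 + (p.lo q.2.1 + q.2.2 / 4 * p.Q) = p.Q + p.Q + q.2.2 / 2 % 2 := by
    unfold shift; omega
  have hA : p.famA.getD (p.queryOf q).1 [] = p.setA (p.keyOf q) (p.chunks.getD q.1 (0, 0)).2
      (p.shift q.2.1 q.2.2 / 2 ^ p.r) := famA_getD hch hu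
  have hB : p.famB.getD (p.queryOf q).2 [] = p.setB (p.keyB (p.keyOf q) q.2.1 q.2.2)
      (p.shift q.2.1 q.2.2 % 2 ^ p.r) := famB_getD (keyB_lt (keyOf_lt hq)) hv
  simp only [SetSystem.answer, sys, hA, hB, Finset.mem_inter, List.mem_toFinset, mem_setA, mem_setB]
  constructor
  -- The extra element 8Q is never common, since the elements of the first family are below Q + 2Q.
  · rintro ⟨⟨h, hh, hj, rfl⟩, h8 | ⟨h', hh', hx⟩⟩
    · have := lt_of_mem_ent hh
      omega
    · have := lt_of_mem_ent hh
      have := lt_of_mem_ent hh'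
      exact ⟨h, hh, hj, rfl, h', hh', by omega⟩
  · rintro ⟨h, hh, hj, rfl, h', hh', hx⟩
    have := lt_of_mem_ent hh
    have := lt_of_mem_ent hh'
    exact ⟨⟨h, hh, hj, rfl⟩, .inr ⟨h', hh', by omega⟩⟩

theorem unshift_of_mem_answer (hp : p.Ok) {q : ℕ × ℕ × ℕ} (hq : q ∈ p.metas) {x : ℕ}
    (hx : x ∈ p.sys.answer (p.queryOf q)) :
    p.shift q.2.1 q.2.2 / 2 ^ p.r * 2 ^ p.r ≤ x ∧ p.unshift q x < p.Q := by
  obtain ⟨h, hh, -, rfl, -⟩ := (mem_answer hp hq).1 hx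
  have := lt_of_mem_ent hh
  exact ⟨by omega, by unfold unshift; omega⟩

end Par

end Reduction

namespace Reduction

open WordRAM SetIntersection

/-! ### Sums of hash values -/

namespace Par
variable {p : Par}

theorem other_eq {q : ℕ × ℕ × ℕ} {a b : ℕ} (hX : ∀ i, p.X i < 2 ^ p.w)
    (h : (p.X a + p.X b) % 2 ^ p.w = p.X q.2.1) : p.other q a = p.X b := by
  have ha := hX a
  have hb := hX b
  rw [other, ← h, Nat.mod_add_mod, show p.X a + p.X b + (2 ^ p.w - p.X a) = p.X b + 2 ^ p.w by omega,
    Nat.add_mod_right, Nat.mod_eq_of_lt hb]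

theorem add_other {q : ℕ × ℕ × ℕ} {a : ℕ} (hX : ∀ i, p.X i < 2 ^ p.w) :
    (p.X a + p.other q a) % 2 ^ p.w = p.X q.2.1 := by
  have ha := hX a
  rw [other, Nat.add_mod_mod, show p.X a + (p.X q.2.1 + (2 ^ p.w - p.X a)) = p.X q.2.1 + 2 ^ p.w by
    omega, Nat.add_mod_right, Nat.mod_eq_of_lt (hX _)]

theorem sign_lt (hp : p.Ok) {x : ℕ} (hx : x < 2 ^ p.w) : x / 2 ^ (p.w - 1) < 2 :=
  Nat.div_lt_of_lt_mul (by
    rwa [mul_comm, ← pow_succ', Nat.sub_add_cancel (Nat.one_le_iff_ne_zero.2 hp.hw)])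

theorem two_pow_eq (hp : p.Ok) : 2 ^ p.w = 2 ^ (p.w - (p.s + (p.r + p.r))) * (2 ^ p.s * p.Q) := by
  have := hp.hm
  rw [Q, ← pow_add, ← pow_add, ← pow_add]
  congr 1; omega

/-- Multiplication by α is linear modulo 2^w. Dividing by M = 2^(w-s-2r) forgets only whether the
two remainders add up to M or more, and this is e. -/
theorem exists_carry (hp : p.Ok) {x y z : ℕ} (h : (x + y) % 2 ^ p.w = z) :
    ∃ e < 2, (p.H x + p.H y + e) % (2 ^ p.s * p.Q) = p.H z := by
  set M := 2 ^ (p.w - (p.s + (p.r + p.r))) with hM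
  have hM0 : 0 < M := Nat.two_pow_pos _
  set x' := p.α * x % 2 ^ p.w with hx'
  set y' := p.α * y % 2 ^ p.w with hy'
  have hz : p.α * z % 2 ^ p.w = (x' + y') % 2 ^ p.w := by
    rw [← h, hx', hy', ← Nat.add_mod, ← mul_add, Nat.mul_mod, Nat.mod_mod, ← Nat.mul_mod]
  have h1 := Nat.div_add_mod x' M
  have h2 := Nat.div_add_mod y' M
  have h3 := Nat.mod_lt x' hM0
  have h4 := Nat.mod_lt y' hM0
  refine ⟨(x' % M + y' % M) / M, Nat.div_lt_of_lt_mul (by omega), ?_⟩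
  change (x' / M + y' / M + _) % _ = (p.α * z % 2 ^ p.w) / M
  rw [hz, two_pow_eq hp, Nat.mod_mul_right_div_self]
  congr 1
  rw [Nat.add_div hM0, Nat.add_div (a := x') hM0, Nat.mod_mod, Nat.mod_mod, Nat.div_eq_of_lt h3,
    Nat.div_eq_of_lt h4]
  split_ifs <;> omega

/-- Schoolbook addition with two digits, the lower one in base Q: f is the carry out of the lower
digit. The upper digits are residues modulo S, and S + S is added to keep the subtraction in ℕ from
truncating. -/
theorem exists_carries {S Q a b c e : ℕ} (hQ : 0 < Q) (ha : a < S * Q)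
    (hb : b < S * Q) (he : e < 2) (h : (a + b + e) % (S * Q) = c) :
    ∃ f < 2, a % Q + b % Q + e = c % Q + f * Q ∧
      (c / Q + (S + S) - a / Q - f) % S = b / Q := by
  have h1 := Nat.div_add_mod a Q
  have h2 := Nat.div_add_mod b Q
  have h3 := Nat.mod_lt a hQ
  have h4 := Nat.mod_lt b hQ
  have h5 : a / Q < S := Nat.div_lt_of_lt_mul (by rwa [mul_comm])
  have h6 : b / Q < S := Nat.div_lt_of_lt_mul (by rwa [mul_comm])
  generalize a / Q = a₁ at *
  generalize b / Q = b₁ at *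
  generalize a % Q = a₀ at *
  generalize b % Q = b₀ at *
  have h7 := Nat.div_add_mod (a₀ + b₀ + e) Q
  have h8 : (a₀ + b₀ + e) % Q < Q := Nat.mod_lt _ hQ
  have hf2 : (a₀ + b₀ + e) / Q < 2 := Nat.div_lt_of_lt_mul (by omega)
  generalize (a₀ + b₀ + e) / Q = f at *
  generalize (a₀ + b₀ + e) % Q = c₀ at *
  have hsum : a + b + e = (a₁ + b₁ + f) * Q + c₀ := by
    have : (a₁ + b₁ + f) * Q = Q * a₁ + Q * b₁ + Q * f := by ring
    omega
  have h9 : c % Q = c₀ := by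
    rw [← h, mul_comm S, Nat.mod_mul_right_mod, hsum, mul_comm, Nat.mul_add_mod,
      Nat.mod_eq_of_lt h8]
  have h10 : c / Q = (a₁ + b₁ + f) % S := by
    rw [← h, mul_comm S, Nat.mod_mul_right_div_self, hsum, mul_comm (_ + f), Nat.mul_add_div hQ,
      Nat.div_eq_of_lt h8, add_zero]
  refine ⟨f, hf2, by rw [h9, mul_comm f]; omega, ?_⟩
  rw [h10]
  by_cases hc : a₁ + b₁ + f < S
  · rw [Nat.mod_eq_of_lt hc, show a₁ + b₁ + f + (S + S) - a₁ - f = b₁ + S + S by omega,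
      Nat.add_mod_right, Nat.add_mod_right, Nat.mod_eq_of_lt h6]
  · have : (a₁ + b₁ + f) % S = a₁ + b₁ + f - S := by
      rw [Nat.mod_eq_sub_mod (by omega), Nat.mod_eq_of_lt (by omega)]
    rw [this, show a₁ + b₁ + f - S + (S + S) - a₁ - f = b₁ + S by omega,
      Nat.add_mod_right, Nat.mod_eq_of_lt h6]

/-- The digits can be put together again: two agreements of digits amount to one congruence of hash
values. This identifies a false positive as a triple counted by `nearSet`. -/
theorem mod_eq_of_carries {S Q a b c e f : ℕ} (ha : a < S * Q) (hc : c < S * Q)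
    (hf : f < 2) (h : a % Q + b % Q + e = c % Q + f * Q)
    (h' : (c / Q + (S + S) - a / Q - f) % S = b / Q) : (a + b + e) % (S * Q) = c := by
  have h1 := Nat.div_add_mod a Q
  have h2 := Nat.div_add_mod b Q
  have h3 := Nat.div_add_mod c Q
  have h5 : a / Q < S := Nat.div_lt_of_lt_mul (by rwa [mul_comm])
  generalize a / Q = a₁ at *
  generalize b / Q = b₁ at *
  generalize c / Q = c₁ at *
  generalize a % Q = a₀ at *
  generalize b % Q = b₀ at *
  generalize c % Q = c₀ at *
  obtain ⟨k, hk⟩ : ∃ k, k = c₁ + (S + S) - a₁ - f := ⟨_, rfl⟩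
  have hk' : k + a₁ + f = c₁ + (S + S) := by omega
  rw [← hk] at h'
  have h4 := Nat.div_add_mod k S
  rw [h'] at h4
  generalize k / S = t at *
  -- The 2 comes from the summand S + S, and t is the quotient of the upper digit by S; as 2 - t may
  -- be negative, the identity is stated in ℤ.
  have hsum : ((a + b + e : ℕ) : ℤ) = c + (2 - (t : ℤ)) * ((S * Q : ℕ) : ℤ) := by
    push_cast
    zify at h1 h2 h3 h h4 hk'
    rw [← h1, ← h2, ← h3]
    linear_combination h + (Q : ℤ) * hk' + (Q : ℤ) * h4
  have : ((a + b + e : ℕ) : ℤ) % ((S * Q : ℕ) : ℤ) = c := by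
    rw [hsum, Int.add_mul_emod_self_right]
    exact Int.emod_eq_of_lt (by positivity) (by exact_mod_cast hc)
  exact_mod_cast this

/-! ### Queries that find a witness -/

/-- The query finds a witness. -/
def Found (p : Par) (q : ℕ × ℕ × ℕ) : Prop :=
  ∃ x ∈ p.sys.answer (p.queryOf q), ∃ a ∈ p.chain (p.keyOf q) (p.unshift q x) p.l, p.Good q a

theorem keyB_div (key i y : ℕ) : p.keyB key i y / 2 ^ p.s =
    key / 2 ^ p.s / 4 * 4 + (2 - key / 2 ^ p.s % 4 / 2 * 2 + y % 2) := by
  rw [keyB, mul_comm (_ + (2 - _ + _)), Nat.mul_add_div (Nat.two_pow_pos _),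
    Nat.div_eq_of_lt (Nat.mod_lt _ (Nat.two_pow_pos _)), add_zero]

theorem keyB_mod (key i y : ℕ) : p.keyB key i y % 2 ^ p.s =
    (p.H (p.X i) / p.Q + (2 ^ p.s + 2 ^ p.s) - key % 2 ^ p.s - y / 4) % 2 ^ p.s := by
  rw [keyB, mul_comm (_ + (2 - _ + _)), Nat.mul_add_mod, Nat.mod_mod]

/-- The indices of the elements differ in the bit of the class. -/
theorem mem_keyB (hp : p.Ok) {key i y a b : ℕ} (ha : p.Mem key a) (hb : p.Mem (p.keyB key i y) b) :
    a ≠ b ∧ p.X b / 2 ^ (p.w - 1) = y % 2 := by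
  obtain ⟨-, h1, -⟩ := ha
  obtain ⟨-, h2, -⟩ := hb
  have h3 := sign_lt hp (hp.hX a)
  have h4 := sign_lt hp (hp.hX b)
  rw [keyB_div] at h2
  have h5 : (key / 2 ^ p.s / 4 * 4 + (2 - key / 2 ^ p.s % 4 / 2 * 2 + y % 2)) / 4 = key / 2 ^ p.s / 4 := by
    omega
  rw [h5] at h2
  generalize p.X b / 2 ^ (p.w - 1) = sb at *
  refine ⟨?_, by omega⟩
  rintro rfl
  generalize p.X a / 2 ^ (p.w - 1) = sa at *
  generalize a / 2 ^ (key / 2 ^ p.s / 4) = z at *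
  omega

/-- The partner of a is forced to be b. It differs from a since the two keys disagree in an index
bit, and the class of the key and the option y carry the signs of a and b, so admissibility is the
sign condition that is tested. -/
theorem good_of_add (hp : p.Ok) (hinj : ∀ i < p.l, ∀ j < p.l, p.X i = p.X j → i = j)
    {q : ℕ × ℕ × ℕ} {a b : ℕ} (ha : p.Mem (p.keyOf q) a) (hal : a < p.l) (hbl : b < p.l)
    (hb : p.Mem (p.keyB (p.keyOf q) q.2.1 q.2.2) b) (hA : p.Admissible (p.keyOf q) q.2.1 q.2.2)
    (h : (p.X a + p.X b) % 2 ^ p.w = p.X q.2.1) : p.Good q a := by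
  obtain ⟨hne, hs⟩ := mem_keyB hp ha hb
  have ho := other_eq hp.hX h
  have hsa : p.keyOf q / 2 ^ p.s % 2 = p.X a / 2 ^ (p.w - 1) := by
    have h1 := ha.2.1
    have h3 := sign_lt hp (hp.hX a)
    generalize p.X a / 2 ^ (p.w - 1) = sa at *
    generalize a / 2 ^ (p.keyOf q / 2 ^ p.s / 4) = z at *
    omega
  refine ⟨⟨b, hbl, ho.symm⟩, fun h' => hne (hinj a hal b hbl (h'.trans ho)), ho ▸ hb.1, ?_⟩
  rw [ho, hs]
  rcases hA with hA | hA
  · left; omega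
  · right; omega

/-- There is a query for every witness. -/
theorem exists_found (hp : p.Ok)
    {a b c : ℕ} (ha : a < p.l) (hb : b < p.l) (hc : c < p.l) (hab : a ≠ b) (ha0 : 0 < p.X a)
    (hb0 : 0 < p.X b) (h : (p.X a + p.X b) % 2 ^ p.w = p.X c)
    (hinj : ∀ i < p.l, ∀ j < p.l, p.X i = p.X j → i = j)
    (hs : p.X a / 2 ^ (p.w - 1) + p.X b / 2 ^ (p.w - 1) = 1 ∨
      p.X c / 2 ^ (p.w - 1) = p.X a / 2 ^ (p.w - 1)) : ∃ q ∈ p.metas, p.Found q := by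
  have hsa := sign_lt hp (hp.hX a)
  have hsb := sign_lt hp (hp.hX b)
  have hS0 : 0 < 2 ^ p.s := Nat.two_pow_pos _
  -- Distinct indices differ in some bit, and that bit lies below the bit length `Lg`; it selects
  -- the class in which a and b go to different sides.
  obtain ⟨k, hk⟩ : ∃ k, a / 2 ^ k % 2 ≠ b / 2 ^ k % 2 := by
    by_contra! hcon
    refine hab (Nat.eq_of_testBit_eq fun i => ?_)
    rw [Nat.testBit_eq_decide_div_mod_eq, Nat.testBit_eq_decide_div_mod_eq, hcon i]
  have hkL : k < p.Lg := by
    by_contra hcon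
    have h1 := hp.hl
    have h2 : 2 ^ p.Lg ≤ 2 ^ k := Nat.pow_le_pow_right (by norm_num) (by omega)
    rw [Nat.div_eq_of_lt (by omega), Nat.div_eq_of_lt (by omega)] at hk
    exact hk rfl
  obtain ⟨sa, hsa'⟩ : ∃ sa, sa = p.X a / 2 ^ (p.w - 1) := ⟨_, rfl⟩
  obtain ⟨sb, hsb'⟩ : ∃ sb, sb = p.X b / 2 ^ (p.w - 1) := ⟨_, rfl⟩
  rw [← hsa'] at hsa hs
  rw [← hsb'] at hsb hs
  have hHa := H_div_lt hp (p.X a)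
  obtain ⟨e, he, hcar⟩ := exists_carry hp h
  obtain ⟨f, hf, hlo, hbuck⟩ := exists_carries p.Q_pos (H_lt hp _) (H_lt hp _) he hcar
  have hm2 : a / 2 ^ k % 2 < 2 := Nat.mod_lt _ (by norm_num)
  have hm2' : b / 2 ^ k % 2 < 2 := Nat.mod_lt _ (by norm_num)
  obtain ⟨ba, hba⟩ : ∃ ba, ba = a / 2 ^ k % 2 := ⟨_, rfl⟩
  obtain ⟨bb, hbb⟩ : ∃ bb, bb = b / 2 ^ k % 2 := ⟨_, rfl⟩
  rw [← hba] at hk hm2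
  rw [← hbb] at hk hm2'
  -- A key encodes the position of a bit, the value of this bit in the index, the sign, and the
  -- bucket.
  obtain ⟨key, hkey⟩ : ∃ key, key = (4 * k + (2 * ba + sa)) * 2 ^ p.s + p.H (p.X a) / p.Q := ⟨_, rfl⟩
  have hkd : key / 2 ^ p.s = 4 * k + (2 * ba + sa) := by
    rw [hkey, mul_comm, Nat.mul_add_div hS0, Nat.div_eq_of_lt hHa, add_zero]
  have hkm : key % 2 ^ p.s = p.H (p.X a) / p.Q := by
    rw [hkey, mul_comm, Nat.mul_add_mod, Nat.mod_eq_of_lt hHa]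
  have hd4 : key / 2 ^ p.s / 4 = k := by omega
  have hm4 : key / 2 ^ p.s % 4 = 2 * ba + sa := by omega
  have hK : key < p.NK := hkey ▸ mul_add_lt (by omega) hHa
  have hMa : p.Mem key a := ⟨ha0, by rw [hd4, hm4, hba, hsa'], hkm⟩
  have hent : p.lo a ∈ p.ent key p.l := mem_ent.2 ⟨a, ha, hMa, rfl⟩
  set j := (p.ent key p.l).idxOf (p.lo a) / p.T with hj
  have hjn : j < p.nc key := by
    have h1 := List.idxOf_lt_length_of_mem hent
    have hT := p.T_pos
    rw [nc, hj]
    refine (Nat.lt_iff_add_one_le).2 ((Nat.le_div_iff_mul_le hT).2 ?_)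
    have := Nat.div_mul_le_self ((p.ent key p.l).idxOf (p.lo a)) p.T
    generalize (p.ent key p.l).idxOf (p.lo a) / p.T = z at *
    rw [add_mul]; omega
  obtain ⟨ch, hch, hch'⟩ := List.getElem_of_mem (mem_chunks.2 ⟨hK, hjn⟩ : (key, j) ∈ p.chunks)
  have hget : p.chunks.getD ch (0, 0) = (key, j) := by rw [List.getD_eq_getElem _ _ hch, hch']
  -- The eight options are the sign of b and the two carries.
  obtain ⟨y, hy⟩ : ∃ y, y = sb + 2 * e + 4 * f := ⟨_, rfl⟩
  have hy1 : y % 2 = sb := by omega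
  have hy2 : y / 2 % 2 = e := by omega
  have hy3 : y / 4 = f := by omega
  set q : ℕ × ℕ × ℕ := (ch, c, y) with hq
  have hkq : p.keyOf q = key := by rw [keyOf, hq, hget]
  have hA : p.Admissible key c y := by
    rw [Admissible, hy1, hkd]
    rcases hs with hs | hs
    · left; omega
    · right; rw [hs]; omega
  have hqm : q ∈ p.metas := mem_metas.2 ⟨hch, hc, by change y < 8; omega, by rw [hkq]; exact hA⟩
  have hMb : p.Mem (p.keyB key c y) b := by
    refine ⟨hb0, ?_, by rw [keyB_mod, hkm, hy3]; exact hbuck⟩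
    rw [keyB_div, hd4, hm4, hy1, show (k * 4 + (2 - (2 * ba + sa) / 2 * 2 + sb)) / 4 = k by omega,
      ← hbb, ← hsb']
    omega
  refine ⟨q, hqm, p.lo a + p.shift c y / 2 ^ p.r * 2 ^ p.r, ?_, a, ?_, ?_⟩
  · rw [mem_answer hp hqm, hkq]
    refine ⟨p.lo a, hent, by rw [← hj, hq, hget], rfl, p.lo b, mem_ent.2 ⟨b, hb, hMb, rfl⟩, ?_⟩
    change p.lo a + p.lo b + y / 2 % 2 = p.lo c + y / 4 * p.Q
    rw [hy2, hy3]; exact hlo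
  · rw [mem_chain, hkq]
    exact ⟨ha, hMa, by simp [unshift, hq]⟩
  · exact good_of_add hp hinj (hkq ▸ hMa) ha hb (hkq ▸ hMb) (hkq ▸ hA) h

/-! ### The costs of the queries -/

/-- The cost of checking the answer of a query. -/
def queryCost (p : Par) (q : ℕ × ℕ × ℕ) : ℕ :=
  ∑ x ∈ p.sys.answer (p.queryOf q), (12 * (p.chain (p.keyOf q) (p.unshift q x) p.l).length + 6) + 8

/-- The number of elements reported and checked by mistake. -/
def chainSum (p : Par) (q : ℕ × ℕ × ℕ) : ℕ :=
  ∑ x ∈ p.sys.answer (p.queryOf q), (p.chain (p.keyOf q) (p.unshift q x) p.l).length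

/-- The hash values of a triple look like those of a witness, but the triple is none. -/
def Near (p : Par) (t : ℕ × ℕ × ℕ × ℕ) : Prop :=
  (p.H (p.X t.1) + p.H (p.X t.2.1) + t.2.2.2) % (2 ^ p.s * p.Q) = p.H (p.X t.2.2.1) ∧
    (p.X t.1 + p.X t.2.1) % 2 ^ p.w ≠ p.X t.2.2.1

instance (t : ℕ × ℕ × ℕ × ℕ) : Decidable (p.Near t) := by unfold Near; infer_instance

def nearSet (p : Par) : Finset (ℕ × ℕ × ℕ × ℕ) :=
  (Finset.range p.l ×ˢ Finset.range p.l ×ˢ Finset.range p.l ×ˢ Finset.range 2).filter p.Near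

theorem chain_nodup (p : Par) (key h n : ℕ) : (p.chain key h n).Nodup :=
  List.nodup_reverse.2 (List.nodup_range.filter _)

/-- A reported value comes from an entry, and an entry is there because some element has this hash
value; so no chain that is walked is empty. -/
theorem card_answer_le_chainSum (hp : p.Ok) {q : ℕ × ℕ × ℕ} (hq : q ∈ p.metas) :
    (p.sys.answer (p.queryOf q)).card ≤ p.chainSum q := by
  rw [chainSum, Finset.card_eq_sum_ones]
  refine Finset.sum_le_sum fun x hx => ?_
  obtain ⟨h, hh, -, rfl, -⟩ := (mem_answer hp hq).1 hx
  obtain ⟨i, hi, hM, rfl⟩ := mem_ent.1 hh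
  exact List.length_pos_of_mem (mem_chain.2 ⟨hi, hM, by simp [unshift]⟩)

theorem queryCost_le (hp : p.Ok) {q : ℕ × ℕ × ℕ} (hq : q ∈ p.metas) :
    p.queryCost q ≤ 18 * p.chainSum q + 8 := by
  have h := card_answer_le_chainSum hp hq
  rw [queryCost, Finset.sum_add_distrib, ← Finset.mul_sum, Finset.sum_const, smul_eq_mul]
  change 12 * p.chainSum q + _ + _ ≤ _
  omega

/-- Within one query, an element lies in the chain of one reported value only, namely its lower hash
half translated. So even the query that finds a witness costs no more than a scan of the input. -/
theorem chainSum_le_l (hp : p.Ok) {q : ℕ × ℕ × ℕ} (hq : q ∈ p.metas) : p.chainSum q ≤ p.l := by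
  have h1 : p.chainSum q = ((p.sys.answer (p.queryOf q)).sigma fun x =>
      (p.chain (p.keyOf q) (p.unshift q x) p.l).toFinset).card := by
    rw [Finset.card_sigma, chainSum]
    exact Finset.sum_congr rfl fun x _ => (List.toFinset_card_of_nodup (p.chain_nodup _ _ _)).symm
  rw [h1, ← Finset.card_range p.l]
  refine Finset.card_le_card_of_injOn (fun t => t.2) ?_ ?_
  · rintro ⟨x, a⟩ ht
    simp only [Finset.coe_sigma, Set.mem_sigma_iff, Finset.mem_coe, List.mem_toFinset, mem_chain] at ht
    simpa using ht.2.1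
  · rintro ⟨x, a⟩ ht ⟨x', a'⟩ ht' (rfl : a = a')
    simp only [Finset.coe_sigma, Set.mem_sigma_iff, Finset.mem_coe, List.mem_toFinset, mem_chain] at ht ht'
    have h2 := (unshift_of_mem_answer hp hq ht.1).1
    have h3 := (unshift_of_mem_answer hp hq ht'.1).1
    have h4 := ht.2.2.2
    have h5 := ht'.2.2.2
    unfold unshift at h4 h5
    obtain rfl : x = x' := by omega
    rfl

/-- This is what the chunks are for: the query that finds a witness cannot be charged to false
positives, and its output is limited by the size of a chunk. -/
theorem card_answer_le (p : Par) (hp : p.Ok) {q : ℕ × ℕ × ℕ} (hq : q ∈ p.metas) :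
    (p.sys.answer (p.queryOf q)).card ≤ p.T := by
  obtain ⟨hch, hi, hy, -⟩ := mem_metas.1 hq
  have hA : p.famA.getD (p.queryOf q).1 [] = p.setA (p.keyOf q) (p.chunks.getD q.1 (0, 0)).2
      (p.shift q.2.1 q.2.2 / 2 ^ p.r) := famA_getD hch (shift_div_lt hp)
  calc _ ≤ (p.famA.getD (p.queryOf q).1 []).toFinset.card := Finset.card_le_card Finset.inter_subset_left
    _ ≤ (p.famA.getD (p.queryOf q).1 []).length := List.toFinset_card_le _
    _ ≤ p.T := by rw [hA, setA, List.length_map, List.length_range]; exact min_le_left _ _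

open Classical in
/-- The queries that find no witness report few elements. -/
theorem sum_chainSum_le (hp : p.Ok) (hinj : ∀ i < p.l, ∀ j < p.l, p.X i = p.X j → i = j) :
    ∑ q ∈ p.metas.toFinset.filter fun q => ¬ p.Found q, p.chainSum q ≤
      8 * p.Lg * p.nearSet.card := by
  set S := (p.metas.toFinset.filter fun q => ¬ p.Found q).sigma fun q =>
    (p.sys.answer (p.queryOf q)).sigma fun x =>
      (p.chain (p.keyOf q) (p.unshift q x) p.l).toFinset with hS
  have h1 : ∑ q ∈ p.metas.toFinset.filter fun q => ¬ p.Found q, p.chainSum q = S.card := by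
    rw [Finset.card_sigma]
    refine Finset.sum_congr rfl fun q _ => ?_
    rw [Finset.card_sigma, chainSum]
    exact Finset.sum_congr rfl fun x _ => (List.toFinset_card_of_nodup (p.chain_nodup _ _ _)).symm
  have mem : ∀ t ∈ S, t.1 ∈ p.metas ∧ ¬ p.Found t.1 ∧
      t.2.1 ∈ p.sys.answer (p.queryOf t.1) ∧ t.2.2 < p.l ∧ p.Mem (p.keyOf t.1) t.2.2 ∧
      p.lo t.2.2 = p.unshift t.1 t.2.1 ∧
      t.2.2 ∈ p.chain (p.keyOf t.1) (p.unshift t.1 t.2.1) p.l := by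
    rintro ⟨q, x, a⟩ ht
    simp only [hS, Finset.mem_sigma, Finset.mem_filter, List.mem_toFinset] at ht
    have := mem_chain.1 ht.2.2
    exact ⟨ht.1.1, ht.1.2, ht.2.1, this.1, this.2.1, this.2.2, ht.2.2⟩
  -- A reported value proves that the partner key has a matching entry, and an entry stems from an
  -- element. One such b is chosen for each reported value and chain element.
  have exB : ∀ t : (_ : ℕ × ℕ × ℕ) × (_ : ℕ) × ℕ, ∃ b, t ∈ S → b < p.l ∧
      p.Mem (p.keyB (p.keyOf t.1) t.1.2.1 t.1.2.2) b ∧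
      p.lo t.2.2 + p.lo b + t.1.2.2 / 2 % 2 = p.lo t.1.2.1 + t.1.2.2 / 4 * p.Q := by
    intro t
    by_cases ht : t ∈ S
    · obtain ⟨hq, -, hx, -, -, hlo, -⟩ := mem t ht
      obtain ⟨h, hh, -, hxe, h', hh', hsum⟩ := (mem_answer hp hq).1 hx
      obtain ⟨b, hb, hM, rfl⟩ := mem_ent.1 hh'
      refine ⟨b, fun _ => ⟨hb, hM, ?_⟩⟩
      rw [hlo, hxe, unshift, Nat.add_sub_cancel]
      exact hsum
    · exact ⟨0, fun h => absurd h ht⟩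
  choose B hB using exB
  have h2 : 8 * p.Lg * p.nearSet.card = (Finset.range p.Lg ×ˢ Finset.range 8 ×ˢ p.nearSet).card := by
    simp only [Finset.card_product, Finset.card_range]; ring
  rw [h1, h2]
  -- The target counts near triples with multiplicity 8·`Lg`, for the option y and the bit position.
  -- The element b is not needed for injectivity: a with the bit position gives the key, its lower
  -- hash half gives the chunk and the reported value, and c and y complete the query.
  refine Finset.card_le_card_of_injOn
    (fun t => (p.keyOf t.1 / 2 ^ p.s / 4, t.1.2.2, (t.2.2, B t, t.1.2.1, t.1.2.2 / 2 % 2))) ?_ ?_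
  · intro t ht
    obtain ⟨hq, hnf, hx, hal, hM, hlo, hch⟩ := mem t ht
    obtain ⟨hbl, hMb, hsum⟩ := hB t ht
    obtain ⟨-, hc, hy, hA⟩ := mem_metas.1 hq
    have hK := keyOf_lt hq
    have hk : p.keyOf t.1 / 2 ^ p.s < 4 * p.Lg := Nat.div_lt_of_lt_mul (by rwa [NK, mul_comm] at hK)
    simp only [Finset.coe_product, Set.mem_prod, Finset.mem_coe, Finset.mem_range, nearSet,
      Finset.mem_filter, Finset.mem_product]
    refine ⟨by omega, hy, ⟨hal, hbl, hc, Nat.mod_lt _ (by norm_num)⟩, ?_, fun hadd => ?_⟩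
    · refine mod_eq_of_carries (H_lt hp _) (H_lt hp _) (f := t.1.2.2 / 4) (by omega) hsum ?_
      have := hMb.2.2
      rw [keyB_mod, hM.2.2] at this
      exact this
    -- If the elements did add up, the query would have found a witness.
    · exact hnf ⟨_, hx, _, hch, good_of_add hp hinj hM hal hbl hMb hA hadd⟩
  · intro t ht t' ht' heq
    obtain ⟨hq, -, hx, -, hM, hlo, -⟩ := mem t ht
    obtain ⟨hq', -, hx', -, hM', hlo', -⟩ := mem t' ht'
    simp only [Prod.mk.injEq] at heq
    obtain ⟨hk, hy, ha, -, hc, -⟩ := heq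
    have hkey : p.keyOf t.1 = p.keyOf t'.1 := by
      have h3 := hM.2.1
      have h4 := hM'.2.1
      have h5 := hM.2.2
      have h6 := hM'.2.2
      rw [← ha] at h4 h6
      rw [← hk] at h4
      have h7 := Nat.div_add_mod (p.keyOf t.1 / 2 ^ p.s) 4
      have h8 := Nat.div_add_mod (p.keyOf t'.1 / 2 ^ p.s) 4
      have h9 : p.keyOf t.1 / 2 ^ p.s = p.keyOf t'.1 / 2 ^ p.s := by omega
      rw [← Nat.div_add_mod (p.keyOf t.1) (2 ^ p.s), ← Nat.div_add_mod (p.keyOf t'.1) (2 ^ p.s),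
        h5, h6, h9]
    have chunk : ∀ t ∈ S, (p.chunks.getD t.1.1 (0, 0)).2 =
        (p.ent (p.keyOf t.1) p.l).idxOf (p.lo t.2.2) / p.T := by
      intro t ht
      obtain ⟨hq, -, hx, -, hM, hlo, -⟩ := mem t ht
      obtain ⟨h, hh, hj, hxe, -⟩ := (mem_answer hp hq).1 hx
      rw [← hj, hlo, hxe, unshift, Nat.add_sub_cancel]
    have hch : t.1.1 = t'.1.1 := by
      have h3 := (mem_metas.1 hq).1
      have h4 := (mem_metas.1 hq').1
      have h5 : p.chunks.getD t.1.1 (0, 0) = p.chunks.getD t'.1.1 (0, 0) :=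
        Prod.ext hkey (by rw [chunk t ht, chunk t' ht', hkey, ha])
      rw [List.getD_eq_getElem _ _ h3, List.getD_eq_getElem _ _ h4] at h5
      exact p.chunks_nodup.getElem_inj_iff.1 h5
    have hq1 : t.1 = t'.1 := Prod.ext hch (Prod.ext hc hy)
    have hx1 : t.2.1 = t'.2.1 := by
      have h3 := (unshift_of_mem_answer hp hq hx).1
      have h4 := (unshift_of_mem_answer hp hq' hx').1
      rw [ha, hlo'] at hlo
      unfold unshift at hlo
      rw [hq1] at hlo h3
      omega
    obtain ⟨q, x, a⟩ := t
    obtain ⟨q', x', a'⟩ := t'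
    simp only at hq1 hx1 ha
    subst hq1 hx1 ha
    rfl

end Par

end Reduction

/-! ### Witnesses and queries -/

namespace ThreeSum

theorem encode_cast (w : ℕ) (a : ℤ) : (encode w a : ℤ) = a % 2 ^ w :=
  Int.toNat_of_nonneg (Int.emod_nonneg _ (by positivity))

theorem encode_lt (w : ℕ) (a : ℤ) : encode w a < 2 ^ w := by
  have : (encode w a : ℤ) < 2 ^ w := by
    rw [encode_cast]; exact Int.emod_lt_of_pos _ (by positivity)
  exact_mod_cast this

/-- The leading bit is the sign. The lemma serves to translate the program's test for overflow into
inequalities between integers. -/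
theorem encode_div {w : ℕ} (hw : w ≠ 0) {a : ℤ} (h : -(2 : ℤ) ^ w ≤ 2 * a) (h' : 2 * a < (2 : ℤ) ^ w) :
    (a < 0 → (encode w a : ℤ) = a + 2 ^ w ∧ encode w a / 2 ^ (w - 1) = 1) ∧
    (0 ≤ a → (encode w a : ℤ) = a ∧ encode w a / 2 ^ (w - 1) = 0) := by
  obtain ⟨k, rfl⟩ := Nat.exists_eq_succ_of_ne_zero hw
  have hk : (2 : ℤ) ^ (k + 1) = 2 * 2 ^ k := by ring
  have hpos : (0 : ℤ) < 2 ^ k := by positivity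
  have hc := encode_cast (k + 1) a
  simp only [Nat.succ_eq_add_one, Nat.add_sub_cancel] at *
  constructor
  · intro ha
    have h1 : (encode (k + 1) a : ℤ) = a + 2 ^ (k + 1) := by
      rw [hc, ← Int.add_emod_right]
      exact Int.emod_eq_of_lt (by omega) (by omega)
    refine ⟨h1, ?_⟩
    have h2 : 2 ^ k ≤ encode (k + 1) a := by zify; omega
    have h3 : encode (k + 1) a < 2 * 2 ^ k := by zify; omega
    exact Nat.div_eq_of_lt_le (by omega) (by omega)
  · intro ha
    have h1 : (encode (k + 1) a : ℤ) = a := by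
      rw [hc]
      exact Int.emod_eq_of_lt (by omega) (by omega)
    exact ⟨h1, Nat.div_eq_of_lt (by zify; omega)⟩

end ThreeSum

namespace Reduction

open WordRAM SetIntersection ThreeSum

namespace Par
variable {p : Par}

/-- The elements of the list are the elements of the reduction. -/
structure Input (p : Par) (A : List ℤ) : Prop where
  inst : ThreeSum.IsInstance A.length p.w A
  len : p.l = A.length
  X : p.X = fun i => (A.map (encode p.w)).getD i 0

theorem Input.X_eq {A : List ℤ} (h : p.Input A) {i : ℕ} (hi : i < A.length) :
    p.X i = encode p.w A[i] := by
  rw [h.X]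
  change (A.map (encode p.w)).getD i 0 = _
  rw [List.getD_eq_getElem _ _ (by simpa using hi), List.getElem_map]

theorem Input.encode_div {A : List ℤ} (h : p.Input A) (hp : p.Ok) {i : ℕ} (hi : i < A.length) :
    (A[i] < 0 → (p.X i : ℤ) = A[i] + 2 ^ p.w ∧ p.X i / 2 ^ (p.w - 1) = 1) ∧
    (0 ≤ A[i] → (p.X i : ℤ) = A[i] ∧ p.X i / 2 ^ (p.w - 1) = 0) := by
  rw [h.X_eq hi]
  obtain ⟨h1, h2⟩ := h.inst.2.2 A[i] (List.getElem_mem hi)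
  exact ThreeSum.encode_div hp.hw h1 h2

theorem Input.inj {A : List ℤ} (h : p.Input A) (hp : p.Ok) {i : ℕ} (hi : i < p.l) {j : ℕ} (hj : j < p.l)
    (hij : p.X i = p.X j) : i = j := by
  rw [h.len] at hi hj
  obtain ⟨h1, h2⟩ := h.encode_div hp hi
  obtain ⟨h3, h4⟩ := h.encode_div hp hj
  have h5 := h.inst.2.2 A[i] (List.getElem_mem hi)
  have h6 := h.inst.2.2 A[j] (List.getElem_mem hj)
  refine h.inst.1.getElem_inj_iff.1 (?_ : A[i] = A[j])
  rcases lt_or_ge A[i] 0 with ha | ha <;> rcases lt_or_ge A[j] 0 with hb | hb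
  · have := (h1 ha).1; have := (h3 hb).1; omega
  · have := (h1 ha).2; have := (h4 hb).2; omega
  · have := (h2 ha).2; have := (h3 hb).2; omega
  · have := (h2 ha).1; have := (h4 hb).1; omega

theorem Input.add_iff {A : List ℤ} (h : p.Input A) {a b c : ℕ} (ha : a < A.length)
    (hb : b < A.length) (hc : c < A.length) :
    (p.X a + p.X b) % 2 ^ p.w = p.X c ↔ (2 : ℤ) ^ p.w ∣ A[a] + A[b] - A[c] := by
  rw [h.X_eq ha, h.X_eq hb, h.X_eq hc, Int.dvd_iff_emod_eq_zero, ← Int.emod_eq_emod_iff_emod_sub_eq_zero,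
    Int.add_emod, ← encode_cast p.w A[a], ← encode_cast p.w A[b], ← encode_cast p.w A[c]]
  norm_cast

theorem Input.hasWitness_iff {A : List ℤ} (h : p.Input A) (hp : p.Ok) :
    HasWitness A ↔ ∃ q ∈ p.metas, p.Found q := by
  constructor
  · rintro ⟨a, ha, b, hb, c, hc, hab, hac, hbc, hsum⟩
    obtain ⟨i, hi, rfl⟩ := List.getElem_of_mem ha
    obtain ⟨j, hj, rfl⟩ := List.getElem_of_mem hb
    obtain ⟨k, hk, rfl⟩ := List.getElem_of_mem hc
    obtain ⟨h1, h2⟩ := h.encode_div hp hi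
    obtain ⟨h3, h4⟩ := h.encode_div hp hj
    obtain ⟨h5, h6⟩ := h.encode_div hp hk
    have hi' := h.inst.2.2 A[i] ha
    have hj' := h.inst.2.2 A[j] hb
    have hl := h.len
    refine exists_found hp (a := i) (b := j) (c := k) (by omega) (by omega) (by omega)
      (by rintro rfl; exact hab rfl) ?_ ?_ ((h.add_iff hi hj hk).2 (by rw [hsum]; simp))
      (fun x hx y hy => h.inj hp hx hy) ?_
    -- No summand of a witness is 0, for otherwise the other summand would equal the sum. This is
    -- why the keys may disregard 0.
    · rcases lt_or_ge A[i] 0 with ha | ha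
      · have := (h1 ha).1; omega
      · have := (h2 ha).1; omega
    · rcases lt_or_ge A[j] 0 with ha | ha
      · have := (h3 ha).1; omega
      · have := (h4 ha).1; omega
    -- Opposite signs of the summands satisfy the first alternative; equal signs force the sign of
    -- the sum, which is the second.
    · rcases lt_or_ge A[i] 0 with ha | ha <;> rcases lt_or_ge A[j] 0 with hb | hb
      · rw [(h1 ha).2, (h5 (by omega)).2]; simp
      · rw [(h1 ha).2, (h4 hb).2]; simp
      · rw [(h2 ha).2, (h3 hb).2]; simp
      · rw [(h2 ha).2, (h6 (by omega)).2]; simp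
  · rintro ⟨q, hq, x, hx, i, hi, ⟨j, hj, hXj⟩, hne, h0, hs⟩
    obtain ⟨hi, hM, -⟩ := mem_chain.1 hi
    have hk := (mem_metas.1 hq).2.1
    have hadd := add_other (q := q) (a := i) hp.hX
    set k := q.2.1
    rw [← hXj] at hne h0 hs hadd
    rw [h.len] at hi hj hk
    rw [h.add_iff hi hj hk] at hadd
    obtain ⟨h1, h2⟩ := h.encode_div hp hi
    obtain ⟨h3, h4⟩ := h.encode_div hp hj
    obtain ⟨h5, h6⟩ := h.encode_div hp hk
    have hi' := h.inst.2.2 A[i] (List.getElem_mem hi)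
    have hj' := h.inst.2.2 A[j] (List.getElem_mem hj)
    have hk' := h.inst.2.2 A[k] (List.getElem_mem hk)
    have hM0 := hM.1
    have hi0 : A[i] ≠ 0 := fun h => by have := (h2 h.ge).1; omega
    have hj0 : A[j] ≠ 0 := fun h => by have := (h4 h.ge).1; omega
    have hij : A[i] ≠ A[j] := fun hij => hne (by
      have : i = j := h.inst.1.getElem_inj_iff.1 hij
      rw [this])
    -- The number is divisible by 2^w. It is smaller than 2^w in absolute value, either because the
    -- summands have opposite signs or because the sum shares their sign.
    have hsum : A[i] + A[j] - A[k] = 0 := by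
      refine Int.eq_zero_of_abs_lt_dvd hadd (abs_lt.2 ?_)
      rcases lt_or_ge A[i] 0 with ha | ha <;> rcases lt_or_ge A[j] 0 with hb | hb
      · rcases lt_or_ge A[k] 0 with hc | hc
        · omega
        · rw [(h1 ha).2, (h3 hb).2, (h6 hc).2] at hs; omega
      · omega
      · omega
      · rcases lt_or_ge A[k] 0 with hc | hc
        · rw [(h2 ha).2, (h4 hb).2, (h5 hc).2] at hs; omega
        · omega
    exact ⟨A[i], List.getElem_mem hi, A[j], List.getElem_mem hj, A[k], List.getElem_mem hk, hij,
      by omega, by omega, by omega⟩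

end Par

end Reduction

namespace Reduction

open WordRAM SetIntersection Par Ex Stm

/-! ### The main loop -/

/-- Pass the query number `r₁₁` to the data structure. -/
def ask : Stm := .seq (asg 100 (ld 7 (v 11))) (asg 101 (ld 8 (v 11)))

/-- Ask queries until a witness has been found. -/
def mainLoop (D : DataStructure) : Cmd :=
  .loop 52 (.seq ask.comp (.seq D.query.embed check.comp))

/-- Return the answer. -/
def answer : Stm := asg 0 (v 25)

open Classical in
/-- The number of queries that are asked. -/
noncomputable def Par.numAsked (p : Par) : ℕ :=
  if h : ∃ j, ∃ hj : j < p.metas.length, p.Found p.metas[j] then Nat.find h + 1 else p.metas.length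

theorem Par.numAsked_le (p : Par) : p.numAsked ≤ p.metas.length := by
  classical
  unfold numAsked
  split_ifs with h
  · exact (Nat.find_spec h).1
  · exact le_rfl

theorem Par.not_found_of_lt_numAsked {p : Par} {j : ℕ} (hj : j < p.metas.length) (h : j + 1 < p.numAsked) :
    ¬ p.Found p.metas[j] := by
  classical
  unfold numAsked at h
  split_ifs at h with h'
  · intro hf
    exact Nat.find_min h' (show j < Nat.find h' by omega) ⟨hj, hf⟩
  · exact fun hf => h' ⟨j, hj, hf⟩

theorem Par.found_numAsked {p : Par} (h : ∃ q ∈ p.metas, p.Found q) :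
    ∃ j, ∃ hj : j < p.metas.length, p.numAsked = j + 1 ∧ p.Found p.metas[j] := by
  classical
  obtain ⟨q, hq, hf⟩ := h
  obtain ⟨j, hj, rfl⟩ := List.getElem_of_mem hq
  have h' : ∃ j, ∃ hj : j < p.metas.length, p.Found p.metas[j] := ⟨j, hj, hf⟩
  refine ⟨Nat.find h', (Nat.find_spec h').1, ?_, (Nat.find_spec h').2⟩
  rw [numAsked, dif_pos h']

theorem Par.numAsked_of_not_found {p : Par} (h : ¬ ∃ q ∈ p.metas, p.Found q) :
    p.numAsked = p.metas.length := by
  rw [numAsked, dif_neg]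
  rintro ⟨j, hj, hf⟩
  exact h ⟨_, List.getElem_mem hj, hf⟩

/-- What holds before the query number `j`. -/
structure LoopInv (p : Par) (j : ℕ) (σ : State) : Prop where
  ready : Ready p σ
  idx : σ.reg 11 = j
  done : j = p.numAsked → (∃ q ∈ p.metas, p.Found q) → σ.reg 25 = 1 ∧ σ.reg 26 = 0
  running : ¬ (j = p.numAsked ∧ ∃ q ∈ p.metas, p.Found q) →
    σ.reg 25 = 0 ∧ σ.reg 26 = p.metas.length - j

/-- The commands for a query. -/
def queryCmds (D : DataStructure) (q : ℕ × ℕ) : List Cmd := [.const 0 q.1, .const 1 q.2, D.query]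

theorem session_append (D : DataStructure) (l : List (ℕ × ℕ)) (q : ℕ × ℕ) :
    D.session (l ++ [q]) = D.session l ++ queryCmds D q := by
  simp [DataStructure.session, queryCmds]

/-- A factor between costs and numbers of steps. -/
def factor : ℕ := (ask.width + 1) * 3 + (check.width + 1) + (answer.width + 1) + 10

theorem inner_of_abs {s : State} {σ : State} (h : s.abs = σ) :
    s.inner = ⟨fun r => σ.reg (100 + r), fun a => σ.mem (50 + a)⟩ := by subst h; rfl

theorem sum_map_range (f : ℕ → ℕ) (N : ℕ) :
    ((List.range N).map f).sum = ∑ i ∈ Finset.range N, f i := by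
  induction N with
  | zero => simp
  | succ N ih => rw [List.range_succ, List.map_append, List.sum_append, ih, Finset.sum_range_succ]; simp

theorem expectedTime_const (w d c : ℕ) (k : List Cmd) (s : State) :
    expectedTime w ⟨.const d c :: k, s⟩ = 1 + expectedTime w ⟨k, s.setReg d (c % 2 ^ w)⟩ := by
  rw [expectedTime_step w (by simp [Config.Halted])]
  simp only [stepWith]
  rw [avg_const]

theorem finalState_const {w d c : ℕ} {k : List Cmd} {s s' : State}
    (h : FinalState w ⟨k, s.setReg d (c % 2 ^ w)⟩ s') : FinalState w ⟨.const d c :: k, s⟩ s' := by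
  rw [finalState_iff] at *
  exact .head ⟨by simp, 0, Nat.two_pow_pos _, rfl⟩ h

/-- The data structure answers the queries of the reduction correctly. -/
def Correct (p : Par) (D : DataStructure) : Prop :=
  ∀ l, l <+: p.metas → ∀ s, FinalState p.w ⟨D.session (l.map p.queryOf), p.sys.initState⟩ s →
    ∀ q ∈ (l.map p.queryOf).getLast?, (reported s).Nodup ∧ (reported s).toFinset = p.sys.answer q

/-- The loop is adaptive, the guarantee of the structure is not. But every possible run of a correct
structure reports the same set, so the decision to stop, hence the whole sequence of queries, is a
function of `p`. The induction is on the number of queries still to be asked; the remaining session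
enters the budget as an expected time from the current inner state, so that at the start it is the
expected time of one fixed session. -/
theorem spec_mainLoop {p : Par} (hp : p.Ok) {D : DataStructure} (hD : Correct p D) :
    ∀ (m j : ℕ), j + m = p.numAsked → ∀ s : State, s.WF p.w → LoopInv p j s.abs →
      FinalState p.w ⟨D.session ((p.metas.take j).map p.queryOf), p.sys.initState⟩ s.inner →
      Spec p.w ⟨[mainLoop D, answer.comp], s⟩
        ((factor * ((((p.metas.take p.numAsked).drop j).map fun q => p.queryCost q + 1).sum + 1) : ℕ) +
          expectedTime p.w ⟨((p.metas.take p.numAsked).drop j).flatMap fun q =>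
            queryCmds D (p.queryOf q), s.inner⟩)
        (fun s => s.reg 0 ≠ 0 ↔ ∃ q ∈ p.metas, p.Found q) := by
  intro m
  induction m with
  | zero =>
    intro j hj s hs hI hF
    obtain rfl : j = p.numAsked := by omega
    have h26 : s.reg 52 = 0 ∧ (s.abs.reg 25 ≠ 0 ↔ ∃ q ∈ p.metas, p.Found q) := by
      by_cases h : ∃ q ∈ p.metas, p.Found q
      · obtain ⟨h1, h2⟩ := hI.done rfl h
        exact ⟨h2, by simp [h1, h]⟩
      · obtain ⟨h1, h2⟩ := hI.running fun h' => h h'.2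
        rw [p.numAsked_of_not_found h, Nat.sub_self] at h2
        exact ⟨h2, by simp [h1, h]⟩
    have hd : Det p.w 1 ⟨[mainLoop D, answer.comp], s⟩ ⟨[answer.comp], s⟩ :=
      .one (by simp) fun x => by simp only [mainLoop, stepWith, h26.1]; simp
    have hb : Big p.w answer s.abs (s.abs.setReg 0 (s.abs.reg 25)) 1 := .asg' rfl
    refine (Spec.det hd (Spec.big hb hs rfl (k := []) (B := 0) fun s' hs' ha => Spec.halted ?_)).mono ?_
    · have : s'.reg 0 = s.abs.reg 25 := by
        change s'.abs.reg 0 = _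
        rw [ha]; simp [reg_setReg]
      rw [this]; exact h26.2
    · refine le_add_right ?_
      have : 1 + ((answer.width + 1) * 1 + 0) ≤
          factor * ((((p.metas.take p.numAsked).drop p.numAsked).map fun q => p.queryCost q + 1).sum + 1) := by
        refine le_trans ?_ (Nat.le_mul_of_pos_right _ (by omega))
        unfold factor; omega
      exact_mod_cast this
  | succ m ih =>
    intro j hj s hs hI hF
    have hnum := p.numAsked_le
    have hjm : j < p.metas.length := by omega
    obtain ⟨h25, h26⟩ := hI.running (by omega)
    set q := p.metas[j] with hq
    have hqm : q ∈ p.metas := List.getElem_mem hjm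
    have hdrop : (p.metas.take p.numAsked).drop j = q :: (p.metas.take p.numAsked).drop (j + 1) := by
      rw [List.drop_eq_getElem_cons (by rw [List.length_take]; omega), List.getElem_take]
    have htake : p.metas.take (j + 1) = p.metas.take j ++ [q] := by
      rw [List.take_succ_eq_append_getElem hjm]
    have hsl := hp.sets_length_lt
    have hq1 : (p.queryOf q).1 < 2 ^ p.w := by
      have := queryOf_fst_lt hp hqm; rw [famA_length] at this; omega
    have hq2 : (p.queryOf q).2 < 2 ^ p.w := by
      have := queryOf_snd_lt hqm; rw [famB_length] at this; omega
    set loop := mainLoop D with hloop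
    have hd : Det p.w 2 ⟨[loop, answer.comp], s⟩
        ⟨[ask.comp, .seq D.query.embed check.comp, loop, answer.comp], s⟩ := by
      -- Machine register 52 carries variable 26, the number of queries left.
      have h52 : s.reg 52 ≠ 0 := by change s.abs.reg 26 ≠ 0; omega
      refine (Det.one (c' := ⟨[.seq ask.comp (.seq D.query.embed check.comp), loop, answer.comp], s⟩)
        (by simp) fun x => ?_).trans (Det.one (by simp) fun x => rfl)
      simp only [hloop, mainLoop, stepWith, if_pos h52]
    set σ₁ := (s.abs.setReg 100 (p.queryOf q).1).setReg 101 (p.queryOf q).2 with hσ₁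
    have b1 : Big p.w ask s.abs σ₁ 3 := by
      refine .seq (.asg' (eval_ld (eval_v hI.idx) ?_)) (.asg' (eval_ld (i := j) (eval_v ?_) ?_))
      · rw [hI.ready.queried.a, getD_map_of_lt hjm]
      · simp [reg_setReg, hI.idx]
      · rw [mem_setReg, hI.ready.queried.b, getD_map_of_lt hjm]
    set B := (factor * ((((p.metas.take p.numAsked).drop (j + 1)).map fun q => p.queryCost q + 1).sum + 1) : ℕ)
      with hB
    set rest := ((p.metas.take p.numAsked).drop (j + 1)).flatMap fun q => queryCmds D (p.queryOf q)
      with hrest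
    have main : Spec p.w ⟨[loop, answer.comp], s⟩ ((2 : ℕ) + (((ask.width + 1) * 3 : ℕ) + ((1 : ℕ) +
        ((((check.width + 1) * p.queryCost q : ℕ) + (B : ℝ≥0∞)) +
        expectedTime p.w ⟨[D.query] ++ rest, (s.inner.setReg 0 (p.queryOf q).1).setReg 1 (p.queryOf q).2⟩))))
        (fun s => s.reg 0 ≠ 0 ↔ ∃ q ∈ p.metas, p.Found q) := by
      refine Spec.det hd (Spec.big b1 hs rfl fun s₁ hs₁ ha₁ => ?_)
      have hin₁ : s₁.inner = (s.inner.setReg 0 (p.queryOf q).1).setReg 1 (p.queryOf q).2 := by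
        rw [inner_of_abs ha₁]
        simp only [State.inner, State.setReg, hσ₁, State.mk.injEq]
        refine ⟨?_, rfl⟩
        funext r
        simp only [Function.update_apply]
        rcases r with _ | _ | r
        all_goals simp
        all_goals omega
      refine Spec.det (.one (c' := ⟨[D.query].map Cmd.embed ++ [check.comp, loop, answer.comp], s₁⟩)
        (by simp) fun x => rfl) ?_
      rw [← hin₁]
      refine Spec.embed hs₁ fun s₂ hs₂ hF₂ hO₂ => ?_
      -- The inner state is a possible outcome of the session with one more query, so the
      -- correctness of the structure applies to what it has just reported.
      have hF₂' : FinalState p.w ⟨D.session ((p.metas.take (j + 1)).map p.queryOf), p.sys.initState⟩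
          s₂.inner := by
        rw [htake, List.map_append, List.map_singleton, session_append]
        refine hF.append (finalState_const (finalState_const ?_))
        rw [Nat.mod_eq_of_lt hq1, Nat.mod_eq_of_lt hq2, ← hin₁]
        exact hF₂
      obtain ⟨hnd, hrep⟩ := hD _ (List.take_prefix _ _) _ hF₂' (p.queryOf q)
        (by rw [htake]; simp)
      set N := s₂.abs.reg 100 with hN
      set R := s₂.abs.mem 52 with hR
      have hrep' : reported s₂.inner = (List.range N).map R := rfl
      rw [hrep'] at hnd hrep
      have hmemR : ∀ x, x ∈ p.sys.answer (p.queryOf q) ↔ ∃ i < N, R i = x := by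
        intro x; rw [← hrep]; simp
      have hRd₂ : Ready p s₂.abs := (hI.ready.frame b1.frame (by decide) (by decide)).congr
        (fun r hr => by
          rw [← ha₁]; exact hO₂.1 r (by simp at hr; omega))
        (fun a ha => by rw [← ha₁]; exact hO₂.2 a (by omega))
      have hreg₂ : ∀ r < 100, s₂.abs.reg r = s.abs.reg r := fun r hr => by
        rw [hO₂.1 r hr, ha₁, hσ₁, reg_setReg, if_neg (by omega), reg_setReg, if_neg (by omega)]
      obtain ⟨σ₃, t₃, b3, ht₃, hRd₃, h11₃, hpos, hneg⟩ := big_check hp hjm (keyOf_lt hqm) hRd₂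
        (N := N) (hs₂.1 200) hN.symm ((hreg₂ 11 (by norm_num)).trans hI.idx) hR.symm
        ((hreg₂ 25 (by norm_num)).trans h25) ((hreg₂ 26 (by norm_num)).trans h26)
        (fun i hi => unshift_of_mem_answer hp hqm ((hmemR _).2 ⟨i, hi, rfl⟩))
      have hfound : p.Found q ↔ ∃ i < N, ∃ a ∈ p.chain (p.keyOf q) (p.unshift q (R i)) p.l,
          p.Good q a := by
        constructor
        · rintro ⟨x, hx, a, ha, hG⟩
          obtain ⟨i, hi, rfl⟩ := (hmemR x).1 hx
          exact ⟨i, hi, a, ha, hG⟩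
        · rintro ⟨i, hi, a, ha, hG⟩
          exact ⟨R i, (hmemR _).2 ⟨i, hi, rfl⟩, a, ha, hG⟩
      rw [← hq, ← hfound] at hpos hneg
      -- The order of the report is unknown, but it lists the answer without repetition, so the sum
      -- over its positions is the sum over the answer.
      have ht₃' : t₃ ≤ p.queryCost q := by
        refine ht₃.trans (le_of_eq ?_)
        rw [queryCost, ← hrep, List.sum_toFinset _ hnd, List.map_map, sum_map_range]
        rfl
      have hI₃ : LoopInv p (j + 1) σ₃ := by
        refine ⟨hRd₃, h11₃, fun h hex => hpos ?_, fun h => hneg fun hf => h ⟨?_, _, hqm, hf⟩⟩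
        · obtain ⟨j', hj', hst, hf⟩ := found_numAsked hex
          obtain rfl : j' = j := by omega
          exact hf
        · by_contra hne
          exact not_found_of_lt_numAsked hjm (by omega) hf
      refine (Spec.big b3 hs₂ rfl (B := B + expectedTime p.w ⟨rest, s₂.inner⟩) fun s₃ hs₃ ha₃ => ?_).mono ?_
      · have hin₃ : s₃.inner = s₂.inner := by
          rw [inner_of_abs ha₃, inner_of_abs (rfl : s₂.abs = _), State.mk.injEq]
          constructor
          · funext r
            rw [b3.frame.reg _ fun h => by
              have : ∀ r ∈ check.regs, r < 100 := by decide
              exact absurd (this _ h) (by omega)]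
          · funext a
            rw [b3.frame.mem _ fun h => by
              have : ∀ r ∈ check.arrs, r < 50 := by decide
              exact absurd (this _ h) (by omega)]
        rw [← hin₃]
        exact ih (j + 1) (by omega) s₃ hs₃ (ha₃ ▸ hI₃) (hin₃ ▸ hF₂')
      · rw [add_assoc]
        gcongr
    refine main.mono ?_
    rw [hdrop, List.flatMap_cons, ← hrest]
    simp only [queryCmds, List.cons_append, List.nil_append, expectedTime_const,
      Nat.mod_eq_of_lt hq1, Nat.mod_eq_of_lt hq2, List.map_cons, List.sum_cons]
    have hc : 2 + ((ask.width + 1) * 3 + (1 + ((check.width + 1) * p.queryCost q + B))) ≤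
        factor * (p.queryCost q + 1 +
          (((p.metas.take p.numAsked).drop (j + 1)).map fun q => p.queryCost q + 1).sum + 1) := by
      have : (check.width + 1) * p.queryCost q + ((ask.width + 1) * 3 + 3) ≤
          factor * (p.queryCost q + 1) := by
        rw [mul_add, mul_one]
        refine Nat.add_le_add (Nat.mul_le_mul_right _ ?_) ?_ <;> unfold factor <;> omega
      rw [hB]
      have h2 : ∀ S : ℕ, factor * (p.queryCost q + 1 + S + 1) =
          factor * (p.queryCost q + 1) + factor * (S + 1) := fun S => by ring
      rw [h2]
      omega
    calc _ = ((2 + ((ask.width + 1) * 3 + (1 + ((check.width + 1) * p.queryCost q + B))) : ℕ) : ℝ≥0∞) +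
          expectedTime p.w ⟨D.query :: rest,
            (s.inner.setReg 0 (p.queryOf q).1).setReg 1 (p.queryOf q).2⟩ := by
          push_cast; ring
      _ ≤ _ := by
          refine add_le_add (by exact_mod_cast hc) ?_
          rw [← add_assoc]
          exact le_add_left le_rfl

end Reduction

namespace Reduction

open WordRAM SetIntersection Par Ex Stm

/-! ### The whole program -/

/-- Solve 3SUM with the help of a data structure for SetIntersection. -/
def program (D : DataStructure) (p₁ p₂ d : ℕ) : Cmd :=
  .seq (setUp p₁ p₂ d).comp <| .seq (.rand 2) <| .seq prepare.comp <| .seq D.pre.embed <|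
    .seq (mainLoop D) answer.comp

theorem Par.Ok.with_alpha {p : Par} (h : p.Ok) {a : ℕ} (ha : a < 2 ^ p.w) : Ok { p with α := a } where
  hw := h.hw
  hα := ha
  hX := h.hX
  hl := h.hl
  hLg := h.hLg
  hr := h.hr
  hm := h.hm
  hbig := h.hbig

theorem setUp_regs (p₁ p₂ d : ℕ) : (setUp p₁ p₂ d).regs =
    [2, 2, 24, 25, 3, 4, 5, 6, 7, 8, 9, 10, 11, 11] := rfl

theorem setUp_arrs (p₁ p₂ d : ℕ) : (setUp p₁ p₂ d).arrs = [1] := rfl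

/-- The preparation and the main loop. -/
theorem spec_prepared {p : Par} (hp : p.Ok) {D : DataStructure} (hD : Correct p D) {s : State}
    (hs : s.WF p.w) {σ : State} {t : ℕ} (hb : Big p.w prepare s.abs σ t) (hR : Ready p σ)
    (h11 : σ.reg 11 = 0) (h25 : σ.reg 25 = 0) (h26 : σ.reg 26 = p.metas.length)
    (hin : (⟨fun r => σ.reg (100 + r), fun a => σ.mem (50 + a)⟩ : State) = p.sys.initState) :
    Spec p.w ⟨[prepare.comp, .seq D.pre.embed (.seq (mainLoop D) answer.comp)], s⟩
      (((prepare.width + 1) * t + 2 +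
        factor * (((p.metas.take p.numAsked).map fun q => p.queryCost q + 1).sum + 1) : ℕ) +
        expectedTime p.w ⟨D.session ((p.metas.take p.numAsked).map p.queryOf), p.sys.initState⟩)
      (fun s => s.reg 0 ≠ 0 ↔ ∃ q ∈ p.metas, p.Found q) := by
  set B := factor * (((p.metas.take p.numAsked).map fun q => p.queryCost q + 1).sum + 1) with hB
  set rest := (p.metas.take p.numAsked).flatMap fun q => queryCmds D (p.queryOf q) with hrest
  have hsess : D.session ((p.metas.take p.numAsked).map p.queryOf) = [D.pre] ++ rest := by
    simp only [DataStructure.session, hrest, List.flatMap_map, queryCmds, List.singleton_append]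
  have main : Spec p.w ⟨[prepare.comp, .seq D.pre.embed (.seq (mainLoop D) answer.comp)], s⟩
      (((prepare.width + 1) * t : ℕ) + ((1 : ℕ) + (((1 : ℕ) + (B : ℝ≥0∞)) +
        expectedTime p.w ⟨[D.pre] ++ rest, p.sys.initState⟩)))
      (fun s => s.reg 0 ≠ 0 ↔ ∃ q ∈ p.metas, p.Found q) := by
    refine Spec.big hb hs rfl fun s₁ hs₁ ha₁ => ?_
    have hin₁ : s₁.inner = p.sys.initState := by rw [inner_of_abs ha₁, hin]
    refine Spec.det (.one (c' := ⟨[D.pre].map Cmd.embed ++ [.seq (mainLoop D) answer.comp], s₁⟩)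
      (by simp) fun x => rfl) ?_
    rw [← hin₁]
    refine Spec.embed hs₁ fun s₂ hs₂ hF₂ hO₂ => ?_
    rw [add_assoc]
    refine Spec.det (.one (c' := ⟨[mainLoop D, answer.comp], s₂⟩) (by simp) fun x => rfl) ?_
    have hreg : ∀ r < 100, s₂.abs.reg r = σ.reg r := fun r hr => by rw [hO₂.1 r hr, ha₁]
    refine (spec_mainLoop hp hD p.numAsked 0 (Nat.zero_add _) s₂ hs₂ ⟨hR.congr (fun r hr => hreg r (by simp at hr; omega))
      (fun a ha => ?_), (hreg 11 (by norm_num)).trans h11, fun h hex => ?_, fun _ =>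
        ⟨(hreg 25 (by norm_num)).trans h25, (hreg 26 (by norm_num)).trans h26⟩⟩ ?_).mono ?_
    · rw [← ha₁]; exact hO₂.2 a (by omega)
    · obtain ⟨j, -, h', -⟩ := found_numAsked hex
      omega
    · rw [hin₁] at hF₂
      simpa [DataStructure.session] using hF₂
    · simp only [List.drop_zero]
      exact le_rfl
  refine main.mono (le_of_eq ?_)
  rw [hsess]
  push_cast
  ring

/-- The specification of the program. -/
theorem spec_program {D : DataStructure} {p₁ p₂ d : ℕ} {p : Par} (hp : p.Ok) (hd : d < 2 ^ p.w)
    (h₁ : p₁ * p.Lg < 2 ^ p.w) (h₁' : p₁ < 2 ^ p.w) (h₂ : p₂ * p.Lg < 2 ^ p.w)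
    (h₂' : p₂ < 2 ^ p.w) (hLg : p.Lg = Nat.size p.l) (hs : p.s = p₁ * p.Lg / d)
    (hr : p.r = p₂ * p.Lg / d + 1) {A : List ℤ} (hA : p.Input A)
    (hD : ∀ a < 2 ^ p.w, Correct { p with α := a } D) {E : ℕ → ℝ≥0∞}
    (hE : ∀ a < 2 ^ p.w, ∀ q : Par, q = { p with α := a } →
      (((prepare.width + 1) * q.prepareCost + 2 +
        factor * (((q.metas.take q.numAsked).map fun x => q.queryCost x + 1).sum + 1) : ℕ) +
        expectedTime p.w ⟨D.session ((q.metas.take q.numAsked).map q.queryOf), q.sys.initState⟩) ≤ E a) :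
    Spec p.w ⟨[program D p₁ p₂ d], ThreeSum.initState p.w A⟩
      ((((setUp p₁ p₂ d).width + 1) * (2 * p.Lg + 4 * p.l + 30) + 4 : ℕ) + avg p.w fun x => E (x ||| 1))
      (fun s => s.reg 0 ≠ 0 ↔ ThreeSum.HasWitness A) := by
  have hlw := hp.lt_of_lt_l (le_refl p.l)
  set s₀ := ThreeSum.initState p.w A with hs₀
  have hw₀ : s₀.WF p.w := by
    constructor
    · intro r
      simp only [hs₀, ThreeSum.initState]
      split_ifs
      · rw [← hA.len]; omega
      · exact Nat.two_pow_pos _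
    · intro a i
      simp only [hs₀, ThreeSum.initState]
      split_ifs
      · have := hp.hX i
        rw [hA.X] at this
        exact this
      · exact Nat.two_pow_pos _
  have hp₀ := hp.with_alpha (Nat.two_pow_pos p.w)
  have hreg₀ : ∀ r, r ≠ 0 → s₀.abs.reg r = 0 := fun r hr => by
    simp [hs₀, ThreeSum.initState, State.abs, hr]
  have hmem₀ : ∀ a, a ≠ 0 → s₀.abs.mem a = fun _ => 0 := fun a ha => by
    funext i; simp [hs₀, ThreeSum.initState, State.abs, ha]
  obtain ⟨σ₁, t₁, b1, ht₁, he₁, hd₁⟩ := big_setUp hp₀ hd h₁ h₁' h₂ h₂' hLg hs hr (σ := s₀.abs)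
    (by simp [hs₀, ThreeSum.initState, State.abs, hA.len]) (hreg₀ 1 (by norm_num))
    (by rw [show ({ p with α := 0 } : Par).X = p.X from rfl, hA.X]
        funext i; simp [hs₀, ThreeSum.initState, State.abs])
    (hmem₀ 1 (by norm_num))
  have main : Spec p.w ⟨[program D p₁ p₂ d], s₀⟩ ((1 : ℕ) + ((((setUp p₁ p₂ d).width + 1) * t₁ : ℕ) +
      ((1 : ℕ) + (1 + avg p.w fun x => (1 : ℕ) + E (x ||| 1)))))
      (fun s => s.reg 0 ≠ 0 ↔ ThreeSum.HasWitness A) := by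
    refine Spec.det (.one (by simp) fun x => rfl) (Spec.big b1 hw₀ rfl fun s₁ hs₁ ha₁ => ?_)
    -- The multiplier is drawn here, before the structure has run. For each value of x the instance
    -- and the queries are fixed, the guarantee applies to them, and only then the average over x is
    -- taken. Machine register 2 is variable 1.
    refine Spec.det (.one (by simp) fun x => rfl) (Spec.step (by simp) fun x hx => ?_)
    refine Spec.det (.one (by simp [stepWith]) fun y => rfl) ?_
    set a := x ||| 1 with ha
    have ha2 : a < 2 ^ p.w := Nat.or_lt_two_pow hx (Nat.one_lt_two_pow hp.hw)
    obtain ⟨q, hq⟩ : ∃ q : Par, q = { p with α := a } := ⟨_, rfl⟩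
    have hqo : q.Ok := hq ▸ hp.with_alpha ha2
    have hqA : q.Input A := by subst hq; exact ⟨hA.inst, hA.len, hA.X⟩
    set s₂ := s₁.setReg 2 x with hs₂
    have hw₂ : s₂.WF p.w := hs₁.setReg hx
    have ha₂ : s₂.abs = σ₁.setReg 1 x := by
      rw [← ha₁]
      simp only [State.abs, hs₂, State.setReg, State.mk.injEq, and_true]
      funext j
      by_cases hj : j = 1
      · subst hj; simp
      · rw [Function.update_of_ne (by omega), Function.update_of_ne hj]
    have hreg : ∀ r, r ∉ [0, 1, 2, 3, 4, 5, 6, 7, 8, 9, 10, 11, 24, 25] → s₂.abs.reg r = 0 := fun r hr => by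
      simp only [List.mem_cons, List.not_mem_nil, not_or, or_false] at hr
      rw [ha₂, reg_setReg, if_neg (by omega), b1.frame.reg r
        (by rw [setUp_regs]; simp only [List.mem_cons, List.not_mem_nil, or_false]; omega), hreg₀ r (by omega)]
    obtain ⟨σ₃, t₃, b3, ht₃, hR₃, h11, h25, h26, hin⟩ := big_prepare hqo (x := x) (σ := s₂.abs)
      (by rw [hq]) (by rw [ha₂, hq]; exact he₁.of_setReg_one) (by rw [ha₂, hq]; exact hd₁)
      (fun r hr => hreg r (by simp at hr; rcases hr with rfl | rfl | rfl | rfl | rfl <;> decide)) (fun r hr => hreg r (by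
        simp only [List.mem_cons, List.not_mem_nil, or_false]; omega))
      (fun b hb => by
        rw [ha₂, mem_setReg, b1.frame.mem b (by rw [setUp_arrs]; simp; omega), hmem₀ b (by omega)])
    have hqw : q.w = p.w := by rw [hq]
    have h := spec_prepared hqo (D := D) (hq ▸ hD a ha2) (hqw ▸ hw₂) b3 hR₃ h11 h25 h26 hin
    have hW := hqA.hasWitness_iff hqo
    simp only [← hW] at h
    rw [hqw] at h
    refine h.mono (le_trans ?_ (hE a ha2 q hq))
    gcongr
  refine main.mono ?_
  rw [avg_add, avg_const]
  calc _ = ((((setUp p₁ p₂ d).width + 1) * t₁ + 4 : ℕ) : ℝ≥0∞) + avg p.w fun x => E (x ||| 1) := by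
        push_cast; ring
    _ ≤ _ := by
        gcongr

end Reduction

namespace Reduction

open WordRAM SetIntersection

/-! ### The hash function -/

theorem or_one_eq (x : ℕ) : x ||| 1 = 2 * (x / 2) + 1 := by
  have h : x ||| 1 = 2 * (x / 2) ||| 1 := by
    refine Nat.eq_of_testBit_eq fun i => ?_
    rw [Nat.testBit_or, Nat.testBit_or]
    cases i with
    | zero => simp
    | succ i => simp [Nat.testBit_succ]
  rw [h]
  have := Nat.two_pow_add_eq_or_of_lt (i := 1) (b := 1) (by norm_num) (x / 2)
  rw [pow_one] at this
  exact this.symm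

/-- A product with a random odd number is near zero with small probability. -/
theorem card_near_zero_le {w L z : ℕ} (hL : 2 ^ (L + 1) ≤ 2 ^ w) (hz0 : z ≠ 0) (hz : z < 2 ^ w) :
    ((Finset.range (2 ^ w)).filter fun x => (x ||| 1) * z % 2 ^ w < 2 ^ (L + 1) ∨
      2 ^ w - 2 ^ (L + 1) < (x ||| 1) * z % 2 ^ w).card ≤ 2 ^ (L + 2) := by
  -- The product with an odd number keeps the factor 2^k, and the cofactor, an odd number modulo
  -- 2^(w-k), is permuted by the odd z'.
  obtain ⟨k, z', hodd, rfl⟩ := Nat.exists_eq_two_pow_mul_odd hz0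
  have hz'0 : 0 < z' := hodd.pos
  have hkw : k < w := by
    by_contra hcon
    have h1 : 2 ^ w ≤ 2 ^ k := Nat.pow_le_pow_right (by norm_num) (by omega)
    have h2 : 2 ^ k * 1 ≤ 2 ^ k * z' := Nat.mul_le_mul_left _ hz'0
    omega
  have hLw : L + 1 ≤ w := (Nat.pow_le_pow_iff_right (by norm_num)).1 hL
  have hWk : 2 ^ w = 2 ^ k * 2 ^ (w - k) := by rw [← pow_add]; congr 1; omega
  set ρ : ℕ → ℕ := fun x => (x ||| 1) * (2 ^ k * z') % 2 ^ w with hρ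
  have hρ' : ∀ x, ρ x = 2 ^ k * ((x ||| 1) * z' % 2 ^ (w - k)) := fun x => by
    rw [hρ]; simp only
    rw [hWk, show (x ||| 1) * (2 ^ k * z') = 2 ^ k * ((x ||| 1) * z') by ring, Nat.mul_mod_mul_left]
  have hoddρ : ∀ x, (x ||| 1) * z' % 2 ^ (w - k) % 2 = 1 := fun x => by
    rw [Nat.mod_mod_of_dvd _ (dvd_pow_self 2 (by omega)), or_one_eq]
    exact Nat.odd_iff.1 (Odd.mul ⟨_, rfl⟩ hodd)
  have hρw : ∀ x, ρ x < 2 ^ w := fun x => Nat.mod_lt _ (Nat.two_pow_pos _)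
  -- In this case ρ x is an odd multiple of 2^k ≥ 2^(L+1), thus at distance at least 2^(L+1) from 0
  -- modulo 2^w, and nothing is counted.
  by_cases hkL : L < k
  · rw [Finset.filter_eq_empty_iff.2, Finset.card_empty]
    · exact Nat.zero_le _
    · intro x _ hx
      change ρ x < _ ∨ _ < ρ x at hx
      have h1 : 2 ^ (L + 1) ≤ 2 ^ k := Nat.pow_le_pow_right (by norm_num) (by omega)
      have h2 := hρ' x
      have h3 := hoddρ x
      have h4 : (x ||| 1) * z' % 2 ^ (w - k) < 2 ^ (w - k) := Nat.mod_lt _ (Nat.two_pow_pos _)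
      generalize (x ||| 1) * z' % 2 ^ (w - k) = u at *
      have h5 : 2 ^ k * 1 ≤ 2 ^ k * u := Nat.mul_le_mul_left _ (by omega)
      have h6 : 2 ^ k * (u + 1) ≤ 2 ^ k * 2 ^ (w - k) := Nat.mul_le_mul_left _ (by omega)
      rw [mul_add] at h6
      omega
  -- After translation by 2^(L+1) the values to be counted lie in a window of length 2^(L+2). All of
  -- them are 2^k modulo 2^(k+1), so the quotient determines them and takes at most 2^(L-k+1)
  -- values.
  set g : ℕ → ℕ := fun x => (ρ x + 2 ^ (L + 1)) % 2 ^ w / 2 ^ (k + 1) with hg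
  have hLk : 2 ^ (L + 1) = 2 ^ (k + 1) * 2 ^ (L - k) := by rw [← pow_add]; congr 1; omega
  have hWk1 : 2 ^ w = 2 ^ (k + 1) * 2 ^ (w - k - 1) := by rw [← pow_add]; congr 1; omega
  have hcard : 2 ^ (L + 2) = (Finset.range (2 ^ (L - k + 1)) ×ˢ Finset.range 2 ×ˢ
      Finset.range (2 ^ k)).card := by
    simp only [Finset.card_product, Finset.card_range]
    rw [← pow_succ', ← pow_add]; congr 1; omega
  rw [hcard]
  -- The first component fixes x or 1 modulo 2^(w-k), as z' is invertible there; the second restores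
  -- the last bit, the third the leading k bits. The numbers of values multiply to 2^(L-k+1)·2·2^k.
  refine Finset.card_le_card_of_injOn (fun x => (g x, x % 2, x / 2 ^ (w - k))) ?_ ?_
  · intro x hx
    simp only [Finset.coe_filter, Set.mem_ofPred_eq, Finset.mem_range] at hx
    obtain ⟨hxw, hx⟩ := hx
    change ρ x < _ ∨ _ < ρ x at hx
    simp only [Finset.coe_product, Set.mem_prod, Finset.mem_coe, Finset.mem_range]
    refine ⟨?_, Nat.mod_lt _ (by norm_num), Nat.div_lt_of_lt_mul (by rwa [mul_comm, ← hWk])⟩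
    refine Nat.div_lt_of_lt_mul ?_
    have h1 : 2 ^ (k + 1) * 2 ^ (L - k + 1) = 2 ^ (L + 1) + 2 ^ (L + 1) := by
      rw [hLk]; ring
    rw [h1]
    have h2 := hρw x
    rcases hx with hx | hx
    · exact (Nat.mod_le _ _).trans_lt (by omega)
    · rw [Nat.mod_eq_sub_mod (by omega)]
      exact (Nat.mod_le _ _).trans_lt (by omega)
  · intro x hx y hy hxy
    simp only [Finset.coe_filter, Set.mem_ofPred_eq, Finset.mem_range, Prod.mk.injEq] at hx hy hxy
    obtain ⟨hgxy, h2, hdiv⟩ := hxy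
    have hmod : ∀ x, (ρ x + 2 ^ (L + 1)) % 2 ^ w % 2 ^ (k + 1) = 2 ^ k := fun x => by
      rw [Nat.mod_mod_of_dvd _ ⟨_, hWk1⟩, hLk, Nat.add_mul_mod_self_left, hρ' x, pow_succ,
        Nat.mul_mod_mul_left, hoddρ, mul_one]
    have h3 : (ρ x + 2 ^ (L + 1)) % 2 ^ w = (ρ y + 2 ^ (L + 1)) % 2 ^ w := by
      rw [← Nat.div_add_mod ((ρ x + 2 ^ (L + 1)) % 2 ^ w) (2 ^ (k + 1)), hmod x,
        ← Nat.div_add_mod ((ρ y + 2 ^ (L + 1)) % 2 ^ w) (2 ^ (k + 1)), hmod y]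
      change _ * g x + _ = _ * g y + _
      rw [hgxy]
    have h4 : ρ x = ρ y := by
      have := Nat.ModEq.add_right_cancel' (n := 2 ^ w) _ h3
      exact Nat.ModEq.eq_of_lt_of_lt this (hρw x) (hρw y)
    rw [hρ' x, hρ' y] at h4
    have h5 : (x ||| 1) * z' ≡ (y ||| 1) * z' [MOD 2 ^ (w - k)] :=
      Nat.eq_of_mul_eq_mul_left (Nat.two_pow_pos k) h4
    have hco : Nat.Coprime (2 ^ (w - k)) z' := (Nat.coprime_two_left.2 hodd).pow_left _
    have h6 : (x ||| 1) ≡ (y ||| 1) [MOD 2 ^ (w - k)] := Nat.ModEq.cancel_right_of_coprime hco h5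
    have h7 : x ≡ y [MOD 2 ^ (w - k)] := by
      have hx' : x + 1 = (x ||| 1) + x % 2 := by rw [or_one_eq]; omega
      have hy' : y + 1 = (y ||| 1) + x % 2 := by rw [or_one_eq]; omega
      have : x + 1 ≡ y + 1 [MOD 2 ^ (w - k)] := by rw [hx', hy']; exact h6.add_right _
      exact Nat.ModEq.add_right_cancel' 1 this
    rw [← Nat.div_add_mod x (2 ^ (w - k)), ← Nat.div_add_mod y (2 ^ (w - k)), hdiv, h7]

namespace Par

theorem near_zero_of_near {p : Par} (hp : p.Ok) {t : ℕ × ℕ × ℕ × ℕ} (he : t.2.2.2 < 2)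
    (h : p.Near t) :
    p.α * ((p.X t.1 + p.X t.2.1 + (2 ^ p.w - p.X t.2.2.1)) % 2 ^ p.w) % 2 ^ p.w <
        2 ^ (p.w - (p.s + (p.r + p.r)) + 1) ∨
      2 ^ p.w - 2 ^ (p.w - (p.s + (p.r + p.r)) + 1) <
        p.α * ((p.X t.1 + p.X t.2.1 + (2 ^ p.w - p.X t.2.2.1)) % 2 ^ p.w) % 2 ^ p.w := by
  obtain ⟨a, b, c, e⟩ := t
  have hc := hp.hX c
  have hw := two_pow_eq hp
  have hsum := h.1
  simp only at he hsum ⊢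
  unfold H at hsum
  have hr := hp.hr
  have hm := hp.hm
  have hL2 : 2 ^ (p.w - (p.s + (p.r + p.r)) + 1) ≤ 2 ^ p.w :=
    Nat.pow_le_pow_right (by norm_num) (by omega)
  rw [pow_succ] at hL2 ⊢
  set L := 2 ^ (p.w - (p.s + (p.r + p.r))) with hL
  have hL0 : 0 < L := Nat.two_pow_pos _
  set M := 2 ^ p.s * p.Q with hM
  set W := 2 ^ p.w with hW
  have hW0 : 0 < W := Nat.two_pow_pos _
  have h1 := Nat.div_add_mod (p.α * p.X a % W) L
  have h2 := Nat.div_add_mod (p.α * p.X b % W) L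
  have h3 := Nat.div_add_mod (p.α * p.X c % W) L
  have h4 := Nat.mod_lt (p.α * p.X a % W) hL0
  have h5 := Nat.mod_lt (p.α * p.X b % W) hL0
  have h6 := Nat.mod_lt (p.α * p.X c % W) hL0
  generalize p.α * p.X a % W / L = ha at *
  generalize p.α * p.X b % W / L = hb at *
  generalize p.α * p.X c % W / L = hc' at *
  have h7 := Nat.div_add_mod (ha + hb + e) M
  rw [hsum] at h7
  generalize (ha + hb + e) / M = t at *
  have h8 := Nat.div_add_mod (p.α * p.X a) W
  have h9 := Nat.div_add_mod (p.α * p.X b) W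
  have h10 := Nat.div_add_mod (p.α * p.X c) W
  generalize p.α * p.X a % W % L = ra at *
  generalize p.α * p.X b % W % L = rb at *
  generalize p.α * p.X c % W % L = rc at *
  -- Modulo 2^w the hash parts cancel up to e, and what remains of α(a+b-c) is a combination of the
  -- discarded low parts, each below L. It lies strictly between -2L and 2L.
  have key : ((p.α * ((p.X a + p.X b + (W - p.X c)) % W) % W : ℕ) : ℤ) =
      ((ra : ℤ) + rb - rc - e * L) % W := by
    push_cast [Nat.cast_sub hc.le]
    rw [Int.mul_emod, Int.emod_emod_of_dvd _ dvd_rfl, ← Int.mul_emod,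
      Int.emod_eq_emod_iff_emod_sub_eq_zero, ← Int.dvd_iff_emod_eq_zero]
    refine ⟨p.α * p.X a / W + p.α * p.X b / W - p.α * p.X c / W + t + p.α, ?_⟩
    rw [← h1] at h8
    rw [← h2] at h9
    rw [← h3] at h10
    zify at h8 h9 h10 hw h7
    linear_combination (-1 : ℤ) * h8 - h9 + h10 - (L : ℤ) * h7 - t * hw
  have hlt : p.α * ((p.X a + p.X b + (W - p.X c)) % W) % W < W := Nat.mod_lt _ hW0
  generalize p.α * ((p.X a + p.X b + (W - p.X c)) % W) % W = ρ at *
  have heL : e * L ≤ L := (Nat.mul_le_mul_right _ (by omega : e ≤ 1)).trans (by omega)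
  zify at heL
  have heL0 : (0 : ℤ) ≤ e * L := by positivity
  by_cases hpos : 0 ≤ (ra : ℤ) + rb - rc - e * L
  · left
    rw [Int.emod_eq_of_lt hpos (by omega)] at key
    omega
  · right
    rw [← Int.add_emod_right, Int.emod_eq_of_lt (by omega) (by omega)] at key
    omega

/-- The probability that a triple that is no witness looks like one. -/
theorem card_near_le {p : Par} (hp : p.Ok) {t : ℕ × ℕ × ℕ × ℕ} (he : t.2.2.2 < 2) :
    ((Finset.range (2 ^ p.w)).filter fun x => ({ p with α := x ||| 1 } : Par).Near t).card ≤
      2 ^ (p.w - (p.s + (p.r + p.r)) + 2) := by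
  have hr := hp.hr
  have hm := hp.hm
  have hW0 : 0 < 2 ^ p.w := Nat.two_pow_pos _
  set z := (p.X t.1 + p.X t.2.1 + (2 ^ p.w - p.X t.2.2.1)) % 2 ^ p.w with hz
  -- Here z is a + b - c modulo 2^w; if it vanishes the elements add up, and the triple is near for
  -- no multiplier.
  by_cases hz0 : z = 0
  · rw [Finset.filter_eq_empty_iff.2, Finset.card_empty]
    · exact Nat.zero_le _
    · rintro x - ⟨-, hne⟩
      refine hne ?_
      have hc := hp.hX t.2.2.1
      change (p.X t.1 + p.X t.2.1) % 2 ^ p.w = p.X t.2.2.1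
      have h1 : (p.X t.1 + p.X t.2.1 + (2 ^ p.w - p.X t.2.2.1)) + p.X t.2.2.1 =
        p.X t.1 + p.X t.2.1 + 2 ^ p.w := by omega
      rw [← Nat.add_mod_right, ← h1, Nat.add_mod, ← hz, hz0, zero_add, Nat.mod_mod,
        Nat.mod_eq_of_lt hc]
  · refine le_trans (Finset.card_le_card ?_) (card_near_zero_le (w := p.w) (z := z)
      (Nat.pow_le_pow_right (by norm_num) (by omega)) hz0 (Nat.mod_lt _ hW0))
    intro x hx
    simp only [Finset.mem_filter, Finset.mem_range] at hx ⊢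
    exact ⟨hx.1, near_zero_of_near (hp.with_alpha
      (Nat.or_lt_two_pow hx.1 (Nat.one_lt_two_pow hp.hw))) he hx.2⟩

/-- The expected number of triples that look like witnesses but are none. -/
theorem avg_nearSet_le {p : Par} (hp : p.Ok) :
    avg p.w (fun x => (({ p with α := x ||| 1 } : Par).nearSet.card : ℝ≥0∞)) ≤
      8 * (p.l : ℝ≥0∞) ^ 3 / (2 ^ p.s * p.Q : ℕ) := by
  set F := Finset.range p.l ×ˢ Finset.range p.l ×ˢ Finset.range p.l ×ˢ Finset.range 2 with hF
  set L := 2 ^ (p.w - (p.s + (p.r + p.r))) with hL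
  -- Double counting: 2·l³ triples with a carry, each near for at most 4L of the words x.
  have h1 : ∑ x ∈ Finset.range (2 ^ p.w), ({ p with α := x ||| 1 } : Par).nearSet.card ≤
      p.l ^ 3 * 2 * (4 * L) := by
    have h2 : ∀ x, ({ p with α := x ||| 1 } : Par).nearSet.card =
        ∑ t ∈ F, if ({ p with α := x ||| 1 } : Par).Near t then 1 else 0 := fun x => by
      rw [nearSet, Finset.card_filter]
    simp only [h2]
    rw [Finset.sum_comm]
    refine (Finset.sum_le_card_nsmul _ _ (4 * L) fun t ht => ?_).trans (le_of_eq ?_)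
    · rw [← Finset.card_filter]
      refine (card_near_le hp ?_).trans (le_of_eq ?_)
      · simp only [hF, Finset.mem_product, Finset.mem_range] at ht
        exact ht.2.2.2
      · rw [hL]; ring
    · simp only [hF, Finset.card_product, Finset.card_range, smul_eq_mul]
      ring
  have hW := two_pow_eq hp
  rw [avg_eq_sum, ← Finset.mul_sum]
  have h3 : (∑ x ∈ Finset.range (2 ^ p.w), (({ p with α := x ||| 1 } : Par).nearSet.card : ℝ≥0∞)) ≤
      8 * (p.l : ℝ≥0∞) ^ 3 * L := by
    calc _ = ((∑ x ∈ Finset.range (2 ^ p.w), ({ p with α := x ||| 1 } : Par).nearSet.card : ℕ) : ℝ≥0∞) := by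
          push_cast; rfl
      _ ≤ ((p.l ^ 3 * 2 * (4 * L) : ℕ) : ℝ≥0∞) := by exact_mod_cast h1
      _ = _ := by push_cast; ring
  refine (mul_le_mul_right h3 _).trans (le_of_eq ?_)
  have h4 : (2 : ℝ≥0∞) ^ p.w = (L : ℝ≥0∞) * ((2 ^ p.s * p.Q : ℕ) : ℝ≥0∞) := by
    exact_mod_cast hW
  have hL0 : (L : ℝ≥0∞) ≠ 0 := by exact_mod_cast (Nat.two_pow_pos _).ne'
  rw [h4, ENNReal.mul_inv (.inl hL0) (.inl (ENNReal.natCast_ne_top _)), ENNReal.div_eq_inv_mul]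
  calc _ = ((L : ℝ≥0∞)⁻¹ * L) * (((2 ^ p.s * p.Q : ℕ) : ℝ≥0∞)⁻¹ * (8 * (p.l : ℝ≥0∞) ^ 3)) := by ring
    _ = _ := by rw [ENNReal.inv_mul_cancel hL0 (ENNReal.natCast_ne_top _), one_mul]

end Par

end Reduction

namespace Reduction

open WordRAM SetIntersection

/-! ### Bounds for the costs -/

namespace Par
variable (p : Par)

/-- For each bit position an element belongs to a single key, since its index bit, its sign and its
bucket are determined. -/
theorem flat_length_le_Lg : (p.flat p.NK).length ≤ p.Lg * p.l := by
  classical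
  have hent : ∀ key, (p.ent key p.l).length ≤ ((Finset.range p.l).filter (p.Mem key)).card := by
    intro key
    rw [← List.toFinset_card_of_nodup (p.ent_nodup key p.l)]
    refine (Finset.card_le_card ?_).trans (Finset.card_image_le (f := p.lo))
    intro h hh
    obtain ⟨i, hi, hM, rfl⟩ := mem_ent.1 (List.mem_toFinset.1 hh)
    exact Finset.mem_image_of_mem _ (Finset.mem_filter.2 ⟨Finset.mem_range.2 hi, hM⟩)
  calc (p.flat p.NK).length ≤ ∑ k ∈ Finset.range p.NK, ((Finset.range p.l).filter (p.Mem k)).card := by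
        rw [flat_length]; exact Finset.sum_le_sum fun k _ => hent k
    _ = ((Finset.range p.NK).sigma fun k => (Finset.range p.l).filter (p.Mem k)).card :=
        (Finset.card_sigma _ _).symm
    _ ≤ (Finset.range p.Lg ×ˢ Finset.range p.l).card := by
        refine Finset.card_le_card_of_injOn (fun t => (t.1 / 2 ^ p.s / 4, t.2)) ?_ ?_
        · rintro ⟨key, i⟩ ht
          simp only [Finset.coe_sigma, Set.mem_sigma_iff, Finset.mem_coe, Finset.mem_filter,
            Finset.mem_range, Finset.coe_product, Set.mem_prod] at ht ⊢
          have hk : key / 2 ^ p.s < 4 * p.Lg :=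
            Nat.div_lt_of_lt_mul (by have := ht.1; rwa [NK, mul_comm] at this)
          exact ⟨by omega, ht.2.1⟩
        · rintro ⟨key, i⟩ ht ⟨key', i'⟩ ht' heq
          simp only [Finset.coe_sigma, Set.mem_sigma_iff, Finset.mem_coe, Finset.mem_filter,
            Finset.mem_range, Prod.mk.injEq] at ht ht' heq
          obtain ⟨hk, rfl⟩ := heq
          have h3 := ht.2.2.2.1
          have h4 := ht'.2.2.2.1
          have h5 := ht.2.2.2.2
          have h6 := ht'.2.2.2.2
          rw [← hk] at h4
          have h9 : key / 2 ^ p.s = key' / 2 ^ p.s := by omega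
          have : key = key' := by
            rw [← Nat.div_add_mod key (2 ^ p.s), ← Nat.div_add_mod key' (2 ^ p.s), h5, h6, h9]
          subst this
          rfl
    _ = p.Lg * p.l := by simp

/-- Each of the 4·`Lg`·2^s keys has at most one chunk that is not full. As T is at least l/2^s, the
full chunks number at most `Lg`·2^s in total. -/
theorem chunks_length_le : p.chunks.length ≤ 5 * (p.Lg * 2 ^ p.s) := by
  have hT := p.T_pos
  have h1 : ∀ key, p.nc key * p.T ≤ (p.ent key p.l).length + p.T := fun key => by
    have := Nat.div_mul_le_self ((p.ent key p.l).length + p.T - 1) p.T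
    unfold nc; omega
  have h2 : p.chunks.length * p.T ≤ (p.flat p.NK).length + p.NK * p.T := by
    rw [chunks, chunksTo_length, flat_length, Finset.sum_mul]
    refine (Finset.sum_le_sum fun k _ => h1 k).trans (le_of_eq ?_)
    rw [Finset.sum_add_distrib]; simp
  have h3 : p.l ≤ 2 ^ p.s * p.T := by
    have := Nat.div_add_mod p.l (2 ^ p.s)
    have := Nat.mod_lt p.l (Nat.two_pow_pos p.s)
    rw [T, mul_add]; omega
  have h4 := p.flat_length_le_Lg
  have h5 : p.Lg * p.l ≤ p.Lg * (2 ^ p.s * p.T) := Nat.mul_le_mul_left _ h3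
  refine Nat.le_of_mul_le_mul_right ?_ hT
  calc _ ≤ p.Lg * (2 ^ p.s * p.T) + p.NK * p.T := by omega
    _ = _ := by rw [NK]; ring

variable {p : Par}

theorem Ok.two_pow_Lg_le (hp : p.Ok) (hLg : p.Lg = Nat.size p.l) : 2 ^ p.Lg ≤ 2 * (p.l + 1) := by
  by_cases h : p.l = 0
  · rw [hLg, h]; simp
  · have := hp.hLg h; omega

theorem prepareCost_le (hp : p.Ok) (hLg : p.Lg = Nat.size p.l) (hs : p.s ≤ p.Lg) :
    p.prepareCost ≤ 3000 * ((p.Lg + 1) * ((p.l + 1) * (2 ^ p.s + 2 ^ p.r))) := by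
  have hS : 2 ^ p.s ≤ 2 * (p.l + 1) :=
    (Nat.pow_le_pow_right (by norm_num) hs).trans (hp.two_pow_Lg_le hLg)
  have hST : 2 ^ p.s * p.T ≤ 3 * (p.l + 1) := by
    have := Nat.div_mul_le_self p.l (2 ^ p.s)
    rw [mul_comm] at this
    rw [T, mul_add]; omega
  have hU : p.U ≤ 3 * 2 ^ p.r := by
    have := Nat.one_le_two_pow (n := p.r)
    unfold U; omega
  have hc := p.chunks_length_le
  have hf := p.flat_length_le_Lg
  unfold prepareCost
  have hNK : p.NK = 4 * p.Lg * 2 ^ p.s := rfl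
  generalize (p.flat _).length = F at *
  rw [hNK]
  clear hNK
  generalize p.chunks.length = c at *
  generalize 2 ^ p.s = S at *
  generalize p.U = U at *
  generalize p.T = T at *
  generalize hR : 2 ^ p.r = R at *
  have hR1 : 1 ≤ R := hR ▸ Nat.one_le_two_pow
  generalize p.Lg = g at *
  generalize p.l = l at *
  have e0 : (g + 1) * ((l + 1) * (S + R)) =
      g * (S * (l + 1)) + g * (R * (l + 1)) + (l + 1) * (S + R) := by ring
  have e0' : 1 ≤ (l + 1) * (S + R) := Nat.mul_pos (by omega) (by omega)
  have e1 : 4 * g * S * (33 * l + 8) ≤ 132 * (g * (S * (l + 1))) := by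
    calc _ ≤ 4 * g * S * (33 * (l + 1)) := by gcongr; omega
      _ = _ := by ring
  have e2 : 4 * g * S ≤ 4 * (g * (S * (l + 1))) := by
    calc _ = 4 * (g * (S * 1)) := by ring
      _ ≤ _ := by gcongr; omega
  have e3 : c * (U * (6 * T + 10) + 16) ≤ 570 * (g * (R * (l + 1))) + 80 * (g * (S * (l + 1))) := by
    calc _ ≤ 5 * (g * S) * (3 * R * (6 * T + 10) + 16) := by gcongr
      _ = 90 * (g * (R * (S * T))) + 150 * (g * (R * S)) + 80 * (g * (S * 1)) := by ring
      _ ≤ 90 * (g * (R * (3 * (l + 1)))) + 150 * (g * (R * (2 * (l + 1)))) + 80 * (g * (S * (l + 1))) := by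
          gcongr; omega
      _ = _ := by ring
  have e4 : R * (6 * F + 14 * (4 * g * S)) ≤ 118 * (g * (R * (l + 1))) := by
    calc _ ≤ R * (6 * (g * (l + 1)) + 14 * (4 * g * (2 * (l + 1)))) := by
          gcongr; exact hf.trans (Nat.mul_le_mul_left _ (by omega))
      _ = _ := by ring
  have e5 : c * (200 * l + 11) ≤ 1000 * (g * (S * (l + 1))) := by
    calc _ ≤ 5 * (g * S) * (200 * (l + 1)) := by gcongr; omega
      _ = _ := by ring
  omega

theorem metas_length_le' (p : Par) : p.metas.length ≤ 40 * (p.Lg * (2 ^ p.s * p.l)) := by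
  refine p.metas_length_le.trans ((Nat.mul_le_mul_right _ p.chunks_length_le).trans (le_of_eq ?_))
  ring

-- Of the queries asked only the last one can find a witness. It is paid for by the uniform bound B,
-- and the others are distinct queries without a witness.
open Classical in
theorem sum_take_numAsked_le (f : ℕ × ℕ × ℕ → ℕ) (B : ℕ) (hB : ∀ q ∈ p.metas, f q ≤ B) :
    ((p.metas.take p.numAsked).map f).sum ≤
      ∑ q ∈ p.metas.toFinset.filter (fun q => ¬ p.Found q), f q + B := by
  have hnd : (p.metas.take p.numAsked).Nodup := p.metas_nodup.sublist (List.take_sublist _ _)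
  rw [← List.sum_toFinset f hnd, ← Finset.sum_filter_add_sum_filter_not _ (fun q => p.Found q), add_comm]
  refine add_le_add (Finset.sum_le_sum_of_subset ?_) ?_
  · refine Finset.filter_subset_filter _ fun q hq => ?_
    rw [List.mem_toFinset] at *
    exact List.mem_of_mem_take hq
  · refine (Finset.sum_le_card_nsmul _ _ B fun q hq => hB q ?_).trans ?_
    · rw [Finset.mem_filter, List.mem_toFinset] at hq
      exact List.mem_of_mem_take hq.1
    · rw [smul_eq_mul]
      refine (Nat.mul_le_mul_right B (Finset.card_le_one.2 ?_)).trans (by omega)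
      have key : ∀ q ∈ (p.metas.take p.numAsked).toFinset.filter (fun q => p.Found q),
          p.metas[p.numAsked - 1]? = some q := by
        intro q hq
        rw [Finset.mem_filter, List.mem_toFinset] at hq
        obtain ⟨hq, hf⟩ := hq
        obtain ⟨j, hj, rfl⟩ := List.getElem_of_mem hq
        rw [List.length_take] at hj
        rw [List.getElem_take] at hf ⊢
        have : ¬ j + 1 < p.numAsked := fun h => not_found_of_lt_numAsked (by omega) h hf
        rw [show p.numAsked - 1 = j by omega]
        exact List.getElem?_eq_getElem _
      intro q hq q' hq'
      exact Option.some_injective _ ((key q hq).symm.trans (key q' hq'))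

/-- Even a query with empty answer costs a constant, which gives the term in the number of queries;
the rest is proportional to the false positives and to one scan for the query that succeeds. -/
theorem sum_queryCost_le (hp : p.Ok) (hinj : ∀ i < p.l, ∀ j < p.l, p.X i = p.X j → i = j) :
    ((p.metas.take p.numAsked).map fun q => p.queryCost q + 1).sum ≤
      9 * p.metas.length + 18 * (8 * p.Lg * p.nearSet.card + p.l) := by
  have h1 : ((p.metas.take p.numAsked).map fun q => p.queryCost q + 1).sum ≤
      ((p.metas.take p.numAsked).map fun q => 18 * p.chainSum q + 9).sum := by
    refine List.sum_le_sum fun q hq => ?_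
    have := queryCost_le hp (List.mem_of_mem_take hq)
    omega
  have h2 : ∀ L : List (ℕ × ℕ × ℕ), (L.map fun q => 18 * p.chainSum q + 9).sum =
      18 * (L.map p.chainSum).sum + 9 * L.length := by
    intro L
    induction L with
    | nil => rfl
    | cons q L ih => simp only [List.map_cons, List.sum_cons, ih, List.length_cons]; ring
  have h3 := sum_take_numAsked_le p.chainSum p.l fun q hq => chainSum_le_l hp hq
  have h4 := sum_chainSum_le hp hinj
  have h5 : (p.metas.take p.numAsked).length ≤ p.metas.length := by
    rw [List.length_take]; exact min_le_right _ _
  rw [h2] at h1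
  omega

open Classical in
theorem sum_card_answer_le (hp : p.Ok) (hinj : ∀ i < p.l, ∀ j < p.l, p.X i = p.X j → i = j) :
    ((p.metas.take p.numAsked).map fun q => (p.sys.answer (p.queryOf q)).card).sum ≤
      8 * p.Lg * p.nearSet.card + p.T := by
  refine (sum_take_numAsked_le _ p.T fun q hq => p.card_answer_le hp hq).trans ?_
  gcongr
  refine le_trans (Finset.sum_le_sum fun q hq => ?_) (sum_chainSum_le hp hinj)
  rw [Finset.mem_filter, List.mem_toFinset] at hq
  exact card_answer_le_chainSum hp hq.1

/-- The instance is small. -/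
theorem isInstance_of_le (hp : p.Ok) (hLg : p.Lg = Nat.size p.l) (hs : p.s ≤ p.Lg)
    (hr : p.r ≤ p.Lg + 1) {N : ℕ} (hN : 33 * ((p.Lg + 1) * ((p.l + 1) * 2 ^ p.r)) ≤ N) :
    p.sys.IsInstance N := by
  have hS : 2 ^ p.s ≤ 2 * (p.l + 1) :=
    (Nat.pow_le_pow_right (by norm_num) hs).trans (hp.two_pow_Lg_le hLg)
  have hRl : 2 ^ p.r ≤ 4 * (p.l + 1) := by
    have h1 : 2 ^ p.r ≤ 2 ^ (p.Lg + 1) := Nat.pow_le_pow_right (by norm_num) hr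
    have h2 := hp.two_pow_Lg_le hLg
    rw [pow_succ] at h1; omega
  have hU : p.U ≤ 3 * 2 ^ p.r := by
    have := Nat.one_le_two_pow (n := p.r)
    unfold U; omega
  have hf := p.flat_length_le_Lg
  have hR0 : 0 < 2 ^ p.r := Nat.two_pow_pos _
  have h0 : 1 * ((p.l + 1) * 2 ^ p.r) ≤ (p.Lg + 1) * ((p.l + 1) * 2 ^ p.r) :=
    Nat.mul_le_mul_right _ (by omega)
  have h00 : 0 < (p.l + 1) * 2 ^ p.r := by positivity
  refine p.isInstance ?_ ?_
  · have h1 : 8 * p.Q ≤ 32 * ((p.l + 1) * 2 ^ p.r) := by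
      calc 8 * p.Q = 8 * (2 ^ p.r * 2 ^ p.r) := rfl
        _ ≤ 8 * (4 * (p.l + 1) * 2 ^ p.r) := by gcongr
        _ = _ := by ring
    omega
  · refine le_trans ?_ hN
    have h1 : p.Lg * p.l ≤ (p.Lg + 1) * (p.l + 1) := Nat.mul_le_mul (by omega) (by omega)
    calc _ ≤ 3 * 2 ^ p.r * ((p.Lg + 1) * (p.l + 1)) +
          2 ^ p.r * ((p.Lg + 1) * (p.l + 1) + 4 * (p.Lg + 1) * (2 * (p.l + 1))) := by
          have := hf.trans h1
          have : p.NK ≤ 4 * (p.Lg + 1) * (2 * (p.l + 1)) :=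
            Nat.mul_le_mul (by omega) hS
          gcongr
      _ = 12 * ((p.Lg + 1) * ((p.l + 1) * 2 ^ p.r)) := by ring
      _ ≤ _ := Nat.mul_le_mul_right _ (by norm_num)

end Par

end Reduction

namespace Reduction

open WordRAM SetIntersection

/-! ### 3SUM by SetIntersection -/

/-- The guarantees of a data structure for one word length and one size. -/
def BoundsAt (D : DataStructure) (w N : ℕ) (tp tq tr : ℝ≥0) : Prop :=
  ∀ I : SetSystem, I.IsInstance N →
    ∀ qs : List (ℕ × ℕ), (∀ q ∈ qs, q.1 < I.A.length ∧ q.2 < I.B.length) →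
      (∀ s, FinalState w ⟨D.session qs, I.initState⟩ s → ∀ q ∈ qs.getLast?,
        (reported s).Nodup ∧ (reported s).toFinset = I.answer q) ∧
      expectedTime w ⟨D.session qs, I.initState⟩ ≤
        ((tp + qs.length * tq + (qs.map fun q => (I.answer q).card).sum * tr : ℝ≥0) : ℝ≥0∞)

namespace Par

theorem queries_valid {p : Par} (hp : p.Ok) {l : List (ℕ × ℕ × ℕ)} (hl : l ⊆ p.metas) :
    ∀ q ∈ l.map p.queryOf, q.1 < p.sys.A.length ∧ q.2 < p.sys.B.length := by
  intro q hq
  obtain ⟨x, hx, rfl⟩ := List.mem_map.1 hq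
  exact ⟨queryOf_fst_lt hp (hl hx), queryOf_snd_lt (hl hx)⟩

theorem correct_of_boundsAt {p : Par} (hp : p.Ok) {D : DataStructure} {N : ℕ} {tp tq tr : ℝ≥0}
    (hD : BoundsAt D p.w N tp tq tr) (hI : p.sys.IsInstance N) : Correct p D := fun _ hl =>
  (hD _ hI _ (queries_valid hp hl.subset)).1

/-- The guarantee is applied to the list of the queries that are actually asked, with its length and
its output replaced by bounds of which only the second depends on the multiplier, through `nearSet`.
-/
theorem session_le {p : Par} (hp : p.Ok) (hinj : ∀ i < p.l, ∀ j < p.l, p.X i = p.X j → i = j)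
    {D : DataStructure} {N : ℕ} {tp tq tr : ℝ≥0}
    (hD : BoundsAt D p.w N tp tq tr) (hI : p.sys.IsInstance N) :
    expectedTime p.w ⟨D.session ((p.metas.take p.numAsked).map p.queryOf), p.sys.initState⟩ ≤
      ((tp + (40 * (p.Lg * (2 ^ p.s * p.l)) : ℕ) * tq + (8 * p.Lg * p.nearSet.card + p.T : ℕ) * tr : ℝ≥0) :
        ℝ≥0∞) := by
  refine (hD _ hI _ (queries_valid hp (List.take_subset _ _))).2.trans ?_
  have h1 : ((p.metas.take p.numAsked).map p.queryOf).length ≤ 40 * (p.Lg * (2 ^ p.s * p.l)) := by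
    rw [List.length_map, List.length_take]
    exact (min_le_right _ _).trans p.metas_length_le'
  have h2 : (((p.metas.take p.numAsked).map p.queryOf).map fun q => (p.sys.answer q).card).sum ≤
      8 * p.Lg * p.nearSet.card + p.T := by
    rw [List.map_map]
    exact sum_card_answer_le hp hinj
  gcongr

end Par

/-- The parameters of the reduction for the input `A`. -/
def ofInput (p₁ p₂ d w : ℕ) (A : List ℤ) : Par where
  w := w
  l := A.length
  X := fun i => (A.map (ThreeSum.encode w)).getD i 0
  α := 0
  Lg := Nat.size A.length
  s := p₁ * Nat.size A.length / d
  r := p₂ * Nat.size A.length / d + 1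

theorem size_le_log (n : ℕ) : Nat.size n ≤ Nat.log 2 n + 1 :=
  Nat.size_le.2 (Nat.lt_pow_succ_log_self (by norm_num) n)

theorem mul_div_le_of_le {p d : ℕ} (h : p ≤ d) (m : ℕ) : p * m / d ≤ m :=
  (Nat.div_le_div_right (Nat.mul_le_mul_right m h)).trans (by
    rcases Nat.eq_zero_or_pos d with rfl | hd
    · simp
    · rw [Nat.mul_div_cancel_left _ hd])

/-- With m = log₂ l + 1, the product in `Ok.hbig` is at most 2^(6m+14), and 6m + 14 ≤ 20m. This is
the origin of the constant 20. -/
theorem ofInput_ok {p₁ p₂ d : ℕ} (h₁ : p₁ ≤ d) (h₂ : p₂ ≤ d) {w : ℕ} {A : List ℤ}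
    (hw : 20 * (Nat.log 2 A.length + 1) ≤ w) : (ofInput p₁ p₂ d w A).Ok := by
  have hsz := size_le_log A.length
  have hlt : A.length < 2 ^ Nat.size A.length := Nat.lt_size_self _
  have hs := mul_div_le_of_le h₁ (Nat.size A.length)
  have hr := mul_div_le_of_le h₂ (Nat.size A.length)
  refine ⟨?_, Nat.two_pow_pos _, fun i => ?_, hlt, fun h0 => ?_, ?_, ?_, ?_⟩
  · simp only [ofInput]; omega
  · simp only [ofInput]
    by_cases hi : i < (A.map (ThreeSum.encode w)).length
    · rw [List.getD_eq_getElem _ _ hi, List.getElem_map]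
      exact ThreeSum.encode_lt _ _
    · rw [List.getD_eq_default _ _ (by omega)]
      exact Nat.two_pow_pos _
  · change 2 ^ Nat.size A.length ≤ 2 * A.length
    have h0' : A.length ≠ 0 := h0
    have h3 : Nat.size A.length ≠ 0 := fun h => h0' (Nat.size_eq_zero.1 h)
    obtain ⟨k, hk⟩ := Nat.exists_eq_succ_of_ne_zero h3
    have := Nat.lt_size.1 (show k < Nat.size A.length by omega)
    rw [hk, Nat.pow_succ]; omega
  · simp [ofInput]
  · simp only [ofInput]; omega
  · simp only [ofInput, Par.NK, Par.Q]
    have hm : 1 ≤ Nat.log 2 A.length + 1 := Nat.le_add_left _ _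
    generalize p₁ * Nat.size A.length / d = s at *
    generalize p₂ * Nat.size A.length / d = r at *
    generalize Nat.log 2 A.length + 1 = m at *
    generalize Nat.size A.length = g at *
    generalize A.length = l at *
    have e1 : 4 * g * 2 ^ s + 1 ≤ 2 ^ (2 * m + 3) := by
      have h4 : g ≤ 2 ^ m := hsz.trans Nat.lt_two_pow_self.le
      calc 4 * g * 2 ^ s + 1 ≤ 4 * 2 ^ m * 2 ^ m + 2 ^ (2 * m) := by
            gcongr
            · norm_num
            · omega
            · exact Nat.one_le_two_pow
        _ = 5 * 2 ^ (2 * m) := by ring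
        _ ≤ 8 * 2 ^ (2 * m) := by omega
        _ = _ := by ring
    have e2 : l + 1 ≤ 2 ^ m := by
      have := Nat.pow_le_pow_right (show 0 < 2 by norm_num) hsz
      omega
    have e3 : 2 ^ (r + 1) * 2 ^ (r + 1) ≤ 2 ^ (2 * m + 2) := by
      rw [← pow_add]
      exact Nat.pow_le_pow_right (by norm_num) (by omega)
    calc _ ≤ 512 * (2 ^ (2 * m + 3) * (2 ^ m * (2 ^ m * 2 ^ (2 * m + 2)))) := by gcongr
      _ = 2 ^ (6 * m + 14) := by ring
      _ ≤ _ := Nat.pow_le_pow_right (by norm_num) (by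
          omega)

/-- The time of the reduction apart from the time of the data structure. -/
theorem Par.program_cost_le {p : Par} (hp : p.Ok)
    (hinj : ∀ i < p.l, ∀ j < p.l, p.X i = p.X j → i = j) (hLg : p.Lg = Nat.size p.l) (hs : p.s ≤ p.Lg) :
    (prepare.width + 1) * p.prepareCost + 2 +
      factor * (((p.metas.take p.numAsked).map fun x => p.queryCost x + 1).sum + 1) ≤
    (3000 * (prepare.width + 1) + 2 + 400 * factor) * ((p.Lg + 1) * ((p.l + 1) * (2 ^ p.s + 2 ^ p.r))) +
      p.nearSet.card * (144 * factor * p.Lg) := by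
  have h1 := prepareCost_le hp hLg hs
  have h2 := sum_queryCost_le hp hinj
  have h3 := p.metas_length_le'
  have h4 : p.Lg * (2 ^ p.s * p.l) ≤ (p.Lg + 1) * ((p.l + 1) * (2 ^ p.s + 2 ^ p.r)) := by
    rw [mul_comm (2 ^ p.s)]
    gcongr <;> exact Nat.le_add_right _ _
  have h5 : p.l + 1 ≤ (p.Lg + 1) * ((p.l + 1) * (2 ^ p.s + 2 ^ p.r)) := by
    have : 1 ≤ 2 ^ p.s + 2 ^ p.r := Nat.one_le_two_pow.trans (Nat.le_add_right _ _)
    calc p.l + 1 = 1 * ((p.l + 1) * 1) := by ring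
      _ ≤ _ := by gcongr; omega
  obtain ⟨V, hV⟩ : ∃ V, V = (p.Lg + 1) * ((p.l + 1) * (2 ^ p.s + 2 ^ p.r)) := ⟨_, rfl⟩
  rw [← hV] at h1 h4 h5 ⊢
  calc _ ≤ (prepare.width + 1) * (3000 * V) + 2 * V +
        factor * (9 * (40 * V) + 18 * (8 * p.Lg * p.nearSet.card + V) + V) := by
        have h6 : ((p.metas.take p.numAsked).map fun x => p.queryCost x + 1).sum + 1 ≤
            9 * (40 * V) + 18 * (8 * p.Lg * p.nearSet.card + V) + V := by
          generalize p.Lg * (2 ^ p.s * p.l) = v1 at *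
          omega
        gcongr
        omega
    _ ≤ (3000 * (prepare.width + 1) + 2 + 400 * factor) * V +
      p.nearSet.card * (144 * factor * p.Lg) := by
        have : 379 * (factor * V) ≤ 400 * (factor * V) := by gcongr; norm_num
        nlinarith

theorem spec_program_of_boundsAt {D : DataStructure} {p₁ p₂ d : ℕ} {p : Par} (hp : p.Ok)
    (hd : d < 2 ^ p.w) (h₁ : p₁ * p.Lg < 2 ^ p.w) (h₁' : p₁ < 2 ^ p.w) (h₂ : p₂ * p.Lg < 2 ^ p.w)
    (h₂' : p₂ < 2 ^ p.w) (hLg : p.Lg = Nat.size p.l) (hs : p.s = p₁ * p.Lg / d)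
    (hr : p.r = p₂ * p.Lg / d + 1) (hsL : p.s ≤ p.Lg) (hrL : p.r ≤ p.Lg + 1) {A : List ℤ}
    (hA : p.Input A) {N F : ℕ} {tp tq tr : ℝ≥0} (hD : BoundsAt D p.w N tp tq tr)
    (hN : 33 * ((p.Lg + 1) * ((p.l + 1) * 2 ^ p.r)) ≤ N) (hF : p.l ^ 3 ≤ F * (2 ^ p.s * p.Q)) :
    Spec p.w ⟨[program D p₁ p₂ d], ThreeSum.initState p.w A⟩
      (((((setUp p₁ p₂ d).width + 1) * (2 * p.Lg + 4 * p.l + 30) + 4 +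
        (3000 * (prepare.width + 1) + 2 + 400 * factor) * ((p.Lg + 1) * ((p.l + 1) * (2 ^ p.s + 2 ^ p.r))) +
        8 * F * (144 * factor * p.Lg) : ℕ) +
        (tp + (40 * (p.Lg * (2 ^ p.s * p.l)) : ℕ) * tq + (64 * p.Lg * F + p.T : ℕ) * tr) : ℝ≥0) : ℝ≥0∞)
      (fun s => s.reg 0 ≠ 0 ↔ ThreeSum.HasWitness A) := by
  have hI : ∀ a < 2 ^ p.w, ({ p with α := a } : Par).sys.IsInstance N := fun a ha =>
    Par.isInstance_of_le (hp.with_alpha ha) hLg hsL hrL hN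
  -- For a fixed multiplier the budget is affine in the number of near triples, with coefficients K₀
  -- and K₁ that do not depend on the multiplier. So the mean of that number is all that is needed.
  set K₀ : ℝ≥0∞ := ((((3000 * (prepare.width + 1) + 2 + 400 * factor) *
    ((p.Lg + 1) * ((p.l + 1) * (2 ^ p.s + 2 ^ p.r))) : ℕ) +
    (tp + (40 * (p.Lg * (2 ^ p.s * p.l)) : ℕ) * tq + (p.T : ℕ) * tr) : ℝ≥0) : ℝ≥0∞) with hK₀
  set K₁ : ℝ≥0∞ := (((144 * factor * p.Lg : ℕ) + (8 * p.Lg : ℕ) * tr : ℝ≥0) : ℝ≥0∞) with hK₁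
  refine (spec_program hp hd h₁ h₁' h₂ h₂' hLg hs hr hA
    (fun a ha => Par.correct_of_boundsAt (hp.with_alpha ha) hD (hI a ha))
    (E := fun a => K₀ + (({ p with α := a } : Par).nearSet.card : ℝ≥0∞) * K₁) ?_).mono ?_
  · intro a ha q hq
    have e : K₀ + (q.nearSet.card : ℝ≥0∞) * K₁ = (((3000 * (prepare.width + 1) + 2 + 400 * factor) *
        ((q.Lg + 1) * ((q.l + 1) * (2 ^ q.s + 2 ^ q.r))) +
        q.nearSet.card * (144 * factor * q.Lg) : ℕ) : ℝ≥0∞) + ((tp + (40 * (q.Lg * (2 ^ q.s * q.l)) : ℕ) * tq +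
          (8 * q.Lg * q.nearSet.card + q.T : ℕ) * tr : ℝ≥0) : ℝ≥0∞) := by
      have e1 : q.Lg = p.Lg := by rw [hq]
      have e2 : q.l = p.l := by rw [hq]
      have e3 : q.s = p.s := by rw [hq]
      have e4 : q.r = p.r := by rw [hq]
      have e5 : q.T = p.T := by rw [hq]; rfl
      rw [hK₀, hK₁, e1, e2, e3, e4, e5]
      push_cast
      ring
    have hqw : p.w = q.w := by rw [hq]
    have hqo : q.Ok := hq ▸ hp.with_alpha ha
    have hqA : q.Input A := by subst hq; exact ⟨hA.inst, hA.len, hA.X⟩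
    have hinj : ∀ i < q.l, ∀ j < q.l, q.X i = q.X j → i = j := fun i hi j hj => hqA.inj hqo hi hj
    have hqI : q.sys.IsInstance N := hq ▸ hI a ha
    have hqD : BoundsAt D q.w N tp tq tr := by rw [hq]; exact hD
    have c1 := Par.program_cost_le hqo hinj (by rw [hq]; exact hLg) (by rw [hq]; exact hsL)
    have c2 := Par.session_le hqo hinj hqD hqI
    rw [hqw]
    refine (add_le_add (Nat.cast_le.2 c1) c2).trans (e.symm.trans ?_).le
    rw [hq]
  · have h5 : avg p.w (fun x => (({ p with α := x ||| 1 } : Par).nearSet.card : ℝ≥0∞)) ≤ 8 * F := by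
      refine (Par.avg_nearSet_le hp).trans ?_
      have h0 : ((2 ^ p.s * p.Q : ℕ) : ℝ≥0∞) ≠ 0 := by
        have : 0 < 2 ^ p.s * p.Q := by unfold Par.Q; positivity
        exact_mod_cast this.ne'
      rw [ENNReal.div_le_iff h0 (ENNReal.natCast_ne_top _), mul_assoc]
      gcongr
      exact_mod_cast hF
    rw [avg_add, avg_const, avg_mul_right]
    refine (add_le_add_right (add_le_add_right (mul_le_mul_left h5 _) _) _).trans (le_of_eq ?_)
    rw [hK₀, hK₁]
    push_cast
    ring

theorem two_pow_add_lt {c m w : ℕ} (hw : (c + 1) * m ≤ w) (hm : 1 ≤ m) : c * m < 2 ^ w := by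
  have h1 : c * m < w := by
    have : (c + 1) * m = c * m + m := by ring
    omega
  exact h1.trans Nat.lt_two_pow_self

/-- The program works with the actual number l of elements, while time is measured by the bound n ≥
l; primed quantities belong to n. -/
theorem total_le {c₁ c₂ c₃ g g' l n S S' R R' F T T' : ℕ} (hg : g ≤ g') (hl : l ≤ n) (hS : S ≤ S')
    (hR : R ≤ R') (hT : T ≤ T') (hS0 : 1 ≤ S') {tp tq tr : ℝ≥0} :
    ((c₁ * (2 * g + 4 * l + 30) + 4 + c₂ * ((g + 1) * ((l + 1) * (S + R))) +
        8 * F * (144 * c₃ * g) : ℕ) : ℝ≥0) +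
        (tp + (40 * (g * (S * l)) : ℕ) * tq + (64 * g * F + T : ℕ) * tr) ≤
      (((34 * c₁ + 4 + c₂ + 1152 * c₃) * ((g' + 1) * ((n + 1) * (S' + R') + F)) : ℕ) : ℝ≥0) +
        (tp + (40 * (g' * (S' * n)) : ℕ) * tq + (64 * g' * F + T' : ℕ) * tr) := by
  refine add_le_add (Nat.cast_le.2 ?_) (by gcongr)
  have e2 : 2 * g + 4 * l + 30 ≤ 34 * ((g' + 1) * ((n + 1) * (S' + R') + F)) := by
    have e3 : (g' + 1) * (n + 1) ≤ (g' + 1) * ((n + 1) * (S' + R') + F) := by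
      refine Nat.mul_le_mul_left _ ((Nat.le_mul_of_pos_right _ ?_).trans (Nat.le_add_right _ _))
      omega
    have e4 : (g' + 1) * (n + 1) = g' * n + g' + n + 1 := by ring
    omega
  have e5 : (g + 1) * ((l + 1) * (S + R)) ≤ (g' + 1) * ((n + 1) * (S' + R') + F) := by
    gcongr
    exact (by gcongr : (l + 1) * (S + R) ≤ (n + 1) * (S' + R')).trans (Nat.le_add_right _ _)
  have e6 : F * g ≤ (g' + 1) * ((n + 1) * (S' + R') + F) := by
    rw [mul_comm]
    exact Nat.mul_le_mul (by omega) (Nat.le_add_left _ _)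
  have e7 : 1 ≤ (g' + 1) * ((n + 1) * (S' + R') + F) :=
    Nat.mul_pos (by omega) (Nat.add_pos_left (Nat.mul_pos (by omega) (by omega)) _)
  generalize (g' + 1) * ((n + 1) * (S' + R') + F) = V at *
  calc _ ≤ c₁ * (34 * V) + 4 * V + c₂ * V + 1152 * c₃ * V := by
        have : 8 * F * (144 * c₃ * g) = 1152 * c₃ * (F * g) := by ring
        rw [this]
        gcongr
        omega
    _ = _ := by ring

/-- A data structure for SetIntersection solves 3SUM. -/
theorem exists_solves {D : DataStructure} {tp tq tr : ℕ → ℝ≥0} (hD : D.HasBounds tp tq tr)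
    {p₁ p₂ d : ℕ} (h₁ : p₁ ≤ d) (h₂ : p₂ ≤ d) :
    ∃ C : ℕ, ∀ (e : ℕ) (N F F' : ℕ → ℕ), (∀ n, Nat.log 2 (N n) ≤ e * (Nat.log 2 n + 1)) →
      (∀ n, 33 * ((Nat.size n + 1) * ((n + 1) * 2 ^ (p₂ * Nat.size n / d + 1))) ≤ N n) →
      (∀ n, ∀ l ≤ n, l ^ 3 ≤ F n * (2 ^ (p₁ * Nat.size l / d) *
        (2 ^ (p₂ * Nat.size l / d + 1) * 2 ^ (p₂ * Nat.size l / d + 1)))) →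
      (∀ n, ∀ l ≤ n, l / 2 ^ (p₁ * Nat.size l / d) + 1 ≤ F' n) →
      ThreeSum.Solves (program D p₁ p₂ d) fun n =>
        ((C * ((Nat.size n + 1) * ((n + 1) * (2 ^ (p₁ * Nat.size n / d) + 2 ^ (p₂ * Nat.size n / d + 1)) +
          F n)) : ℕ) : ℝ≥0) + (tp (N n) +
        (40 * (Nat.size n * (2 ^ (p₁ * Nat.size n / d) * n)) : ℕ) * tq (N n) +
        (64 * Nat.size n * F n + F' n : ℕ) * tr (N n)) := by
  obtain ⟨κ, hκ⟩ := hD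
  refine ⟨34 * ((setUp p₁ p₂ d).width + 1) + 4 + (3000 * (prepare.width + 1) + 2 + 400 * factor) +
    1152 * factor, fun e N F F' hNle hN hF hF' => ⟨20 + (d + 1) + κ * (e + 1), fun n w hw A hA => ?_⟩⟩
  have hm : 1 ≤ Nat.log 2 n + 1 := Nat.le_add_left _ _
  have hln : A.length ≤ n := hA.2.1
  have hlog : Nat.log 2 A.length ≤ Nat.log 2 n := Nat.log_mono_right hln
  have hsz : Nat.size A.length ≤ Nat.size n := Nat.size_le_size hln
  have hszl := size_le_log A.length
  -- The three summands provide for exact arithmetic, for the products of p₁, p₂ with the bit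
  -- length, and for the word length that the structure demands at size N n.
  have hw' : 20 * (Nat.log 2 n + 1) + (d + 1) * (Nat.log 2 n + 1) +
      κ * ((e + 1) * (Nat.log 2 n + 1)) ≤ w := by
    refine le_trans (le_of_eq ?_) hw; ring
  have hp := ofInput_ok h₁ h₂ (w := w) (A := A) (by omega)
  set p := ofInput p₁ p₂ d w A with hpdef
  have hpw : p.w = w := rfl
  have hd1 : ∀ c ≤ d, ∀ k ≤ Nat.log 2 n + 1, c * k < 2 ^ w := fun c hc k hk =>
    (Nat.mul_le_mul hc hk).trans_lt (two_pow_add_lt (c := d) (by omega) hm)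
  have hd2 : ∀ c ≤ d, c < 2 ^ w := fun c hc => by simpa using hd1 c hc 1 hm
  have hk : p.Lg ≤ Nat.log 2 n + 1 := by change Nat.size A.length ≤ _; omega
  have hDN : BoundsAt D p.w (N n) (tp (N n)) (tq (N n)) (tr (N n)) := by
    refine fun I hI qs hqs => hκ (N n) w ?_ I hI qs hqs
    refine le_trans (Nat.mul_le_mul_left κ ?_) ((Nat.le_add_left _ _).trans hw')
    have := hNle n
    rw [add_mul]; omega
  have main := spec_program_of_boundsAt (p₁ := p₁) (p₂ := p₂) (d := d) (F := F n) hp (hd2 d le_rfl)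
    (hd1 p₁ h₁ _ hk) (hd2 p₁ h₁) (hd1 p₂ h₂ _ hk) (hd2 p₂ h₂) rfl rfl rfl (mul_div_le_of_le h₁ _)
    (Nat.add_le_add_right (mul_div_le_of_le h₂ _) 1) (A := A) ⟨⟨hA.1, le_rfl, hA.2.2⟩, rfl, rfl⟩
    hDN ?_ (hF n _ hln)
  · refine ⟨main.2, main.1.trans (ENNReal.coe_le_coe.2 ?_)⟩
    have hS : 2 ^ (p₁ * Nat.size A.length / d) ≤ 2 ^ (p₁ * Nat.size n / d) := by gcongr; norm_num
    have hR : 2 ^ (p₂ * Nat.size A.length / d + 1) ≤ 2 ^ (p₂ * Nat.size n / d + 1) := by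
      gcongr; norm_num
    have hF2 := hF' n _ hln
    exact total_le hsz hln hS hR hF2 Nat.one_le_two_pow
  · refine le_trans ?_ (hN n)
    have e1 : p.Lg = Nat.size A.length := rfl
    have e2 : p.l = A.length := rfl
    have e3 : p.r = p₂ * Nat.size A.length / d + 1 := rfl
    rw [e1, e2, e3]
    gcongr
    norm_num

end Reduction

/-! ## Asymptotics -/

theorem isOmegaPowSubLittleO_of_forall {f : ℕ → ℝ} {c : ℝ}
    (h : ∀ ε > 0, ∀ᶠ n : ℕ in atTop, (n : ℝ) ^ (c - ε) ≤ f n) : IsOmegaPowSubLittleO f c := by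
  -- The exponent of f n in base n is log f n / log n; η is the amount by which it falls short of c,
  -- and each ε in the hypothesis eventually bounds this amount.
  refine ⟨fun n => max 0 (c - Real.log (f n) / Real.log n), ?_, ?_⟩
  · rw [Metric.tendsto_atTop']
    intro ε hε
    obtain ⟨m, hm⟩ := eventually_atTop.1 ((h (ε / 2) (half_pos hε)).and (eventually_ge_atTop 2))
    refine ⟨m, fun n hn => ?_⟩
    obtain ⟨h1, h2⟩ := hm n hn.le
    have hn2 : (2 : ℝ) ≤ n := by exact_mod_cast h2
    have hlog : 0 < Real.log n := Real.log_pos (by linarith)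
    have h3 := Real.log_le_log (by positivity) h1
    rw [Real.log_rpow (by linarith), ← le_div_iff₀ hlog] at h3
    rw [Real.dist_0_eq_abs, abs_of_nonneg (le_max_left _ _)]
    exact max_lt hε (by linarith)
  · refine IsBigO.of_bound 1 ?_
    filter_upwards [h 1 one_pos, eventually_ge_atTop 2] with n h1 h2
    have hn2 : (2 : ℝ) ≤ n := by exact_mod_cast h2
    have hn0 : (0 : ℝ) < n := by linarith
    have hlog : 0 < Real.log n := Real.log_pos (by linarith)
    have hf : 0 < f n := (by positivity : (0 : ℝ) < (n : ℝ) ^ (c - 1)).trans_le h1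
    rw [one_mul, Real.norm_of_nonneg (by positivity), Real.norm_of_nonneg hf.le]
    calc (n : ℝ) ^ (c - max 0 (c - Real.log (f n) / Real.log n))
        ≤ (n : ℝ) ^ (Real.log (f n) / Real.log n) :=
          Real.rpow_le_rpow_of_exponent_le (by linarith) (by linarith [le_max_right 0 (c - Real.log (f n) / Real.log n)])
      _ = f n := by
          rw [Real.rpow_def_of_pos hn0, mul_div_cancel₀ _ hlog.ne', Real.exp_log hf]

theorem eventually_mul_rpow_le (K : ℝ) {p q : ℝ} (hp : 0 ≤ p) (h : p < q) :
    ∀ᶠ n : ℕ in atTop, K * ((n : ℝ) + 1) ^ p ≤ (n : ℝ) ^ q := by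
  have h1 : Tendsto (fun n : ℕ => (n : ℝ) ^ (q - p)) atTop atTop :=
    (tendsto_rpow_atTop (sub_pos.2 h)).comp tendsto_natCast_atTop_atTop
  filter_upwards [h1.eventually_ge_atTop (|K| * 2 ^ p), eventually_ge_atTop 1] with n hn hn1
  have hn1' : (1 : ℝ) ≤ n := by exact_mod_cast hn1
  calc K * ((n : ℝ) + 1) ^ p ≤ |K| * (2 * n) ^ p := by
        gcongr
        · exact le_abs_self K
        · linarith
    _ = (|K| * 2 ^ p) * (n : ℝ) ^ p := by rw [Real.mul_rpow (by norm_num) (by linarith)]; ring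
    _ ≤ (n : ℝ) ^ (q - p) * (n : ℝ) ^ p := by gcongr
    _ = (n : ℝ) ^ q := by rw [← Real.rpow_add (by linarith)]; ring_nf

/-- Half of ε absorbs η, the other half the implied constant. Nonnegativity of f is needed because
the relation of growth only sees its absolute value. -/
theorem IsOmegaPowSubLittleO.eventually_le {f : ℕ → ℝ} {c : ℝ} (h : IsOmegaPowSubLittleO f c)
    (hf : ∀ n, 0 ≤ f n) {ε : ℝ} (hε : 0 < ε) : ∀ᶠ n : ℕ in atTop, (n : ℝ) ^ (c - ε) ≤ f n := by
  obtain ⟨η, hη, hO⟩ := h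
  obtain ⟨K, hK, hO⟩ := hO.exists_pos
  have h1 : Tendsto (fun n : ℕ => (n : ℝ) ^ (ε / 2)) atTop atTop :=
    (tendsto_rpow_atTop (half_pos hε)).comp tendsto_natCast_atTop_atTop
  filter_upwards [hO.bound, h1.eventually_ge_atTop K, hη.eventually_lt_const (half_pos hε),
    eventually_ge_atTop 1] with n h2 h3 h4 h5
  have hn1 : (1 : ℝ) ≤ n := by exact_mod_cast h5
  rw [Real.norm_of_nonneg (by positivity), Real.norm_of_nonneg (hf n)] at h2
  refine le_of_mul_le_mul_left ?_ hK
  calc K * (n : ℝ) ^ (c - ε) ≤ (n : ℝ) ^ (ε / 2) * (n : ℝ) ^ (c - ε) := by gcongr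
    _ = (n : ℝ) ^ (c - ε / 2) := by rw [← Real.rpow_add (by linarith)]; ring_nf
    _ ≤ (n : ℝ) ^ (c - η n) := Real.rpow_le_rpow_of_exponent_le hn1 (by linarith)
    _ ≤ _ := h2

/-- All logarithmic factors of the reduction are absorbed into an arbitrarily small power of n + 1;
n + 1 rather than n avoids exceptions at small n. -/
theorem size_add_one_le {ν : ℝ} (hν : 0 < ν) :
    ∃ K : ℝ, ∀ n : ℕ, (Nat.size n : ℝ) + 1 ≤ K * ((n : ℝ) + 1) ^ ν := by
  refine ⟨2 + 1 / (ν * Real.log 2), fun n => ?_⟩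
  have h2 : 0 < Real.log 2 := Real.log_pos (by norm_num)
  have hx : (1 : ℝ) ≤ (n : ℝ) + 1 := by linarith [n.cast_nonneg (α := ℝ)]
  have h1 : (Nat.size n : ℝ) ≤ Nat.log 2 n + 1 := by exact_mod_cast Reduction.size_le_log n
  have h3 : (Nat.log 2 n : ℝ) ≤ Real.log ((n : ℝ) + 1) / Real.log 2 := by
    have h4 : ((2 ^ Nat.log 2 n : ℕ) : ℝ) ≤ (n : ℝ) + 1 := by
      have : 2 ^ Nat.log 2 n ≤ n + 1 := by
        rcases Nat.eq_zero_or_pos n with rfl | hn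
        · simp
        · exact (Nat.pow_log_le_self 2 hn.ne').trans (Nat.le_succ n)
      exact_mod_cast this
    have h5 := Real.log_le_log (by positivity) h4
    push_cast at h5
    rw [Real.log_pow] at h5
    exact (le_div_iff₀ h2).2 h5
  have h4 := Real.log_le_rpow_div (by linarith : 0 ≤ (n : ℝ) + 1) hν
  have h5 : (1 : ℝ) ≤ ((n : ℝ) + 1) ^ ν := Real.one_le_rpow hx hν.le
  calc (Nat.size n : ℝ) + 1 ≤ 2 * 1 + Real.log ((n : ℝ) + 1) / Real.log 2 := by linarith
    _ ≤ 2 * ((n : ℝ) + 1) ^ ν + ((n : ℝ) + 1) ^ ν / ν / Real.log 2 := by gcongr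
    _ = _ := by field_simp

/-! ### Powers of two with rounded exponents -/

section Powers
variable {p d : ℕ}

theorem two_pow_size_le (n : ℕ) : (2 : ℝ) ^ Nat.size n ≤ 2 * ((n : ℝ) + 1) := by
  have : 2 ^ Nat.size n ≤ 2 * (n + 1) := by
    rcases h : Nat.size n with _ | k
    · simp; omega
    · have := Nat.lt_size.1 (show k < Nat.size n by omega)
      rw [pow_succ]; omega
  exact_mod_cast this

theorem two_pow_div_le (hd : 0 < d) (hp : p ≤ d) (n : ℕ) :
    (2 : ℝ) ^ (p * Nat.size n / d) ≤ 2 * ((n : ℝ) + 1) ^ ((p : ℝ) / d) := by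
  have hx : (1 : ℝ) ≤ (n : ℝ) + 1 := by linarith [n.cast_nonneg (α := ℝ)]
  have hd' : (0 : ℝ) < d := by exact_mod_cast hd
  have hpd : (p : ℝ) / d ≤ 1 := (div_le_one hd').2 (by exact_mod_cast hp)
  calc (2 : ℝ) ^ (p * Nat.size n / d) = (2 : ℝ) ^ ((p * Nat.size n / d : ℕ) : ℝ) := (Real.rpow_natCast _ _).symm
    _ ≤ (2 : ℝ) ^ ((Nat.size n : ℝ) * ((p : ℝ) / d)) := by
        refine Real.rpow_le_rpow_of_exponent_le (by norm_num) (Nat.cast_div_le.trans (le_of_eq ?_))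
        push_cast; ring
    _ = ((2 : ℝ) ^ Nat.size n) ^ ((p : ℝ) / d) := by rw [Real.rpow_mul (by norm_num), Real.rpow_natCast]
    _ ≤ (2 * ((n : ℝ) + 1)) ^ ((p : ℝ) / d) := by gcongr; exact two_pow_size_le n
    _ = 2 ^ ((p : ℝ) / d) * ((n : ℝ) + 1) ^ ((p : ℝ) / d) := Real.mul_rpow (by norm_num) (by linarith)
    _ ≤ 2 ^ (1 : ℝ) * ((n : ℝ) + 1) ^ ((p : ℝ) / d) := by gcongr; norm_num
    _ = _ := by rw [Real.rpow_one]

/-- Rounding the exponent down loses at most a factor 2. -/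
theorem le_two_pow_div (hd : 0 < d) (n : ℕ) :
    (n : ℝ) ^ ((p : ℝ) / d) ≤ 2 * (2 : ℝ) ^ (p * Nat.size n / d) := by
  have hd' : (0 : ℝ) < d := by exact_mod_cast hd
  have h1 : (n : ℝ) ≤ 2 ^ Nat.size n := by exact_mod_cast (Nat.lt_size_self n).le
  calc (n : ℝ) ^ ((p : ℝ) / d) ≤ ((2 : ℝ) ^ Nat.size n) ^ ((p : ℝ) / d) := by gcongr
    _ = (2 : ℝ) ^ ((Nat.size n : ℝ) * ((p : ℝ) / d)) := by rw [Real.rpow_mul (by norm_num), Real.rpow_natCast]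
    _ ≤ (2 : ℝ) ^ (((p * Nat.size n / d + 1 : ℕ)) : ℝ) := by
        refine Real.rpow_le_rpow_of_exponent_le (by norm_num) ?_
        rw [← mul_div_assoc, div_le_iff₀ hd']
        have := Nat.lt_div_mul_add (a := p * Nat.size n) hd
        have h2 : p * Nat.size n ≤ (p * Nat.size n / d + 1) * d := by rw [add_mul]; omega
        have : ((p * Nat.size n : ℕ) : ℝ) ≤ ((p * Nat.size n / d + 1) * d : ℕ) := by exact_mod_cast h2
        push_cast at this ⊢
        linarith
    _ = _ := by rw [Real.rpow_natCast, pow_succ]; ring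

end Powers

/-! ### The running time in terms of exponents -/

namespace Reduction

open SetIntersection

section Sizes
variable {p₁ p₂ d : ℕ}

/-- Three powers of two replace real powers of l, each at the price of a factor 2. The increment of
the exponent pays for the two of width r, so a single 2 remains. The rest, l^(3-a-2b), is monotone
in l because a and b are at most 1. -/
theorem cube_le (hd : 0 < d) (h₁ : p₁ ≤ d) (h₂ : p₂ ≤ d) {l n : ℕ} (hl : l ≤ n) :
    l ^ 3 ≤ ⌈2 * ((n : ℝ) + 1) ^ (3 - (p₁ : ℝ) / d - 2 * ((p₂ : ℝ) / d))⌉₊ *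
      (2 ^ (p₁ * Nat.size l / d) * (2 ^ (p₂ * Nat.size l / d + 1) * 2 ^ (p₂ * Nat.size l / d + 1))) := by
  rcases Nat.eq_zero_or_pos l with rfl | hl0
  · simp
  have hd' : (0 : ℝ) < d := by exact_mod_cast hd
  have ha : (p₁ : ℝ) / d ≤ 1 := (div_le_one hd').2 (by exact_mod_cast h₁)
  have hb : (p₂ : ℝ) / d ≤ 1 := (div_le_one hd').2 (by exact_mod_cast h₂)
  have e1 := le_two_pow_div (p := p₁) hd l
  have e2 := le_two_pow_div (p := p₂) hd l
  have hl0' : (0 : ℝ) < l := by exact_mod_cast hl0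
  have hln : (l : ℝ) ≤ n + 1 := by exact_mod_cast hl.trans (Nat.le_succ n)
  generalize (p₁ : ℝ) / d = a at *
  generalize (p₂ : ℝ) / d = b at *
  have key : (l : ℝ) ^ 3 ≤ ⌈2 * ((n : ℝ) + 1) ^ (3 - a - 2 * b)⌉₊ *
      (2 ^ (p₁ * Nat.size l / d) * (2 ^ (p₂ * Nat.size l / d + 1) * 2 ^ (p₂ * Nat.size l / d + 1))) := by
    rw [pow_succ 2 (p₂ * Nat.size l / d)]
    generalize (2 : ℝ) ^ (p₁ * Nat.size l / d) = S at *
    generalize (2 : ℝ) ^ (p₂ * Nat.size l / d) = R at *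
    have hS0 : 0 ≤ S := by linarith [(Real.rpow_nonneg hl0'.le a).trans e1]
    have hR0 : 0 ≤ R := by linarith [(Real.rpow_nonneg hl0'.le b).trans e2]
    calc (l : ℝ) ^ 3 = (l : ℝ) ^ (3 - a - 2 * b) * ((l : ℝ) ^ a * ((l : ℝ) ^ b * (l : ℝ) ^ b)) := by
          rw [← Real.rpow_natCast, ← Real.rpow_add hl0', ← Real.rpow_add hl0', ← Real.rpow_add hl0']
          congr 1; push_cast; ring
      _ ≤ ((n : ℝ) + 1) ^ (3 - a - 2 * b) * ((2 * S) * ((2 * R) * (2 * R))) := by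
          gcongr
          linarith
      _ = 2 * ((n : ℝ) + 1) ^ (3 - a - 2 * b) * (S * ((R * 2) * (R * 2))) := by ring
      _ ≤ _ := by
          gcongr
          exact Nat.le_ceil _
  exact_mod_cast key

theorem div_two_pow_le (hd : 0 < d) (h₁ : p₁ ≤ d) {l n : ℕ} (hl : l ≤ n) :
    l / 2 ^ (p₁ * Nat.size l / d) + 1 ≤ ⌈2 * ((n : ℝ) + 1) ^ (1 - (p₁ : ℝ) / d)⌉₊ + 1 := by
  rcases Nat.eq_zero_or_pos l with rfl | hl0
  · simp
  have hd' : (0 : ℝ) < d := by exact_mod_cast hd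
  have ha : (p₁ : ℝ) / d ≤ 1 := (div_le_one hd').2 (by exact_mod_cast h₁)
  have e1 := le_two_pow_div (p := p₁) hd l
  have hl0' : (0 : ℝ) < l := by exact_mod_cast hl0
  have hln : (l : ℝ) ≤ n + 1 := by exact_mod_cast hl.trans (Nat.le_succ n)
  refine Nat.add_le_add_right ?_ 1
  have h2 : ((l / 2 ^ (p₁ * Nat.size l / d) : ℕ) : ℝ) ≤ 2 * ((n : ℝ) + 1) ^ (1 - (p₁ : ℝ) / d) := by
    refine Nat.cast_div_le.trans ?_
    rw [div_le_iff₀ (by positivity)]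
    push_cast
    calc (l : ℝ) = (l : ℝ) ^ (1 - (p₁ : ℝ) / d) * (l : ℝ) ^ ((p₁ : ℝ) / d) := by
          rw [← Real.rpow_add hl0', sub_add_cancel, Real.rpow_one]
      _ ≤ ((n : ℝ) + 1) ^ (1 - (p₁ : ℝ) / d) * (2 * 2 ^ (p₁ * Nat.size l / d)) := by
          gcongr
      _ = _ := by ring
  exact_mod_cast h2.trans (Nat.le_ceil _)

end Sizes

/-- The least size of the instances of SetIntersection. -/
def minSize (p₂ d n : ℕ) : ℕ := 33 * ((Nat.size n + 1) * ((n + 1) * 2 ^ (p₂ * Nat.size n / d + 1)))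

theorem succ_le_two_pow (n : ℕ) : n + 1 ≤ 2 ^ (Nat.log 2 n + 1) :=
  Nat.lt_pow_succ_log_self (by norm_num) n

theorem log_minSize_le {p₂ d : ℕ} (h₂ : p₂ ≤ d) (n : ℕ) :
    Nat.log 2 (minSize p₂ d n) ≤ 13 * (Nat.log 2 n + 1) := by
  have h1 := size_le_log n
  have h2 := succ_le_two_pow n
  have h3 := mul_div_le_of_le h₂ (Nat.size n)
  have hm : 1 ≤ Nat.log 2 n + 1 := Nat.le_add_left _ _
  have h4 : minSize p₂ d n ≤ 2 ^ (13 * (Nat.log 2 n + 1)) := by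
    unfold minSize
    generalize p₂ * Nat.size n / d = r at *
    generalize Nat.log 2 n + 1 = m at *
    have h5 : Nat.size n + 1 ≤ 2 ^ m := by
      have : m < 2 ^ m := Nat.lt_two_pow_self
      omega
    calc _ ≤ 2 ^ 6 * (2 ^ m * (2 ^ m * 2 ^ (m + 1))) := by
          gcongr
          · norm_num
          · norm_num
          · omega
      _ = 2 ^ (3 * m + 7) := by ring
      _ ≤ _ := Nat.pow_le_pow_right (by norm_num) (by omega)
  exact (Nat.log_mono_right h4).trans (Nat.log_pow (by norm_num) _).le

/-- Sizes polynomial in n cost only a constant factor in the word length, which the definition of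
solving 3SUM permits. -/
theorem log_le_of_le_rpow {N n : ℕ} {τ : ℝ} (h : (N : ℝ) ≤ ((n : ℝ) + 1) ^ τ) :
    Nat.log 2 N ≤ ⌈τ⌉₊ * (Nat.log 2 n + 1) := by
  have h1 : (N : ℝ) ≤ ((n : ℝ) + 1) ^ ⌈τ⌉₊ := by
    rw [← Real.rpow_natCast]
    exact h.trans (Real.rpow_le_rpow_of_exponent_le (by linarith [n.cast_nonneg (α := ℝ)]) (Nat.le_ceil τ))
  have h2 : N ≤ (n + 1) ^ ⌈τ⌉₊ := by exact_mod_cast h1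
  have h3 : N ≤ 2 ^ (⌈τ⌉₊ * (Nat.log 2 n + 1)) := by
    rw [mul_comm, pow_mul]
    exact h2.trans (Nat.pow_le_pow_left (succ_le_two_pow n) _)
  exact (Nat.log_mono_right h3).trans (Nat.log_pow (by norm_num) _).le

/-- The time of the reduction in terms of the exponents. -/
theorem time_le {x S R F F' g n C K a b ν τ μ u v z tp tq tr : ℝ} (hx1 : 1 ≤ x) (hnx : n ≤ x)
    (hF0 : 0 ≤ F) (hg0 : 0 ≤ g) (hC : 0 ≤ C) (htq : 0 ≤ tq) (htr : 0 ≤ tr) (hn0 : 0 ≤ n)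
    (hv : 0 ≤ v) (hz : 0 ≤ z) (hτ0 : 0 ≤ τ) (c₁ : u * τ ≤ 2 - 2 * μ)
    (c₂ : 1 + a + v * τ ≤ 2 - 2 * μ) (c₃ : 3 - a - 2 * b + z * τ ≤ 2 - 2 * μ)
    (c₄ : 1 - a + z * τ ≤ 2 - 2 * μ) (c₅ : 1 + b ≤ 2 - 2 * μ)
    (hp : tp ≤ x ^ (u * τ)) (hq : tq ≤ x ^ (v * τ)) (hr : tr ≤ x ^ (z * τ)) (hS : S ≤ 2 * x ^ a)
    (hR : R ≤ 2 * x ^ b) (hF : F ≤ 3 * x ^ (3 - a - 2 * b)) (hF' : F' + 1 ≤ 4 * x ^ (1 - a))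
    (hg : g + 1 ≤ K * x ^ ν) :
    C * ((g + 1) * (x * (S + R * 2) + F)) + (tp + 40 * (g * (S * n)) * tq + (64 * g * F + (F' + 1)) * tr) ≤
      (9 * C + 300) * K * x ^ (2 - 2 * μ + ν) := by
  have hx0 : 0 < x := by linarith
  have hvτ : 0 ≤ v * τ := by positivity
  have hzτ : 0 ≤ z * τ := by positivity
  have hle' : ∀ e ≤ 2 - 2 * μ, x ^ e ≤ x ^ (2 - 2 * μ) := fun e he =>
    Real.rpow_le_rpow_of_exponent_le hx1 he
  have t1 : x * S ≤ 2 * x ^ (2 - 2 * μ) := by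
    calc x * S ≤ x * (2 * x ^ a) := by gcongr
      _ = 2 * x ^ (1 + a) := by rw [Real.rpow_add hx0, Real.rpow_one]; ring
      _ ≤ _ := mul_le_mul_of_nonneg_left (hle' _ (by linarith)) (by norm_num)
  have t2 : x * R ≤ 2 * x ^ (2 - 2 * μ) := by
    calc x * R ≤ x * (2 * x ^ b) := by gcongr
      _ = 2 * x ^ (1 + b) := by rw [Real.rpow_add hx0, Real.rpow_one]; ring
      _ ≤ _ := mul_le_mul_of_nonneg_left (hle' _ c₅) (by norm_num)
  have t3 : F ≤ 3 * x ^ (2 - 2 * μ) := hF.trans (mul_le_mul_of_nonneg_left (hle' _ (by linarith)) (by norm_num))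
  have t4 : tp ≤ x ^ (2 - 2 * μ) := hp.trans (hle' _ c₁)
  have t5 : S * n * tq ≤ 2 * x ^ (2 - 2 * μ) := by
    calc S * n * tq ≤ (2 * x ^ a) * x * x ^ (v * τ) := by gcongr
      _ = 2 * x ^ (1 + a + v * τ) := by
          rw [Real.rpow_add hx0, Real.rpow_add hx0, Real.rpow_one]; ring
      _ ≤ _ := mul_le_mul_of_nonneg_left (hle' _ c₂) (by norm_num)
  have t6 : F * tr ≤ 3 * x ^ (2 - 2 * μ) := by
    calc F * tr ≤ (3 * x ^ (3 - a - 2 * b)) * x ^ (z * τ) := by gcongr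
      _ = 3 * x ^ (3 - a - 2 * b + z * τ) := by rw [Real.rpow_add hx0 (3 - a - 2 * b)]; ring
      _ ≤ _ := mul_le_mul_of_nonneg_left (hle' _ c₃) (by norm_num)
  have t7 : (F' + 1) * tr ≤ 4 * x ^ (2 - 2 * μ) := by
    calc (F' + 1) * tr ≤ (4 * x ^ (1 - a)) * x ^ (z * τ) := by gcongr
      _ = 4 * x ^ (1 - a + z * τ) := by rw [Real.rpow_add hx0 (1 - a)]; ring
      _ ≤ _ := mul_le_mul_of_nonneg_left (hle' _ c₄) (by norm_num)
  have hX0 : 0 ≤ x ^ (2 - 2 * μ) := by positivity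
  rw [Real.rpow_add hx0 (2 - 2 * μ)]
  generalize x ^ (2 - 2 * μ) = X at *
  calc _ = C * ((g + 1) * (x * S + 2 * (x * R) + F)) + (tp + 40 * (g * (S * n * tq)) +
        64 * (g * (F * tr)) + (F' + 1) * tr) := by ring
    _ ≤ C * ((g + 1) * (2 * X + 2 * (2 * X) + 3 * X)) + (X + 40 * (g * (2 * X)) + 64 * (g * (3 * X)) + 4 * X) := by
        gcongr
    -- Here 9 = 2 + 4 + 3, and 300 covers 40·2 + 64·3 and the terms without the factor g.
    _ ≤ (9 * C + 300) * ((g + 1) * X) := by nlinarith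
    _ ≤ (9 * C + 300) * ((K * x ^ ν) * X) := by gcongr
    _ = _ := by ring

/-- A data structure for SetIntersection cannot be fast for infinitely many sizes. -/
theorem not_frequently_fast (h3SUM : ThreeSum.Conjecture) {D : DataStructure} {tp tq tr : ℕ → ℝ≥0}
    (hD : D.HasBounds tp tq tr) {p₁ p₂ d : ℕ} (hd : 0 < d) (h₁ : p₁ ≤ d) (h₂ : p₂ ≤ d)
    {a b τ μ u v z : ℝ} (ha : a = (p₁ : ℝ) / d) (hb : b = (p₂ : ℝ) / d) (hμ : 0 < μ)
    (hu : 0 ≤ u) (hv : 0 ≤ v) (hz : 0 ≤ z) (hτ : 1 + b < τ) (c₁ : u * τ ≤ 2 - 2 * μ)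
    (c₂ : 1 + a + v * τ ≤ 2 - 2 * μ) (c₃ : 3 - a - 2 * b + z * τ ≤ 2 - 2 * μ)
    (c₄ : 1 - a + z * τ ≤ 2 - 2 * μ) (c₅ : 1 + b ≤ 2 - 2 * μ) :
    ¬ ∃ᶠ N : ℕ in atTop, (tp N : ℝ) ≤ (N : ℝ) ^ u ∧ (tq N : ℝ) ≤ (N : ℝ) ^ v ∧ (tr N : ℝ) ≤ (N : ℝ) ^ z := by
  intro hfr
  classical
  have hd' : (0 : ℝ) < d := by exact_mod_cast hd
  have ha0 : 0 ≤ a := ha ▸ by positivity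
  have hb0 : 0 ≤ b := hb ▸ by positivity
  have ha1 : a ≤ 1 := ha ▸ (div_le_one hd').2 (by exact_mod_cast h₁)
  have hb1 : b ≤ 1 := hb ▸ (div_le_one hd').2 (by exact_mod_cast h₂)
  have hτ0 : 0 < τ := by linarith
  -- The exponent ν pays for logarithms twice: in the running time, which must stay below n^(2-μ),
  -- and in the size of the instance, which must stay below n^τ.
  obtain ⟨ν, hν, hνμ, hντ⟩ : ∃ ν > 0, ν ≤ μ / 2 ∧ 1 + b + ν < τ :=
    ⟨min (μ / 2) ((τ - 1 - b) / 2), lt_min (by linarith) (by linarith), min_le_left _ _, by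
      linarith [min_le_right (μ / 2) ((τ - 1 - b) / 2)]⟩
  obtain ⟨K, hK⟩ := size_add_one_le hν
  set P : ℕ → ℕ → Prop := fun n N => ((tp N : ℝ) ≤ (N : ℝ) ^ u ∧ (tq N : ℝ) ≤ (N : ℝ) ^ v ∧
    (tr N : ℝ) ≤ (N : ℝ) ^ z) ∧ minSize p₂ d n ≤ N ∧ (N : ℝ) ≤ ((n : ℝ) + 1) ^ τ with hP
  -- A good size N serves n = ⌊N^(1/τ)⌋: the instance for n needs size about n^(1+b), which is less
  -- than n^τ ≤ N ≤ (n+1)^τ. This n tends to infinity with N.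
  have hPfr : ∃ᶠ n in atTop, ∃ N, P n N := by
    have hfl : Tendsto (fun N : ℕ => ⌊(N : ℝ) ^ (1 / τ)⌋₊) atTop atTop :=
      tendsto_nat_floor_atTop.comp
        ((tendsto_rpow_atTop (by positivity)).comp tendsto_natCast_atTop_atTop)
    refine hfl.frequently ((hfr.and_eventually
      (hfl.eventually (eventually_mul_rpow_le (132 * K) (by linarith) hντ))).mono ?_)
    rintro N ⟨h1, h2⟩
    refine ⟨N, h1, ?_, ?_⟩
    · set n := ⌊(N : ℝ) ^ (1 / τ)⌋₊ with hn
      have h3 : (n : ℝ) ^ τ ≤ N := by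
        calc (n : ℝ) ^ τ ≤ ((N : ℝ) ^ (1 / τ)) ^ τ := by
              gcongr
              exact Nat.floor_le (by positivity)
          _ = N := by
              rw [← Real.rpow_mul (by positivity), one_div, inv_mul_cancel₀ hτ0.ne', Real.rpow_one]
      have h4 : (minSize p₂ d n : ℝ) ≤ 132 * K * ((n : ℝ) + 1) ^ (1 + b + ν) := by
        have h5 := two_pow_div_le hd h₂ n
        have hx : (0 : ℝ) < (n : ℝ) + 1 := by positivity
        have h6 := (by positivity : (0 : ℝ) ≤ (Nat.size n : ℝ) + 1).trans (hK n)
        unfold minSize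
        push_cast
        rw [← hb] at h5
        rw [pow_succ]
        calc _ ≤ 33 * ((K * ((n : ℝ) + 1) ^ ν) * (((n : ℝ) + 1) * (2 * ((n : ℝ) + 1) ^ b * 2))) := by
              gcongr
              exact hK n
          _ = 132 * K * (((n : ℝ) + 1) ^ (1 : ℝ) * ((n : ℝ) + 1) ^ b * ((n : ℝ) + 1) ^ ν) := by
              rw [Real.rpow_one]; ring
          _ = _ := by rw [← Real.rpow_add hx, ← Real.rpow_add hx]
      exact_mod_cast h4.trans (h2.trans h3)
    · calc (N : ℝ) = ((N : ℝ) ^ (1 / τ)) ^ τ := by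
            rw [← Real.rpow_mul (by positivity), one_div, inv_mul_cancel₀ hτ0.ne', Real.rpow_one]
        _ ≤ _ := by
            gcongr
            exact (Nat.lt_floor_add_one _).le
  -- The program does not know N; it is only the size at which its time is analysed. Where no good
  -- size exists any admissible one will do, since the time bound then merely has to be finite.
  set N : ℕ → ℕ := fun n => if h : ∃ N, P n N then h.choose else minSize p₂ d n with hN
  have hNP : ∀ n, (∃ N, P n N) → P n (N n) := fun n h => by
    simp only [hN, dif_pos h]; exact h.choose_spec
  have hNlog : ∀ n, Nat.log 2 (N n) ≤ (⌈τ⌉₊ + 13) * (Nat.log 2 n + 1) := by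
    intro n
    rw [add_mul]
    by_cases h : ∃ N, P n N
    · exact (log_le_of_le_rpow (hNP n h).2.2).trans (Nat.le_add_right _ _)
    · simp only [hN, dif_neg h]
      exact (log_minSize_le h₂ n).trans (Nat.le_add_left _ _)
  have hNmin : ∀ n, minSize p₂ d n ≤ N n := by
    intro n
    by_cases h : ∃ N, P n N
    · exact (hNP n h).2.1
    · simp only [hN, dif_neg h]; exact le_rfl
  obtain ⟨C, hC⟩ := exists_solves hD h₁ h₂
  have hsol := hC (⌈τ⌉₊ + 13) N (fun n => ⌈2 * ((n : ℝ) + 1) ^ (3 - (p₁ : ℝ) / d - 2 * ((p₂ : ℝ) / d))⌉₊)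
    (fun n => ⌈2 * ((n : ℝ) + 1) ^ (1 - (p₁ : ℝ) / d)⌉₊ + 1) hNlog hNmin
    (fun n l hl => cube_le hd h₁ h₂ hl) (fun n l hl => div_two_pow_le hd h₁ hl)
  rw [← ha, ← hb] at hsol
  -- The conjecture bounds the time from below at all large n, whereas it is small at infinitely
  -- many n. One common n gives the contradiction.
  have hΩ := (h3SUM _ _ hsol).eventually_le (fun n => NNReal.coe_nonneg _) (half_pos hμ)
  have hbig := eventually_mul_rpow_le ((9 * C + 300) * K) (p := 2 - 2 * μ + ν) (q := 2 - μ) (by linarith)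
    (by linarith)
  obtain ⟨n, hn, h1, h2, h3⟩ := (hPfr.and_eventually (hΩ.and (hbig.and (eventually_ge_atTop 2)))).exists
  obtain ⟨⟨hp, hq, hr⟩, -, hle⟩ := hNP n hn
  have hn2 : (2 : ℝ) ≤ n := by exact_mod_cast h3
  have hlt : (n : ℝ) ^ (2 - μ) < (n : ℝ) ^ (2 - μ / 2) :=
    Real.rpow_lt_rpow_of_exponent_lt (by linarith) (by linarith)
  refine absurd (h1.trans ?_) (not_le.2 (h2.trans_lt hlt))
  have hx1 : (1 : ℝ) ≤ (n : ℝ) + 1 := by linarith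
  have hS := two_pow_div_le hd h₁ n
  have hR := two_pow_div_le hd h₂ n
  rw [← ha] at hS
  rw [← hb] at hR
  have hg := hK n
  have hpow : ∀ w, 0 ≤ w → (N n : ℝ) ^ w ≤ ((n : ℝ) + 1) ^ (w * τ) := fun w hw => by
    rw [mul_comm, Real.rpow_mul (by linarith)]
    gcongr
  replace hp := hp.trans (hpow u hu)
  replace hq := hq.trans (hpow v hv)
  replace hr := hr.trans (hpow z hz)
  have hnx : (n : ℝ) ≤ (n : ℝ) + 1 := by linarith
  push_cast
  rw [pow_succ]
  have hF : (⌈2 * ((n : ℝ) + 1) ^ (3 - a - 2 * b)⌉₊ : ℝ) ≤ 3 * ((n : ℝ) + 1) ^ (3 - a - 2 * b) := by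
    have h4 := (Nat.ceil_lt_add_one (show 0 ≤ 2 * ((n : ℝ) + 1) ^ (3 - a - 2 * b) by positivity)).le
    have h5 := Real.one_le_rpow hx1 (show 0 ≤ 3 - a - 2 * b by linarith)
    linarith
  have hF' : (⌈2 * ((n : ℝ) + 1) ^ (1 - a)⌉₊ : ℝ) + 1 ≤ 4 * ((n : ℝ) + 1) ^ (1 - a) := by
    have h4 := (Nat.ceil_lt_add_one (show 0 ≤ 2 * ((n : ℝ) + 1) ^ (1 - a) by positivity)).le
    have h5 := Real.one_le_rpow hx1 (show 0 ≤ 1 - a by linarith)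
    linarith
  exact time_le hx1 hnx (by positivity) (by positivity) (by positivity) (NNReal.coe_nonneg _)
    (NNReal.coe_nonneg _) (by positivity) hv hz hτ0.le c₁ c₂ c₃ c₄ c₅ hp hq hr hS hR hF hF' hg

end Reduction

/-! ### Choice of the parameters for δ < 1 + γ -/

namespace Reduction

open SetIntersection

/-- A program can contain only integers, so its exponents are rational. Rounding up keeps the number
of false positives small at an arbitrarily small cost elsewhere. -/
theorem exists_ratio {d : ℕ} (hd : 0 < d) {y : ℝ} (hy0 : 0 ≤ y) (hy1 : y ≤ 1) :
    ∃ p : ℕ, p ≤ d ∧ y ≤ (p : ℝ) / d ∧ (p : ℝ) / d ≤ y + 1 / d := by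
  have hd' : (0 : ℝ) < d := by exact_mod_cast hd
  refine ⟨⌈y * d⌉₊, Nat.ceil_le.2 (mul_le_of_le_one_left hd'.le hy1), ?_, ?_⟩
  · rw [le_div_iff₀ hd']; exact Nat.le_ceil _
  · rw [div_le_iff₀ hd', add_mul, one_div, inv_mul_cancel₀ hd'.ne']
    exact (Nat.ceil_lt_add_one (by positivity)).le

/-- Conversion of exponents of N into exponents of n, where N is about n^τ and τ slightly exceeds
D/2; the loss ε outweighs this excess. -/
theorem sub_mul_le {y D ε ε₁ : ℝ} (hy4 : y ≤ 4) (hD : 2 ≤ D) (hε : 0 ≤ ε) (hε₁ : 0 ≤ ε₁) :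
    (y / D - ε) * (D / 2 + 2 * ε₁) ≤ y / 2 - ε + 4 * ε₁ := by
  have h1 : y / D * (D / 2) = y / 2 := by field_simp
  have h2 : y / D ≤ 2 := (div_le_iff₀ (by linarith)).2 (by linarith)
  have h3 : y / D * ε₁ ≤ 2 * ε₁ := by gcongr
  have h4 : ε * 2 ≤ ε * D := by gcongr
  have h5 : 0 ≤ ε * ε₁ := by positivity
  calc _ = y / D * (D / 2) + 2 * (y / D * ε₁) - ε * D / 2 - 2 * (ε * ε₁) := by ring
    _ ≤ _ := by rw [h1]; linarith

theorem le_rpow_sub {N : ℕ} (hN : 1 ≤ N) {t e u : ℝ} (h : (N : ℝ) ^ e * t ≤ (N : ℝ) ^ u) :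
    t ≤ (N : ℝ) ^ (u - e) := by
  have hN' : (0 : ℝ) < N := by exact_mod_cast hN
  rw [Real.rpow_sub hN', le_div_iff₀ (by positivity), mul_comm]
  exact h

/-- The lower bound if reporting is cheap. -/
theorem omega_of_lt (h3SUM : ThreeSum.Conjecture) {γ δ : ℝ} (hγ0 : 0 ≤ γ) (hγ1 : γ < 1) (hδ : 0 < δ)
    (hδγ : δ < 1 + γ) {D : DataStructure} {tp tq tr : ℕ → ℝ≥0} (hD : D.HasBounds tp tq tr) :
    IsOmegaPowSubLittleO
      (fun N : ℕ => (tp N : ℝ)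
        + (N : ℝ) ^ (2 * (1 + γ) / (3 + δ - γ)) * (tq N : ℝ)
        + (N : ℝ) ^ (2 * (2 - δ) / (3 + δ - γ)) * (tr N : ℝ))
      (4 / (3 + δ - γ)) := by
  refine isOmegaPowSubLittleO_of_forall fun ε₀ hε₀ => ?_
  by_contra hcon
  rw [not_eventually] at hcon
  simp only [not_le] at hcon
  set Δ := 3 + δ - γ with hΔ
  have hΔ2 : 2 ≤ Δ := by linarith
  have hΔ0 : 0 < Δ := by linarith
  -- The first bounds after ε₀ keep the exponents of the three times nonnegative; the last keeps the
  -- size n^(1+b) of the instance below n². It exists because δ < 1 + γ.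
  obtain ⟨ε, hε, hεε, e1, e2, e3, e4⟩ : ∃ ε > 0, ε ≤ ε₀ ∧ ε ≤ 4 / Δ ∧ ε ≤ 2 * (1 - γ) / Δ ∧
      ε ≤ 2 * δ / Δ ∧ ε ≤ (1 + γ - δ) / 2 := by
    have h1 : 0 < 2 * (1 - γ) / Δ := div_pos (by linarith) hΔ0
    have h2 : 0 < 2 * δ / Δ := by positivity
    have h3 : 0 < (1 + γ - δ) / 2 := by linarith
    have h4 : 0 < 4 / Δ := by positivity
    refine ⟨min ε₀ (min (4 / Δ) (min (2 * (1 - γ) / Δ) (min (2 * δ / Δ) ((1 + γ - δ) / 2)))), ?_, ?_⟩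
    · exact lt_min hε₀ (lt_min h4 (lt_min h1 (lt_min h2 h3)))
    · simp
  obtain ⟨d, hd⟩ := exists_nat_gt (8 / ε)
  have hd' : (0 : ℝ) < d := lt_trans (by positivity) hd
  have hd0 : 0 < d := by exact_mod_cast hd'
  have hdε : 1 / (d : ℝ) ≤ ε / 8 := by
    rw [one_div_le hd' (by positivity), one_div_div]
    exact hd.le
  clear hd
  obtain ⟨p₁, h₁, a1, a2⟩ := exists_ratio hd0 hγ0 hγ1.le
  obtain ⟨p₂, h₂, b1, b2⟩ := exists_ratio hd0 (y := (1 + δ - γ) / 2) (by linarith) (by linarith)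
  obtain ⟨a, ha⟩ : ∃ a, a = (p₁ : ℝ) / d := ⟨_, rfl⟩
  obtain ⟨b, hb⟩ : ∃ b, b = (p₂ : ℝ) / d := ⟨_, rfl⟩
  rw [← ha] at a1 a2
  rw [← hb] at b1 b2
  replace a2 := a2.trans (add_le_add_right hdε γ)
  replace b2 := b2.trans (add_le_add_right hdε _)
  have t1 := sub_mul_le (y := 4) (D := Δ) (ε := ε) (ε₁ := ε / 8) le_rfl hΔ2 hε.le (by positivity)
  have t2 := sub_mul_le (y := 2 * (1 - γ)) (D := Δ) (ε := ε) (ε₁ := ε / 8) (by linarith) hΔ2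
    hε.le (by positivity)
  have t3 := sub_mul_le (y := 2 * δ) (D := Δ) (ε := ε) (ε₁ := ε / 8) (by linarith) hΔ2
    hε.le (by positivity)
  -- The exponents v and z are 4/Δ - ε minus the exponents of the factors in front of the query and
  -- reporting times. All slack is counted in units ε/8: one for the rounding of a and b, two in τ,
  -- two as the gain 2μ.
  refine not_frequently_fast h3SUM hD hd0 h₁ h₂ ha hb (τ := Δ / 2 + 2 * (ε / 8)) (μ := ε / 8)
    (u := 4 / Δ - ε) (v := 2 * (1 - γ) / Δ - ε) (z := 2 * δ / Δ - ε) (by positivity) (by linarith)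
    (by linarith) (by linarith) (by linarith) (by linarith) (by linarith) (by linarith) (by linarith)
    (by linarith) ?_
  refine (hcon.and_eventually (eventually_ge_atTop 1)).mono ?_
  rintro N ⟨hN, hN1⟩
  have hN1' : (1 : ℝ) ≤ N := by exact_mod_cast hN1
  have hN2 := hN.le.trans (Real.rpow_le_rpow_of_exponent_le hN1' (by linarith : 4 / Δ - ε₀ ≤ 4 / Δ - ε))
  have f1 : 0 ≤ (tp N : ℝ) := NNReal.coe_nonneg _
  have f2 : 0 ≤ (N : ℝ) ^ (2 * (1 + γ) / Δ) * (tq N : ℝ) := by positivity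
  have f3 : 0 ≤ (N : ℝ) ^ (2 * (2 - δ) / Δ) * (tr N : ℝ) := by positivity
  refine ⟨by linarith, ?_, ?_⟩
  · have := le_rpow_sub hN1 (show (N : ℝ) ^ (2 * (1 + γ) / Δ) * (tq N : ℝ) ≤ (N : ℝ) ^ (4 / Δ - ε) by linarith)
    rwa [show 4 / Δ - ε - 2 * (1 + γ) / Δ = 2 * (1 - γ) / Δ - ε by field_simp; ring] at this
  · have := le_rpow_sub hN1 (show (N : ℝ) ^ (2 * (2 - δ) / Δ) * (tr N : ℝ) ≤ (N : ℝ) ^ (4 / Δ - ε) by linarith)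
    rwa [show 4 / Δ - ε - 2 * (2 - δ) / Δ = 2 * δ / Δ - ε by field_simp; ring] at this

end Reduction

/-! ## The cells of the input that are read -/

namespace WordRAM

/-- The configurations differ at most in cell `i` of array `0`. -/
structure AgreeOff (i : ℕ) (c c' : Config) : Prop where
  todo : c.todo = c'.todo
  reg : c.state.reg = c'.state.reg
  mem : ∀ a j, ¬ (a = 0 ∧ j = i) → c.state.mem a j = c'.state.mem a j

/-- The cells of array `0` that are read in the next step. -/
def Config.reads : Config → Finset ℕ
  | ⟨.load _ 0 a :: _, s⟩ => {s.reg a}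
  | _ => ∅

theorem Config.card_reads_le (c : Config) : c.reads.card ≤ 1 := by
  unfold Config.reads
  split <;> simp

/-- Only a load can transfer the differing cell to the registers. Control flow depends on registers
alone, and a store into that cell at most removes the difference. -/
theorem AgreeOff.stepWith {i : ℕ} {c c' : Config} (h : AgreeOff i c c') (hi : i ∉ c.reads) (w x : ℕ) :
    AgreeOff i (stepWith w x c) (stepWith w x c') := by
  obtain ⟨l, ⟨r, m⟩⟩ := c
  obtain ⟨l', ⟨r', m'⟩⟩ := c'
  obtain ⟨h1, h2, h3⟩ := h
  dsimp only at h1 h2 h3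
  subst h1 h2
  rcases l with _ | ⟨e, k⟩
  · exact ⟨rfl, rfl, h3⟩
  cases e with
  | load d arr a =>
    refine ⟨rfl, ?_, h3⟩
    change Function.update r d (m arr (r a)) = Function.update r d (m' arr (r a))
    rw [h3]
    rintro ⟨rfl, hj⟩
    exact hi (by simp [Config.reads, hj])
  | store arr a b =>
    refine ⟨rfl, rfl, fun b' j hj => ?_⟩
    change Function.update m arr (Function.update (m arr) (r a) (r b)) b' j =
      Function.update m' arr (Function.update (m' arr) (r a) (r b)) b' j
    by_cases hb : b' = arr
    · subst hb
      simp only [Function.update_self]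
      by_cases hja : j = r a
      · subst hja; simp
      · rw [Function.update_of_ne hja, Function.update_of_ne hja, h3 _ _ hj]
    · rw [Function.update_of_ne hb, Function.update_of_ne hb, h3 _ _ hj]
  | ite a c₁ c₂ =>
    simp only [WordRAM.stepWith]
    split_ifs <;> exact ⟨rfl, rfl, h3⟩
  | loop a c =>
    simp only [WordRAM.stepWith]
    split_ifs <;> exact ⟨rfl, rfl, h3⟩
  | _ => exact ⟨rfl, rfl, h3⟩

/-- A run of `t` steps reads at most `t` cells; it does not depend on the others. -/
theorem exists_reads (w : ℕ) (c : Config) (t : ℕ) {d : Config} (hd : d ∈ (distAfter w c t).support) :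
    ∃ R : Finset ℕ, R.card ≤ t ∧ ∀ i ∉ R, ∀ c', AgreeOff i c c' →
      ∃ d' ∈ (distAfter w c' t).support, AgreeOff i d d' := by
  induction t generalizing d with
  | zero =>
    simp only [distAfter, PMF.support_pure, Set.mem_singleton_iff] at hd ⊢
    exact ⟨∅, by simp, fun i _ c' h => ⟨c', rfl, hd ▸ h⟩⟩
  | succ t ih =>
    rw [distAfter, PMF.mem_support_bind_iff] at hd
    obtain ⟨e, he, hd⟩ := hd
    obtain ⟨x, hx, rfl⟩ := mem_support_step.1 hd
    obtain ⟨R, hR, h⟩ := ih he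
    refine ⟨R ∪ e.reads, (Finset.card_union_le _ _).trans (add_le_add hR e.card_reads_le), fun i hi c' hc => ?_⟩
    rw [Finset.mem_union, not_or] at hi
    obtain ⟨e', he', hee⟩ := h i hi.1 c' hc
    refine ⟨stepWith w x e', ?_, hee.stepWith hi.2 w x⟩
    rw [distAfter, PMF.mem_support_bind_iff]
    exact ⟨e', he', mem_support_step.2 ⟨x, hx, rfl⟩⟩

/-- A run that is shorter than expected. -/
theorem exists_halted {w : ℕ} {c : Config} {m : ℕ} (h : expectedTime w c < m) :
    ∃ t < m, ∃ s, (⟨[], s⟩ : Config) ∈ (distAfter w c t).support := by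
  by_contra! hcon
  refine absurd h (not_lt.2 ?_)
  calc (m : ℝ≥0∞) = ∑ t ∈ Finset.range m, 1 := by simp
    _ ≤ ∑ t ∈ Finset.range m, running w c t := by
        refine Finset.sum_le_sum fun t ht => ?_
        -- If no run halts before time m, the machine is surely running at each of these times, and
        -- every term is 1.
        refine ((PMF.toOuterMeasure_apply_eq_one_iff _ _).2 fun d hd => ?_).ge
        obtain ⟨l, s⟩ := d
        intro hl
        have hl' : l = [] := hl
        subst hl'
        exact hcon t (Finset.mem_range.1 ht) s hd
    _ ≤ expectedTime w c := timeUpTo_le w c m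

end WordRAM

/-! ### A linear lower bound from reading the input -/

namespace SetIntersection

open WordRAM

/-- The families `{S}` and `{{m, …, 2 m - 1}}`. -/
def twoSets (m : ℕ) (S : List ℕ) : SetSystem := ⟨[S], [List.range' m m]⟩

theorem twoSets_isInstance {m N : ℕ} {S : List ℕ} (hm : 0 < m) (hN : 2 * m ≤ N) (hS : S.length = m)
    (hnd : S.Nodup) (hlt : ∀ x ∈ S, x ≤ m) : (twoSets m S).IsInstance N := by
  constructor
  · intro L hL
    simp only [twoSets, SetSystem.sets, List.cons_append, List.nil_append, List.mem_cons, List.not_mem_nil,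
      or_false] at hL
    rcases hL with rfl | rfl
    · exact ⟨List.ne_nil_of_length_pos (by omega), hnd, fun x hx => by have := hlt x hx; omega⟩
    · refine ⟨List.ne_nil_of_length_pos (by simpa using hm), List.nodup_range', fun x hx => ?_⟩
      rw [List.mem_range'_1] at hx; omega
  · simp [twoSets, SetSystem.sets, hS]; omega

/-- Replacing an element keeps all lengths, so the numbers of sets and the table of starts do not
reveal it. -/
theorem twoSets_initState {m i : ℕ} (S : List ℕ) (y : ℕ) (k : List Cmd) :
    AgreeOff i ⟨k, (twoSets m S).initState⟩ ⟨k, (twoSets m (S.set i y)).initState⟩ := by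
  refine ⟨rfl, rfl, fun a j hj => ?_⟩
  simp only [twoSets, SetSystem.initState, SetSystem.sets]
  by_cases ha : a = 0
  · have hji : i ≠ j := fun h => hj ⟨ha, h.symm⟩
    rw [if_pos ha, if_pos ha]
    simp only [List.cons_append, List.nil_append, List.flatten_cons, List.flatten_nil, List.append_nil,
      List.getD_eq_getElem?_getD, List.getElem?_append, List.length_set, List.getElem?_set_ne hji]
  · rw [if_neg ha, if_neg ha]
    have e : ∀ L : List ℕ, ([L] ++ [List.range' m m]).map List.length = [L.length, m] := fun L => by simp
    simp only [List.map_take, e, List.length_set, List.length_append, List.length_singleton]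

/-- A set has to be read in order to intersect it with another one. -/
theorem le_preprocessing_add_query {D : DataStructure} {tp tq tr : ℕ → ℝ≥0} (hD : D.HasBounds tp tq tr)
    (N : ℕ) : ((N / 2 : ℕ) : ℝ≥0) ≤ tp N + tq N := by
  obtain ⟨κ, hκ⟩ := hD
  rcases Nat.eq_zero_or_pos (N / 2) with hm | hm
  · rw [hm]; simp
  generalize hmN : N / 2 = m at *
  have hN : 2 * m ≤ N := by omega
  by_contra! hlt
  set w := κ * (Nat.log 2 N + 1) with hw
  have h := fun S hS hnd hl => hκ N w le_rfl _ (twoSets_isInstance (S := S) hm hN hS hnd hl) [(0, 0)]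
    (by simp [twoSets])
  have hnd : (List.range m).Nodup := List.nodup_range
  have h0 := h (List.range m) (by simp) hnd (fun x hx => (List.mem_range.1 hx).le)
  have ha : (twoSets m (List.range m)).answer (0, 0) = ∅ := by
    ext x
    simp [twoSets, SetSystem.answer, List.mem_range'_1]
    omega
  have hT : expectedTime w ⟨D.session [(0, 0)], (twoSets m (List.range m)).initState⟩ < m := by
    refine h0.2.trans_lt ?_
    rw [show (m : ℝ≥0∞) = ((m : ℝ≥0) : ℝ≥0∞) by simp]
    refine ENNReal.coe_lt_coe.2 (lt_of_le_of_lt (le_of_eq ?_) hlt)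
    simp [ha]
  obtain ⟨t, ht, s, hs⟩ := exists_halted hT
  obtain ⟨R, hR, hread⟩ := exists_reads w _ t hs
  -- Fewer than m cells have been read on this run, so one of the m cells of the first set has not.
  obtain ⟨i, hi, hiR⟩ : ∃ i ∈ Finset.range m, i ∉ R :=
    Finset.exists_mem_notMem_of_card_lt_card (by rw [Finset.card_range]; omega)
  rw [Finset.mem_range] at hi
  obtain ⟨⟨l, s'⟩, hd, hag⟩ := hread i hiR _ (twoSets_initState _ m _)
  have hl : [] = l := hag.todo
  subst hl
  have hrep : reported s = reported s' := by
    have h1 : s.reg = s'.reg := hag.reg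
    have h2 : s.mem 2 = s'.mem 2 := funext fun j => hag.mem 2 j (by simp)
    rw [reported, reported, h1, h2]
  have hmem : ∀ x ∈ (List.range m).set i m, x ≤ m := fun x hx => by
    rcases List.mem_or_eq_of_mem_set hx with hx | rfl
    · exact (List.mem_range.1 hx).le
    · exact le_rfl
  -- The sets {0, …, m-1} and {m, …, 2m-1} are disjoint, but putting m into the unread cell makes m
  -- a common element. The same run is possible on the changed input and again reports nothing,
  -- although its answer must be correct.
  have h1 := h ((List.range m).set i m) (by simp) (hnd.set (by simp)) hmem
  have c0 := (h0.1 s ⟨t, hs⟩ (0, 0) (by simp)).2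
  have c1 := (h1.1 s' ⟨t, hd⟩ (0, 0) (by simp)).2
  rw [← hrep, c0, ha] at c1
  have : m ∈ (twoSets m ((List.range m).set i m)).answer (0, 0) := by
    simp only [twoSets, SetSystem.answer, List.getD_cons_zero, Finset.mem_inter, List.mem_toFinset,
      List.mem_range'_1]
    exact ⟨List.mem_set (by simpa using hi) m, by omega⟩
  rw [← c1] at this
  simp at this

end SetIntersection

/-! ### The bound for δ ≥ 1 + γ -/

namespace Reduction

open SetIntersection

/-- The lower bound if reporting is expensive. -/
theorem omega_of_le {γ δ : ℝ} (hγ0 : 0 ≤ γ) (hδγ : 1 + γ ≤ δ) {D : DataStructure}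
    {tp tq tr : ℕ → ℝ≥0} (hD : D.HasBounds tp tq tr) :
    IsOmegaPowSubLittleO
      (fun N : ℕ => (tp N : ℝ)
        + (N : ℝ) ^ (2 * (1 + γ) / (3 + δ - γ)) * (tq N : ℝ)
        + (N : ℝ) ^ (2 * (2 - δ) / (3 + δ - γ)) * (tr N : ℝ))
      (4 / (3 + δ - γ)) := by
  refine isOmegaPowSubLittleO_of_forall fun ε hε => ?_
  have hΔ : 0 < 3 + δ - γ := by linarith
  -- Since δ - γ ≥ 1, a linear bound is enough; the factor in front of the query time is at least 1
  -- and may be dropped.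
  have hc : 4 / (3 + δ - γ) ≤ 1 := (div_le_one hΔ).2 (by linarith)
  have hpow : Tendsto (fun N : ℕ => (N : ℝ) ^ ε) atTop atTop :=
    (tendsto_rpow_atTop hε).comp tendsto_natCast_atTop_atTop
  filter_upwards [hpow.eventually_ge_atTop 4, eventually_ge_atTop 2] with N h1 h2
  have hN2 : (2 : ℝ) ≤ N := by exact_mod_cast h2
  have hN0 : (0 : ℝ) < N := by linarith
  have h3 : ((N / 2 : ℕ) : ℝ) ≤ tp N + tq N := by exact_mod_cast le_preprocessing_add_query hD N
  have h4 : (N : ℝ) ≤ 4 * (N / 2 : ℕ) := by exact_mod_cast (by omega : N ≤ 4 * (N / 2))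
  have h5 : (N : ℝ) ^ (4 / (3 + δ - γ) - ε) * 4 ≤ N := by
    calc (N : ℝ) ^ (4 / (3 + δ - γ) - ε) * 4 ≤ (N : ℝ) ^ (1 - ε) * (N : ℝ) ^ ε := by
          gcongr
          linarith
      _ = N := by rw [← Real.rpow_add hN0, sub_add_cancel, Real.rpow_one]
  have h6 : (1 : ℝ) ≤ (N : ℝ) ^ (2 * (1 + γ) / (3 + δ - γ)) := Real.one_le_rpow (by linarith) (by positivity)
  have h7 : 1 * (tq N : ℝ) ≤ (N : ℝ) ^ (2 * (1 + γ) / (3 + δ - γ)) * (tq N : ℝ) := by gcongr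
  have h8 : 0 ≤ (N : ℝ) ^ (2 * (2 - δ) / (3 + δ - γ)) * (tr N : ℝ) := by positivity
  linarith

end Reduction

theorem mainTheorem9 (h3SUM : ThreeSum.Conjecture)
    (γ δ : ℝ) (hγ0 : 0 ≤ γ) (hγ1 : γ < 1) (hδ : 0 < δ)
    (D : SetIntersection.DataStructure) (tp tq tr : ℕ → ℝ≥0) (hD : D.HasBounds tp tq tr) :
    IsOmegaPowSubLittleO
      (fun N : ℕ => (tp N : ℝ)
        + (N : ℝ) ^ (2 * (1 + γ) / (3 + δ - γ)) * (tq N : ℝ)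
        + (N : ℝ) ^ (2 * (2 - δ) / (3 + δ - γ)) * (tr N : ℝ))
      (4 / (3 + δ - γ)) := by
  -- At δ = 1 + γ the reduction loses its gain: the instance alone has size about n². There the
  -- exponent has just dropped to 1, and reading the input takes over.
  rcases lt_or_ge δ (1 + γ) with h | h
  · exact Reduction.omega_of_lt h3SUM hγ0 hγ1 hδ h hD
  · exact Reduction.omega_of_le hγ0 h hD
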